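/- **Setting.** Let $K$ be a field of characteristic $0$ containing an element $q^{1/2}\neq 0$ that is not a root of unity (for example $K=\mathbb C(q^{1/2})$), let $p^{1/2}$ be a formal variable, $R=K[[p^{1/2}]]$, $[k]=\frac{q^k-q^{-k}}{q-q^{-1}}$. Let $n\ge 2$, let $A=(a_{ij})_{1\le i,j\le n-1}$ be the Cartan matrix of $\mathfrak{sl}_n$ with simple roots $\alpha_i$, root lattice $\overline Q$, weight lattice $\overline P$ and classical fundamental weights $\overline\Lambda_i$ ($\overline\Lambda_0=0$). Let $\theta_p(z)=\prod_{j>0}(1-p^j)(1-p^{j-1}z)(1-p^jz^{-1})$ and $$g_{ij}(z)=\frac{G^+_{ij}(z)}{G^-_{ij}(z)},\quad G^+_{ij}(z)=q^{-a_{ij}}\theta_p(q^{a_{ij}}z),\quad G^-_{ij}(z)=\theta_p(q^{-a_{ij}}z),$$ where $g_{ij}(z)^{\pm1}$ is expanded in the region $|q^{\pm a_{ij}}|>|z|>|q^{\pm a_{ij}}p|$, i.e. in the ring $K((z))[[p^{1/2}]]$. Let $\delta(z)=\sum_{m\in\mathbb Z}z^m$. **The algebra.** A representation of $U_q(\theta,\mathfrak{sl}_n)$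 of level $c\in\mathbb Z$ on an $R$-module $M$ consists of operators $\bar a_i(l),\bar b_i(l)$ ($l\ne0$), invertible operators $e^{\bar a_i(0)},e^{\bar b_i(0)}$, and operators $x_i^\pm(l)$ ($l\in\mathbb Z$), for $1\le i\le n-1$, such that each vector is killed by almost all coefficients of $\exp[\sum_{m>0}\bar a_i(m)z^{-m}]$ and of $\exp[\sum_{m>0}\bar b_i(m)z^{-m}]$; the $\bar a_i(l)$, $e^{\bar a_i(0)}$ all commute with one another, as do the $\bar b_i(l)$, $e^{\bar b_i(0)}$; and the series $x_i^\pm(z)=\sum_l x_i^\pm(l)z^{-l}$, $\varphi_i(z)=\exp[\sum_{m<0}\bar a_i(m)z^{-m}]\exp[\sum_{m>0}\bar a_i(m)z^{-m}]e^{\bar a_i(0)}$, and $\psi_i(z)$ (the same with $\bar b$) satisfy \begin{align*} &\varphi_i(z)\psi_j(w)=\frac{g_{ij}(\frac zw q^{-c})}{g_{ij}(\frac zw q^{c})}\psi_j(w)\varphi_i(z),\\ &\varphi_i(z)x_j^\pm(w)=g_{ij}(\tfrac zw q^{\mp c/2})^{\pm1}x_j^\pm(w)\varphi_i(z),\qquad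 \psi_i(z)x_j^\pm(w)=g_{ij}(\tfrac wz q^{\mp c/2})^{\mp1}x_j^\pm(w)\psi_i(z),\\ &[x_i^+(z),x_j^-(w)]=\frac{\delta_{ij}}{q-q^{-1}}\Bigl\{\delta(\tfrac zw q^{-c})\psi_i(wq^{c/2})-\delta(\tfrac zw q^{c})\varphi_i(zq^{c/2})\Bigr\},\\ &G^\mp_{ij}(\tfrac zw)x_i^\pm(z)x_j^\pm(w)=G^\pm_{ij}(\tfrac zw)x_j^\pm(w)x_i^\pm(z)\ (a_{ij}\ne0),\qquad [x_i^\pm(z),x_j^\pm(w)]=0\ (a_{ij}=0), \end{align*} and, for $a_{ij}=-1$, the cubic relation $$x_i^\pm(z_1)x_i^\pm(z_2)x_j^\pm(w)-h_{ij}(\tfrac{z_1}w,\tfrac{z_2}w)\,x_i^\pm(z_1)x_j^\pm(w)x_i^\pm(z_2)+x_j^\pm(w)x_i^\pm(z_1)x_i^\pm(z_2)+\{z_1\leftrightarrow z_2\}=0,$$ $$h_{ij}(\tfrac{z_1}w,\tfrac{z_2}w)=\frac{(g_{ii}(z_1/z_2)+1)(g_{ij}(z_1/w)g_{ij}(z_2/w)+1)}{g_{ij}(z_2/w)+g_{ii}(z_1/z_2)g_{ij}(z_1/w)}.$$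 All relations are identities of formal series, coefficient by coefficient, applied to any vector of $M$, infinite sums converging unconditionally in the $p^{1/2}$-adic topology of $M$. The cubic relation means: let $\mathcal E$ be the ring of power series in $p^{1/2}$ whose coefficients are Laurent polynomials in $z_1/w,z_2/w$ over $K$; whenever $H_0,H,H'\in\mathcal E$ satisfy $H=H_0\,h_{ij}(\frac{z_1}w,\frac{z_2}w)$ and $H'=H_0\,h_{ij}(\frac{z_2}w,\frac{z_1}w)$ in the field of fractions of $\mathcal E$, the relation multiplied by $H_0$ (with $H,H'$ in place of $H_0h_{ij}$) holds. Such a representation is a *highest weight representation* with highest weight vector $v\neq0$ and classical weight $\lambda$ if $\bar a_j(l)v=\bar b_j(l)v=0$ for $l>0$, $x_j^+(l)v=0$ for $l\ge0$, $x_j^-(l)v=0$ for $l>0$, $e^{\bar a_j(0)}v=q^{-(\alpha_j,\lambda)}v$, $e^{\bar b_j(0)}v=q^{(\alpha_j,\lambda)}v$, and $v$ generates $M$ after inverting $p^{1/2}$: for each $u\in M$ some $p^{N/2}u$ lies in the smallest $R$-submodule containing $v$ and stable under all the operators above and the inverses of $e^{\bar a_j(0)}$, $e^{\bar b_j(0)}$.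 **The Fock space.** Let $a_{j,k},b_{j,k}$ ($1\le j\le n-1$, $k\ne0$) generate the Heisenberg algebra: for $k>0$, $$[a_{i,k},a_{j,-k}]=-[b_{i,k},b_{j,-k}]=\frac{[a_{ij}k][k]}{k(1-p^k)},$$ all other commutators of generators being $0$. Let $e^{\alpha_2},\dots,e^{\alpha_{n-1}},e^{\overline\Lambda_{n-1}}$ and their inverses generate the twisted group algebra of $\overline P$, with $e^{\alpha_i}e^{\alpha_j}=(-1)^{(\alpha_i,\alpha_j)}e^{\alpha_j}e^{\alpha_i}$ and $e^{\alpha_i}e^{\overline\Lambda_{n-1}}=(-1)^{\delta_{i,n-1}}e^{\overline\Lambda_{n-1}}e^{\alpha_i}$, and put $e^{\alpha}=e^{m_2\alpha_2}\cdots e^{m_{n-1}\alpha_{n-1}}e^{m_n\overline\Lambda_{n-1}}$ for $\alpha=m_2\alpha_2+\dots+m_{n-1}\alpha_{n-1}+m_n\overline\Lambda_{n-1}$. For $0\le i\le n-1$ let $$\mathcal F_i=R[a_{j,-k},b_{j,-k}\mid 1\le j\le n-1,\ k>0]\otimes_K K[\overline Q]e^{\overline\Lambda_i},$$ on which $a_{j,-k},b_{j,-k}$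 ($k>0$) act by multiplication, $a_{j,k},b_{j,k}$ ($k>0$) by the derivations $f\mapsto[a_{j,k},f]$, $f\mapsto[b_{j,k},f]$, and $\partial_\alpha(f\otimes e^\beta)=(\alpha,\beta)f\otimes e^\beta$, $e^\alpha(f\otimes e^\beta)=f\otimes e^\alpha e^\beta$. **Proposition.** For every $0\le i\le n-1$ the formulas \begin{align*} x_j^\pm(z)&\mapsto\exp\Bigl[\pm\sum_{k>0}\tfrac{a_{j,-k}q^{\mp k/2}-b_{j,-k}(pq^{\pm1})^{k/2}}{[k]}z^k\Bigr]\exp\Bigl[\mp\sum_{k>0}\tfrac{a_{j,k}q^{\mp k/2}-b_{j,k}(pq^{\pm1})^{k/2}}{[k]}z^{-k}\Bigr]e^{\pm\alpha_j}z^{\pm\partial_{\alpha_j}+1},\\ \varphi_j(z)&\mapsto\exp\Bigl[-(q-q^{-1})\sum_{k>0}a_{j,-k}z^k\Bigr]\exp\Bigl[(q-q^{-1})\sum_{k>0}b_{j,k}p^{k/2}z^{-k}\Bigr]q^{-\partial_{\alpha_j}},\\ \psi_j(z)&\mapsto\exp\Bigl[-(q-q^{-1})\sum_{k>0}b_{j,-k}p^{k/2}z^k\Bigr]\exp\Bigl[(q-q^{-1})\sum_{k>0}a_{j,k}z^{-k}\Bigr]q^{\partial_{\alpha_j}}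 \end{align*} define a highest weight representation of $U_q(\theta,\mathfrak{sl}_n)$ of level $c=1$ on $\mathcal F_i$, with highest weight vector $1\otimes e^{\overline\Lambda_i}$ and classical weight $\overline\Lambda_i$ (so $(\alpha_j,\overline\Lambda_i)=\delta_{ij}$). Here $\bar a_j(m)$, $\bar b_j(m)$ ($m\ne 0$) act as the coefficients of $z^{-m}$ in the exponents of the formulas for $\varphi_j(z)$, $\psi_j(z)$, and $e^{\bar a_j(0)}=q^{-\partial_{\alpha_j}}$, $e^{\bar b_j(0)}=q^{\partial_{\alpha_j}}$. -/

import Mathlib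

open scoped PowerSeries

namespace EllipticAlgebra

noncomputable section

/-! ### Theta functions and structure functions

`K` is the coefficient field, `s : Kˣ` stands for `q^{1/2}`, and the variable `X` of the power series
rings below stands for `p^{1/2}`, so that `p = X ^ 2` and `K⟦X⟧` is `K[[p^{1/2}]]`. -/

section Theta

variable {K : Type*} [Field K]

/-- `q`, where `s` is `q^{1/2}`. -/
def q (s : Kˣ) : Kˣ := s ^ 2

/-- The quantum integer `[k] = (q^k - q^{-k}) / (q - q^{-1})`. -/
def qInt (s : Kˣ) (k : ℤ) : K :=
  (((q s ^ k : Kˣ) : K) - ((q s ^ (-k) : Kˣ) : K)) / ((q s : K) - ((q s)⁻¹ : Kˣ))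

/-- Jacobi's theta function `θ_p(x) = ∏_{j > 0} (1 - p^j) (1 - p^{j-1} x) (1 - p^j x⁻¹)`, as a power
series in `X = p^{1/2}` with coefficients in a ring containing `x` and its inverse `xinv`.
The factors with `j > N + 1` are congruent to `1` modulo `X ^ (N + 1)`, so the coefficient of `X ^ N`
in the infinite product is its coefficient in the product of the first `N + 1` factors. -/
def theta {A : Type*} [CommRing A] (x xinv : A) : A⟦X⟧ :=
  PowerSeries.mk fun N => PowerSeries.coeff N
    (∏ j ∈ Finset.range (N + 1),
      (1 - PowerSeries.X ^ (2 * (j + 1))) * (1 - PowerSeries.C x * PowerSeries.X ^ (2 * j)) *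
        (1 - PowerSeries.C xinv * PowerSeries.X ^ (2 * (j + 1))))

/-- Every product of at least `N + 1` factors has the same coefficient of `X ^ N`. -/
theorem coeff_theta {A : Type*} [CommRing A] (x xinv : A) (N M : ℕ) (h : N + 1 ≤ M) :
    PowerSeries.coeff N (theta x xinv) = PowerSeries.coeff N
      (∏ j ∈ Finset.range M,
        (1 - PowerSeries.X ^ (2 * (j + 1))) * (1 - PowerSeries.C x * PowerSeries.X ^ (2 * j)) *
          (1 - PowerSeries.C xinv * PowerSeries.X ^ (2 * (j + 1)))) := by
  induction M, h using Nat.le_induction with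
  | base => simp [theta]
  | succ M hM ih =>
    rw [ih, Finset.prod_range_succ]
    set P := ∏ j ∈ Finset.range M,
        (1 - (PowerSeries.X : A⟦X⟧) ^ (2 * (j + 1))) *
          (1 - PowerSeries.C x * PowerSeries.X ^ (2 * j)) *
          (1 - PowerSeries.C xinv * PowerSeries.X ^ (2 * (j + 1)))
    have hd : (PowerSeries.X : A⟦X⟧) ^ (N + 1) ∣
        P * ((1 - PowerSeries.X ^ (2 * (M + 1))) * (1 - PowerSeries.C x * PowerSeries.X ^ (2 * M)) *
          (1 - PowerSeries.C xinv * PowerSeries.X ^ (2 * (M + 1)))) - P := by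
      obtain ⟨r, hr⟩ : ∃ r, 2 * M = (N + 1) + r := ⟨2 * M - (N + 1), by omega⟩
      refine ⟨P * (-(PowerSeries.X ^ (r + 2)) - PowerSeries.C x * PowerSeries.X ^ r
        - PowerSeries.C xinv * PowerSeries.X ^ (r + 2)
        + PowerSeries.C x * PowerSeries.X ^ (r + 2 + (N + 1) + r)
        + PowerSeries.C xinv * PowerSeries.X ^ (r + 2 + (N + 1) + r + 2)
        + PowerSeries.C x * PowerSeries.C xinv * PowerSeries.X ^ (r + (N + 1) + r + 2)
        - PowerSeries.C x * PowerSeries.C xinv *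
            PowerSeries.X ^ (r + (N + 1) + r + 2 + (N + 1) + r + 2)), ?_⟩
      rw [show 2 * (M + 1) = N + 1 + r + 2 by omega, hr]
      ring
    have := (PowerSeries.X_pow_dvd_iff.1 hd) N (by omega)
    rw [map_sub, sub_eq_zero] at this
    exact this.symm

/-- Formal functions in variables with exponent group `Γ`, without poles except at `0` and `∞`: power
series in `p^{1/2}` whose coefficients are Laurent polynomials. -/
abbrev Entire (K : Type*) [Field K] (Γ : Type*) [AddCommGroup Γ] : Type _ :=
  (AddMonoidAlgebra K Γ)⟦X⟧

/-- The coefficient, in `K[[p^{1/2}]]`, of the monomial `z^d`. -/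
def Entire.coeffAt {Γ : Type*} [AddCommGroup Γ] (f : Entire K Γ) (d : Γ) : K⟦X⟧ :=
  PowerSeries.mk fun N => (PowerSeries.coeff N f).coeff d

/-- `θ_p(κ z^d)`. -/
def thetaEntire {Γ : Type*} [AddCommGroup Γ] (κ : Kˣ) (d : Γ) : Entire K Γ :=
  theta (AddMonoidAlgebra.single d (κ : K)) (AddMonoidAlgebra.single (-d) ((κ⁻¹ : Kˣ) : K))

/-- Numerator and denominator of the structure function
`g(z) = q^{-a} θ_p(q^a z) / θ_p(q^{-a} z) = G⁺(z) / G⁻(z)` attached to the entry `a` of the Cartan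
matrix, taken at the monomial `z^d`. The sign selects `G⁺ = q^{-a} θ_p(q^a z)` or
`G⁻ = θ_p(q^{-a} z)`. -/
def G (s : Kˣ) (σ : ℤˣ) (a : ℤ) {Γ : Type*} [AddCommGroup Γ] (d : Γ) : Entire K Γ :=
  if σ = 1 then
    PowerSeries.C (AddMonoidAlgebra.single 0 ((q s ^ (-a) : Kˣ) : K)) * thetaEntire (q s ^ a) d
  else thetaEntire (q s ^ (-a)) d

/-- The Laurent expansion of `θ_p(κ z)` in `K((z))[[p^{1/2}]]`. -/
def thetaLaurent (κ : Kˣ) : (LaurentSeries K)⟦X⟧ :=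
  theta (HahnSeries.single (1 : ℤ) (κ : K)) (HahnSeries.single (-1 : ℤ) ((κ⁻¹ : Kˣ) : K))

/-- The expansion of `g(κ z)`, for `g(z) = q^{-a} θ_p(q^a z) / θ_p(q^{-a} z)`, in the annulus
`|q^a| > |κ z| > |q^a p|`. Formally, expansions in this annulus are those in the ring
`K((z))[[p^{1/2}]]` of doubly infinite series in `z` whose coefficients tend `p`-adically to `0` in
the direction `z^{-∞}`. -/
def gLaurent (s : Kˣ) (a : ℤ) (κ : Kˣ) : (LaurentSeries K)⟦X⟧ :=
  PowerSeries.C (HahnSeries.C ((q s ^ (-a) : Kˣ) : K)) * thetaLaurent (q s ^ a * κ) *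
    (thetaLaurent (q s ^ (-a) * κ))⁻¹

/-- The expansion of `g(κ z)^{±1}`. -/
def gLaurentPow (s : Kˣ) (a : ℤ) (κ : Kˣ) (σ : ℤˣ) : (LaurentSeries K)⟦X⟧ :=
  if σ = 1 then gLaurent s a κ else (gLaurent s a κ)⁻¹

/-- The coefficient, in `K[[p^{1/2}]]`, of `z^m`. -/
def laurentCoeff (f : (LaurentSeries K)⟦X⟧) (m : ℤ) : K⟦X⟧ :=
  PowerSeries.mk fun N => (PowerSeries.coeff N f).coeff m

/-- The structure function `g` as an element of the field of fractions of the ring of functions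
of `y₁ = z₁ / w` and `y₂ = z₂ / w` without poles except at `0` and `∞`, taken at the monomial `y^d`. -/
def gFrac (s : Kˣ) (a : ℤ) (d : ℤ × ℤ) : FractionRing (Entire K (ℤ × ℤ)) :=
  algebraMap (Entire K (ℤ × ℤ)) _ (G s 1 a d) / algebraMap (Entire K (ℤ × ℤ)) _ (G s (-1) a d)

/-- The function
`h = (g_ii(z₁/z₂) + 1) (g_ij(z₁/w) g_ij(z₂/w) + 1) / (g_ij(z₂/w) + g_ii(z₁/z₂) g_ij(z₁/w))`
for `a_ij = -1`, where `d₁`, `d₂` are the exponents of `z₁ / w` and `z₂ / w`. -/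
def hFrac (s : Kˣ) (d₁ d₂ : ℤ × ℤ) : FractionRing (Entire K (ℤ × ℤ)) :=
  ((gFrac s 2 (d₁ - d₂) + 1) * (gFrac s (-1) d₁ * gFrac s (-1) d₂ + 1)) /
    (gFrac s (-1) d₂ + gFrac s 2 (d₁ - d₂) * gFrac s (-1) d₁)

end Theta

/-! ### Convergence, exponentials and normally ordered products -/

section Operators

variable {K : Type*} [Field K] {M : Type*} [AddCommGroup M] [Module K⟦X⟧ M]

/-- The family `f` is (unconditionally) summable to `v` for the `p^{1/2}`-adic topology of `M`. -/
def HasAdicSum (K : Type*) [Field K] {M : Type*} [AddCommGroup M] [Module K⟦X⟧ M] {ι : Type*} (f : ι → M) (v : M) : Prop :=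
  ∀ N : ℕ, ∃ S : Finset ι, ∀ T : Finset ι, S ⊆ T →
    ∃ w : M, ∑ t ∈ T, f t - v = (PowerSeries.X ^ N : K⟦X⟧) • w

/-- The formal series `∑_{k > 0} y_k z^k`. -/
def posSeries (y : ℕ+ → Module.End K⟦X⟧ M) : (Module.End K⟦X⟧ M)⟦X⟧ :=
  PowerSeries.mk fun k => if h : 0 < k then y ⟨k, h⟩ else 0

/-- The coefficient of `z^m` in `exp [∑_{k > 0} y_k z^k]`. The powers with exponent greater than `m`
do not contribute. -/
def expCoeff (y : ℕ+ → Module.End K⟦X⟧ M) (m : ℕ) : Module.End K⟦X⟧ M :=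
  ∑ r ∈ Finset.range (m + 1),
    (PowerSeries.C ((r.factorial : K)⁻¹) : K⟦X⟧) • PowerSeries.coeff m (posSeries y ^ r)

/-- Every vector is killed by all but finitely many members of the sequence. -/
def LocallyFinite (A : ℕ → Module.End K⟦X⟧ M) : Prop :=
  ∀ u : M, ∃ N : ℕ, ∀ m : ℕ, N ≤ m → A m u = 0

theorem LocallyFinite.finite_support {A : ℕ → Module.End K⟦X⟧ M} (hA : LocallyFinite A)
    (B : ℕ → Module.End K⟦X⟧ M) (l : ℤ) (u : M) :
    (Function.support fun m : ℕ => if l ≤ m then B ((m : ℤ) - l).toNat (A m u) else 0).Finite := by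
  obtain ⟨N, hN⟩ := hA u
  refine (Set.finite_lt_nat N).subset fun m hm => ?_
  by_contra hlt
  exact hm (by simp [hN m (not_lt.1 hlt)])

/-- The coefficient of `z^{-l}` in the product of two operator valued series
`(∑_{k ≥ 0} B_k z^k) (∑_{m ≥ 0} A_m z^{-m})`. -/
def modeOfProduct (B A : ℕ → Module.End K⟦X⟧ M) (hA : LocallyFinite A) (l : ℤ) :
    Module.End K⟦X⟧ M where
  toFun u := ∑ᶠ m : ℕ, if l ≤ m then B ((m : ℤ) - l).toNat (A m u) else 0
  map_add' u v := by
    rw [← finsum_add_distrib (hA.finite_support B l u) (hA.finite_support B l v)]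
    refine finsum_congr fun m => ?_
    split_ifs <;> simp
  map_smul' c u := by
    rw [RingHom.id_apply, smul_finsum' c (hA.finite_support B l u)]
    refine finsum_congr fun m => ?_
    split_ifs <;> simp

/-- If `y k` lowers an exhaustive filtration, which vanishes in negative degrees, by `k`, then the
coefficients of `exp [∑_{k > 0} y_k z^k]` are locally finite. -/
theorem locallyFinite_expCoeff (W : ℤ → Submodule K⟦X⟧ M) (hneg : ∀ d < 0, W d = ⊥)
    (hex : ∀ u, ∃ d, u ∈ W d) (y : ℕ+ → Module.End K⟦X⟧ M)
    (hy : ∀ (k : ℕ+) d u, u ∈ W d → y k u ∈ W (d - (k : ℕ))) : LocallyFinite (expCoeff y) := by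
  have key : ∀ (r m : ℕ) (d : ℤ) (u : M), u ∈ W d →
      PowerSeries.coeff m (posSeries y ^ r) u ∈ W (d - m) := by
    intro r
    induction r with
    | zero =>
      intro m d u hu
      rw [pow_zero, PowerSeries.coeff_one]
      split_ifs with h
      · subst h; simpa using hu
      · simp
    | succ r ih =>
      intro m d u hu
      rw [pow_succ, PowerSeries.coeff_mul, LinearMap.sum_apply]
      refine Submodule.sum_mem _ fun x hx => ?_
      have hx' : x.1 + x.2 = m := Finset.HasAntidiagonal.mem_antidiagonal.1 hx
      rw [Module.End.mul_apply]
      have h1 : PowerSeries.coeff x.2 (posSeries y) u ∈ W (d - x.2) := by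
        rw [posSeries, PowerSeries.coeff_mk]
        split_ifs with h
        · exact hy ⟨x.2, h⟩ d u hu
        · simp
      have h2 := ih x.1 _ _ h1
      rwa [show d - (x.2 : ℤ) - x.1 = d - m by rw [← hx']; push_cast; ring] at h2
  intro u
  obtain ⟨d, hd⟩ := hex u
  refine ⟨(d + 1).toNat, fun m hm => ?_⟩
  rw [expCoeff, LinearMap.sum_apply]
  refine Finset.sum_eq_zero fun r _ => ?_
  have h := key r m d u hd
  rw [hneg _ (by omega), Submodule.mem_bot] at h
  rw [LinearMap.smul_apply, h, smul_zero]

end Operators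

/-! ### Representations of the elliptic algebra -/

section Representation

/-- The images in `End M` of the generators of the algebra: `aBar σ i k` is the image of
`ā_i(σ k)` and `bBar σ i k` that of `b̄_i(σ k)` (`k > 0`, `σ = ±1`), `aZero i` and `bZero i` are the
images of the exponentials of `ā_i(0)` and `b̄_i(0)`, and `x σ i l` is the image of `x_i^σ(l)`.
The exponentials of the positive modes act locally finitely, so that the modes of the currents
`φ_i(z)` and `ψ_i(z)` are well defined. -/
structure Currents (K : Type*) [Field K] (n : ℕ) (M : Type*) [AddCommGroup M]
    [Module K⟦X⟧ M] where
  aBar : ℤˣ → Fin (n - 1) → ℕ+ → Module.End K⟦X⟧ M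
  bBar : ℤˣ → Fin (n - 1) → ℕ+ → Module.End K⟦X⟧ M
  aZero : Fin (n - 1) → (Module.End K⟦X⟧ M)ˣ
  bZero : Fin (n - 1) → (Module.End K⟦X⟧ M)ˣ
  x : ℤˣ → Fin (n - 1) → ℤ → Module.End K⟦X⟧ M
  aBar_locallyFinite : ∀ i, LocallyFinite (expCoeff (aBar 1 i))
  bBar_locallyFinite : ∀ i, LocallyFinite (expCoeff (bBar 1 i))

variable {K : Type*} [Field K] {n : ℕ} {M : Type*} [AddCommGroup M] [Module K⟦X⟧ M]

/-- The coefficient `φ_i(l)` of `z^{-l}` in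
`φ_i(z) = exp [∑_{m < 0} ā_i(m) z^{-m}] exp [∑_{m > 0} ā_i(m) z^{-m}] exp [ā_i(0)]`. -/
def Currents.phi (D : Currents K n M) (i : Fin (n - 1)) (l : ℤ) : Module.End K⟦X⟧ M :=
  modeOfProduct (expCoeff (D.aBar (-1) i)) (expCoeff (D.aBar 1 i)) (D.aBar_locallyFinite i) l *
    D.aZero i

/-- The coefficient `ψ_i(l)` of `z^{-l}` in
`ψ_i(z) = exp [∑_{m < 0} b̄_i(m) z^{-m}] exp [∑_{m > 0} b̄_i(m) z^{-m}] exp [b̄_i(0)]`. -/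
def Currents.psi (D : Currents K n M) (i : Fin (n - 1)) (l : ℤ) : Module.End K⟦X⟧ M :=
  modeOfProduct (expCoeff (D.bBar (-1) i)) (expCoeff (D.bBar 1 i)) (D.bBar_locallyFinite i) l *
    D.bZero i

/-- The operators `D` define a representation of `U_q(θ, sl_n)` on which the central element acts by
the integer `c`: the defining relations hold, coefficient by coefficient, on every vector. -/
structure IsRepresentation (s : Kˣ) (c : ℤ) (D : Currents K n M) : Prop where
  aBar_comm : ∀ σ τ i j k l, Commute (D.aBar σ i k) (D.aBar τ j l)
  aBar_aZero_comm : ∀ σ i j k, Commute (D.aBar σ i k) (D.aZero j : Module.End K⟦X⟧ M)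
  aZero_comm : ∀ i j, Commute (D.aZero i) (D.aZero j)
  bBar_comm : ∀ σ τ i j k l, Commute (D.bBar σ i k) (D.bBar τ j l)
  bBar_bZero_comm : ∀ σ i j k, Commute (D.bBar σ i k) (D.bZero j : Module.End K⟦X⟧ M)
  bZero_comm : ∀ i j, Commute (D.bZero i) (D.bZero j)
  /-- `φ_i(z) ψ_j(w) = g_ij(z/w q^{-c}) / g_ij(z/w q^c) ψ_j(w) φ_i(z)` -/
  phi_psi : ∀ i j (m l : ℤ) (u : M), HasAdicSum K
    (fun r : ℤ => laurentCoeff (gLaurent s (CartanMatrix.A (n - 1) i j) (q s ^ (-c)) *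
        (gLaurent s (CartanMatrix.A (n - 1) i j) (q s ^ c))⁻¹) r •
      D.psi j (l - r) (D.phi i (m + r) u))
    (D.phi i m (D.psi j l u))
  /-- `φ_i(z) x_j^±(w) = g_ij(z/w q^{∓c/2})^{±1} x_j^±(w) φ_i(z)` -/
  phi_x : ∀ (σ : ℤˣ) i j (m l : ℤ) (u : M), HasAdicSum K
    (fun r : ℤ => laurentCoeff
        (gLaurentPow s (CartanMatrix.A (n - 1) i j) (s ^ (-(σ : ℤ) * c)) σ) r •
      D.x σ j (l - r) (D.phi i (m + r) u))
    (D.phi i m (D.x σ j l u))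
  /-- `ψ_i(z) x_j^±(w) = g_ij(w/z q^{∓c/2})^{∓1} x_j^±(w) ψ_i(z)` -/
  psi_x : ∀ (σ : ℤˣ) i j (m l : ℤ) (u : M), HasAdicSum K
    (fun r : ℤ => laurentCoeff
        (gLaurentPow s (CartanMatrix.A (n - 1) i j) (s ^ (-(σ : ℤ) * c)) (-σ)) r •
      D.x σ j (l + r) (D.psi i (m - r) u))
    (D.psi i m (D.x σ j l u))
  /-- `[x_i^+(z), x_j^-(w)] = δ_ij / (q - q^{-1})
    (δ(z/w q^{-c}) ψ_i(w q^{c/2}) - δ(z/w q^c) φ_i(z q^{c/2}))`, coefficient of `z^{-m} w^{-l}` -/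
  x_plus_x_minus : ∀ i j (m l : ℤ),
    D.x 1 i m * D.x (-1) j l - D.x (-1) j l * D.x 1 i m =
      if i = j then
        (PowerSeries.C ((q s : K) - ((q s)⁻¹ : Kˣ))⁻¹ : K⟦X⟧) •
          ((PowerSeries.C ((s ^ (c * (m - l)) : Kˣ) : K) : K⟦X⟧) • D.psi i (m + l) -
            (PowerSeries.C ((s ^ (c * (l - m)) : Kˣ) : K) : K⟦X⟧) • D.phi i (m + l))
      else 0
  /-- `G_ij^∓(z/w) x_i^±(z) x_j^±(w) = G_ij^±(z/w) x_j^±(w) x_i^±(z)` -/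
  x_x : ∀ (σ : ℤˣ) i j (m l : ℤ) (u : M), CartanMatrix.A (n - 1) i j ≠ 0 → ∃ v : M,
    HasAdicSum K (fun r : ℤ => (G s (-σ) (CartanMatrix.A (n - 1) i j) (1 : ℤ)).coeffAt r •
      D.x σ i (m + r) (D.x σ j (l - r) u)) v ∧
    HasAdicSum K (fun r : ℤ => (G s σ (CartanMatrix.A (n - 1) i j) (1 : ℤ)).coeffAt r •
      D.x σ j (l - r) (D.x σ i (m + r) u)) v
  /-- `[x_i^±(z), x_j^±(w)] = 0` if `a_ij = 0` -/
  x_x_zero : ∀ (σ : ℤˣ) i j (m l : ℤ), CartanMatrix.A (n - 1) i j = 0 →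
    Commute (D.x σ i m) (D.x σ j l)
  /-- The cubic relation
    `x_i(z₁) x_i(z₂) x_j(w) - h(z₁/w, z₂/w) x_i(z₁) x_j(w) x_i(z₂) + x_j(w) x_i(z₁) x_i(z₂)
      + {z₁ ↔ z₂} = 0`
    if `a_ij = -1`. Denominators are cleared in every possible way: whenever
    `h(z₁/w, z₂/w) = H / H₀` and `h(z₂/w, z₁/w) = H' / H₀` with `H`, `H'`, `H₀` free of poles except
    at `0` and `∞`, the relation holds after multiplication by `H₀`. -/
  serre : ∀ (σ : ℤˣ) i j, CartanMatrix.A (n - 1) i j = -1 →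
    ∀ H₀ H H' : Entire K (ℤ × ℤ),
    algebraMap _ (FractionRing (Entire K (ℤ × ℤ))) H =
      algebraMap _ (FractionRing (Entire K (ℤ × ℤ))) H₀ * hFrac s (1, 0) (0, 1) →
    algebraMap _ (FractionRing (Entire K (ℤ × ℤ))) H' =
      algebraMap _ (FractionRing (Entire K (ℤ × ℤ))) H₀ * hFrac s (0, 1) (1, 0) →
    ∀ (m₁ m₂ l : ℤ) (u : M), HasAdicSum K
      (fun d : ℤ × ℤ =>
        H₀.coeffAt d •
          (D.x σ i (m₁ + d.1) (D.x σ i (m₂ + d.2) (D.x σ j (l - d.1 - d.2) u)) +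
            D.x σ j (l - d.1 - d.2) (D.x σ i (m₁ + d.1) (D.x σ i (m₂ + d.2) u)) +
            D.x σ i (m₂ + d.2) (D.x σ i (m₁ + d.1) (D.x σ j (l - d.1 - d.2) u)) +
            D.x σ j (l - d.1 - d.2) (D.x σ i (m₂ + d.2) (D.x σ i (m₁ + d.1) u))) -
          H.coeffAt d • D.x σ i (m₁ + d.1) (D.x σ j (l - d.1 - d.2) (D.x σ i (m₂ + d.2) u)) -
          H'.coeffAt d • D.x σ i (m₂ + d.2) (D.x σ j (l - d.1 - d.2) (D.x σ i (m₁ + d.1) u)))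
      0

/-- The representation `D` of level `c` is a highest weight representation with highest weight vector
`v`, whose classical weight has the value `wt j` on the `j`-th simple coroot. As `p^{1/2}` is not
invertible in `K[[p^{1/2}]]`, generation by `v` is required after inverting `p^{1/2}`. -/
structure IsHighestWeightRep (s : Kˣ) (c : ℤ) (wt : Fin (n - 1) → ℤ) (D : Currents K n M)
    (v : M) : Prop where
  isRepresentation : IsRepresentation s c D
  ne_zero : v ≠ 0
  aBar_vec : ∀ i k, D.aBar 1 i k v = 0
  bBar_vec : ∀ i k, D.bBar 1 i k v = 0
  xPlus_vec : ∀ i (l : ℤ), 0 ≤ l → D.x 1 i l v = 0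
  xMinus_vec : ∀ i (l : ℤ), 0 < l → D.x (-1) i l v = 0
  aZero_vec : ∀ i, (D.aZero i : Module.End K⟦X⟧ M) v =
    (PowerSeries.C ((q s ^ (-wt i) : Kˣ) : K) : K⟦X⟧) • v
  bZero_vec : ∀ i, (D.bZero i : Module.End K⟦X⟧ M) v =
    (PowerSeries.C ((q s ^ wt i : Kˣ) : K) : K⟦X⟧) • v
  generates : ∀ W : Submodule K⟦X⟧ M, v ∈ W →
    (∀ u ∈ W, ∀ i,
      (∀ σ k, D.aBar σ i k u ∈ W ∧ D.bBar σ i k u ∈ W) ∧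
      (D.aZero i : Module.End K⟦X⟧ M) u ∈ W ∧
      (((D.aZero i)⁻¹ : (Module.End K⟦X⟧ M)ˣ) : Module.End K⟦X⟧ M) u ∈ W ∧
      (D.bZero i : Module.End K⟦X⟧ M) u ∈ W ∧
      (((D.bZero i)⁻¹ : (Module.End K⟦X⟧ M)ˣ) : Module.End K⟦X⟧ M) u ∈ W ∧
      ∀ σ l, D.x σ i l u ∈ W) →
    ∀ u : M, ∃ N : ℕ, (PowerSeries.X ^ N : K⟦X⟧) • u ∈ W

end Representation

/-! ### The weight lattice and its twisted group algebra

The weight lattice of `sl_n` is `Fin (n - 1) → ℤ`: these are the coordinates with respect to the basis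
`α_2, …, α_{n-1}, Λ̄_{n-1}`. The coordinate `k` belongs to `α_{k+2}` if `k + 2 < n` and to `Λ̄_{n-1}`
if `k + 2 = n`. The simple root `α_{j+1}` is indexed by `j : Fin (n - 1)`. -/

section Lattice

variable (n : ℕ)

abbrev WeightLattice : Type := Fin (n - 1) → ℤ

/-- The simple root `α_{j+1}`, with
`α_1 = -2 α_2 - 3 α_3 - ⋯ - (n-1) α_{n-1} + n Λ̄_{n-1}`. -/
def root (j : Fin (n - 1)) : WeightLattice n := fun k =>
  if (j : ℕ) = 0 then (if (k : ℕ) + 2 = n then (n : ℤ) else -((k : ℤ) + 2))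
  else if (k : ℕ) + 1 = j then 1 else 0

/-- The classical part `Λ̄_i` of the `i`-th fundamental weight: `Λ̄_0 = 0` and
`Λ̄_i = -α_{i+1} - 2 α_{i+2} - ⋯ - (n-i-1) α_{n-1} + (n-i) Λ̄_{n-1}` for `i > 0`. -/
def fundWeight (i : ℕ) : WeightLattice n := fun k =>
  if i = 0 then 0
  else if (k : ℕ) + 2 = n then (n : ℤ) - i
  else if i < (k : ℕ) + 2 then -((k : ℤ) + 2 - i) else 0

/-- The pairing `(α_{j+1}, β)`. -/
def pairing (j : Fin (n - 1)) (β : WeightLattice n) : ℤ :=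
  ∑ k : Fin (n - 1), β k *
    (if h : (k : ℕ) + 2 = n then (if (j : ℕ) + 2 = n then 1 else 0)
      else CartanMatrix.A (n - 1) j (⟨k + 1, by omega⟩ : Fin (n - 1)))

/-- The exponentials `e_k`, `e_l` of the `k`-th and the `l`-th basis vectors, `l < k`, satisfy
`e_k e_l = (-1)^{commSign k l} e_l e_k`. -/
def commSign (k l : Fin (n - 1)) (h : l < k) : ℤ :=
  if hk : (k : ℕ) + 2 = n then (if (l : ℕ) + 3 = n then 1 else 0)
  else CartanMatrix.A (n - 1) (⟨k + 1, by omega⟩ : Fin (n - 1))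
    (⟨l + 1, by have : (l : ℕ) < k := h; omega⟩ : Fin (n - 1))

/-- The sign in `e^α e^β = sign α β · e^{α + β}`, where `e^α` is the product of the powers of the
exponentials of the basis vectors in increasing order: reordering the product moves the factors of
`e^β` with smaller index to the left past those of `e^α` with larger index. -/
def sign (α β : WeightLattice n) : ℤˣ :=
  (-1) ^ (∑ k : Fin (n - 1), ∑ l : Fin (n - 1),
    if h : l < k then α k * β l * commSign n k l h else 0)

/-- The root lattice. -/
def rootLattice : AddSubgroup (WeightLattice n) := AddSubgroup.closure (Set.range (root n))

/-- The coset of the root lattice containing `Λ̄_i`. -/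
abbrev Coset (i : ℕ) : Type := {β : WeightLattice n // β - fundWeight n i ∈ rootLattice n}

/-- `β ↦ β ± α_{j+1}` -/
def Coset.shift {n i : ℕ} (σ : ℤˣ) (j : Fin (n - 1)) (β : Coset n i) : Coset n i :=
  ⟨(σ : ℤ) • root n j + β.1, by
    rw [add_sub_assoc]
    exact add_mem (zsmul_mem (AddSubgroup.subset_closure (Set.mem_range_self j)) _) β.2⟩

end Lattice

/-! ### The Fock space -/

section Fock

/-- The creation operators `a_{j,-k}` and `b_{j,-k}`, `k > 0`. -/
inductive FockVar (n : ℕ) : Type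
  | a (j : Fin (n - 1)) (k : ℕ+)
  | b (j : Fin (n - 1)) (k : ℕ+)

/-- The index `k` of `a_{j,-k}` or `b_{j,-k}`. -/
def FockVar.deg {n : ℕ} : FockVar n → ℕ
  | .a _ k => k
  | .b _ k => k

/-- `K[[p^{1/2}]][a_{j,-k}, b_{j,-k}]` -/
abbrev FockPoly (K : Type*) [Field K] (n : ℕ) : Type _ := MvPolynomial (FockVar n) K⟦X⟧

/-- The Fock space `F_i = K[[p^{1/2}]][a_{j,-k}, b_{j,-k}] ⊗ K[Q̄] e^{Λ̄_i}`: the element `f ⊗ e^β` is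
`Finsupp.single β f`. -/
abbrev Fock (K : Type*) [Field K] (n i : ℕ) : Type _ := Coset n i →₀ FockPoly K n

variable {K : Type*} [Field K] {n : ℕ} {i : ℕ}

/-- `[a_{j,k}, a_{l,-k}] = [(α_j, α_l) k] [k] / (k (1 - p^k))` for `k > 0`. -/
def heisCoeff (s : Kˣ) (j l : Fin (n - 1)) (k : ℕ+) : K⟦X⟧ :=
  PowerSeries.C (qInt s (CartanMatrix.A (n - 1) j l * (k : ℤ)) * qInt s (k : ℤ) / ((k : ℕ) : K)) *
    (1 - PowerSeries.X ^ (2 * (k : ℕ)))⁻¹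

/-- `a_{j,-k}`, acting by multiplication. -/
def aCre (j : Fin (n - 1)) (k : ℕ+) : Module.End K⟦X⟧ (FockPoly K n) :=
  LinearMap.mulLeft K⟦X⟧ (MvPolynomial.X (FockVar.a j k))

/-- `b_{j,-k}`, acting by multiplication. -/
def bCre (j : Fin (n - 1)) (k : ℕ+) : Module.End K⟦X⟧ (FockPoly K n) :=
  LinearMap.mulLeft K⟦X⟧ (MvPolynomial.X (FockVar.b j k))

/-- The commutators of `a_{j,k}` with the creation operators. -/
def aComm (s : Kˣ) (j : Fin (n - 1)) (k : ℕ+) : FockVar n → K⟦X⟧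
  | .a l m => if m = k then heisCoeff s j l k else 0
  | .b _ _ => 0

/-- The commutators of `b_{j,k}` with the creation operators. -/
def bComm (s : Kˣ) (j : Fin (n - 1)) (k : ℕ+) : FockVar n → K⟦X⟧
  | .a _ _ => 0
  | .b l m => if m = k then -heisCoeff s j l k else 0

/-- `a_{j,k}`, acting by the derivation `f ↦ [a_{j,k}, f]`. -/
def aAnn (s : Kˣ) (j : Fin (n - 1)) (k : ℕ+) : Module.End K⟦X⟧ (FockPoly K n) :=
  (MvPolynomial.mkDerivation K⟦X⟧ fun v : FockVar n =>
    (MvPolynomial.C (aComm s j k v) : FockPoly K n)).toLinearMap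

/-- `b_{j,k}`, acting by the derivation `f ↦ [b_{j,k}, f]`. -/
def bAnn (s : Kˣ) (j : Fin (n - 1)) (k : ℕ+) : Module.End K⟦X⟧ (FockPoly K n) :=
  (MvPolynomial.mkDerivation K⟦X⟧ fun v : FockVar n =>
    (MvPolynomial.C (bComm s j k v) : FockPoly K n)).toLinearMap

/-- The operator `T ⊗ 1` on the Fock space. -/
def onFock (T : Module.End K⟦X⟧ (FockPoly K n)) : Module.End K⟦X⟧ (Fock K n i) :=
  Finsupp.mapRange.linearMap T

/-- The coefficient `±(a_{j,-k} q^{∓k/2} - b_{j,-k} (p q^{±1})^{k/2}) / [k]` of `z^k` in the first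
exponent of `x_j^±(z)`. -/
def xCre (s : Kˣ) (σ : ℤˣ) (j : Fin (n - 1)) (k : ℕ+) : Module.End K⟦X⟧ (FockPoly K n) :=
  (PowerSeries.C (((σ : ℤ) : K) / qInt s (k : ℤ)) : K⟦X⟧) •
    ((PowerSeries.C ((s ^ (-(σ : ℤ) * (k : ℤ)) : Kˣ) : K) : K⟦X⟧) • aCre j k -
      (PowerSeries.C ((s ^ ((σ : ℤ) * (k : ℤ)) : Kˣ) : K) * PowerSeries.X ^ (k : ℕ) : K⟦X⟧) •
        bCre j k)

/-- The coefficient `∓(a_{j,k} q^{∓k/2} - b_{j,k} (p q^{±1})^{k/2}) / [k]` of `z^{-k}` in the second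
exponent of `x_j^±(z)`. -/
def xAnn (s : Kˣ) (σ : ℤˣ) (j : Fin (n - 1)) (k : ℕ+) : Module.End K⟦X⟧ (FockPoly K n) :=
  (PowerSeries.C (-((σ : ℤ) : K) / qInt s (k : ℤ)) : K⟦X⟧) •
    ((PowerSeries.C ((s ^ (-(σ : ℤ) * (k : ℤ)) : Kˣ) : K) : K⟦X⟧) • aAnn s j k -
      (PowerSeries.C ((s ^ ((σ : ℤ) * (k : ℤ)) : Kˣ) : K) * PowerSeries.X ^ (k : ℕ) : K⟦X⟧) •
        bAnn s j k)

/-! The annihilation operators lower the degree in which `a_{j,-k}` and `b_{j,-k}` have degree `k`. -/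

/-- The degree of a monomial. -/
def monDeg (m : FockVar n →₀ ℕ) : ℕ := m.sum fun v e => e * v.deg

/-- Polynomials of degree at most `d`. -/
def polyFilt (K : Type*) [Field K] (n : ℕ) (d : ℤ) : Submodule K⟦X⟧ (FockPoly K n) where
  carrier := {f | ∀ m, MvPolynomial.coeff m f ≠ 0 → (monDeg m : ℤ) ≤ d}
  zero_mem' := by simp
  add_mem' {f g} hf hg m hm := by
    by_contra h
    refine hm ?_
    rw [MvPolynomial.coeff_add, not_imp_comm.1 (hf m) h, not_imp_comm.1 (hg m) h, add_zero]
  smul_mem' c f hf m hm := by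
    refine hf m fun h => hm ?_
    rw [MvPolynomial.coeff_smul, h, smul_zero]

theorem polyFilt_neg (d : ℤ) (hd : d < 0) : polyFilt K n d = ⊥ := by
  rw [eq_bot_iff]
  intro f hf
  rw [Submodule.mem_bot]
  refine MvPolynomial.ext _ _ fun m => ?_
  by_contra h
  have := hf m h
  omega

theorem exists_mem_polyFilt (f : FockPoly K n) : ∃ d, ∀ d', d ≤ d' → f ∈ polyFilt K n d' := by
  refine ⟨(f.support.sup monDeg : ℕ), fun d' hd m hm => le_trans ?_ hd⟩
  exact_mod_cast Finset.le_sup (f := monDeg) (MvPolynomial.mem_support_iff.2 hm)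

theorem mkDerivation_mem_polyFilt (k : ℕ) (c : FockVar n → K⟦X⟧)
    (hc : ∀ v, c v ≠ 0 → v.deg = k) (d : ℤ) (f : FockPoly K n) (hf : f ∈ polyFilt K n d) :
    MvPolynomial.mkDerivation K⟦X⟧ (fun v => (MvPolynomial.C (c v) : FockPoly K n)) f ∈
      polyFilt K n (d - k) := by
  rw [f.as_sum, map_sum]
  refine Submodule.sum_mem _ fun m hm => ?_
  rw [MvPolynomial.mkDerivation_monomial]
  refine Submodule.smul_mem _ _ (Submodule.sum_mem _ fun v hv => ?_)
  have hm' := hf m (MvPolynomial.mem_support_iff.1 hm)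
  have hv0 : m v ≠ 0 := Finsupp.mem_support_iff.1 hv
  by_cases hcv : c v = 0
  · simp [hcv]
  have hk := hc v hcv
  have hle : Finsupp.single v 1 ≤ m := by
    rw [Finsupp.single_le_iff]; omega
  have hdeg : monDeg (m - Finsupp.single v 1) + k = monDeg m := by
    conv_rhs => rw [← tsub_add_cancel_of_le hle]
    unfold monDeg
    classical
    rw [Finsupp.sum_add_index' (h := fun (v : FockVar n) (e : ℕ) => e * v.deg)
      (by simp) (by intros; ring), Finsupp.sum_single_index (by simp), hk,
      one_mul]
  intro m' hm''
  change MvPolynomial.coeff m' (MvPolynomial.monomial (m - Finsupp.single v 1) (m v : K⟦X⟧) *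
    MvPolynomial.C (c v)) ≠ 0 at hm''
  classical
  rw [mul_comm, MvPolynomial.C_mul_monomial, MvPolynomial.coeff_monomial] at hm''
  have : m - Finsupp.single v 1 = m' := by
    by_contra h
    simp [h] at hm''
  subst this
  omega

theorem aAnn_mem (s : Kˣ) (j : Fin (n - 1)) (k : ℕ+) (d : ℤ) (f : FockPoly K n)
    (hf : f ∈ polyFilt K n d) : aAnn s j k f ∈ polyFilt K n (d - (k : ℕ)) := by
  refine mkDerivation_mem_polyFilt (k : ℕ) (aComm s j k) ?_ d f hf
  rintro (⟨l, m⟩ | ⟨l, m⟩) hv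
  · by_cases hm : m = k
    · simp [FockVar.deg, hm]
    · simp [aComm, hm] at hv
  · simp [aComm] at hv

theorem bAnn_mem (s : Kˣ) (j : Fin (n - 1)) (k : ℕ+) (d : ℤ) (f : FockPoly K n)
    (hf : f ∈ polyFilt K n d) : bAnn s j k f ∈ polyFilt K n (d - (k : ℕ)) := by
  refine mkDerivation_mem_polyFilt (k : ℕ) (bComm s j k) ?_ d f hf
  rintro (⟨l, m⟩ | ⟨l, m⟩) hv
  · simp [bComm] at hv
  · by_cases hm : m = k
    · simp [FockVar.deg, hm]
    · simp [bComm, hm] at hv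

theorem xAnn_locallyFinite (s : Kˣ) (σ : ℤˣ) (j : Fin (n - 1)) :
    LocallyFinite (expCoeff (xAnn (n := n) s σ j)) :=
  locallyFinite_expCoeff (polyFilt K n) (fun d hd => polyFilt_neg d hd)
    (fun f => (exists_mem_polyFilt f).imp fun d h => h d le_rfl) _ fun k d f hf =>
      Submodule.smul_mem _ _ (Submodule.sub_mem _ (Submodule.smul_mem _ _ (aAnn_mem s j k d f hf))
        (Submodule.smul_mem _ _ (bAnn_mem s j k d f hf)))

/-- Elements of the Fock space of degree at most `d`. -/
def fockFilt (K : Type*) [Field K] (n i : ℕ) (d : ℤ) : Submodule K⟦X⟧ (Fock K n i) where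
  carrier := {u | ∀ β, u β ∈ polyFilt K n d}
  zero_mem' β := by simp
  add_mem' hu hv β := Submodule.add_mem _ (hu β) (hv β)
  smul_mem' c _ hu β := Submodule.smul_mem _ c (hu β)

theorem onFock_locallyFinite (y : ℕ+ → Module.End K⟦X⟧ (FockPoly K n))
    (hy : ∀ (k : ℕ+) d f, f ∈ polyFilt K n d → y k f ∈ polyFilt K n (d - (k : ℕ))) :
    LocallyFinite (K := K) (M := Fock K n i) (expCoeff fun k => (onFock (y k) : Module.End K⟦X⟧ (Fock K n i))) := by
  refine locallyFinite_expCoeff (fockFilt K n i) (fun d hd => ?_) (fun u => ?_) _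
    fun k d u hu => ?_
  · rw [eq_bot_iff]
    intro u hu
    rw [Submodule.mem_bot]
    ext1 β
    have h := hu β
    rw [polyFilt_neg d hd, Submodule.mem_bot] at h
    exact h
  · choose D hD using exists_mem_polyFilt (K := K) (n := n)
    refine ⟨∑ β ∈ u.support, |D (u β)|, fun β => ?_⟩
    by_cases hβ : β ∈ u.support
    · refine hD _ _ ((le_abs_self _).trans ?_)
      exact Finset.single_le_sum (f := fun β => |D (u β)|) (fun _ _ => abs_nonneg _) hβ
    · rw [Finsupp.notMem_support_iff.1 hβ]
      exact Submodule.zero_mem _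
  · intro β
    simpa [onFock] using hy k d _ (hu β)

/-- The operator `q^{m ∂_{α_j}}`, where `∂_{α_j} (f ⊗ e^β) = (α_j, β) f ⊗ e^β`. -/
def qPartial (s : Kˣ) (m : ℤ) (j : Fin (n - 1)) : Module.End K⟦X⟧ (Fock K n i) :=
  Finsupp.lsum K⟦X⟧ fun β : Coset n i =>
    (PowerSeries.C ((q s ^ (m * pairing n j β.1) : Kˣ) : K) : K⟦X⟧) • Finsupp.lsingle β

theorem qPartial_single (s : Kˣ) (m : ℤ) (j : Fin (n - 1)) (β : Coset n i) (f : FockPoly K n) :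
    qPartial s m j (Finsupp.single β f) =
      (PowerSeries.C ((q s ^ (m * pairing n j β.1) : Kˣ) : K) : K⟦X⟧) • Finsupp.single β f := by
  simp [qPartial]

theorem qPartial_mul (s : Kˣ) (m : ℤ) (j : Fin (n - 1)) :
    qPartial (i := i) s m j * qPartial s (-m) j = 1 := by
  refine Finsupp.lhom_ext fun β f => ?_
  rw [Module.End.mul_apply, qPartial_single, map_smul, qPartial_single, smul_smul, ← map_mul,
    ← Units.val_mul, ← zpow_add]
  simp

/-- `q^{m ∂_{α_j}}` as an invertible operator. -/
def qPartialUnit (s : Kˣ) (m : ℤ) (j : Fin (n - 1)) : (Module.End K⟦X⟧ (Fock K n i))ˣ where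
  val := qPartial s m j
  inv := qPartial s (-m) j
  val_inv := qPartial_mul s m j
  inv_val := by simpa using qPartial_mul (i := i) s (-m) j

/-- The coefficient of `z^{-l}` in the vertex operator
`x_j^±(z) = exp [± ∑_{k > 0} (a_{j,-k} q^{∓k/2} - b_{j,-k} (p q^{±1})^{k/2}) / [k] z^k]
  exp [∓ ∑_{k > 0} (a_{j,k} q^{∓k/2} - b_{j,k} (p q^{±1})^{k/2}) / [k] z^{-k}]
  e^{±α_j} z^{±∂_{α_j} + 1}`.
On `f ⊗ e^β` the operator `z^{±∂_{α_j} + 1}` is multiplication by `z^{±(α_j, β) + 1}`. -/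
def xMode (s : Kˣ) (σ : ℤˣ) (j : Fin (n - 1)) (l : ℤ) : Module.End K⟦X⟧ (Fock K n i) :=
  Finsupp.lsum K⟦X⟧ fun β : Coset n i =>
    (((sign n ((σ : ℤ) • root n j) β.1 : ℤˣ) : ℤ) : K⟦X⟧) •
      (Finsupp.lsingle (β.shift σ j) ∘ₗ
        modeOfProduct (expCoeff (xCre s σ j)) (expCoeff (xAnn s σ j)) (xAnn_locallyFinite s σ j)
          (l + ((σ : ℤ) * pairing n j β.1 + 1)))

/-- The operators on the Fock space: the vertex operators `x_j^±(z)`, and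
`φ_j(z) = exp [-(q - q^{-1}) ∑_{k > 0} a_{j,-k} z^k]
  exp [(q - q^{-1}) ∑_{k > 0} b_{j,k} p^{k/2} z^{-k}] q^{-∂_{α_j}}`,
`ψ_j(z) = exp [-(q - q^{-1}) ∑_{k > 0} b_{j,-k} p^{k/2} z^k]
  exp [(q - q^{-1}) ∑_{k > 0} a_{j,k} z^{-k}] q^{∂_{α_j}}`. -/
def fockCurrents (s : Kˣ) (n i : ℕ) : Currents K n (Fock K n i) where
  aBar σ j k :=
    if σ = 1 then
      onFock ((PowerSeries.C ((q s : K) - ((q s)⁻¹ : Kˣ)) * PowerSeries.X ^ (k : ℕ) : K⟦X⟧) •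
        bAnn s j k)
    else onFock ((-PowerSeries.C ((q s : K) - ((q s)⁻¹ : Kˣ)) : K⟦X⟧) • aCre j k)
  bBar σ j k :=
    if σ = 1 then onFock ((PowerSeries.C ((q s : K) - ((q s)⁻¹ : Kˣ)) : K⟦X⟧) • aAnn s j k)
    else
      onFock ((-(PowerSeries.C ((q s : K) - ((q s)⁻¹ : Kˣ)) * PowerSeries.X ^ (k : ℕ)) : K⟦X⟧) •
        bCre j k)
  aZero j := qPartialUnit s (-1) j
  bZero j := qPartialUnit s 1 j
  x := xMode s
  aBar_locallyFinite j := by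
    simpa using onFock_locallyFinite (i := i) _ fun k d f hf =>
      Submodule.smul_mem _ _ (bAnn_mem s j k d f hf)
  bBar_locallyFinite j := by
    simpa using onFock_locallyFinite (i := i) _ fun k d f hf =>
      Submodule.smul_mem _ _ (aAnn_mem s j k d f hf)

theorem fundWeight_mem (n i : ℕ) : fundWeight n i - fundWeight n i ∈ rootLattice n := by
  rw [sub_self]; exact zero_mem _

/-- The vector `1 ⊗ e^{Λ̄_i}`. -/
def vacuum (K : Type*) [Field K] (n i : ℕ) : Fock K n i :=
  Finsupp.single ⟨fundWeight n i, fundWeight_mem n i⟩ 1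

end Fock

end

end EllipticAlgebra

/-! Every current is a vertex operator: an exponential of creation operators, times an exponential
of annihilation operators, times a lattice part. Annihilation and creation operators have scalar
commutators, so Wick's theorem applies (`Vtx.A_B`, `Vtx.mode_mode`, `Vtx.no2_mode`): V(z)V'(w) is a
scalar series in w/z, the contraction, times the normally ordered product. The normally ordered
product does not depend on the order of the factors and, on a given vector and in a given total
degree, has only finitely many nonzero coefficients. Each defining relation thus becomes a
comparison of contractions multiplying one and the same finitely supported distribution.

Because of the denominators 1 - p^k in the Heisenberg relations, the contractions are quotients of
infinite products (κx;p)_∞ (`poch`), of which theta functions are also products (`theta_eq`).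

For φ, ψ against each other and against x^±, one order of the factors has a contraction in z/w, the
other one in pw/z, and their quotient is the prescribed factor g, up to the constant that the
lattice part supplies (`gLaurentPow_mul_sw`, `Vtx.hasAdicSum_exchange`).

For x^+ against x^-, the a- and b-contributions combine so that p cancels. For equal indices the
contraction is 1/((1 - qw/z)(1 - q^{-1}w/z)); the difference of its two expansions is a sum of delta
functions at z = q^{±1}w, where the normally ordered product degenerates to ψ or φ
(`commutator_coeff`, `fuse_plus_minus`, `fuse_plus_minus'`). For neighbouring indices the
contraction is 1 - w/z, and the sign from exchanging the factors cancels against the sign of the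
twisted group algebra.

For x^± of equal sign, the contraction is an elementary factor times a series in pw/z. Modulo a
power of p^{1/2} the latter is a Laurent polynomial, so it acts on every distribution irrespective
of the direction of expansion (`distAct`, `conv_rescale`). If a_ij = 2 the elementary factor is a
polynomial, and the relation is an identity between entire functions. If a_ij = -1 it is 1/(1 -
Q^{-1}w/z) with Q = q^{±1}, and the two orders of the factors expand poles at different points. As
the two denominators are coprime, both expansions are entire multiples of one distribution ρ
(`exists_divisor`, `exists_divisor₂`). On ρ the quadratic and the cubic relations reduce to
identities of entire functions; the cubic one, `cubic_identity`, is checked in the fraction field,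
where h is exactly the function that makes it true.

The highest weight conditions are degree counts. The extremal modes of x_j^± carry the vacuum to
every 1 ⊗ e^β, and the negative modes of φ and ψ create all polynomials, up to powers of p^{1/2}
(`fock_generates`). -/

set_option linter.unusedSectionVars false

namespace EllipticAlgebra

noncomputable section

/-! ### Formal exponentials -/

section EulerOperator

variable {A : Type*} [Ring A]

/-- The Euler operator `x d/dx`. -/
def euler : A⟦X⟧ →+ A⟦X⟧ where
  toFun F := PowerSeries.mk fun n => n • PowerSeries.coeff n F
  map_zero' := by ext; simp
  map_add' F G := by ext; simp

@[simp] theorem coeff_euler (n : ℕ) (F : A⟦X⟧) :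
    PowerSeries.coeff n (euler F) = n • PowerSeries.coeff n F := by
  simp [euler]

theorem euler_mul (F G : A⟦X⟧) : euler (F * G) = euler F * G + F * euler G := by
  ext n
  simp only [coeff_euler, map_add, PowerSeries.coeff_mul, Finset.smul_sum, ← Finset.sum_add_distrib]
  refine Finset.sum_congr rfl fun x hx => ?_
  rw [← Finset.HasAntidiagonal.mem_antidiagonal.1 hx, add_smul, smul_mul_assoc, mul_smul_comm]

theorem euler_one : euler (1 : A⟦X⟧) = 0 := by
  ext n
  rcases n with _ | n <;> simp [PowerSeries.coeff_one]

theorem commute_of_coeff {F G : A⟦X⟧}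
    (h : ∀ i j, Commute (PowerSeries.coeff i F) (PowerSeries.coeff j G)) : Commute F G := by
  ext n
  rw [PowerSeries.coeff_mul, PowerSeries.coeff_mul, ← Finset.Nat.sum_antidiagonal_swap]
  exact Finset.sum_congr rfl fun x _ => h _ _

/-- The commutative power rule survives because a series whose coefficients commute with each other
commutes with its Euler derivative. -/
theorem euler_pow_succ (F : A⟦X⟧)
    (h : ∀ i j, Commute (PowerSeries.coeff i F) (PowerSeries.coeff j F)) (r : ℕ) :
    euler (F ^ (r + 1)) = (r + 1) • (euler F * F ^ r) := by
  have hc : Commute F (euler F) := commute_of_coeff fun i j => by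
    rw [coeff_euler]; exact (h i j).smul_right j
  induction r with
  | zero => simp
  | succ r ih =>
    rw [pow_succ, euler_mul, ih, smul_mul_assoc, mul_assoc, ← pow_succ,
      ((hc.pow_left (r + 1)).eq : F ^ (r + 1) * euler F = _), ← succ_nsmul]

theorem coeff_pow_of_lt (F : A⟦X⟧) (h0 : PowerSeries.coeff 0 F = 0) {m r : ℕ} (h : m < r) :
    PowerSeries.coeff m (F ^ r) = 0 := by
  induction r generalizing m with
  | zero => omega
  | succ r ih =>
    rw [pow_succ, PowerSeries.coeff_mul]
    refine Finset.sum_eq_zero fun x hx => ?_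
    have hx' : x.1 + x.2 = m := Finset.HasAntidiagonal.mem_antidiagonal.1 hx
    rcases Nat.eq_zero_or_pos x.2 with h2 | h2
    · rw [h2, h0, mul_zero]
    · rw [ih (by omega), zero_mul]

/-- `F` is the exponential of a series with Euler derivative `D`. -/
structure IsExp (D F : A⟦X⟧) : Prop where
  coeff_zero : PowerSeries.coeff 0 F = 1
  euler_eq : euler F = D * F

/-- A linear differential equation `x F' = D F` determines `F` from its constant term. -/
theorem eq_of_euler_eq [IsAddTorsionFree A] {D F G : A⟦X⟧} (hD : PowerSeries.coeff 0 D = 0)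
    (h0 : PowerSeries.coeff 0 F = PowerSeries.coeff 0 G) (hF : euler F = D * F)
    (hG : euler G = D * G) : F = G := by
  ext n
  induction n using Nat.strong_induction_on with
  | _ n ih =>
    rcases Nat.eq_zero_or_pos n with rfl | hn
    · exact h0
    refine nsmul_right_injective hn.ne' ?_
    change n • PowerSeries.coeff n F = n • PowerSeries.coeff n G
    rw [← coeff_euler, ← coeff_euler, hF, hG, PowerSeries.coeff_mul, PowerSeries.coeff_mul]
    refine Finset.sum_congr rfl fun x hx => ?_
    have hx' : x.1 + x.2 = n := Finset.HasAntidiagonal.mem_antidiagonal.1 hx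
    rcases Nat.eq_zero_or_pos x.1 with h1 | h1
    · rw [h1, hD, zero_mul, zero_mul]
    · rw [ih x.2 (by omega)]

theorem IsExp.unique [IsAddTorsionFree A] {D F G : A⟦X⟧} (hD : PowerSeries.coeff 0 D = 0)
    (hF : IsExp D F) (hG : IsExp D G) : F = G :=
  eq_of_euler_eq hD (hF.coeff_zero.trans hG.coeff_zero.symm) hF.euler_eq hG.euler_eq

theorem IsExp.mul {D D' F F' : A⟦X⟧} (hF : IsExp D F) (hF' : IsExp D' F') (h : Commute F D') :
    IsExp (D + D') (F * F') where
  coeff_zero := by simp [PowerSeries.coeff_mul, hF.coeff_zero, hF'.coeff_zero]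
  euler_eq := by
    rw [euler_mul, hF.euler_eq, hF'.euler_eq, add_mul, mul_assoc, ← mul_assoc F, h.eq, mul_assoc]

end EulerOperator

/-! ### Commutation of exponentials whose exponents have scalar commutators. -/

section Commutation

variable {R A : Type*} [CommRing R] [Ring A] [Algebra R A]

/-- Extension of a sequence by zero. -/
def zext {B : Type*} [Zero B] (F : ℕ → B) (e : ℤ) : B := if 0 ≤ e then F e.toNat else 0

theorem zext_natCast {B : Type*} [Zero B] (F : ℕ → B) (e : ℕ) : zext F e = F e := by simp [zext]

theorem zext_of_neg {B : Type*} [Zero B] (F : ℕ → B) {e : ℤ} (h : e < 0) : zext F e = 0 := by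
  simp [zext, not_le.2 h]

theorem coeff_scalarX (c : R) (j n : ℕ) (F : A⟦X⟧) : PowerSeries.coeff n
    (PowerSeries.X ^ j * (c • F)) = c • zext (fun m => PowerSeries.coeff m F) ((n : ℤ) - j) := by
  rw [PowerSeries.coeff_X_pow_mul', zext]
  split_ifs with h1 h2 h2
  · rw [PowerSeries.coeff_smul]; congr 3; omega
  · omega
  · omega
  · simp

variable [IsAddTorsionFree A]

/-- Commutation of an annihilation operator with the exponential of creation operators. -/
theorem IsExp.bracket {Y F : A⟦X⟧} (hF : IsExp (euler Y) F) {d : A} {c : R} {j : ℕ} (hj : 0 < j)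
    (hd : ∀ k, d * PowerSeries.coeff k Y - PowerSeries.coeff k Y * d =
      if k = j then algebraMap R A c else 0) (m : ℤ) :
    d * zext (fun k => PowerSeries.coeff k F) m =
      zext (fun k => PowerSeries.coeff k F) m * d +
        c • zext (fun k => PowerSeries.coeff k F) (m - j) := by
  have hX : ∀ H : A⟦X⟧, euler (PowerSeries.X ^ j * (c • H)) =
      PowerSeries.X ^ j * (c • euler H) + j • (PowerSeries.X ^ j * (c • H)) := by
    intro H
    ext n
    rw [coeff_euler, map_add, map_nsmul, coeff_scalarX, coeff_scalarX, zext, zext]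
    split_ifs with h
    · rw [coeff_euler, smul_comm c (_ : ℕ), ← add_smul]; congr 1; omega
    · simp
  have hdY : PowerSeries.C d * euler Y =
      euler Y * PowerSeries.C d + j • (PowerSeries.X ^ j * (c • 1)) := by
    ext n
    rw [map_add, map_nsmul, coeff_scalarX, PowerSeries.coeff_C_mul, PowerSeries.coeff_mul_C,
      coeff_euler, mul_smul_comm, smul_mul_assoc, ← sub_eq_iff_eq_add', ← smul_sub, hd, zext]
    simp only [PowerSeries.coeff_one]
    split_ifs with h1 h2 h3 h3 h4
    · rw [h1, Algebra.algebraMap_eq_smul_one]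
    · omega
    · omega
    · omega
    · simp
    · simp
  have hcF : ∀ H : A⟦X⟧, PowerSeries.X ^ j * (c • (H * F)) = H * (PowerSeries.X ^ j * (c • F)) := by
    intro H
    rw [← mul_assoc H, ((PowerSeries.commute_X_pow H j).eq : H * PowerSeries.X ^ j = _), mul_assoc,
      mul_smul_comm, mul_smul_comm, mul_smul_comm]
  -- The difference of the two sides solves x H' = (x Y') H with zero constant term, hence vanishes.
  have key : PowerSeries.C d * F = F * PowerSeries.C d + PowerSeries.X ^ j * (c • F) := by
    rw [← sub_eq_zero]
    refine eq_of_euler_eq (D := euler Y) (by simp) ?_ ?_ (by simp)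
    · simp only [map_sub, map_add, map_zero, coeff_scalarX, PowerSeries.coeff_C_mul,
        PowerSeries.coeff_mul_C, hF.coeff_zero, mul_one, one_mul]
      rw [zext_of_neg _ (by simpa using hj)]; simp
    · have hC : euler (PowerSeries.C d) = 0 := by
        ext n; rcases n with _ | n <;> simp [PowerSeries.coeff_C]
      rw [map_sub, map_add, euler_mul, euler_mul, hX, hC, hF.euler_eq, hcF, zero_mul, zero_add,
        mul_zero, add_zero, ← mul_assoc, hdY, add_mul, smul_mul_assoc, mul_assoc (PowerSeries.X ^ j),
        smul_mul_assoc, one_mul]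
      noncomm_ring
  rcases lt_or_ge m 0 with hm | hm
  · rw [zext_of_neg _ hm, zext_of_neg _ (by omega)]; simp
  · lift m to ℕ using hm
    have := congrArg (PowerSeries.coeff m) key
    rw [map_add, coeff_scalarX, PowerSeries.coeff_C_mul, PowerSeries.coeff_mul_C] at this
    rw [zext_natCast]; exact this

/-- Commutation of the exponential of annihilation operators with the exponential of creation
operators. -/
theorem IsExp.comm {Y D F G : A⟦X⟧} {c C : R⟦X⟧} (hF : IsExp (euler Y) F) (hG : IsExp (euler D) G)
    (hC : IsExp (euler c) C) 
    (hDY : ∀ j k, PowerSeries.coeff j D * PowerSeries.coeff k Y -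
      PowerSeries.coeff k Y * PowerSeries.coeff j D =
      if k = j then algebraMap R A (PowerSeries.coeff j c) else 0) (n : ℕ) (m : ℤ) :
    PowerSeries.coeff n G * zext (fun k => PowerSeries.coeff k F) m =
      ∑ x ∈ Finset.HasAntidiagonal.antidiagonal n, PowerSeries.coeff x.1 C •
        (zext (fun k => PowerSeries.coeff k F) (m - x.1) * PowerSeries.coeff x.2 G) := by
  set B := zext (fun k => PowerSeries.coeff k F)
  set H : A⟦X⟧ := PowerSeries.mk fun k => PowerSeries.coeff k C • B (m - k) with hH
  -- Moving the i-th coefficient of `D` past B(m - k) produces the scalar c_i times B(m - k - i).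
  -- Summed with weights i C_k, these terms give the coefficients of x C' = (x c') C, which is the
  -- Euler derivative of `H`.
  have hDH : euler D * H = H * euler D + euler H := by
    rw [← sub_eq_iff_eq_add']
    ext t
    rw [map_sub, PowerSeries.coeff_mul, PowerSeries.coeff_mul,
      ← Finset.Nat.sum_antidiagonal_swap (f := fun x => PowerSeries.coeff x.1 H * _),
      ← Finset.sum_sub_distrib, coeff_euler, hH, PowerSeries.coeff_mk, ← smul_assoc, ← coeff_euler,
      hC.euler_eq, PowerSeries.coeff_mul, Finset.sum_smul]
    refine Finset.sum_congr rfl fun x hx => ?_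
    have hx' : x.1 + x.2 = t := Finset.HasAntidiagonal.mem_antidiagonal.1 hx
    rcases Nat.eq_zero_or_pos x.1 with h1 | h1
    · simp [h1]
    have hb := hF.bracket h1 (hDY x.1) (m - x.2)
    simp only [Prod.fst_swap, Prod.snd_swap, PowerSeries.coeff_mk, coeff_euler]
    change PowerSeries.coeff x.1 D * B (m - x.2) = B (m - x.2) * _ + _ • B _ at hb
    rw [smul_mul_assoc, mul_smul_comm, smul_mul_assoc, mul_smul_comm,
      smul_comm (PowerSeries.coeff x.2 C) x.1, ← smul_sub, ← smul_sub, hb,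
      add_sub_cancel_left, ← hx',
      show m - (x.2 : ℤ) - x.1 = m - ((x.1 + x.2 : ℕ) : ℤ) by push_cast; ring, smul_smul,
      smul_mul_assoc, smul_assoc, mul_comm]
  -- Both sides solve the differential equation of `G` with initial value B(m).
  have key : G * PowerSeries.C (B m) = H * G := by
    refine eq_of_euler_eq (D := euler D) (by simp) ?_ ?_ ?_
    · simp [PowerSeries.coeff_mul, PowerSeries.coeff_C, hG.coeff_zero, hH, hC.coeff_zero]
    · have hC : euler (PowerSeries.C (B m)) = 0 := by
        ext n; rcases n with _ | n <;> simp [PowerSeries.coeff_C]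
      rw [euler_mul, hC, hG.euler_eq, mul_zero, add_zero, mul_assoc]
    · rw [euler_mul, hG.euler_eq, ← mul_assoc (euler D), hDH]; noncomm_ring
  have := congrArg (PowerSeries.coeff n) key
  rw [PowerSeries.coeff_mul_C, PowerSeries.coeff_mul] at this
  rw [this]
  refine Finset.sum_congr rfl fun x _ => ?_
  rw [hH, PowerSeries.coeff_mk, smul_mul_assoc]

end Commutation

/-! ### Exponential coefficients, scalar exponentials and the infinite product (κx;p)_∞. -/

section Exponential

variable {K : Type*} [Field K] [CharZero K] {M : Type*} [AddCommGroup M] [Module K⟦X⟧ M]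

/-- Termwise differentiation: the Euler derivative of Y^{r+1}/(r+1)! is (x Y') Y^r / r!. From here
on exponentials are handled only through this differential equation. -/
theorem isExp_expCoeff {y : ℕ+ → Module.End K⟦X⟧ M} (hy : ∀ k l, Commute (y k) (y l)) :
    IsExp (euler (posSeries y)) (PowerSeries.mk (expCoeff y)) := by
  have h0 : PowerSeries.coeff 0 (posSeries y) = 0 := by simp [posSeries]
  have hcomm : ∀ i j, Commute (PowerSeries.coeff i (posSeries y))
      (PowerSeries.coeff j (posSeries y)) := by
    intro i j
    simp only [posSeries, PowerSeries.coeff_mk]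
    split_ifs
    · exact hy _ _
    all_goals simp
  refine ⟨by simp [expCoeff], ?_⟩
  ext1 m
  rw [coeff_euler, PowerSeries.coeff_mk, PowerSeries.coeff_mul]
  -- The exponent has no constant term, so higher powers do not contribute and the range of
  -- summation can be made independent of `k`.
  have hext : ∀ k n : ℕ, k ≤ n → expCoeff y k = ∑ r ∈ Finset.range (n + 1),
      (PowerSeries.C ((r.factorial : K)⁻¹) : K⟦X⟧) • PowerSeries.coeff k (posSeries y ^ r) := by
    intro k n hkn
    refine Finset.sum_subset (Finset.range_subset_range.2 (by omega)) fun r _ hr => ?_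
    rw [coeff_pow_of_lt _ h0 (by simpa using hr), smul_zero]
  rcases m with _ | m
  · simp [h0]
  rw [expCoeff, Finset.sum_range_succ']
  have hz : PowerSeries.coeff (m + 1) (posSeries y ^ 0) = 0 := by
    rw [pow_zero, PowerSeries.coeff_one, if_neg (by omega)]
  rw [hz, smul_zero, add_zero, Finset.smul_sum]
  have hterm : ∀ r, (m + 1) • ((PowerSeries.C (((r + 1).factorial : K)⁻¹) : K⟦X⟧) •
      PowerSeries.coeff (m + 1) (posSeries y ^ (r + 1))) =
      (PowerSeries.C ((r.factorial : K)⁻¹) : K⟦X⟧) •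
        PowerSeries.coeff (m + 1) (euler (posSeries y) * posSeries y ^ r) := by
    intro r
    rw [smul_comm, ← coeff_euler, euler_pow_succ _ hcomm, map_nsmul,
      ← Nat.cast_smul_eq_nsmul K⟦X⟧ (r + 1), smul_smul]
    congr 1
    rw [show ((r + 1 : ℕ) : K⟦X⟧) = PowerSeries.C ((r + 1 : ℕ) : K) by simp, ← map_mul]
    congr 1
    rw [Nat.factorial_succ]
    have : ((r + 1 : ℕ) : K) ≠ 0 := by exact_mod_cast r.succ_ne_zero
    push_cast at this ⊢
    field_simp
  rw [Finset.sum_congr rfl fun r _ => hterm r]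
  simp only [PowerSeries.coeff_mul, Finset.smul_sum]
  rw [Finset.sum_comm]
  refine Finset.sum_congr rfl fun x hx => ?_
  have hx' : x.1 + x.2 = m + 1 := Finset.HasAntidiagonal.mem_antidiagonal.1 hx
  rcases Nat.eq_zero_or_pos x.1 with h1 | h1
  · simp [h1]
  rw [PowerSeries.coeff_mk, hext x.2 m (by omega), Finset.mul_sum]
  exact Finset.sum_congr rfl fun r _ => (mul_smul_comm _ _ _).symm

/-- The series `∑_{k > 0} c_k x^k` with scalar coefficients. -/
def ser (c : ℕ+ → K⟦X⟧) : (K⟦X⟧)⟦X⟧ :=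
  PowerSeries.mk fun k => if h : 0 < k then c ⟨k, h⟩ else 0

/-- The scalar series `exp [∑_{k > 0} c_k x^k]`. -/
def expS (c : ℕ+ → K⟦X⟧) : (K⟦X⟧)⟦X⟧ :=
  PowerSeries.mk fun m => expCoeff (fun k => c k • (1 : Module.End K⟦X⟧ K⟦X⟧)) m 1

theorem isExp_expS (c : ℕ+ → K⟦X⟧) : IsExp (euler (ser c)) (expS c) := by
  have h := isExp_expCoeff (y := fun k => c k • (1 : Module.End K⟦X⟧ K⟦X⟧))
    fun k l => ((Commute.one_right _).smul_right _)
  refine ⟨?_, ?_⟩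
  · have := congrArg (fun f : Module.End K⟦X⟧ K⟦X⟧ => f 1) h.coeff_zero
    simpa [expS] using this
  · ext1 m
    have := congrArg (fun f : (Module.End K⟦X⟧ K⟦X⟧)⟦X⟧ => PowerSeries.coeff m f 1) h.euler_eq
    simp only [coeff_euler, PowerSeries.coeff_mk, PowerSeries.coeff_mul, LinearMap.sum_apply,
      LinearMap.smul_apply, Module.End.mul_apply, posSeries, expS, ser] at this ⊢
    rw [this]
    refine Finset.sum_congr rfl fun x _ => ?_
    split_ifs with hx
    · simp [mul_assoc]
    · simp

/-- The uniqueness of solutions of x F' = D F divides by the degree; characteristic zero of `K`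
makes every K⟦X⟧-module a rational vector space. -/
theorem isAddTorsionFree_of_module (K M : Type*) [Field K] [CharZero K] [AddCommGroup M]
    [Module K⟦X⟧ M] : IsAddTorsionFree M := by
  let _ : Module ℚ M := Module.compHom M (PowerSeries.C.comp (algebraMap ℚ K) : ℚ →+* K⟦X⟧)
  exact IsAddTorsionFree.of_module_rat M

instance : IsAddTorsionFree (Module.End K⟦X⟧ M) := isAddTorsionFree_of_module K _

theorem ser_add (c c' : ℕ+ → K⟦X⟧) : ser (c + c') = ser c + ser c' := by
  ext1 k
  simp only [ser, map_add, PowerSeries.coeff_mk]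
  split_ifs
  · rfl
  · simp

theorem expS_unique {c : ℕ+ → K⟦X⟧} {F : (K⟦X⟧)⟦X⟧} (hF : IsExp (euler (ser c)) F) :
    expS c = F :=
  have := isAddTorsionFree_of_module K K⟦X⟧
  (isExp_expS c).unique (by simp) hF

theorem expS_add (c c' : ℕ+ → K⟦X⟧) : expS (c + c') = expS c * expS c' := by
  refine expS_unique ?_
  rw [ser_add, map_add]
  exact (isExp_expS c).mul (isExp_expS c') (Commute.all _ _)

theorem expS_zero : expS (0 : ℕ+ → K⟦X⟧) = 1 := by
  refine expS_unique ⟨by simp, ?_⟩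
  have : ser (0 : ℕ+ → K⟦X⟧) = 0 := by
    ext1 k
    rw [ser, PowerSeries.coeff_mk]
    split_ifs <;> rfl
  rw [this, euler_one, map_zero, zero_mul]

theorem expS_mul_neg (c : ℕ+ → K⟦X⟧) : expS c * expS (-c) = 1 := by
  rw [← expS_add, add_neg_cancel, expS_zero]

theorem expS_sub_mul (c c' : ℕ+ → K⟦X⟧) : expS (c - c') * expS c' = expS c := by
  rw [← expS_add, sub_add_cancel]

/-- Multiplying the k-th exponent by r^k amounts to substituting r x for x. With r = p this isolates
the part of a contraction that involves p. -/
theorem expS_pow_mul (r : K⟦X⟧) (c : ℕ+ → K⟦X⟧) :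
    expS (fun k => r ^ (k : ℕ) * c k) = PowerSeries.rescale r (expS c) := by
  have h := isExp_expS c
  refine expS_unique ⟨by simp [h.coeff_zero], ?_⟩
  have hr : ∀ F : (K⟦X⟧)⟦X⟧, euler (PowerSeries.rescale r F) = PowerSeries.rescale r (euler F) := by
    intro F
    ext1 n
    rw [coeff_euler, PowerSeries.coeff_rescale, PowerSeries.coeff_rescale, coeff_euler,
      mul_smul_comm]
  have hs : ser (fun k => r ^ (k : ℕ) * c k) = PowerSeries.rescale r (ser c) := by
    ext1 n
    rw [PowerSeries.coeff_rescale, ser, ser, PowerSeries.coeff_mk, PowerSeries.coeff_mk]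
    split_ifs <;> simp
  rw [hs, hr, hr, h.euler_eq, map_mul]

/-- `exp [-∑_{k > 0} κ^k x^k / k] = 1 - κ x` -/
theorem expS_log (κ : K) :
    expS (fun k => -PowerSeries.C (κ ^ (k : ℕ) / ((k : ℕ) : K))) =
      1 - PowerSeries.C (PowerSeries.C κ) * PowerSeries.X := by
  refine expS_unique ⟨by simp, ?_⟩
  set L : (K⟦X⟧)⟦X⟧ := euler (ser fun k => -PowerSeries.C (κ ^ (k : ℕ) / ((k : ℕ) : K))) with hL
  have hc : ∀ n, PowerSeries.coeff (n + 1) L = -PowerSeries.C (κ ^ (n + 1)) := by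
    intro n
    rw [hL, coeff_euler, ser, PowerSeries.coeff_mk, dif_pos n.succ_pos, smul_neg, ← map_nsmul]
    congr 2
    have : ((n + 1 : ℕ) : K) ≠ 0 := by exact_mod_cast n.succ_ne_zero
    rw [nsmul_eq_mul, PNat.mk_coe, mul_div_cancel₀ _ this]
  have hc0 : PowerSeries.coeff 0 L = 0 := by rw [hL, coeff_euler, zero_smul]
  rw [mul_sub, mul_one, ← mul_assoc]
  ext1 n
  rw [coeff_euler, map_sub, map_sub]
  rcases n with _ | _ | n
  · simp [hc0]
  · rw [PowerSeries.coeff_succ_mul_X _ (L * _), hc 0, PowerSeries.coeff_mul_C, hc0]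
    simp [PowerSeries.coeff_one]
  · rw [PowerSeries.coeff_succ_mul_X _ (L * _), hc, PowerSeries.coeff_mul_C, hc, ← neg_mul_eq_neg_mul,
      ← map_mul, ← pow_succ]
    simp [PowerSeries.coeff_one]

/-- `p = X ^ 2`, where `X` is `p^{1/2}`. -/
def pp (K : Type*) [Field K] : K⟦X⟧ := PowerSeries.X ^ 2

/-- The exponents `-κ^k / (k (1 - p^k))` of the infinite product `(κ x; p)_∞`. -/
def ell (κ : K) (k : ℕ+) : K⟦X⟧ :=
  -(PowerSeries.C (κ ^ (k : ℕ) / ((k : ℕ) : K)) * (1 - PowerSeries.X ^ (2 * (k : ℕ)))⁻¹)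

theorem one_sub_mul_inv (k : ℕ+) :
    (1 - PowerSeries.X ^ (2 * (k : ℕ)) : K⟦X⟧) * (1 - PowerSeries.X ^ (2 * (k : ℕ)))⁻¹ = 1 :=
  PowerSeries.mul_inv_cancel _ (by simp)

theorem pp_pow {K : Type*} [Field K] (k : ℕ) : pp K ^ k = PowerSeries.X ^ (2 * k) := by rw [pp, pow_mul]

theorem ell_sub (κ : K) (k : ℕ+) :
    ell κ k - pp K ^ (k : ℕ) * ell κ k = -PowerSeries.C (κ ^ (k : ℕ) / ((k : ℕ) : K)) := by
  rw [pp_pow, ell]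
  linear_combination -PowerSeries.C (κ ^ (k : ℕ) / ((k : ℕ) : K)) * one_sub_mul_inv (K := K) k

/-- The infinite product `(κ x; p)_∞ = ∏_{j ≥ 0} (1 - κ p^j x)`. -/
def poch (κ : K) : (K⟦X⟧)⟦X⟧ := expS (ell κ)

/-- The functional equation (κx;p)_∞ = (1 - κx)(κpx;p)_∞ is ell_k - p^k ell_k = -κ^k/k
exponentiated. It splits off the only factor that is sensitive to the direction of expansion. -/
theorem poch_eq (κ : K) : poch κ =
    (1 - PowerSeries.C (PowerSeries.C κ) * PowerSeries.X) *
      PowerSeries.rescale (pp K) (poch κ) := by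
  rw [← expS_log, poch, ← expS_pow_mul, ← expS_add]
  congr 1
  funext k
  rw [Pi.add_apply, ← ell_sub]
  ring

end Exponential


end

end EllipticAlgebra


set_option linter.unusedSectionVars false

namespace EllipticAlgebra

noncomputable section

/-! ### Vertex operators on the polynomial part of the Fock space -/

section ExpCoeff

variable {K : Type*} [Field K] {M : Type*} [AddCommGroup M] [Module K⟦X⟧ M]

/-- Applied to centralizers, this shows that whatever commutes with the exponents commutes with the
coefficients of the exponential. -/
theorem expCoeff_mem_subalgebra (S : Subalgebra K⟦X⟧ (Module.End K⟦X⟧ M))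
    {y : ℕ+ → Module.End K⟦X⟧ M} (hy : ∀ k, y k ∈ S) (m : ℕ) : expCoeff y m ∈ S := by
  refine sum_mem fun r hr => S.smul_mem ?_ _
  clear hr
  induction r generalizing m with
  | zero =>
    rw [pow_zero, PowerSeries.coeff_one]
    split_ifs
    exacts [S.one_mem, S.zero_mem]
  | succ r ih =>
    rw [pow_succ, PowerSeries.coeff_mul]
    refine sum_mem fun x _ => S.mul_mem (ih _) ?_
    rw [posSeries, PowerSeries.coeff_mk]
    split_ifs
    exacts [hy _, S.zero_mem]

theorem commute_expCoeff {y y' : ℕ+ → Module.End K⟦X⟧ M} (h : ∀ k l, Commute (y k) (y' l))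
    (m m' : ℕ) : Commute (expCoeff y m) (expCoeff y' m') := by
  have h1 : ∀ l, expCoeff y m ∈ Subalgebra.centralizer K⟦X⟧ {y' l} := fun l =>
    expCoeff_mem_subalgebra _ (fun k => (Subalgebra.mem_centralizer_iff _).2 (by
      rintro _ rfl; exact (h k l).symm.eq)) m
  have h2 : expCoeff y' m' ∈ Subalgebra.centralizer K⟦X⟧ {expCoeff y m} :=
    expCoeff_mem_subalgebra _ (fun l => (Subalgebra.mem_centralizer_iff _).2 (by
      rintro _ rfl
      exact ((Subalgebra.mem_centralizer_iff _).1 (h1 l) _ rfl).symm)) m'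
  exact (Subalgebra.mem_centralizer_iff _).1 h2 _ rfl

theorem expCoeff_mem_filtration (W : ℤ → Submodule K⟦X⟧ M) {y : ℕ+ → Module.End K⟦X⟧ M}
    (hy : ∀ (k : ℕ+) d u, u ∈ W d → y k u ∈ W (d - (k : ℕ))) (m : ℕ) {d : ℤ} {u : M}
    (hu : u ∈ W d) : expCoeff y m u ∈ W (d - m) := by
  rw [expCoeff, LinearMap.sum_apply]
  refine sum_mem fun r hr => Submodule.smul_mem _ _ ?_
  clear hr
  induction r generalizing m d u with
  | zero =>
    rw [pow_zero, PowerSeries.coeff_one]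
    split_ifs with h
    · subst h; simpa using hu
    · simp
  | succ r ih =>
    rw [pow_succ, PowerSeries.coeff_mul, LinearMap.sum_apply]
    refine sum_mem fun x hx => ?_
    have hx' : x.1 + x.2 = m := Finset.HasAntidiagonal.mem_antidiagonal.1 hx
    rw [show d - (m : ℤ) = d - (x.2 : ℤ) - x.1 by rw [← hx']; push_cast; ring]
    rw [Module.End.mul_apply]
    refine ih x.1 ?_
    rw [posSeries, PowerSeries.coeff_mk]
    split_ifs with h
    · exact hy ⟨x.2, h⟩ d u hu
    · simp

theorem modeOfProduct_apply {B A : ℕ → Module.End K⟦X⟧ M} (hA : LocallyFinite A) (l : ℤ) {u : M}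
    {N : ℕ} (hN : ∀ m, N ≤ m → A m u = 0) :
    modeOfProduct B A hA l u = ∑ m ∈ Finset.range N, zext B ((m : ℤ) - l) (A m u) := by
  change ∑ᶠ m : ℕ, (if l ≤ m then B ((m : ℤ) - l).toNat (A m u) else 0) = _
  rw [finsum_eq_sum_of_support_subset (s := Finset.range N)]
  · refine Finset.sum_congr rfl fun m _ => ?_
    rw [zext]
    simp only [sub_nonneg]
    split_ifs <;> simp
  · intro m hm
    by_contra h
    exact hm (by simp [hN m (by simpa using h)])

end ExpCoeff

variable {K : Type*} [Field K] {n : ℕ}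

/-- The data of a vertex operator
`exp [∑_{k > 0} (p_k a_{j,-k} + r_k b_{j,-k}) z^k] exp [∑_{k > 0} (p'_k a_{j,k} + r'_k b_{j,k}) z^{-k}]`. -/
structure Vtx (K : Type*) [Field K] (n : ℕ) where
  j : Fin (n - 1)
  p : ℕ+ → K⟦X⟧
  r : ℕ+ → K⟦X⟧
  p' : ℕ+ → K⟦X⟧
  r' : ℕ+ → K⟦X⟧

namespace Vtx

/-- The creation part of the exponent. -/
def cre (V : Vtx K n) (k : ℕ+) : Module.End K⟦X⟧ (FockPoly K n) :=
  V.p k • aCre V.j k + V.r k • bCre V.j k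

/-- The annihilation part of the exponent. -/
def ann (s : Kˣ) (V : Vtx K n) (k : ℕ+) : Module.End K⟦X⟧ (FockPoly K n) :=
  V.p' k • aAnn s V.j k + V.r' k • bAnn s V.j k

/-- The coefficients of the exponential of the creation part, extended by zero. -/
def B (V : Vtx K n) : ℤ → Module.End K⟦X⟧ (FockPoly K n) := zext (expCoeff V.cre)

/-- The coefficients of the exponential of the annihilation part. -/
def A (s : Kˣ) (V : Vtx K n) : ℕ → Module.End K⟦X⟧ (FockPoly K n) := expCoeff (V.ann s)

theorem ann_mem (s : Kˣ) (V : Vtx K n) (k : ℕ+) (d : ℤ) (f : FockPoly K n)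
    (hf : f ∈ polyFilt K n d) : V.ann s k f ∈ polyFilt K n (d - (k : ℕ)) :=
  add_mem (Submodule.smul_mem _ _ (aAnn_mem s V.j k d f hf))
    (Submodule.smul_mem _ _ (bAnn_mem s V.j k d f hf))

theorem A_mem (s : Kˣ) (V : Vtx K n) (m : ℕ) {d : ℤ} {f : FockPoly K n}
    (hf : f ∈ polyFilt K n d) : V.A s m f ∈ polyFilt K n (d - m) :=
  expCoeff_mem_filtration _ (V.ann_mem s) m hf

theorem A_eq_zero (s : Kˣ) (V : Vtx K n) {D : ℕ} {f : FockPoly K n}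
    (hf : f ∈ polyFilt K n D) {m : ℕ} (hm : D + 1 ≤ m) : V.A s m f = 0 := by
  have := V.A_mem s m hf
  rwa [polyFilt_neg _ (by omega), Submodule.mem_bot] at this

theorem A_locallyFinite (s : Kˣ) (V : Vtx K n) : LocallyFinite (V.A s) :=
  locallyFinite_expCoeff (polyFilt K n) (fun d hd => polyFilt_neg d hd)
    (fun f => (exists_mem_polyFilt f).imp fun d h => h d le_rfl) _ (V.ann_mem s)

/-- The coefficient of `z^e` in the vertex operator. -/
def mode (s : Kˣ) (V : Vtx K n) (e : ℤ) : Module.End K⟦X⟧ (FockPoly K n) :=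
  modeOfProduct (expCoeff V.cre) (V.A s) (V.A_locallyFinite s) (-e)

theorem mode_apply (s : Kˣ) (V : Vtx K n) (e : ℤ) {f : FockPoly K n} {N : ℕ}
    (hN : ∀ m, N ≤ m → V.A s m f = 0) :
    V.mode s e f = ∑ m ∈ Finset.range N, V.B (m + e) (V.A s m f) := by
  rw [mode, modeOfProduct_apply _ _ hN]
  simp only [sub_neg_eq_add]; rfl

theorem exists_mem (f : FockPoly K n) : ∃ D : ℕ, ∀ d : ℕ, D ≤ d → f ∈ polyFilt K n d := by
  obtain ⟨d, hd⟩ := exists_mem_polyFilt f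
  exact ⟨d.toNat, fun d' h => hd _ (by omega)⟩

theorem mem_mono {f : FockPoly K n} {d d' : ℤ} (h : d ≤ d') (hf : f ∈ polyFilt K n d) :
    f ∈ polyFilt K n d' := fun m hm => (hf m hm).trans h

theorem cre_comm (V V' : Vtx K n) (k l : ℕ+) : Commute (V.cre k) (V'.cre l) := by
  refine LinearMap.ext fun f => ?_
  simp only [cre, aCre, bCre, Module.End.mul_apply, LinearMap.add_apply, LinearMap.smul_apply,
    LinearMap.mulLeft_apply, MvPolynomial.smul_eq_C_mul]
  ring

/-- The commutator of the two derivations is a derivation that kills every generator, because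
derivations kill constants. -/
theorem derivation_comm (D D' : Derivation K⟦X⟧ (FockPoly K n) (FockPoly K n))
    (h : ∀ v, ∃ c, D (MvPolynomial.X v) = MvPolynomial.C c)
    (h' : ∀ v, ∃ c, D' (MvPolynomial.X v) = MvPolynomial.C c) :
    D.toLinearMap * D'.toLinearMap = D'.toLinearMap * D.toLinearMap := by
  have : ⁅D, D'⁆ = 0 := by
    refine MvPolynomial.derivation_ext fun v => ?_
    obtain ⟨c, hc⟩ := h v
    obtain ⟨c', hc'⟩ := h' v
    rw [Derivation.commutator_apply, hc, hc', MvPolynomial.derivation_C, MvPolynomial.derivation_C]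
    simp
  refine LinearMap.ext fun f => ?_
  have := congrArg (fun E => E f) this
  simpa [Derivation.commutator_apply, sub_eq_zero] using this

/-- The annihilation part as a derivation. -/
def annDer (s : Kˣ) (V : Vtx K n) (k : ℕ+) : Derivation K⟦X⟧ (FockPoly K n) (FockPoly K n) :=
  MvPolynomial.mkDerivation K⟦X⟧ fun v =>
    MvPolynomial.C (V.p' k * aComm s V.j k v + V.r' k * bComm s V.j k v)

theorem ann_eq (s : Kˣ) (V : Vtx K n) (k : ℕ+) : V.ann s k = (V.annDer s k).toLinearMap := by
  have : V.annDer s k = V.p' k • MvPolynomial.mkDerivation K⟦X⟧ (fun v : FockVar n =>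
      (MvPolynomial.C (aComm s V.j k v) : FockPoly K n)) + V.r' k • MvPolynomial.mkDerivation K⟦X⟧
        (fun v : FockVar n => (MvPolynomial.C (bComm s V.j k v) : FockPoly K n)) := by
    refine MvPolynomial.derivation_ext fun v => ?_
    simp [annDer, MvPolynomial.mkDerivation_X, MvPolynomial.smul_eq_C_mul]
  rw [this]; rfl

theorem annDer_X (s : Kˣ) (V : Vtx K n) (k : ℕ+) (v : FockVar n) :
    V.annDer s k (MvPolynomial.X v) =
      MvPolynomial.C (V.p' k * aComm s V.j k v + V.r' k * bComm s V.j k v) :=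
  MvPolynomial.mkDerivation_X _ _ _

theorem ann_comm (s : Kˣ) (V V' : Vtx K n) (k l : ℕ+) : Commute (V.ann s k) (V'.ann s l) := by
  rw [ann_eq, ann_eq]
  exact derivation_comm _ _ (fun v => ⟨_, V.annDer_X s k v⟩) (fun v => ⟨_, V'.annDer_X s l v⟩)

/-- The contraction of two vertex operators. -/
def contr (s : Kˣ) (V V' : Vtx K n) (k : ℕ+) : K⟦X⟧ :=
  (V.p' k * V'.p k - V.r' k * V'.r k) * heisCoeff s V.j V'.j k

/-- The commutator is a scalar, which is all that Wick's theorem needs. The minus sign in `contr`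
reflects the opposite signs of the a- and b-Heisenberg relations. -/
theorem ann_cre (s : Kˣ) (V V' : Vtx K n) (k l : ℕ+) :
    V.ann s k * V'.cre l - V'.cre l * V.ann s k =
      if l = k then algebraMap K⟦X⟧ _ (V.contr s V' k) else 0 := by
  refine LinearMap.ext fun f => ?_
  rw [ann_eq]
  simp only [cre, aCre, bCre, LinearMap.sub_apply, Module.End.mul_apply, LinearMap.add_apply,
    LinearMap.smul_apply, LinearMap.mulLeft_apply, map_add, map_smul, Derivation.coeFn_coe,
    Derivation.leibniz, annDer_X, smul_eq_mul]
  by_cases h : l = k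
  · subst h
    simp [aComm, bComm, contr, MvPolynomial.smul_eq_C_mul, Algebra.algebraMap_eq_smul_one]
    ring
  · simp [aComm, bComm, h, MvPolynomial.smul_eq_C_mul]

variable [CharZero K]

theorem isExp_cre (V : Vtx K n) :
    IsExp (euler (posSeries V.cre)) (PowerSeries.mk (expCoeff V.cre)) :=
  isExp_expCoeff (V.cre_comm V)

theorem isExp_ann (s : Kˣ) (V : Vtx K n) :
    IsExp (euler (posSeries (V.ann s))) (PowerSeries.mk (V.A s)) :=
  isExp_expCoeff (V.ann_comm s V)

theorem B_comm (V V' : Vtx K n) (e e' : ℤ) : Commute (V.B e) (V'.B e') := by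
  simp only [B, zext]
  split_ifs
  · exact commute_expCoeff (V.cre_comm V') _ _
  all_goals simp

theorem A_comm (s : Kˣ) (V V' : Vtx K n) (m m' : ℕ) : Commute (V.A s m) (V'.A s m') :=
  commute_expCoeff (V.ann_comm s V') _ _

/-- The coefficients of the exponential of the contraction. -/
def C (s : Kˣ) (V V' : Vtx K n) (k : ℕ) : K⟦X⟧ := PowerSeries.coeff k (expS (V.contr s V'))

/-- Wick's theorem in its basic form: an instance of `IsExp.comm` in which the commutators of the
exponents are the contraction coefficients. -/
theorem A_B (s : Kˣ) (V V' : Vtx K n) (m : ℕ) (e : ℤ) :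
    V.A s m * V'.B e = ∑ x ∈ Finset.HasAntidiagonal.antidiagonal m,
      V.C s V' x.1 • (V'.B (e - x.1) * V.A s x.2) := by
  have h := V'.isExp_cre.comm (V.isExp_ann s) (isExp_expS (V.contr s V')) (fun i k => ?_) m e
  · simp only [PowerSeries.coeff_mk] at h
    exact h
  · simp only [posSeries, ser, PowerSeries.coeff_mk]
    split_ifs with h1 h2 h3 h3 h4 h4 h5
    · subst h3
      exact (ann_cre s V V' ⟨k, h1⟩ ⟨k, h1⟩).trans (if_pos rfl)
    · exact (ann_cre s V V' ⟨i, h1⟩ ⟨k, h2⟩).trans (if_neg fun h => h3 (Subtype.ext_iff.1 h))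
    all_goals first | omega | simp

end Vtx

end

end EllipticAlgebra


set_option linter.unusedSectionVars false

namespace EllipticAlgebra

noncomputable section

/-! ### Wick's theorem for products of two and three vertex operators -/

/-- Products of power series are summed along antidiagonals, iterated modes over boxes. For summands
supported in a box the two agree once enough antidiagonals are taken. -/
theorem sum_antidiagonal_box {M : Type*} [AddCommMonoid M] (f : ℕ → ℕ → M) (a b : ℕ)
    (hf : ∀ i j, a ≤ i ∨ b ≤ j → f i j = 0) :
    ∑ m ∈ Finset.range (a + b), ∑ x ∈ Finset.HasAntidiagonal.antidiagonal m, f x.1 x.2 =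
      ∑ i ∈ Finset.range a, ∑ j ∈ Finset.range b, f i j := by
  classical
  rw [← Finset.sum_product', ← Finset.sum_fiberwise_of_maps_to (t := Finset.range (a + b))
    (g := fun x : ℕ × ℕ => x.1 + x.2)]
  · refine Finset.sum_congr rfl fun m _ => (Finset.sum_subset ?_ ?_).symm
    · intro x hx
      exact Finset.HasAntidiagonal.mem_antidiagonal.2 (Finset.mem_filter.1 hx).2
    · intro x hx hx'
      refine hf _ _ ?_
      by_contra h
      push Not at h
      exact hx' (Finset.mem_filter.2 ⟨Finset.mem_product.2 ⟨Finset.mem_range.2 h.1,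
        Finset.mem_range.2 h.2⟩, Finset.HasAntidiagonal.mem_antidiagonal.1 hx⟩)
  · intro x hx
    have := Finset.mem_product.1 hx
    simp only [Finset.mem_range] at this ⊢
    omega

namespace Vtx

variable {K : Type*} [Field K] [CharZero K] {n : ℕ} (s : Kˣ)

theorem B_of_neg (V : Vtx K n) {e : ℤ} (h : e < 0) : V.B e = 0 := zext_of_neg _ h

theorem A_B_apply (V V' : Vtx K n) (m : ℕ) (e : ℤ) (f : FockPoly K n) :
    V.A s m (V'.B e f) = ∑ x ∈ Finset.HasAntidiagonal.antidiagonal m,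
      V.C s V' x.1 • V'.B (e - x.1) (V.A s x.2 f) := by
  rw [← Module.End.mul_apply, A_B, LinearMap.sum_apply]; rfl

theorem A_B_eq_zero (V V' : Vtx K n) {m N b : ℕ} {e : ℤ} {f : FockPoly K n}
    (hN : ∀ m, N ≤ m → V.A s m f = 0) (hb : e < b) (hm : b + N ≤ m) : V.A s m (V'.B e f) = 0 := by
  rw [A_B_apply]
  refine Finset.sum_eq_zero fun x hx => ?_
  have hx' := Finset.HasAntidiagonal.mem_antidiagonal.1 hx
  rcases lt_or_ge x.1 b with h | h
  · rw [hN _ (by omega), map_zero, smul_zero]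
  · rw [B_of_neg _ (by omega), LinearMap.zero_apply, smul_zero]

theorem B_B_apply (V V' : Vtx K n) (e e' : ℤ) (f : FockPoly K n) :
    V.B e (V'.B e' f) = V'.B e' (V.B e f) := by
  rw [← Module.End.mul_apply, (B_comm V V' e e').eq]; rfl

theorem A_A_apply (V V' : Vtx K n) (m m' : ℕ) (f : FockPoly K n) :
    V.A s m (V'.A s m' f) = V'.A s m' (V.A s m f) := by
  rw [← Module.End.mul_apply, (A_comm s V V' m m').eq]; rfl

/-- A sum over the terms of `A_m B'_e f`, in which the factors have been interchanged. -/
theorem sum_A_B (V V' : Vtx K n) {N b : ℕ} {e : ℤ}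
    {f : FockPoly K n} (hN : ∀ m, N ≤ m → V.A s m f = 0) (hb : e < b)
    (T : ℕ → Module.End K⟦X⟧ (FockPoly K n)) :
    ∑ m ∈ Finset.range (b + N), T m (V.A s m (V'.B e f)) =
      ∑ k ∈ Finset.range b, ∑ m ∈ Finset.range N,
        V.C s V' k • T (k + m) (V'.B (e - k) (V.A s m f)) := by
  rw [← sum_antidiagonal_box (f := fun k m => V.C s V' k • T (k + m) (V'.B (e - k) (V.A s m f)))]
  · refine Finset.sum_congr rfl fun m _ => ?_
    rw [A_B_apply, map_sum]
    refine Finset.sum_congr rfl fun x hx => ?_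
    rw [Finset.HasAntidiagonal.mem_antidiagonal.1 hx, map_smul]
  · rintro i j (h | h)
    · rw [B_of_neg _ (by omega), LinearMap.zero_apply, map_zero, smul_zero]
    · rw [hN _ h, map_zero, map_zero, smul_zero]

/-- The annihilation part is moved past one creation coefficient. The sum over `k` stops at `b`
because `B` vanishes in negative degrees. -/
theorem mode_B (V V' : Vtx K n) (e : ℤ) {j : ℤ} {b : ℕ} (hb : j < b) (f : FockPoly K n) :
    V.mode s e (V'.B j f) = ∑ k ∈ Finset.range b,
      V.C s V' k • V'.B (j - k) (V.mode s (e + k) f) := by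
  obtain ⟨N, hN⟩ := V.A_locallyFinite s f
  rw [mode_apply s V e (fun m hm => A_B_eq_zero s V V' hN hb hm)]
  refine (sum_A_B s V V' hN hb fun m => V.B (m + e)).trans ?_
  refine Finset.sum_congr rfl fun k _ => ?_
  rw [mode_apply s V (e + k) hN, map_sum, Finset.smul_sum]
  refine Finset.sum_congr rfl fun m _ => ?_
  rw [B_B_apply]
  congr 4
  push_cast; ring

/-- The coefficient of `z^{e₁} w^{e₂}` in the normally ordered product of two vertex operators. -/
def no2 (V V' : Vtx K n) (e₁ e₂ : ℤ) (f : FockPoly K n) : FockPoly K n :=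
  ∑ᶠ m : ℕ, V'.B (m + e₂) (V.mode s e₁ (V'.A s m f))

theorem no2_apply (V V' : Vtx K n) (e₁ e₂ : ℤ) {f : FockPoly K n} {N : ℕ}
    (hN : ∀ m, N ≤ m → V'.A s m f = 0) :
    no2 s V V' e₁ e₂ f =
      ∑ m ∈ Finset.range N, V'.B (m + e₂) (V.mode s e₁ (V'.A s m f)) := by
  rw [no2, finsum_eq_sum_of_support_subset]
  intro m hm
  by_contra h
  exact hm (by simp [hN m (by simpa using h)])

theorem A_eq_zero' (V V' : Vtx K n) {D : ℕ} {f : FockPoly K n} (hf : f ∈ polyFilt K n D)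
    (k : ℕ) {m : ℕ} (hm : D + 1 ≤ m) : V.A s m (V'.A s k f) = 0 :=
  V.A_eq_zero s (mem_mono (by omega) (V'.A_mem s k hf)) hm

theorem no2_apply' (V V' : Vtx K n) (e₁ e₂ : ℤ) {D : ℕ} {f : FockPoly K n}
    (hf : f ∈ polyFilt K n D) : no2 s V V' e₁ e₂ f =
      ∑ m ∈ Finset.range (D + 1), ∑ k ∈ Finset.range (D + 1),
        V'.B (m + e₂) (V.B (k + e₁) (V.A s k (V'.A s m f))) := by
  rw [no2_apply s V V' e₁ e₂ fun m hm => V'.A_eq_zero s hf hm]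
  refine Finset.sum_congr rfl fun m _ => ?_
  rw [mode_apply s V e₁ (fun k hk => A_eq_zero' s V V' hf m hk), map_sum]

/-- Creation parts commute with each other, and so do annihilation parts. Therefore both orders of a
product can be compared with the same distribution. -/
theorem no2_symm (V V' : Vtx K n) (e₁ e₂ : ℤ) (f : FockPoly K n) :
    no2 s V' V e₂ e₁ f = no2 s V V' e₁ e₂ f := by
  obtain ⟨D, hD⟩ := exists_mem f
  rw [no2_apply' s _ _ _ _ (hD D le_rfl), no2_apply' s _ _ _ _ (hD D le_rfl), Finset.sum_comm]
  refine Finset.sum_congr rfl fun m _ => Finset.sum_congr rfl fun k _ => ?_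
  rw [B_B_apply, A_A_apply]

theorem mode_eq_zero (V : Vtx K n) {e : ℤ} {D : ℕ} {f : FockPoly K n} (hf : f ∈ polyFilt K n D)
    (he : e < -D) : V.mode s e f = 0 := by
  rw [mode_apply s V e fun m hm => V.A_eq_zero s hf hm]
  refine Finset.sum_eq_zero fun m hm => ?_
  rw [B_of_neg _ (by have := Finset.mem_range.1 hm; omega), LinearMap.zero_apply]

theorem no2_eq_zero (V V' : Vtx K n) {e₁ e₂ : ℤ} {D : ℕ} {f : FockPoly K n}
    (hf : f ∈ polyFilt K n D) (he : e₁ < -D ∨ e₂ < -D) : no2 s V V' e₁ e₂ f = 0 := by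
  rw [no2_apply s V V' e₁ e₂ fun m hm => V'.A_eq_zero s hf hm]
  refine Finset.sum_eq_zero fun m hm => ?_
  rcases he with he | he
  · rw [mode_eq_zero s V (mem_mono (by omega) (V'.A_mem s m hf)) he, map_zero]
  · rw [B_of_neg _ (by have := Finset.mem_range.1 hm; omega), LinearMap.zero_apply]

/-- Coefficientwise form of V(z)V'(w) = C(w/z) :V(z)V'(w):. Only finitely many `k` contribute, since
normally ordered products vanish when an exponent is too negative. -/
theorem mode_mode (V V' : Vtx K n) (e₁ e₂ : ℤ) (f : FockPoly K n) :
    V.mode s e₁ (V'.mode s e₂ f) =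
      ∑ᶠ k : ℕ, V.C s V' k • no2 s V V' (e₁ + k) (e₂ - k) f := by
  obtain ⟨D, hD⟩ := exists_mem f
  have hf := hD D le_rfl
  have hN : ∀ m, D + 1 ≤ m → V'.A s m f = 0 := fun m hm => V'.A_eq_zero s hf hm
  rw [finsum_eq_sum_of_support_subset (s := Finset.range (D + 1 + e₂).toNat),
    mode_apply s V' e₂ hN, map_sum,
    Finset.sum_congr rfl fun m hm => mode_B s V V' e₁ (b := (D + 1 + e₂).toNat)
      (by have := Finset.mem_range.1 hm; omega) _, Finset.sum_comm]
  · refine Finset.sum_congr rfl fun k _ => ?_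
    rw [no2_apply s _ _ _ _ hN, Finset.smul_sum]
    refine Finset.sum_congr rfl fun m _ => ?_
    rw [add_sub_assoc]
  · intro k hk
    by_contra h
    have h' : ¬ k < (D + 1 + e₂).toNat := fun h' => h (by simpa using h')
    exact hk (by
      change _ • _ = _
      rw [no2_eq_zero s V V' hf (Or.inr (by omega)), smul_zero])

theorem no2_B (V V' V'' : Vtx K n) (e₁ e₂ : ℤ) {j : ℤ} {b : ℕ} (hb : j < b) (f : FockPoly K n) :
    no2 s V V' e₁ e₂ (V''.B j f) = ∑ k ∈ Finset.range b, ∑ l ∈ Finset.range b,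
      V.C s V'' k • V'.C s V'' l • V''.B (j - k - l) (no2 s V V' (e₁ + k) (e₂ + l) f) := by
  obtain ⟨N, hN⟩ := V'.A_locallyFinite s f
  rw [no2_apply s V V' e₁ e₂ (fun m hm => A_B_eq_zero s V' V'' hN hb hm)]
  refine (sum_A_B s V' V'' hN hb fun m => V'.B (m + e₂) * V.mode s e₁).trans ?_
  rw [Finset.sum_comm (s := Finset.range b) (t := Finset.range b)]
  refine Finset.sum_congr rfl fun l _ => ?_
  simp only [no2_apply s V V' _ _ hN, map_sum, Finset.smul_sum]
  rw [Finset.sum_comm]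
  refine Finset.sum_congr rfl fun m _ => ?_
  rw [Module.End.mul_apply, mode_B s V V'' e₁ (show j - l < b by omega), map_sum, Finset.smul_sum]
  refine Finset.sum_congr rfl fun k _ => ?_
  rw [map_smul, B_B_apply, smul_comm, sub_right_comm]
  congr 5
  push_cast; ring

/-- The coefficient of `z₁^{e₁} z₂^{e₂} z₃^{e₃}` in the normally ordered product of three vertex
operators. -/
def no3 (V V' V'' : Vtx K n) (e₁ e₂ e₃ : ℤ) (f : FockPoly K n) : FockPoly K n :=
  ∑ᶠ m : ℕ, V''.B (m + e₃) (no2 s V V' e₁ e₂ (V''.A s m f))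

theorem no3_apply (V V' V'' : Vtx K n) (e₁ e₂ e₃ : ℤ) {f : FockPoly K n} {N : ℕ}
    (hN : ∀ m, N ≤ m → V''.A s m f = 0) :
    no3 s V V' V'' e₁ e₂ e₃ f =
      ∑ m ∈ Finset.range N, V''.B (m + e₃) (no2 s V V' e₁ e₂ (V''.A s m f)) := by
  rw [no3, finsum_eq_sum_of_support_subset]
  intro m hm
  by_contra h
  refine hm ?_
  change V''.B _ _ = _
  rw [hN m (by simpa using h), no2_apply s V V' (N := 0) e₁ e₂ (by simp)]
  simp

theorem no3_swap_left (V V' V'' : Vtx K n) (e₁ e₂ e₃ : ℤ) (f : FockPoly K n) :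
    no3 s V' V V'' e₂ e₁ e₃ f = no3 s V V' V'' e₁ e₂ e₃ f := by
  rw [no3, no3]
  exact finsum_congr fun m => by rw [no2_symm]

theorem no3_swap_right (V V' V'' : Vtx K n) (e₁ e₂ e₃ : ℤ) (f : FockPoly K n) :
    no3 s V V'' V' e₁ e₃ e₂ f = no3 s V V' V'' e₁ e₂ e₃ f := by
  obtain ⟨D, hD⟩ := exists_mem f
  have hf := hD D le_rfl
  have hA : ∀ (W : Vtx K n) (m : ℕ), W.A s m f ∈ polyFilt K n D := fun W m =>
    mem_mono (by omega) (W.A_mem s m hf)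
  rw [no3_apply s _ _ _ _ _ _ fun m hm => Vtx.A_eq_zero s _ hf hm,
    no3_apply s _ _ _ _ _ _ fun m hm => Vtx.A_eq_zero s _ hf hm]
  simp only [no2_apply' s _ _ _ _ (hA _ _), map_sum]
  rw [Finset.sum_comm]
  refine Finset.sum_congr rfl fun m _ => Finset.sum_congr rfl fun k _ =>
    Finset.sum_congr rfl fun l _ => ?_
  rw [B_B_apply, A_A_apply s V'' V']

theorem no3_eq_zero (V V' V'' : Vtx K n) {e₁ e₂ e₃ : ℤ} {D : ℕ} {f : FockPoly K n}
    (hf : f ∈ polyFilt K n D) (he : e₁ < -D ∨ e₂ < -D ∨ e₃ < -D) :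
    no3 s V V' V'' e₁ e₂ e₃ f = 0 := by
  rw [no3_apply s _ _ _ _ _ _ fun m hm => Vtx.A_eq_zero s _ hf hm]
  refine Finset.sum_eq_zero fun m hm => ?_
  rw [← or_assoc] at he
  rcases he with he | he
  · rw [no2_eq_zero s _ _ (mem_mono (by omega) (V''.A_mem s m hf)) he, map_zero]
  · rw [B_of_neg _ (by have := Finset.mem_range.1 hm; omega), LinearMap.zero_apply]

/-- The third operator is contracted with each of the first two; combined with `mode_mode` this
gives Wick's theorem for three factors. -/
theorem no2_mode (V V' V'' : Vtx K n) (e₁ e₂ e₃ : ℤ) (f : FockPoly K n) :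
    no2 s V V' e₁ e₂ (V''.mode s e₃ f) = ∑ᶠ k : ℕ, V.C s V'' k • ∑ᶠ l : ℕ, V'.C s V'' l •
      no3 s V V' V'' (e₁ + k) (e₂ + l) (e₃ - k - l) f := by
  obtain ⟨D, hD⟩ := exists_mem f
  have hf := hD D le_rfl
  have hN : ∀ m, D + 1 ≤ m → V''.A s m f = 0 := fun m hm => V''.A_eq_zero s hf hm
  have hl : ∀ k : ℕ, ∑ᶠ l : ℕ, V'.C s V'' l •
      no3 s V V' V'' (e₁ + k) (e₂ + l) (e₃ - k - l) f =
      ∑ l ∈ Finset.range (D + 1 + e₃).toNat, V'.C s V'' l •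
        no3 s V V' V'' (e₁ + k) (e₂ + l) (e₃ - k - l) f := by
    intro k
    refine finsum_eq_sum_of_support_subset _ fun l hl => ?_
    by_contra h
    have h' : ¬ l < (D + 1 + e₃).toNat := fun h' => h (by simpa using h')
    exact hl (by
      change _ • _ = _
      rw [no3_eq_zero s _ _ _ hf (by omega), smul_zero])
  -- `no2` is a bare function defined by a finite sum whose range depends on the vector, so its
  -- additivity has to be established before it can be applied to a sum.
  have hadd : ∀ g g' : FockPoly K n, no2 s V V' e₁ e₂ (g + g') =
      no2 s V V' e₁ e₂ g + no2 s V V' e₁ e₂ g' := by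
    intro g g'
    obtain ⟨N₁, h1⟩ := V'.A_locallyFinite s g
    obtain ⟨N₂, h2⟩ := V'.A_locallyFinite s g'
    have h1' : ∀ m, max N₁ N₂ ≤ m → V'.A s m g = 0 := fun m hm => h1 m (by omega)
    have h2' : ∀ m, max N₁ N₂ ≤ m → V'.A s m g' = 0 := fun m hm => h2 m (by omega)
    rw [no2_apply s _ _ _ _ h1', no2_apply s _ _ _ _ h2',
      no2_apply s _ _ _ _ (N := max N₁ N₂) fun m hm => by rw [map_add, h1' m hm, h2' m hm, add_zero]]
    simp only [map_add, Finset.sum_add_distrib]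
  let T : FockPoly K n →+ FockPoly K n := AddMonoidHom.mk' (no2 s V V' e₁ e₂) hadd
  rw [finsum_congr fun k => by rw [hl k],
    finsum_eq_sum_of_support_subset (s := Finset.range (D + 1 + e₃).toNat),
    mode_apply s V'' e₃ hN]
  · refine (map_sum T _ _).trans ?_
    refine (Finset.sum_congr rfl fun m hm => no2_B s V V' V'' e₁ e₂
      (b := (D + 1 + e₃).toNat) (by have := Finset.mem_range.1 hm; omega) _).trans ?_
    rw [Finset.sum_comm]
    refine Finset.sum_congr rfl fun k _ => ?_
    rw [Finset.sum_comm, Finset.smul_sum]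
    refine Finset.sum_congr rfl fun l _ => ?_
    rw [no3_apply s _ _ _ _ _ _ hN, Finset.smul_sum, Finset.smul_sum]
    refine Finset.sum_congr rfl fun m _ => ?_
    rw [add_sub_assoc, add_sub_assoc]
  · intro k hk
    by_contra h
    have h' : ¬ k < (D + 1 + e₃).toNat := fun h' => h (by simpa using h')
    refine hk ?_
    change _ • _ = _
    rw [Finset.sum_eq_zero fun l _ => ?_, smul_zero]
    rw [no3_eq_zero s _ _ _ hf (by omega), smul_zero]

end Vtx

end

end EllipticAlgebra


set_option linter.unusedSectionVars false

namespace EllipticAlgebra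

noncomputable section

/-! ### Fusion: normally ordered products at proportional arguments. -/

section FusionExp

variable {K : Type*} [Field K] [CharZero K] {M : Type*} [AddCommGroup M] [Module K⟦X⟧ M]

theorem expCoeff_add {y y' : ℕ+ → Module.End K⟦X⟧ M} (hy : ∀ k l, Commute (y k) (y l))
    (hy' : ∀ k l, Commute (y' k) (y' l)) (h : ∀ k l, Commute (y k) (y' l)) (m : ℕ) :
    expCoeff (y + y') m =
      ∑ x ∈ Finset.HasAntidiagonal.antidiagonal m, expCoeff y x.1 * expCoeff y' x.2 := by
  have h1 := isExp_expCoeff hy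
  have h2 := isExp_expCoeff hy'
  have h3 : IsExp (euler (posSeries (y + y'))) (PowerSeries.mk (expCoeff (y + y'))) :=
    isExp_expCoeff fun k l =>
      ((hy k l).add_left (h l k).symm).add_right ((h k l).add_left (hy' k l))
  have hser : posSeries (y + y') = posSeries y + posSeries y' := by
    ext1 k
    simp only [posSeries, map_add, PowerSeries.coeff_mk]
    split_ifs
    · rfl
    · simp
  have hc : Commute (PowerSeries.mk (expCoeff y)) (euler (posSeries y')) := by
    refine commute_of_coeff fun i j => ?_
    rw [PowerSeries.coeff_mk, coeff_euler, posSeries, PowerSeries.coeff_mk]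
    refine Commute.smul_right ?_ _
    split_ifs with hj
    · have hmem := expCoeff_mem_subalgebra (Subalgebra.centralizer K⟦X⟧ {y' ⟨j, hj⟩}) (y := y)
        (fun k => (Subalgebra.mem_centralizer_iff _).2 (by rintro _ rfl; exact (h k _).symm.eq)) i
      exact ((Subalgebra.mem_centralizer_iff _).1 hmem _ rfl).symm
    · simp
  have h4 := h1.mul h2 hc
  rw [← map_add, ← hser] at h4
  have := congrArg (PowerSeries.coeff m) (h3.unique (by simp) h4)
  simpa [PowerSeries.coeff_mul] using this

theorem expCoeff_pow_smul {y : ℕ+ → Module.End K⟦X⟧ M} (hy : ∀ k l, Commute (y k) (y l))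
    (c : K⟦X⟧) (m : ℕ) : expCoeff (fun k => c ^ (k : ℕ) • y k) m = c ^ m • expCoeff y m := by
  have h1 := isExp_expCoeff hy
  have h3 : IsExp (euler (posSeries fun k => c ^ (k : ℕ) • y k))
      (PowerSeries.mk (expCoeff fun k => c ^ (k : ℕ) • y k)) :=
    isExp_expCoeff fun k l => ((hy k l).smul_left _).smul_right _
  have h2 : IsExp (euler (posSeries fun k => c ^ (k : ℕ) • y k))
      (PowerSeries.mk fun m => c ^ m • expCoeff y m) := by
    refine ⟨by simpa using h1.coeff_zero, ?_⟩
    ext1 m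
    have h := congrArg (fun F => c ^ m • PowerSeries.coeff m F) h1.euler_eq
    simp only [coeff_euler, PowerSeries.coeff_mk, PowerSeries.coeff_mul, Finset.smul_sum] at h ⊢
    rw [smul_comm, h]
    refine Finset.sum_congr rfl fun x hx => ?_
    rw [← Finset.HasAntidiagonal.mem_antidiagonal.1 hx, pow_add, ← smul_mul_smul_comm,
      smul_comm _ x.1]
    congr 2
    simp only [posSeries, PowerSeries.coeff_mk]
    split_ifs
    · rfl
    · simp
  have := congrArg (PowerSeries.coeff m) (h3.unique (by simp) h2)
  simpa using this

end FusionExp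

namespace Vtx

variable {K : Type*} [Field K] [CharZero K] {n : ℕ} (s : Kˣ)

/-- The normally ordered product of two vertex operators of the same index, with the variable of the
first one replaced by `κ` times the variable of the second one. -/
def fuse (κ : Kˣ) (V V' : Vtx K n) : Vtx K n where
  j := V'.j
  p k := PowerSeries.C (κ : K) ^ (k : ℕ) * V.p k + V'.p k
  r k := PowerSeries.C (κ : K) ^ (k : ℕ) * V.r k + V'.r k
  p' k := PowerSeries.C ((κ⁻¹ : Kˣ) : K) ^ (k : ℕ) * V.p' k + V'.p' k
  r' k := PowerSeries.C ((κ⁻¹ : Kˣ) : K) ^ (k : ℕ) * V.r' k + V'.r' k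

variable {V V' : Vtx K n} (hj : V.j = V'.j) (κ : Kˣ)
include hj

theorem fuse_A (m : ℕ) : (fuse κ V V').A s m = ∑ x ∈ Finset.HasAntidiagonal.antidiagonal m,
    PowerSeries.C ((κ⁻¹ : Kˣ) : K) ^ x.1 • (V.A s x.1 * V'.A s x.2) := by
  have h : (fuse κ V V').ann s =
      (fun k : ℕ+ => PowerSeries.C ((κ⁻¹ : Kˣ) : K) ^ (k : ℕ) • V.ann s k) + V'.ann s := by
    funext k
    simp only [ann, fuse, Pi.add_apply, hj, add_smul, mul_smul, smul_add]
    abel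
  rw [A, h, expCoeff_add]
  · refine Finset.sum_congr rfl fun x _ => ?_
    rw [expCoeff_pow_smul (V.ann_comm s V), smul_mul_assoc]; rfl
  · exact fun k l => ((V.ann_comm s V k l).smul_left _).smul_right _
  · exact V'.ann_comm s V'
  · exact fun k l => (V.ann_comm s V' k l).smul_left _

theorem fuse_B_nat (m : ℕ) : (fuse κ V V').B m = ∑ x ∈ Finset.HasAntidiagonal.antidiagonal m,
    PowerSeries.C (κ : K) ^ x.1 • (V.B x.1 * V'.B x.2) := by
  have h : (fuse κ V V').cre =
      (fun k : ℕ+ => PowerSeries.C (κ : K) ^ (k : ℕ) • V.cre k) + V'.cre := by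
    funext k
    simp only [cre, fuse, Pi.add_apply, hj, add_smul, mul_smul, smul_add]
    abel
  rw [B, zext_natCast, h, expCoeff_add]
  · refine Finset.sum_congr rfl fun x _ => ?_
    rw [expCoeff_pow_smul (V.cre_comm V), smul_mul_assoc, B, B, zext_natCast, zext_natCast]
  · exact fun k l => ((V.cre_comm V k l).smul_left _).smul_right _
  · exact V'.cre_comm V'
  · exact fun k l => (V.cre_comm V' k l).smul_left _

theorem fuse_B (e : ℤ) (S : Finset ℤ) (hS : Finset.Icc 0 e ⊆ S) : (fuse κ V V').B e =
    ∑ t ∈ S, (PowerSeries.C ((κ ^ t : Kˣ) : K) : K⟦X⟧) • (V.B t * V'.B (e - t)) := by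
  rcases lt_or_ge e 0 with he | he
  · rw [B_of_neg _ he, Finset.sum_eq_zero]
    intro t _
    rcases lt_or_ge t 0 with ht | ht
    · rw [B_of_neg _ ht, zero_mul, smul_zero]
    · rw [B_of_neg V' (by omega), mul_zero, smul_zero]
  · lift e to ℕ using he
    rw [fuse_B_nat hj κ]
    refine Finset.sum_of_injOn (fun x : ℕ × ℕ => (x.1 : ℤ)) ?_ ?_ ?_ ?_
    · intro x hx y hy hxy
      have h1 := Finset.HasAntidiagonal.mem_antidiagonal.1 hx
      have h2 := Finset.HasAntidiagonal.mem_antidiagonal.1 hy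
      have h3 : (x.1 : ℤ) = y.1 := hxy
      exact Prod.ext (by omega) (by omega)
    · intro x hx
      have h1 := Finset.HasAntidiagonal.mem_antidiagonal.1 hx
      exact hS (Finset.mem_Icc.2 ⟨by simp, by simp; omega⟩)
    · intro t _ ht
      rcases lt_or_ge t 0 with h | h
      · rw [B_of_neg _ h, zero_mul, smul_zero]
      · rw [B_of_neg V', mul_zero, smul_zero]
        by_contra hc
        exact ht ⟨(t.toNat, e - t.toNat), Finset.HasAntidiagonal.mem_antidiagonal.2 (by omega),
          by simpa using h⟩
    · intro x hx
      have h1 := Finset.HasAntidiagonal.mem_antidiagonal.1 hx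
      simp only [← h1]
      rw [Nat.cast_add]
      rw [add_sub_cancel_left, zpow_natCast, Units.val_pow_eq_pow_val, map_pow]

/-- Normally ordered products have no singularities, so z = κw may be substituted: the coefficients
with e₁ + e₂ = E are added up with weights κ^{e₁}. -/
theorem fuse_mode (E : ℤ) (f : FockPoly K n) : (fuse κ V V').mode s E f =
    ∑ᶠ e : ℤ, (PowerSeries.C ((κ ^ e : Kˣ) : K) : K⟦X⟧) • no2 s V V' e (E - e) f := by
  obtain ⟨D, hD⟩ := exists_mem f
  have hf := hD D le_rfl
  have hAA : ∀ i j : ℕ, D + 1 ≤ i ∨ D + 1 ≤ j → V.A s i (V'.A s j f) = 0 := by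
    rintro i j (h | h)
    · exact A_eq_zero' s V V' hf j h
    · rw [V'.A_eq_zero s hf h, map_zero]
  have hA : ∀ m, (fuse κ V V').A s m f = ∑ x ∈ Finset.HasAntidiagonal.antidiagonal m,
      PowerSeries.C ((κ⁻¹ : Kˣ) : K) ^ x.1 • (V.A s x.1 (V'.A s x.2 f)) := by
    intro m
    rw [fuse_A s hj κ, LinearMap.sum_apply]; rfl
  rw [finsum_eq_sum_of_support_subset (s := Finset.Icc (-D : ℤ) (E + D)),
    mode_apply s _ E (N := D + 1 + (D + 1))]
  · have hbox := sum_antidiagonal_box (fun i j => PowerSeries.C ((κ⁻¹ : Kˣ) : K) ^ i •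
      (fuse κ V V').B ((i : ℤ) + j + E) (V.A s i (V'.A s j f))) (D + 1) (D + 1)
      (fun i j h => by rw [hAA i j h, map_zero, smul_zero])
    calc _ = _ := Finset.sum_congr rfl fun m _ => ?_
      _ = _ := hbox
      _ = _ := ?_
    · rw [hA, map_sum]
      refine Finset.sum_congr rfl fun x hx => ?_
      rw [← Finset.HasAntidiagonal.mem_antidiagonal.1 hx, map_smul]
      push_cast; rfl
    · simp only [no2_apply' s _ _ _ _ hf, Finset.smul_sum]
      rw [Finset.sum_comm (s := Finset.Icc (-D : ℤ) (E + D)), Finset.sum_comm]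
      refine Finset.sum_congr rfl fun m hm => ?_
      rw [Finset.sum_comm (s := Finset.Icc (-D : ℤ) (E + D))]
      refine Finset.sum_congr rfl fun k hk => ?_
      have hm' := Finset.mem_range.1 hm
      have hk' := Finset.mem_range.1 hk
      -- The creation exponent is t = e + k. The factor κ^{-k} from the annihilation part turns κ^t
      -- into κ^e, hence the translation of the interval by `k`.
      rw [fuse_B hj κ _ ((Finset.Icc (-D : ℤ) (E + D)).map (addRightEmbedding (k : ℤ))) ?_,
        Finset.sum_map, LinearMap.sum_apply, Finset.smul_sum]
      · refine Finset.sum_congr rfl fun e _ => ?_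
        rw [addRightEmbedding_apply, LinearMap.smul_apply, smul_smul, Module.End.mul_apply,
          B_B_apply, ← map_pow, ← map_mul, ← Units.val_pow_eq_pow_val, ← Units.val_mul, inv_pow,
          zpow_add, zpow_natCast, mul_comm, mul_inv_cancel_right, add_comm e]
        congr 3
        ring
      · rw [Finset.map_add_right_Icc]
        exact Finset.Icc_subset_Icc (by omega) (by omega)
  · intro m hm
    rw [hA]
    refine Finset.sum_eq_zero fun x hx => ?_
    have := Finset.HasAntidiagonal.mem_antidiagonal.1 hx
    rw [hAA _ _ (by omega), smul_zero]
  · intro e he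
    by_contra h
    refine he ?_
    change _ • _ = _
    have : ¬ (-D ≤ e ∧ e ≤ E + D) := by simpa using h
    rw [no2_eq_zero s _ _ hf (by omega), smul_zero]

end Vtx

end

end EllipticAlgebra


set_option linter.unusedSectionVars false

namespace EllipticAlgebra

noncomputable section

/-! ### Theta functions as products of substituted series -/

section Sub

variable {K : Type*} [Field K] {A : Type*} [CommRing A] [Algebra K A]

/-- The series `∑_k U_k p^k y^k`. -/
def sub (y : A) (U : (K⟦X⟧)⟦X⟧) : A⟦X⟧ :=
  PowerSeries.mk fun n => ∑ k ∈ Finset.range (n + 1),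
    PowerSeries.coeff n (PowerSeries.X ^ (2 * k) * PowerSeries.coeff k U) • y ^ k

theorem coeff_X_pow_mul_eq_zero {n k : ℕ} (h : n < 2 * k) (f : K⟦X⟧) :
    PowerSeries.coeff n (PowerSeries.X ^ (2 * k) * f) = 0 := by
  rw [PowerSeries.coeff_X_pow_mul', if_neg (by omega)]

theorem coeff_sub (y : A) (U : (K⟦X⟧)⟦X⟧) {n m : ℕ} (h : n < 2 * m) :
    PowerSeries.coeff n (sub y U) = ∑ k ∈ Finset.range m,
      PowerSeries.coeff n (PowerSeries.X ^ (2 * k) * PowerSeries.coeff k U) • y ^ k := by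
  have key : ∀ a b : ℕ, n < 2 * a → a ≤ b → ∑ k ∈ Finset.range a,
      PowerSeries.coeff n (PowerSeries.X ^ (2 * k) * PowerSeries.coeff k U) • y ^ k =
      ∑ k ∈ Finset.range b,
      PowerSeries.coeff n (PowerSeries.X ^ (2 * k) * PowerSeries.coeff k U) • y ^ k := by
    intro a b ha hab
    refine Finset.sum_subset (Finset.range_subset_range.2 hab) fun k _ hk => ?_
    rw [coeff_X_pow_mul_eq_zero (by have : ¬ k < a := by simpa using hk
                                    omega), zero_smul]
  rw [sub, PowerSeries.coeff_mk, key (n + 1) (max (n + 1) m) (by omega) (le_max_left _ _),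
    key m (max (n + 1) m) h (le_max_right _ _)]

/-- The factor p^k attached to y^k makes each coefficient of p^{1/2} a finite sum, so substituting p
y for the variable is multiplicative for an arbitrary element `y`. -/
theorem sub_mul (y : A) (U V : (K⟦X⟧)⟦X⟧) : sub y (U * V) = sub y U * sub y V := by
  ext n
  have hbox := sum_antidiagonal_box (fun i j => PowerSeries.coeff n
    ((PowerSeries.X ^ (2 * i) * PowerSeries.coeff i U) *
      (PowerSeries.X ^ (2 * j) * PowerSeries.coeff j V)) • y ^ (i + j)) (n + 1) (n + 1) ?_
  · calc _ = _ := coeff_sub (m := n + 1 + (n + 1)) _ _ (by omega)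
      _ = _ := Finset.sum_congr rfl fun k _ => ?_
      _ = _ := hbox
      _ = _ := ?_
    · rw [PowerSeries.coeff_mul k, Finset.mul_sum, map_sum, Finset.sum_smul]
      refine Finset.sum_congr rfl fun x hx => ?_
      rw [← Finset.HasAntidiagonal.mem_antidiagonal.1 hx]
      congr 2
      ring
    · rw [PowerSeries.coeff_mul]
      have h1 : ∀ x ∈ Finset.HasAntidiagonal.antidiagonal n,
          PowerSeries.coeff x.1 (sub y U) * PowerSeries.coeff x.2 (sub y V) =
          ∑ i ∈ Finset.range (n + 1), ∑ j ∈ Finset.range (n + 1),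
            (PowerSeries.coeff x.1 (PowerSeries.X ^ (2 * i) * PowerSeries.coeff i U) *
            PowerSeries.coeff x.2 (PowerSeries.X ^ (2 * j) * PowerSeries.coeff j V)) •
              y ^ (i + j) := by
        intro x hx
        have := Finset.HasAntidiagonal.mem_antidiagonal.1 hx
        rw [coeff_sub y U (m := n + 1) (by omega), coeff_sub y V (m := n + 1) (by omega),
          Finset.sum_mul_sum]
        refine Finset.sum_congr rfl fun i _ => Finset.sum_congr rfl fun j _ => ?_
        rw [smul_mul_smul_comm, pow_add]
      rw [Finset.sum_congr rfl h1, Finset.sum_comm (s := Finset.HasAntidiagonal.antidiagonal n)]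
      refine Finset.sum_congr rfl fun i _ => ?_
      rw [Finset.sum_comm (s := Finset.HasAntidiagonal.antidiagonal n)]
      refine Finset.sum_congr rfl fun j _ => ?_
      rw [PowerSeries.coeff_mul, Finset.sum_smul]
  · rintro i j h
    have : PowerSeries.coeff n ((PowerSeries.X ^ (2 * i) * PowerSeries.coeff i U) *
        (PowerSeries.X ^ (2 * j) * PowerSeries.coeff j V)) = 0 := by
      rw [mul_mul_mul_comm, ← pow_add, ← mul_add, coeff_X_pow_mul_eq_zero (by omega)]
    rw [this, zero_smul]

theorem sub_one (y : A) : sub y (1 : (K⟦X⟧)⟦X⟧) = 1 := by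
  ext n
  rw [coeff_sub y 1 (m := n + 1) (by omega), Finset.sum_eq_single 0]
  · rw [mul_zero, pow_zero, pow_zero, one_mul, PowerSeries.coeff_zero_one, PowerSeries.coeff_one,
      PowerSeries.coeff_one]
    split_ifs <;> simp
  · intro k _ hk
    simp [PowerSeries.coeff_one, hk]
  · simp

theorem sub_add (y : A) (U V : (K⟦X⟧)⟦X⟧) : sub y (U + V) = sub y U + sub y V := by
  ext n
  simp only [sub, map_add, PowerSeries.coeff_mk, mul_add, add_smul, Finset.sum_add_distrib]

/-- `sub` as a ring homomorphism. -/
def subHom (y : A) : (K⟦X⟧)⟦X⟧ →+* A⟦X⟧ where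
  toFun := sub y
  map_one' := sub_one y
  map_mul' := sub_mul y
  map_zero' := by
    have := sub_add y (0 : (K⟦X⟧)⟦X⟧) 0
    rwa [add_zero, left_eq_add] at this
  map_add' := sub_add y

theorem subHom_apply (y : A) (U : (K⟦X⟧)⟦X⟧) : subHom y U = sub y U := rfl

theorem sub_C_mul_X (y : A) (κ : K) :
    sub y (PowerSeries.C (PowerSeries.C κ) * PowerSeries.X) =
      PowerSeries.C (κ • y) * PowerSeries.X ^ 2 := by
  ext n
  rw [coeff_sub (m := n + 2) _ _ (by omega), Finset.sum_eq_single 1, pow_one,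
    PowerSeries.coeff_C_mul, PowerSeries.coeff_one_X, mul_one, mul_comm, mul_one,
    PowerSeries.coeff_C_mul, PowerSeries.coeff_C_mul, PowerSeries.coeff_X_pow,
    PowerSeries.coeff_X_pow]
  · split_ifs <;> simp
  · intro k _ hk
    rw [PowerSeries.coeff_C_mul, PowerSeries.coeff_X, if_neg hk]; simp
  · simp

theorem sub_C (y : A) (c : K⟦X⟧) : sub y (PowerSeries.C c) = PowerSeries.map (algebraMap K A) c := by
  ext n
  rw [coeff_sub (m := n + 1) _ _ (by omega), Finset.sum_eq_single 0]
  · simp [Algebra.smul_def]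
  · intro k _ hk
    simp [PowerSeries.coeff_C, hk]
  · simp

theorem sub_poch_rescale (y : A) (U : (K⟦X⟧)⟦X⟧) (h : PowerSeries.coeff 0 U = 1) (M : ℕ) :
    PowerSeries.X ^ M ∣ sub y (PowerSeries.rescale (pp K ^ M) U) - 1 := by
  rw [PowerSeries.X_pow_dvd_iff]
  intro n hn
  rw [map_sub, coeff_sub (m := n + 1) _ _ (by omega), Finset.sum_range_succ']
  rw [Finset.sum_eq_zero]
  · rw [mul_zero, pow_zero, pow_zero, one_mul, PowerSeries.coeff_rescale, h, pow_zero, one_mul,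
      PowerSeries.coeff_one, PowerSeries.coeff_one, zero_add]
    split_ifs <;> simp
  · intro k _
    rw [PowerSeries.coeff_rescale, ← mul_assoc, ← pow_mul, pp_pow, ← pow_add,
      PowerSeries.coeff_X_pow_mul', if_neg, zero_smul]
    nlinarith

variable [CharZero K]

theorem coeff_zero_poch (κ : K) : PowerSeries.coeff 0 (poch κ) = 1 := (isExp_expS _).coeff_zero

/-- `(κ p y; p)_∞` is congruent to its finite partial products. -/
theorem sub_poch (y : A) (κ : K) (M : ℕ) :
    PowerSeries.X ^ M ∣ sub y (poch κ) -
      ∏ j ∈ Finset.range M, (1 - PowerSeries.C (κ • y) * PowerSeries.X ^ (2 * (j + 1))) := by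
  -- The functional equation iterated M times; the remaining factor is congruent to 1 modulo X^M.
  have h : ∀ M : ℕ, sub y (poch κ) =
      (∏ j ∈ Finset.range M, (1 - PowerSeries.C (κ • y) * PowerSeries.X ^ (2 * (j + 1)))) *
        sub y (PowerSeries.rescale (pp K ^ M) (poch κ)) := by
    intro M
    induction M with
    | zero => simp
    | succ M ih =>
      rw [ih, Finset.prod_range_succ, mul_assoc]
      congr 1
      conv_lhs => rw [poch_eq, map_mul, sub_mul, PowerSeries.rescale_rescale, ← pow_succ']
      congr 1
      rw [map_sub, map_one, map_mul, PowerSeries.rescale_X]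
      have hc : PowerSeries.rescale (pp K ^ M) (PowerSeries.C (PowerSeries.C κ)) =
          PowerSeries.C (PowerSeries.C κ) := by
        ext1 n; rw [PowerSeries.coeff_rescale, PowerSeries.coeff_C]; split_ifs with hn <;> simp [hn]
      rw [hc, mul_left_comm, ← subHom_apply, map_sub, map_one, map_mul, subHom_apply, subHom_apply,
        sub_C, sub_C_mul_X, pp_pow, map_pow, PowerSeries.map_X]
      ring
  rw [h M]
  obtain ⟨r, hr⟩ := sub_poch_rescale y (poch κ) (coeff_zero_poch κ) M
  exact ⟨_ * r, by rw [eq_add_of_sub_eq hr]; ring⟩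

/-- The theta function as a product. -/
theorem theta_eq (y y' : A) (κ κ' : K) : theta (κ • y) (κ' • y') =
    sub 1 (poch (1 : K)) * (1 - PowerSeries.C (κ • y)) * sub y (poch κ) * sub y' (poch κ') := by
  ext N
  -- One factor more than necessary: after the factor j = 0 has been split off from the middle
  -- product, N + 1 factors remain, which suffices modulo X^{N+1}.
  rw [coeff_theta _ _ N (N + 2) (by omega)]
  have h1 := sub_poch (1 : A) (1 : K) (N + 2)
  have h2 := sub_poch y κ (N + 1)
  have h3 := sub_poch y' κ' (N + 2)
  obtain ⟨r1, h1⟩ := h1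
  obtain ⟨r2, h2⟩ := h2
  obtain ⟨r3, h3⟩ := h3
  rw [Finset.prod_mul_distrib, Finset.prod_mul_distrib,
    Finset.prod_range_succ' (fun j => 1 - PowerSeries.C (κ • y) * PowerSeries.X ^ (2 * j))]
  rw [eq_add_of_sub_eq h1, eq_add_of_sub_eq h2, eq_add_of_sub_eq h3]
  simp only [one_smul, map_one, one_mul, mul_zero, pow_zero, mul_one]
  generalize ∏ j ∈ Finset.range (N + 2), (1 - (PowerSeries.X : A⟦X⟧) ^ (2 * (j + 1))) = P1
  generalize ∏ j ∈ Finset.range (N + 1),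
    (1 - PowerSeries.C (κ • y) * (PowerSeries.X : A⟦X⟧) ^ (2 * (j + 1))) = P2
  generalize ∏ j ∈ Finset.range (N + 2),
    (1 - PowerSeries.C (κ' • y') * (PowerSeries.X : A⟦X⟧) ^ (2 * (j + 1))) = P3
  rw [← sub_eq_zero, ← map_sub]
  have hX : PowerSeries.X ^ (N + 1) ∣ P1 * (P2 * (1 - PowerSeries.C (κ • y))) * P3 -
      (PowerSeries.X ^ (N + 2) * r1 + P1) * (1 - PowerSeries.C (κ • y)) *
        (PowerSeries.X ^ (N + 1) * r2 + P2) * (PowerSeries.X ^ (N + 2) * r3 + P3) := by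
    rw [pow_succ _ (N + 1)]
    set x : A⟦X⟧ := PowerSeries.X ^ (N + 1)
    set e := 1 - PowerSeries.C (κ • y)
    set X : A⟦X⟧ := PowerSeries.X
    refine ⟨-(X * r1 * e * P2 * P3 + P1 * e * r2 * P3 + P1 * e * P2 * X * r3
      + x * X * r1 * e * r2 * P3 + x * X * r1 * e * P2 * X * r3 + x * P1 * e * r2 * X * r3 +
      x * x * X * r1 * e * r2 * X * r3), ?_⟩
    ring
  exact PowerSeries.X_pow_dvd_iff.1 hX N (by omega)

end Sub

end

end EllipticAlgebra


set_option linter.unusedSectionVars false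

namespace EllipticAlgebra

noncomputable section

/-! ### Entire functions acting on distributions -/

section DistAct

variable {K : Type*} [Field K] {Γ : Type*} [AddCommGroup Γ]
variable {M : Type*} [AddCommGroup M] [Module K⟦X⟧ M]

/-- Translation of distributions. -/
def shiftHom (K Γ M : Type*) [Field K] [AddCommGroup Γ] [AddCommGroup M] [Module K⟦X⟧ M] :
    Multiplicative Γ →* Module.End K⟦X⟧ (Γ → M) where
  toFun d := LinearMap.funLeft K⟦X⟧ M fun γ => γ - d.toAdd
  map_one' := by ext; simp [LinearMap.funLeft]
  map_mul' d e := by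
    refine LinearMap.ext fun F => funext fun γ => ?_
    simp only [LinearMap.funLeft_apply, Module.End.mul_apply, toAdd_mul]
    congr 1; abel

/-- Laurent polynomials acting on distributions. -/
def laurentAct (K Γ M : Type*) [Field K] [AddCommGroup Γ] [AddCommGroup M] [Module K⟦X⟧ M] :
    AddMonoidAlgebra K Γ →+* Module.End K⟦X⟧ (Γ → M) :=
  (AddMonoidAlgebra.lift K⟦X⟧ _ Γ (shiftHom K Γ M)).toRingHom.comp
    (AddMonoidAlgebra.mapRingHom Γ PowerSeries.C)

theorem laurentAct_single (d : Γ) (κ : K) (F : Γ → M) (γ : Γ) :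
    laurentAct K Γ M (AddMonoidAlgebra.single d κ) F γ =
      (PowerSeries.C κ : K⟦X⟧) • F (γ - d) := by
  simp [laurentAct, shiftHom, LinearMap.funLeft_apply]

theorem laurentAct_apply (a : AddMonoidAlgebra K Γ) (S : Finset Γ) (hS : a.coeff.support ⊆ S)
    (F : Γ → M) (γ : Γ) : laurentAct K Γ M a F γ =
      ∑ d ∈ S, (PowerSeries.C (a.coeff d) : K⟦X⟧) • F (γ - d) := by
  have ha : a = ∑ d ∈ S, AddMonoidAlgebra.single d (a.coeff d) := by
    conv_lhs => rw [← AddMonoidAlgebra.sum_coeff_single a]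
    exact Finsupp.sum_of_support_subset _ hS _ (by simp)
  conv_lhs => rw [ha]
  rw [map_sum, LinearMap.sum_apply, Finset.sum_apply]
  exact Finset.sum_congr rfl fun d _ => laurentAct_single d _ F γ

/-- Evaluation of power series at a nilpotent endomorphism. -/
def evalNil {A E : Type*} [CommRing A] [Ring E] (φ : A →+* E) (ξ : E)
    (hc : ∀ a, Commute (φ a) ξ) {N : ℕ} (hN : ξ ^ N = 0) : A⟦X⟧ →+* E := by
  -- Terms of degree at least N vanish at ξ, so truncation is invisible. This is what makes the
  -- evaluation multiplicative.
  have key : ∀ P : Polynomial A, Polynomial.eval₂RingHom' φ ξ hc (PowerSeries.trunc N (P : A⟦X⟧)) =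
      Polynomial.eval₂RingHom' φ ξ hc P := by
    intro P
    change Polynomial.eval₂ φ ξ _ = Polynomial.eval₂ φ ξ P
    rw [PowerSeries.eval₂_trunc_eq_sum_range,
      Polynomial.eval₂_eq_sum_range' φ (n := max N (P.natDegree + 1)) (by omega)]
    simp only [Polynomial.coeff_coe]
    refine Finset.sum_subset (Finset.range_subset_range.2 (by omega)) fun i _ hi => ?_
    have hi' : N ≤ i := by simpa using hi
    rw [← Nat.sub_add_cancel hi', pow_add, hN, mul_zero, mul_zero]
  exact
  { toFun := fun f => Polynomial.eval₂RingHom' φ ξ hc (PowerSeries.trunc N f)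
    map_zero' := by rw [map_zero, map_zero]
    map_one' := by
      have := key 1
      rw [Polynomial.coe_one] at this
      exact this.trans (map_one _)
    map_add' := fun f g => by rw [map_add, map_add]
    map_mul' := fun f g => by
      rw [← PowerSeries.trunc_trunc_mul_trunc, ← Polynomial.coe_mul, key, map_mul] }

theorem evalNil_apply {A E : Type*} [CommRing A] [Ring E] (φ : A →+* E) (ξ : E)
    (hc : ∀ a, Commute (φ a) ξ) {N : ℕ} (hN : ξ ^ N = 0) (f : A⟦X⟧) : evalNil φ ξ hc hN f =
      ∑ k ∈ Finset.range N, φ (PowerSeries.coeff k f) * ξ ^ k :=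
  PowerSeries.eval₂_trunc_eq_sum_range _ _ _ _

variable {N : ℕ} (hM : ∀ u : M, (PowerSeries.X ^ N : K⟦X⟧) • u = 0)

/-- Entire functions acting on distributions with values in a module killed by `p^{N/2}`. -/
def distAct (Γ : Type*) [AddCommGroup Γ] (hM : ∀ u : M, (PowerSeries.X ^ N : K⟦X⟧) • u = 0) :
    Entire K Γ →+* Module.End K⟦X⟧ (Γ → M) :=
  evalNil (laurentAct K Γ M) (algebraMap K⟦X⟧ _ PowerSeries.X)
    (fun a => Algebra.commute_algebraMap_right _ _) (N := N) (by
      rw [← map_pow]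
      refine LinearMap.ext fun F => funext fun γ => ?_
      simpa [Algebra.algebraMap_eq_smul_one] using hM (F γ))

theorem distAct_apply_sum (f : Entire K Γ) (F : Γ → M) (γ : Γ) : distAct Γ hM f F γ =
    ∑ k ∈ Finset.range N, (PowerSeries.X ^ k : K⟦X⟧) •
      laurentAct K Γ M (PowerSeries.coeff k f) F γ := by
  rw [distAct, evalNil_apply, LinearMap.sum_apply, Finset.sum_apply]
  refine Finset.sum_congr rfl fun k _ => ?_
  rw [← map_pow, Algebra.algebraMap_eq_smul_one, mul_smul_comm, mul_one]
  rfl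

theorem distAct_C_single (d : Γ) (κ : K) (F : Γ → M) (γ : Γ) :
    distAct Γ hM (PowerSeries.C (AddMonoidAlgebra.single d κ)) F γ =
      (PowerSeries.C κ : K⟦X⟧) • F (γ - d) := by
  rcases N with _ | N
  · have h0 : ∀ u : M, u = 0 := fun u => by simpa using hM u
    rw [h0 (F (γ - d)), h0 (distAct _ _ _ _ _), smul_zero]
  rw [distAct_apply_sum, Finset.sum_eq_single 0]
  · simp [laurentAct_single]
  · intro k _ hk
    rw [PowerSeries.coeff_C, if_neg hk, map_zero]; simp
  · simp

include hM in
theorem smul_eq_sum (r : K⟦X⟧) (u : M) : r • u = ∑ k ∈ Finset.range N,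
    (PowerSeries.X ^ k : K⟦X⟧) • (PowerSeries.C (PowerSeries.coeff k r) : K⟦X⟧) • u := by
  conv_lhs => rw [PowerSeries.eq_X_pow_mul_shift_add_trunc N r]
  rw [add_smul, mul_smul, hM, zero_add, PowerSeries.trunc_apply]
  rw [← Polynomial.coeToPowerSeries.ringHom_apply, map_sum, Finset.sum_smul, Nat.Ico_zero_eq_range]
  refine Finset.sum_congr rfl fun k _ => ?_
  rw [Polynomial.coeToPowerSeries.ringHom_apply, Polynomial.coe_monomial, smul_smul,
    PowerSeries.monomial_eq_mk, mul_comm]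
  congr 1
  ext m
  simp [PowerSeries.coeff_X_pow]

/-- The action of an entire function in terms of its coefficients. -/
theorem distAct_apply (f : Entire K Γ) : ∃ S : Finset Γ,
    (∀ d ∉ S, ∀ u : M, f.coeffAt d • u = 0) ∧
    ∀ (S' : Finset Γ), S ⊆ S' → ∀ (F : Γ → M) (γ : Γ), distAct Γ hM f F γ =
      ∑ d ∈ S', f.coeffAt d • F (γ - d) := by
  classical
  refine ⟨(Finset.range N).biUnion fun k => (PowerSeries.coeff k f).coeff.support, ?_, ?_⟩
  · intro d hd u
    rw [smul_eq_sum hM]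
    refine Finset.sum_eq_zero fun k hk => ?_
    have : (PowerSeries.coeff k f).coeff d = 0 := by
      by_contra h
      exact hd (Finset.mem_biUnion.2 ⟨k, hk, Finsupp.mem_support_iff.2 h⟩)
    simp [Entire.coeffAt, this]
  · intro S' hS F γ
    rw [distAct_apply_sum]
    simp only [smul_eq_sum hM (f.coeffAt _)]
    rw [Finset.sum_comm]
    refine Finset.sum_congr rfl fun k hk => ?_
    rw [laurentAct_apply _ S' ((Finset.subset_biUnion_of_mem
      (fun k => (PowerSeries.coeff k f).coeff.support) hk).trans hS), Finset.smul_sum]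
    simp [Entire.coeffAt]

end DistAct

/-! ### Convolution of one-sided series with bounded distributions -/

section Conv

variable {K : Type*} [Field K] {Γ : Type*} [AddCommGroup Γ]
variable {M : Type*} [AddCommGroup M] [Module K⟦X⟧ M]

/-- Distributions supported in a half space. -/
def Bdd (lam : Γ →+ ℤ) (F : Γ → M) : Prop := ∃ c : ℤ, ∀ γ, lam γ < c → F γ = 0

/-- The product of `∑_k C_k z^{k δ}` with a distribution. -/
def conv (δ : Γ) (C : (K⟦X⟧)⟦X⟧) (F : Γ → M) (γ : Γ) : M :=
  ∑ᶠ k : ℕ, PowerSeries.coeff k C • F (γ - k • δ)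

theorem conv_apply {δ : Γ} (C : (K⟦X⟧)⟦X⟧) {F : Γ → M} {γ : Γ} {N : ℕ}
    (h : ∀ k, N ≤ k → F (γ - k • δ) = 0) :
    conv δ C F γ = ∑ k ∈ Finset.range N, PowerSeries.coeff k C • F (γ - k • δ) := by
  rw [conv, finsum_eq_sum_of_support_subset]
  intro k hk
  by_contra hk'
  exact hk (by simp [h k (by simpa using hk')])

variable {lam : Γ →+ ℤ} {δ : Γ}

theorem Bdd.exists_bound {F : Γ → M} (hF : Bdd lam F) (hδ : 0 < lam δ) (γ : Γ) :
    ∃ N : ℕ, ∀ k, N ≤ k → F (γ - k • δ) = 0 := by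
  obtain ⟨c, hc⟩ := hF
  refine ⟨(lam γ - c + 1).toNat, fun k hk => hc _ ?_⟩
  rw [map_sub, map_nsmul, nsmul_eq_mul]
  have : (k : ℤ) * 1 ≤ k * lam δ := by gcongr; omega
  omega

theorem Bdd.series {F : Γ → M} (hF : Bdd lam F) (hδ : 0 < lam δ) (C : (K⟦X⟧)⟦X⟧) :
    Bdd lam (conv δ C F) := by
  obtain ⟨c, hc⟩ := hF
  refine ⟨c, fun γ hγ => ?_⟩
  rw [conv_apply (N := 0), Finset.sum_range_zero]
  intro k _
  refine hc _ ?_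
  rw [map_sub, map_nsmul, nsmul_eq_mul]
  have : 0 ≤ (k : ℤ) * lam δ := by positivity
  omega

theorem bdd_of_finite (lam : Γ →+ ℤ) {F : Γ → M} (hF : F.support.Finite) : Bdd lam F := by
  obtain ⟨c, hc⟩ := (hF.image lam).bddBelow
  refine ⟨c, fun γ hγ => ?_⟩
  by_contra h
  have := hc ⟨γ, h, rfl⟩
  omega

/-- On a distribution supported in a half space on which z^δ points inwards, all the sums are finite
and may be rearranged. -/
theorem conv_mul {F : Γ → M} (hF : Bdd lam F) (hδ : 0 < lam δ) (C C' : (K⟦X⟧)⟦X⟧) :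
    conv δ (C * C') F = conv δ C (conv δ C' F) := by
  funext γ
  obtain ⟨N, hN⟩ := hF.exists_bound hδ γ
  have hs : ∀ i j : ℕ, γ - i • δ - j • δ = γ - (i + j) • δ := fun i j => by
    rw [add_smul]; abel
  rw [conv_apply (N := N + N) _ fun k hk => hN k (by omega), conv_apply (N := N)]
  · have h : ∀ i, conv δ C' F (γ - i • δ) =
        ∑ j ∈ Finset.range N, PowerSeries.coeff j C' • F (γ - (i + j) • δ) := by
      intro i
      rw [conv_apply (N := N)]
      · simp only [hs]
      · intro j hj; rw [hs]; exact hN _ (by omega)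
    simp only [h, Finset.smul_sum, smul_smul]
    rw [← sum_antidiagonal_box (fun i j => (PowerSeries.coeff i C * PowerSeries.coeff j C') •
      F (γ - (i + j) • δ))]
    · refine Finset.sum_congr rfl fun n _ => ?_
      rw [PowerSeries.coeff_mul, Finset.sum_smul]
      refine Finset.sum_congr rfl fun x hx => ?_
      rw [← Finset.HasAntidiagonal.mem_antidiagonal.1 hx]
    · intro i j hij; rw [hN _ (by omega), smul_zero]
  · intro i hi
    rw [conv_apply (N := 0), Finset.sum_range_zero]
    intro j _; rw [hs]; exact hN _ (by omega)

theorem conv_one (F : Γ → M) : conv δ (1 : (K⟦X⟧)⟦X⟧) F = F := by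
  funext γ
  rw [conv, finsum_eq_single _ 0]
  · simp
  · intro k hk; simp [PowerSeries.coeff_one, hk]

theorem conv_map {M' : Type*} [AddCommGroup M'] [Module K⟦X⟧ M'] (g : M →ₗ[K⟦X⟧] M') {F : Γ → M}
    (hF : Bdd lam F) (hδ : 0 < lam δ) (C : (K⟦X⟧)⟦X⟧) :
    (fun γ => g (conv δ C F γ)) = conv δ C (fun γ => g (F γ)) := by
  funext γ
  obtain ⟨N, hN⟩ := hF.exists_bound hδ γ
  rw [conv_apply C hN, conv_apply (N := N) C fun k hk => by rw [hN k hk, map_zero], map_sum]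
  simp

theorem Bdd.map {M' : Type*} [AddCommGroup M'] [Module K⟦X⟧ M'] (g : M →ₗ[K⟦X⟧] M') {F : Γ → M}
    (hF : Bdd lam F) : Bdd lam fun γ => g (F γ) := by
  obtain ⟨c, hc⟩ := hF
  exact ⟨c, fun γ h => (congrArg g (hc γ h)).trans (map_zero g)⟩

variable {N : ℕ} (hM : ∀ u : M, (PowerSeries.X ^ N : K⟦X⟧) • u = 0)

theorem Bdd.entire {F : Γ → M} (hF : Bdd lam F) (f : Entire K Γ) :
    Bdd lam (distAct Γ hM f F) := by
  obtain ⟨c, hc⟩ := hF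
  obtain ⟨S, -, hS⟩ := distAct_apply hM f
  obtain ⟨b, hb⟩ := (S.finite_toSet.image lam).bddBelow
  refine ⟨c + b, fun γ hγ => ?_⟩
  rw [hS S subset_rfl]
  refine Finset.sum_eq_zero fun d hd => ?_
  have := hb ⟨d, hd, rfl⟩
  rw [hc _ (by rw [map_sub]; omega), smul_zero]

include hM in
-- A series in p z^δ is a Laurent polynomial modulo any power of p^{1/2}. It therefore acts as an
-- entire function, and the direction of expansion plays no role.
theorem conv_rescale (F : Γ → M) (U : (K⟦X⟧)⟦X⟧) :
    conv δ (PowerSeries.rescale (pp K) U) F =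
      distAct Γ hM (sub (AddMonoidAlgebra.single δ 1) U) F := by
  classical
  funext γ
  have h0 : ∀ k, N ≤ k → ∀ u : M, PowerSeries.coeff k (PowerSeries.rescale (pp K) U) • u = 0 := by
    intro k hk u
    rw [PowerSeries.coeff_rescale, pp_pow, show 2 * k = (2 * k - N) + N by omega, pow_add, mul_comm,
      mul_smul, mul_smul, hM, smul_zero, smul_zero]
  have hl : conv δ (PowerSeries.rescale (pp K) U) F γ = ∑ k ∈ Finset.range N,
      PowerSeries.coeff k (PowerSeries.rescale (pp K) U) • F (γ - k • δ) := by
    rw [conv, finsum_eq_sum_of_support_subset]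
    intro k hk
    by_contra hk'
    exact hk (h0 k (by simpa using hk') _)
  rw [hl, distAct_apply_sum]
  simp only [smul_eq_sum hM (PowerSeries.coeff _ (PowerSeries.rescale (pp K) U))]
  rw [Finset.sum_comm]
  refine Finset.sum_congr rfl fun n hn => ?_
  rw [coeff_sub (m := N) _ _ (by have := Finset.mem_range.1 hn; omega), map_sum, LinearMap.sum_apply,
    Finset.sum_apply, Finset.smul_sum]
  refine Finset.sum_congr rfl fun k _ => ?_
  rw [AddMonoidAlgebra.single_pow, one_pow, AddMonoidAlgebra.smul_single, laurentAct_single,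
    PowerSeries.coeff_rescale, pp_pow, smul_eq_mul, mul_one]

theorem conv_one_sub (κ : K) (F : Γ → M) :
    conv δ (1 - PowerSeries.C (PowerSeries.C κ) * PowerSeries.X) F =
      distAct Γ hM (1 - PowerSeries.C (AddMonoidAlgebra.single δ κ)) F := by
  funext γ
  rw [map_sub, map_one, LinearMap.sub_apply, Pi.sub_apply, distAct_C_single, conv,
    finsum_eq_sum_of_support_subset (s := Finset.range 2)]
  · simp [Finset.sum_range_succ, PowerSeries.coeff_one, sub_eq_add_neg]
  · intro k hk
    by_contra hk'
    have hk2 : ¬ k < 2 := by simpa using hk'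
    refine hk ?_
    change PowerSeries.coeff k _ • _ = _
    rw [map_sub, PowerSeries.coeff_one, if_neg (by omega), PowerSeries.coeff_C_mul,
      PowerSeries.coeff_X, if_neg (by omega)]
    simp

/-- On bounded distributions, `1 - κ z^δ` is injective. -/
theorem Bdd.injective {F G : Γ → M} (hF : Bdd lam F) (hG : Bdd lam G) (hδ : 0 < lam δ) (κ : K)
    (h : distAct Γ hM (1 - PowerSeries.C (AddMonoidAlgebra.single δ κ)) F =
      distAct Γ hM (1 - PowerSeries.C (AddMonoidAlgebra.single δ κ)) G) : F = G := by
  -- An element of the kernel is multiplied by κ under translation by δ; iterating moves the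
  -- argument out of the support.
  have key : ∀ k : ℕ, ∀ γ, F γ - G γ =
      (PowerSeries.C κ : K⟦X⟧) ^ k • (F (γ - k • δ) - G (γ - k • δ)) := by
    intro k
    induction k with
    | zero => simp
    | succ k ih =>
      intro γ
      have h1 := congrFun h (γ - k • δ)
      rw [map_sub, map_one, LinearMap.sub_apply, LinearMap.sub_apply, Pi.sub_apply, Pi.sub_apply,
        distAct_C_single, distAct_C_single, Module.End.one_apply, Module.End.one_apply,
        sub_eq_sub_iff_sub_eq_sub] at h1
      rw [ih, h1, ← smul_sub, smul_smul, ← pow_succ, succ_nsmul, sub_sub]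
  funext γ
  obtain ⟨N₁, h₁⟩ := hF.exists_bound hδ γ
  obtain ⟨N₂, h₂⟩ := hG.exists_bound hδ γ
  rw [← sub_eq_zero, key (max N₁ N₂), h₁ _ (le_max_left _ _), h₂ _ (le_max_right _ _), sub_zero,
    smul_zero]

end Conv

/-! ### A criterion for summability -/

section Summability

variable {K : Type*} [Field K] {M : Type*} [AddCommGroup M] [Module K⟦X⟧ M]

/-- The reduction of `M` modulo `p^{N/2}`. -/
abbrev Red (K M : Type*) [Field K] [AddCommGroup M] [Module K⟦X⟧ M] (N : ℕ) : Type _ :=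
  M ⧸ LinearMap.range (LinearMap.lsmul K⟦X⟧ M (PowerSeries.X ^ N))

/-- The reduction map. -/
abbrev red (K : Type*) {M : Type*} [Field K] [AddCommGroup M] [Module K⟦X⟧ M] (N : ℕ) :
    M →ₗ[K⟦X⟧] Red K M N := Submodule.mkQ _

theorem red_pow_smul (N : ℕ) (u : Red K M N) : (PowerSeries.X ^ N : K⟦X⟧) • u = 0 := by
  obtain ⟨u, rfl⟩ := Submodule.mkQ_surjective _ u
  rw [← map_smul]
  exact (Submodule.Quotient.mk_eq_zero _).2 ⟨u, rfl⟩

/-- Modulo p^{N/2} the topology is discrete, where unconditional convergence means that almost all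
terms vanish. Convergence questions thereby become finite ones in the modules `Red`. -/
theorem hasAdicSum_iff {ι : Type*} (f : ι → M) (v : M) : HasAdicSum K f v ↔
    ∀ N : ℕ, ∃ S : Finset ι, (∀ t ∉ S, red K N (f t) = 0) ∧
      ∑ t ∈ S, red K N (f t) = red K N v := by
  classical
  have h1 : ∀ (N : ℕ) (T : Finset ι), (∃ w : M, ∑ t ∈ T, f t - v = (PowerSeries.X ^ N : K⟦X⟧) • w) ↔
      ∑ t ∈ T, red K N (f t) = red K N v := by
    intro N T
    rw [← map_sum, ← sub_eq_zero, ← map_sub]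
    exact ⟨fun ⟨w, hw⟩ => (Submodule.Quotient.mk_eq_zero _).2 ⟨w, hw.symm⟩,
      fun h => (Submodule.Quotient.mk_eq_zero _).1 h |>.imp fun w hw => hw.symm⟩
  simp only [HasAdicSum, h1]
  refine forall_congr' fun N => exists_congr fun S => ⟨fun h => ⟨fun t ht => ?_, h S subset_rfl⟩,
    fun ⟨h0, hS⟩ T hT => ?_⟩
  -- Adding a single index to a sufficiently large set does not change the sum, so the corresponding
  -- term is zero.
  · have := h (insert t S) (Finset.subset_insert _ _)
    rwa [Finset.sum_insert ht, h S subset_rfl, add_eq_right] at this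
  · rw [← hS]
    exact (Finset.sum_subset hT fun t _ ht => h0 t ht).symm

theorem HasAdicSum.add {ι : Type*} {f g : ι → M} {v w : M} (hf : HasAdicSum K f v)
    (hg : HasAdicSum K g w) : HasAdicSum K (fun t => f t + g t) (v + w) := by
  classical
  intro N
  obtain ⟨S, hS⟩ := hf N
  obtain ⟨T, hT⟩ := hg N
  refine ⟨S ∪ T, fun U hU => ?_⟩
  obtain ⟨a, ha⟩ := hS U (Finset.union_subset_left hU)
  obtain ⟨b, hb⟩ := hT U (Finset.union_subset_right hU)
  refine ⟨a + b, ?_⟩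
  rw [Finset.sum_add_distrib, smul_add, ← ha, ← hb]
  abel

theorem HasAdicSum.map {M' : Type*} [AddCommGroup M'] [Module K⟦X⟧ M'] {ι : Type*} {f : ι → M}
    {v : M} (hf : HasAdicSum K f v) (g : M →ₗ[K⟦X⟧] M') : HasAdicSum K (fun t => g (f t)) (g v) := by
  intro N
  obtain ⟨S, hS⟩ := hf N
  refine ⟨S, fun U hU => ?_⟩
  obtain ⟨a, ha⟩ := hS U hU
  exact ⟨g a, by rw [← map_sum, ← map_sub, ha, map_smul]⟩

theorem hasAdicSum_zero {ι : Type*} : HasAdicSum K (fun _ : ι => (0 : M)) 0 :=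
  fun _ => ⟨∅, fun _ _ => ⟨0, by simp⟩⟩

/-- Convergence of the product of an entire function with a distribution. -/
theorem hasAdicSum_of_distAct {Γ : Type*} [AddCommGroup Γ] (f : Entire K Γ) (F : Γ → M) (γ : Γ)
    (v : M) (h : ∀ N, distAct Γ (red_pow_smul N) f (fun γ => red K N (F γ)) γ = red K N v) :
    HasAdicSum K (fun d => f.coeffAt d • F (γ - d)) v := by
  refine (hasAdicSum_iff _ _).2 fun N => ?_
  obtain ⟨S, h0, hS⟩ := distAct_apply (red_pow_smul (M := M) N) f
  refine ⟨S, fun d hd => by rw [map_smul, h0 d hd], ?_⟩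
  rw [← h N, hS S subset_rfl]
  simp only [map_smul]

/-- The product of an entire function with a finitely supported distribution. -/
theorem exists_distAct {Γ : Type*} [AddCommGroup Γ] (f : Entire K Γ) {F : Γ → M}
    (hF : F.support.Finite) (γ : Γ) : ∃ v : M, ∀ N,
    distAct Γ (red_pow_smul N) f (fun γ => red K N (F γ)) γ = red K N v := by
  classical
  refine ⟨∑ d ∈ hF.toFinset.image fun d => γ - d, f.coeffAt d • F (γ - d), fun N => ?_⟩
  obtain ⟨S, h0, hS⟩ := distAct_apply (red_pow_smul (M := M) N) f
  rw [hS (S ∪ hF.toFinset.image fun d => γ - d) Finset.subset_union_left, map_sum]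
  symm
  refine (Finset.sum_subset Finset.subset_union_right fun d _ hd => ?_).trans
    (Finset.sum_congr rfl fun d _ => map_smul _ _ _)
  have : F (γ - d) = 0 := by
    by_contra h
    exact hd (Finset.mem_image.2 ⟨γ - d, by simpa using h, by abel⟩)
  simp [this]

end Summability

end

end EllipticAlgebra


set_option linter.unusedSectionVars false

namespace EllipticAlgebra

noncomputable section

/-! ### Expansions in `K((z))[[p^{1/2}]]` -/

section Laurent

variable {K : Type*} [Field K]

theorem laurent_ext {f g : (LaurentSeries K)⟦X⟧} (h : ∀ m, laurentCoeff f m = laurentCoeff g m) :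
    f = g := by
  ext1 N
  refine HahnSeries.ext (funext fun m => ?_)
  simpa [laurentCoeff] using congrArg (PowerSeries.coeff N) (h m)

theorem exists_lower_bound (f : LaurentSeries K) : ∃ c : ℤ, ∀ m < c, f.coeff m = 0 :=
  ⟨f.order, fun _ h => HahnSeries.coeff_eq_zero_of_lt_order h⟩

/-- The lower bound is uniform over finitely many powers of p^{1/2}; consequently a coefficient of a
product of expansions is a finite sum modulo p^{N/2}. -/
theorem exists_lower_bound_range (f : (LaurentSeries K)⟦X⟧) (N : ℕ) :
    ∃ c : ℤ, ∀ k ≤ N, ∀ m < c, (PowerSeries.coeff k f).coeff m = 0 := by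
  induction N with
  | zero =>
    obtain ⟨c, hc⟩ := exists_lower_bound (PowerSeries.coeff 0 f)
    exact ⟨c, fun k hk => by rw [Nat.le_zero.1 hk]; exact hc⟩
  | succ N ih =>
    obtain ⟨c, hc⟩ := ih
    obtain ⟨c', hc'⟩ := exists_lower_bound (PowerSeries.coeff (N + 1) f)
    refine ⟨min c c', fun k hk m hm => ?_⟩
    rcases Nat.le_succ_iff.1 hk with h | rfl
    · exact hc k h m (hm.trans_le (min_le_left _ _))
    · exact hc' m (hm.trans_le (min_le_right _ _))

theorem coeff_mul_eq_sum (f g : LaurentSeries K) {c c' : ℤ} (hf : ∀ m < c, f.coeff m = 0)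
    (hg : ∀ m < c', g.coeff m = 0) (t : ℤ) {S : Finset ℤ} (hS : Finset.Icc c (t - c') ⊆ S) :
    (f * g).coeff t = ∑ r ∈ S, f.coeff r * g.coeff (t - r) := by
  classical
  rw [HahnSeries.coeff_mul]
  refine Finset.sum_bij_ne_zero (fun x _ _ => x.1) ?_ ?_ ?_ ?_
  · intro x hx h0
    have hx' := Finset.mem_antidiagonal.1 hx
    refine hS (Finset.mem_Icc.2 ⟨?_, ?_⟩)
    · by_contra h; exact hx'.1 (hf _ (by omega))
    · by_contra h; exact hx'.2.1 (hg _ (by have := hx'.2.2; omega))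
  · intro x hx _ y hy _ h
    have hx' := (Finset.mem_antidiagonal.1 hx).2.2
    have hy' := (Finset.mem_antidiagonal.1 hy).2.2
    exact Prod.ext h (by omega)
  · intro r _ h0
    refine ⟨(r, t - r), Finset.mem_antidiagonal.2 ⟨left_ne_zero_of_mul h0,
      right_ne_zero_of_mul h0, by simp⟩, h0, rfl⟩
  · intro x hx _
    have hx' := (Finset.mem_antidiagonal.1 hx).2.2
    rw [show t - x.1 = x.2 by omega]

/-- The product of two expansions, coefficient by coefficient. -/
theorem hasAdicSum_laurent_mul (f g : (LaurentSeries K)⟦X⟧) (t : ℤ) :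
    HasAdicSum K (fun r : ℤ => laurentCoeff f r * laurentCoeff g (t - r)) (laurentCoeff (f * g) t) := by
  intro N
  obtain ⟨c, hc⟩ := exists_lower_bound_range f N
  obtain ⟨c', hc'⟩ := exists_lower_bound_range g N
  refine ⟨Finset.Icc c (t - c'), fun T hT => ?_⟩
  have : (PowerSeries.X ^ N : K⟦X⟧) ∣ ∑ r ∈ T, laurentCoeff f r * laurentCoeff g (t - r) -
      laurentCoeff (f * g) t := by
    rw [PowerSeries.X_pow_dvd_iff]
    intro m hm
    rw [map_sub, map_sum, laurentCoeff, PowerSeries.coeff_mk, PowerSeries.coeff_mul,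
      HahnSeries.coeff_sum, sub_eq_zero]
    simp only [PowerSeries.coeff_mul]
    rw [Finset.sum_comm]
    refine Finset.sum_congr rfl fun x hx => ?_
    have hx' := Finset.HasAntidiagonal.mem_antidiagonal.1 hx
    rw [coeff_mul_eq_sum _ _ (hc x.1 (by omega)) (hc' x.2 (by omega)) t hT]
    simp [laurentCoeff]
  obtain ⟨w, hw⟩ := this
  exact ⟨w, hw⟩

/-- The product of a series in `z` with coefficients in `K[[p^{1/2}]]`, as an expansion. -/
def sw : (K⟦X⟧)⟦X⟧ →+* (LaurentSeries K)⟦X⟧ where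
  toFun C := PowerSeries.mk fun N => HahnSeries.ofPowerSeries ℤ K
    (PowerSeries.mk fun k => PowerSeries.coeff N (PowerSeries.coeff k C))
  map_zero' := by
    ext1 N
    rw [PowerSeries.coeff_mk, map_zero, ← map_zero (HahnSeries.ofPowerSeries ℤ K)]
    congr 1
  map_one' := by
    ext1 N
    rw [PowerSeries.coeff_mk, PowerSeries.coeff_one]
    split_ifs with h
    · rw [← map_one (HahnSeries.ofPowerSeries ℤ K)]
      congr 1; ext k; rw [PowerSeries.coeff_mk, PowerSeries.coeff_one, PowerSeries.coeff_one]
      split_ifs <;> simp [h]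
    · rw [← map_zero (HahnSeries.ofPowerSeries ℤ K)]
      congr 1; ext k; rw [PowerSeries.coeff_mk, PowerSeries.coeff_one]
      split_ifs <;> simp [PowerSeries.coeff_one, h]
  map_add' C C' := by
    ext1 N
    rw [map_add, PowerSeries.coeff_mk, PowerSeries.coeff_mk, PowerSeries.coeff_mk, ← map_add]
    congr 1
  map_mul' C C' := by
    ext1 N
    rw [PowerSeries.coeff_mk, PowerSeries.coeff_mul]
    simp only [PowerSeries.coeff_mk, ← map_mul, ← map_sum]
    congr 1
    ext k
    simp only [PowerSeries.coeff_mk, map_sum, PowerSeries.coeff_mul]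
    rw [Finset.sum_comm]

theorem coeff_ofPowerSeries (F : K⟦X⟧) (m : ℤ) :
    (HahnSeries.ofPowerSeries ℤ K F).coeff m = zext (fun k => PowerSeries.coeff k F) m := by
  rw [zext]
  split_ifs with h
  · obtain ⟨k, rfl⟩ := Int.eq_ofNat_of_zero_le h
    exact HahnSeries.ofPowerSeries_apply_coeff F k
  · rw [HahnSeries.ofPowerSeries_apply]
    refine HahnSeries.embDomain_of_notMem_range ?_
    rintro ⟨k, hk⟩
    exact h (hk ▸ Int.natCast_nonneg k)

theorem laurentCoeff_sw (C : (K⟦X⟧)⟦X⟧) (m : ℤ) :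
    laurentCoeff (sw C) m = zext (fun k => PowerSeries.coeff k C) m := by
  ext N
  rw [laurentCoeff, PowerSeries.coeff_mk]
  rw [sw, RingHom.coe_mk, MonoidHom.coe_mk, OneHom.coe_mk, PowerSeries.coeff_mk, coeff_ofPowerSeries,
    zext, zext]
  split_ifs <;> simp

theorem laurent_algebraMap (c : K) : algebraMap K (LaurentSeries K) c = HahnSeries.C c := by
  rw [HahnSeries.algebraMap_apply', PowerSeries.algebraMap_apply,
    Algebra.algebraMap_self, RingHom.id_apply, HahnSeries.ofPowerSeries_C]

theorem laurentCoeff_sub (ε : ℤˣ) (U : (K⟦X⟧)⟦X⟧) (m : ℤ) :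
    laurentCoeff (sub (HahnSeries.single (ε : ℤ) (1 : K)) U) m =
      zext (fun k => PowerSeries.coeff k (PowerSeries.rescale (pp K) U)) (ε * m) := by
  have hε : (ε : ℤ) * ε = 1 := by rw [← Units.val_mul, Int.units_mul_self, Units.val_one]
  ext N
  rw [laurentCoeff, PowerSeries.coeff_mk, coeff_sub (m := N + 1) _ _ (by omega),
    HahnSeries.coeff_sum]
  simp only [Algebra.smul_def, laurent_algebraMap]
  have h : ∀ k : ℕ, (HahnSeries.C (PowerSeries.coeff N (PowerSeries.X ^ (2 * k) * PowerSeries.coeff k U)) *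
      (HahnSeries.single (ε : ℤ) (1 : K)) ^ k).coeff m =
      if (k : ℤ) = ε * m then PowerSeries.coeff N (PowerSeries.X ^ (2 * k) * PowerSeries.coeff k U)
        else 0 := by
    intro k
    have h1 : (k : ℤ) = ε * m ↔ m = k • (ε : ℤ) := by
      rw [nsmul_eq_mul]
      constructor
      · intro h; rw [h, mul_right_comm, hε, one_mul]
      · rintro rfl; rw [mul_left_comm, hε, mul_one]
    rw [HahnSeries.single_pow, one_pow, HahnSeries.C_apply, HahnSeries.coeff_single_zero_mul, HahnSeries.coeff_single]
    simp only [h1]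
    split_ifs <;> simp
  rw [Finset.sum_congr rfl fun k _ => h k, zext]
  split_ifs with hm
  · obtain ⟨k, hk⟩ := Int.eq_ofNat_of_zero_le hm
    rw [hk, Int.toNat_natCast, PowerSeries.coeff_rescale, pp_pow]
    simp only [Int.natCast_inj]
    rw [Finset.sum_ite_eq', ite_eq_left_iff]
    intro hk'
    rw [coeff_X_pow_mul_eq_zero]
    have : ¬ k < N + 1 := by simpa using hk'
    omega
  · rw [map_zero]
    exact Finset.sum_eq_zero fun k _ => if_neg (by omega)

theorem sw_rescale (U : (K⟦X⟧)⟦X⟧) :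
    sw (PowerSeries.rescale (pp K) U) = sub (HahnSeries.single (1 : ℤ) (1 : K)) U :=
  laurent_ext fun m => by
    rw [laurentCoeff_sw]
    simpa using (laurentCoeff_sub 1 U m).symm

theorem sw_one_sub (κ : K) : sw (1 - PowerSeries.C (PowerSeries.C κ) * PowerSeries.X) =
    1 - PowerSeries.C (HahnSeries.single (1 : ℤ) κ) := by
  rw [map_sub, map_one]
  congr 1
  refine laurent_ext fun m => ?_
  rw [laurentCoeff_sw]
  ext N
  simp only [laurentCoeff, PowerSeries.coeff_mk, zext, PowerSeries.coeff_C_mul, PowerSeries.coeff_X,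
    PowerSeries.coeff_C]
  by_cases h1 : m = 1
  · subst h1; simp [PowerSeries.coeff_C]; split_ifs <;> simp
  · have : ¬ (0 ≤ m ∧ m.toNat = 1) := by omega
    split_ifs <;> simp_all

variable {M : Type*} [AddCommGroup M] [Module K⟦X⟧ M]

theorem conv_int (ε : ℤˣ) (C : (K⟦X⟧)⟦X⟧) {η : ℤ → M} {S : Finset ℤ} (hS : ∀ t ∉ S, η t = 0)
    (γ : ℤ) : conv (ε : ℤ) C η γ =
      ∑ t ∈ S, zext (fun k => PowerSeries.coeff k C) (ε * (γ - t)) • η t := by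
  have hε : (ε : ℤ) * ε = 1 := by rw [← Units.val_mul, Int.units_mul_self, Units.val_one]
  rw [conv, finsum_eq_sum_of_support_subset (s := (S.image fun t => ((ε : ℤ) * (γ - t)).toNat))]
  · refine Finset.sum_bij_ne_zero (fun k _ _ => γ - k • (ε : ℤ)) ?_ ?_ ?_ ?_
    · intro k _ h; by_contra h'; exact h (by rw [hS _ h', smul_zero])
    · intro k _ _ l _ _ h
      have : (k : ℤ) * ε = l * ε := by simpa using h
      have := congrArg (· * (ε : ℤ)) this
      simpa [mul_assoc, hε] using this
    · intro t ht h
      rw [zext] at h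
      split_ifs at h with h0
      · have : γ - ((ε : ℤ) * (γ - t)).toNat • (ε : ℤ) = t := by
          rw [nsmul_eq_mul, Int.toNat_of_nonneg h0, mul_right_comm, hε]; ring
        exact ⟨((ε : ℤ) * (γ - t)).toNat, Finset.mem_image.2 ⟨t, ht, rfl⟩, by rwa [this], this⟩
      · simp at h
    · intro k _ _
      rw [nsmul_eq_mul, sub_sub_cancel, mul_left_comm, hε, mul_one, zext_natCast]
  · intro k hk
    refine Finset.mem_coe.2 (Finset.mem_image.2 ⟨γ - k • (ε : ℤ), ?_, ?_⟩)
    · by_contra h; exact hk (by simp only [hS _ h, smul_zero])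
    · rw [nsmul_eq_mul, sub_sub_cancel, mul_left_comm, hε, mul_one, Int.toNat_natCast]

theorem hasAdicSum_smul_sum {ι κ : Type*} (S : Finset κ) {a : κ → ι → K⟦X⟧} {b : κ → K⟦X⟧}
    (h : ∀ t, HasAdicSum K (a t) (b t)) (η : κ → M) :
    HasAdicSum K (fun r => ∑ t ∈ S, a t r • η t) (∑ t ∈ S, b t • η t) := by
  classical
  induction S using Finset.induction_on with
  | empty => simpa using hasAdicSum_zero
  | insert t S ht ih =>
    simp only [Finset.sum_insert ht]
    exact ((h t).map (LinearMap.toSpanSingleton K⟦X⟧ M (η t))).add ih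

/-- Multiplication of a distribution by an expansion. -/
theorem hasAdicSum_star {f g f' : (LaurentSeries K)⟦X⟧} (h : g * f = f') {η F F' : ℤ → M}
    {S : Finset ℤ} (hF : ∀ γ, F γ = ∑ t ∈ S, laurentCoeff f (γ - t) • η t)
    (hF' : ∀ γ, F' γ = ∑ t ∈ S, laurentCoeff f' (γ - t) • η t) (e : ℤ) :
    HasAdicSum K (fun r => laurentCoeff g r • F (e - r)) (F' e) := by
  simp only [hF, hF', ← h, Finset.smul_sum, smul_smul]
  refine hasAdicSum_smul_sum S (fun t => ?_) η
  have := hasAdicSum_laurent_mul g f (e - t)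
  simpa only [sub_right_comm] using this

end Laurent

end

end EllipticAlgebra


set_option linter.unusedSectionVars false

namespace EllipticAlgebra

noncomputable section

/-! ### The expansions of the structure functions -/

section StructureFunctions

variable {K : Type*} [Field K] [CharZero K]

theorem sw_poch (κ : K) : sw (poch κ) =
    (1 - PowerSeries.C (HahnSeries.single (1 : ℤ) κ)) *
      sub (HahnSeries.single (1 : ℤ) (1 : K)) (poch κ) := by
  conv_lhs => rw [poch_eq, map_mul, sw_one_sub, sw_rescale]

/-- The Jacobi product in K((z))[[p^{1/2}]]: the constant (p;p)_∞, a series in z, and a series in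
p/z. -/
theorem thetaLaurent_eq (κ : Kˣ) : thetaLaurent κ =
    sub (1 : LaurentSeries K) (poch (1 : K)) * sw (poch (κ : K)) *
      sub (HahnSeries.single (-1 : ℤ) (1 : K)) (poch ((κ⁻¹ : Kˣ) : K)) := by
  have h := theta_eq (HahnSeries.single (1 : ℤ) (1 : K)) (HahnSeries.single (-1 : ℤ) (1 : K))
    (κ : K) ((κ⁻¹ : Kˣ) : K)
  simp only [Algebra.smul_def, laurent_algebraMap, HahnSeries.C_apply, HahnSeries.single_mul_single,
    zero_add, mul_one] at h
  rw [thetaLaurent, h, sw_poch]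
  ring

theorem constantCoeff_thetaLaurent (κ : Kˣ) : PowerSeries.constantCoeff (thetaLaurent κ) ≠ 0 := by
  rw [← PowerSeries.coeff_zero_eq_constantCoeff_apply, thetaLaurent, coeff_theta _ _ 0 1 le_rfl]
  have : (1 : LaurentSeries K) - HahnSeries.single (1 : ℤ) (κ : K) ≠ 0 := by
    intro h
    have := congrArg (fun f : LaurentSeries K => HahnSeries.coeff f 0) h
    simp at this
  simpa using this

theorem constantCoeff_gLaurent (s : Kˣ) (a : ℤ) (κ : Kˣ) :
    PowerSeries.constantCoeff (gLaurent s a κ) ≠ 0 := by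
  rw [gLaurent, map_mul, map_mul, PowerSeries.constantCoeff_C, PowerSeries.constantCoeff_inv]
  refine mul_ne_zero (mul_ne_zero ?_ (constantCoeff_thetaLaurent _))
    (inv_ne_zero (constantCoeff_thetaLaurent _))
  exact (map_ne_zero HahnSeries.C).2 (Units.ne_zero _)

theorem gLaurentPow_mul (s : Kˣ) (a : ℤ) (κ : Kˣ) (σ : ℤˣ) :
    gLaurentPow s a κ σ * gLaurentPow s a κ (-σ) = 1 := by
  have h := PowerSeries.mul_inv_cancel _ (constantCoeff_gLaurent s a κ)
  rcases Int.units_eq_one_or σ with rfl | rfl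
  · simpa [gLaurentPow] using h
  · rw [mul_comm] at h
    simpa [gLaurentPow] using h

/-- The series `((κ q^{-a} x; p)_∞ / (κ q^a x; p)_∞)^{±1}`. -/
def pochQuot (s : Kˣ) (a : ℤ) (κ : Kˣ) (σ : ℤˣ) : (K⟦X⟧)⟦X⟧ :=
  expS fun k => (σ : ℤ) • (ell ((q s ^ (-a) * κ : Kˣ) : K) k - ell ((q s ^ a * κ : Kˣ) : K) k)

theorem pochQuot_mul_neg (s : Kˣ) (a : ℤ) (κ : Kˣ) (σ : ℤˣ) :
    pochQuot s a κ σ * pochQuot s a κ (-σ) = 1 := by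
  rw [pochQuot, pochQuot, ← expS_mul_neg]
  congr 2
  funext k
  simp

theorem pochQuot_mul_poch (s : Kˣ) (a : ℤ) (κ : Kˣ) :
    pochQuot s a κ 1 * poch ((q s ^ a * κ : Kˣ) : K) = poch ((q s ^ (-a) * κ : Kˣ) : K) := by
  have h : pochQuot s a κ 1 =
      expS (ell ((q s ^ (-a) * κ : Kˣ) : K) - ell ((q s ^ a * κ : Kˣ) : K)) :=
    congrArg expS (funext fun k => by simp)
  rw [h, poch, poch, expS_sub_mul]

/-- A quotient of two theta functions separates into a series in z and a series in p/z. The first is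
the contraction of the two operators in one order, the second in the other order, so g is precisely
the exchange factor. The proof multiplies by the denominator of g, which is a nonzero element of a
domain. -/
theorem gLaurent_mul (s : Kˣ) (a : ℤ) (κ : Kˣ) : gLaurent s a κ * sw (pochQuot s a κ 1) =
    PowerSeries.C (HahnSeries.C ((q s ^ (-a) : Kˣ) : K) : LaurentSeries K) *
      sub (HahnSeries.single (-1 : ℤ) (1 : K)) (pochQuot s a κ⁻¹ 1) := by
  have h0 := PowerSeries.mul_inv_cancel _ (constantCoeff_thetaLaurent (q s ^ (-a) * κ))
  have hne : thetaLaurent (q s ^ (-a) * κ) ≠ 0 := by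
    intro h; rw [h, zero_mul] at h0; exact zero_ne_one h0
  have h1 := congrArg sw (pochQuot_mul_poch s a κ)
  have h2 := congrArg (subHom (HahnSeries.single (-1 : ℤ) (1 : K)))
    (pochQuot_mul_poch s a κ⁻¹)
  rw [map_mul] at h1 h2
  refine mul_right_cancel₀ hne ?_
  rw [gLaurent]
  rw [thetaLaurent_eq (q s ^ a * κ)]
  have e1 : (q s ^ a * κ)⁻¹ = q s ^ (-a) * κ⁻¹ := by rw [mul_inv, zpow_neg]
  have e2 : (q s ^ (-a) * κ)⁻¹ = q s ^ a * κ⁻¹ := by rw [mul_inv, zpow_neg, inv_inv]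
  simp only [subHom_apply] at h2
  rw [e1]
  generalize hθ : thetaLaurent (q s ^ (-a) * κ) = θ at h0 ⊢
  rw [thetaLaurent_eq, e2] at hθ
  generalize PowerSeries.C (HahnSeries.C ((q s ^ (-a) : Kˣ) : K) : LaurentSeries K) = k
  generalize sub (1 : LaurentSeries K) (poch (1 : K)) = c at *
  generalize sw (pochQuot s a κ 1) = E at *
  generalize sw (poch ((q s ^ a * κ : Kˣ) : K)) = A1 at *
  generalize sw (poch ((q s ^ (-a) * κ : Kˣ) : K)) = A2 at *
  generalize sub (HahnSeries.single (-1 : ℤ) (1 : K)) (pochQuot s a κ⁻¹ 1) = E' at *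
  generalize sub (HahnSeries.single (-1 : ℤ) (1 : K)) (poch ((q s ^ a * κ⁻¹ : Kˣ) : K)) = B1 at *
  generalize sub (HahnSeries.single (-1 : ℤ) (1 : K)) (poch ((q s ^ (-a) * κ⁻¹ : Kˣ) : K)) = B2 at *
  linear_combination (k * c * A1 * B2 * E) * h0 + k * c * B2 * h1 - k * c * A2 * h2 + k * E' * hθ

theorem gLaurentPow_mul_sw (s : Kˣ) (a : ℤ) (κ : Kˣ) (σ : ℤˣ) :
    gLaurentPow s a κ σ * sw (pochQuot s a κ σ) =
    PowerSeries.C (HahnSeries.C ((q s ^ (-(σ : ℤ) * a) : Kˣ) : K)) *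
      sub (HahnSeries.single (-1 : ℤ) (1 : K)) (pochQuot s a κ⁻¹ σ) := by
  rcases Int.units_eq_one_or σ with rfl | rfl
  · simpa [gLaurentPow] using gLaurent_mul s a κ
  · have h1 := gLaurent_mul s a κ
    have h2 := PowerSeries.mul_inv_cancel _ (constantCoeff_gLaurent s a κ)
    have h3 := congrArg sw (pochQuot_mul_neg s a κ 1)
    have h4 := (sub_mul (HahnSeries.single (-1 : ℤ) (1 : K)) _ _).symm.trans
      ((congrArg (sub _) (pochQuot_mul_neg s a κ⁻¹ 1)).trans (sub_one _))
    have h5 : PowerSeries.C (HahnSeries.C ((q s ^ (-a) : Kˣ) : K) : LaurentSeries K) *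
        PowerSeries.C (HahnSeries.C ((q s ^ a : Kˣ) : K) : LaurentSeries K) = (1 : (LaurentSeries K)⟦X⟧) := by
      rw [← map_mul PowerSeries.C, ← map_mul HahnSeries.C, ← Units.val_mul, ← zpow_add]; simp
    rw [map_mul, map_one] at h3
    have h6 : gLaurentPow s a κ (-1) = (gLaurent s a κ)⁻¹ := by
      rw [gLaurentPow, if_neg (by decide)]
    have h7 : -((-1 : ℤˣ) : ℤ) * a = a := by simp
    rw [h6, h7]
    generalize (gLaurent s a κ)⁻¹ = g' at *
    generalize gLaurent s a κ = g at *
    generalize PowerSeries.C (HahnSeries.C ((q s ^ (-a) : Kˣ) : K) : LaurentSeries K) = k at *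
    generalize PowerSeries.C (HahnSeries.C ((q s ^ a : Kˣ) : K) : LaurentSeries K) = k' at *
    generalize sw (pochQuot s a κ 1) = E at *
    generalize sw (pochQuot s a κ (-1)) = F at *
    generalize sub (HahnSeries.single (-1 : ℤ) (1 : K)) (pochQuot s a κ⁻¹ 1) = E' at *
    generalize sub (HahnSeries.single (-1 : ℤ) (1 : K)) (pochQuot s a κ⁻¹ (-1)) = F' at *
    linear_combination (-g' * F * E' * F') * h5 - g' * F * h4 - g' * F * k' * F' * h1 + E * F * k' * F' * h2 + k' * F' * h3

end StructureFunctions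

/-! ### The currents on the Fock space as vertex operators -/

section Vertex

variable {K : Type*} [Field K] {n : ℕ} {i : ℕ}

/-- The vertex operator in `x_j^±(z)`. -/
def xV (s : Kˣ) (σ : ℤˣ) (j : Fin (n - 1)) : Vtx K n where
  j := j
  p k := PowerSeries.C (((σ : ℤ) : K) / qInt s (k : ℤ)) *
    PowerSeries.C ((s ^ (-(σ : ℤ) * (k : ℤ)) : Kˣ) : K)
  r k := -(PowerSeries.C (((σ : ℤ) : K) / qInt s (k : ℤ)) *
    (PowerSeries.C ((s ^ ((σ : ℤ) * (k : ℤ)) : Kˣ) : K) * PowerSeries.X ^ (k : ℕ)))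
  p' k := -(PowerSeries.C (((σ : ℤ) : K) / qInt s (k : ℤ)) *
    PowerSeries.C ((s ^ (-(σ : ℤ) * (k : ℤ)) : Kˣ) : K))
  r' k := PowerSeries.C (((σ : ℤ) : K) / qInt s (k : ℤ)) *
    (PowerSeries.C ((s ^ ((σ : ℤ) * (k : ℤ)) : Kˣ) : K) * PowerSeries.X ^ (k : ℕ))

/-- The vertex operator in `φ_j(z)`. -/
def phiV (s : Kˣ) (j : Fin (n - 1)) : Vtx K n where
  j := j
  p _ := -PowerSeries.C ((q s : K) - ((q s)⁻¹ : Kˣ))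
  r _ := 0
  p' _ := 0
  r' k := PowerSeries.C ((q s : K) - ((q s)⁻¹ : Kˣ)) * PowerSeries.X ^ (k : ℕ)

/-- The vertex operator in `ψ_j(z)`. -/
def psiV (s : Kˣ) (j : Fin (n - 1)) : Vtx K n where
  j := j
  p _ := 0
  r k := -(PowerSeries.C ((q s : K) - ((q s)⁻¹ : Kˣ)) * PowerSeries.X ^ (k : ℕ))
  p' _ := PowerSeries.C ((q s : K) - ((q s)⁻¹ : Kˣ))
  r' _ := 0

theorem xCre_eq (s : Kˣ) (σ : ℤˣ) (j : Fin (n - 1)) : xCre s σ j = (xV s σ j).cre := by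
  refine funext fun k => LinearMap.ext fun f => ?_
  simp only [xCre, Vtx.cre, xV, LinearMap.smul_apply, LinearMap.sub_apply, LinearMap.add_apply,
    MvPolynomial.smul_eq_C_mul, map_mul, map_neg]
  ring

theorem xAnn_eq (s : Kˣ) (σ : ℤˣ) (j : Fin (n - 1)) : xAnn s σ j = (xV s σ j).ann s := by
  refine funext fun k => LinearMap.ext fun f => ?_
  simp only [xAnn, Vtx.ann, xV, neg_div, map_neg, LinearMap.smul_apply, LinearMap.sub_apply,
    LinearMap.add_apply, MvPolynomial.smul_eq_C_mul, map_mul, map_neg]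
  ring

/-- `onFock` as an algebra homomorphism. -/
def onFockHom : Module.End K⟦X⟧ (FockPoly K n) →ₐ[K⟦X⟧] Module.End K⟦X⟧ (Fock K n i) :=
  AlgHom.ofLinearMap
    { toFun := onFock
      map_add' := fun S T => by refine Finsupp.lhom_ext fun β f => ?_; simp [onFock]
      map_smul' := fun c T => by refine Finsupp.lhom_ext fun β f => ?_; simp [onFock] }
    (by refine Finsupp.lhom_ext fun β f => ?_; simp [onFock])
    (fun S T => by refine Finsupp.lhom_ext fun β f => ?_; simp [onFock])

theorem onFock_single (T : Module.End K⟦X⟧ (FockPoly K n)) (β : Coset n i) (f : FockPoly K n) :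
    onFock T (Finsupp.single β f) = Finsupp.single β (T f) := by
  simp [onFock]

theorem expCoeff_onFock (y : ℕ+ → Module.End K⟦X⟧ (FockPoly K n)) (m : ℕ) :
    expCoeff (K := K) (M := Fock K n i) (fun k => onFock (y k)) m = onFock (expCoeff y m) := by
  have h : posSeries (K := K) (M := Fock K n i) (fun k => onFock (y k)) =
      PowerSeries.map (onFockHom (K := K) (n := n) (i := i)).toRingHom (posSeries y) := by
    ext1 k
    simp only [posSeries, PowerSeries.coeff_mk, PowerSeries.coeff_map]
    split_ifs
    · rfl
    · exact (map_zero _).symm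
  change _ = onFockHom _
  rw [expCoeff, expCoeff, map_sum, h]
  refine Finset.sum_congr rfl fun r _ => ?_
  rw [map_smul, ← map_pow, PowerSeries.coeff_map]
  rfl

theorem zext_onFock (B : ℕ → Module.End K⟦X⟧ (FockPoly K n)) (e : ℤ) (β : Coset n i)
    (f : FockPoly K n) : zext (fun m => (onFock (B m) : Module.End K⟦X⟧ (Fock K n i))) e
      (Finsupp.single β f) = Finsupp.single β (zext B e f) := by
  rw [zext, zext]
  split_ifs
  · exact onFock_single _ _ _
  · simp

theorem modeOfProduct_onFock (V : Vtx K n) (s : Kˣ) {B A : ℕ → Module.End K⟦X⟧ (Fock K n i)}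
    (hA' : LocallyFinite (K := K) (M := Fock K n i) A) (hB : B = fun m => onFock (expCoeff V.cre m))
    (hA : A = fun m => onFock (V.A s m)) (l : ℤ) (β : Coset n i) (f : FockPoly K n) :
    modeOfProduct (K := K) (M := Fock K n i) B A hA' l (Finsupp.single β f) = Finsupp.single β (V.mode s (-l) f) := by
  obtain ⟨N, hN⟩ := V.A_locallyFinite s f
  have hN' : ∀ m, N ≤ m → A m (Finsupp.single β f) = 0 := fun m hm => by
    rw [hA, onFock_single, hN m hm, Finsupp.single_zero]
  rw [modeOfProduct_apply _ _ hN', Vtx.mode_apply s V _ hN]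
  refine Eq.trans ?_ (map_sum (Finsupp.singleAddHom β) _ _).symm
  refine Finset.sum_congr rfl fun m _ => ?_
  rw [hA, onFock_single, hB, zext_onFock, sub_eq_add_neg]
  rfl

theorem phi_single (s : Kˣ) (j : Fin (n - 1)) (l : ℤ) (β : Coset n i) (f : FockPoly K n) :
    (fockCurrents s n i).phi j l (Finsupp.single β f) =
      (PowerSeries.C ((q s ^ (-pairing n j β.1) : Kˣ) : K) : K⟦X⟧) •
        Finsupp.single β ((phiV s j).mode s (-l) f) := by
  have h : ((fockCurrents s n i).aZero j : Module.End K⟦X⟧ (Fock K n i)) = qPartial s (-1) j := rfl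
  rw [Currents.phi, Module.End.mul_apply, h, qPartial_single, map_smul, neg_one_mul,
    modeOfProduct_onFock (phiV s j) s]
  · funext m
    rw [← expCoeff_onFock]
    congr 1
    funext k
    simp [fockCurrents, Vtx.cre, phiV]
  · funext m
    rw [Vtx.A, ← expCoeff_onFock]
    congr 1
    funext k
    simp [fockCurrents, Vtx.ann, phiV]

theorem psi_single (s : Kˣ) (j : Fin (n - 1)) (l : ℤ) (β : Coset n i) (f : FockPoly K n) :
    (fockCurrents s n i).psi j l (Finsupp.single β f) =
      (PowerSeries.C ((q s ^ (pairing n j β.1) : Kˣ) : K) : K⟦X⟧) •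
        Finsupp.single β ((psiV s j).mode s (-l) f) := by
  have h : ((fockCurrents s n i).bZero j : Module.End K⟦X⟧ (Fock K n i)) = qPartial s 1 j := rfl
  rw [Currents.psi, Module.End.mul_apply, h, qPartial_single, map_smul, one_mul,
    modeOfProduct_onFock (psiV s j) s]
  · funext m
    rw [← expCoeff_onFock]
    congr 1
    funext k
    simp [fockCurrents, Vtx.cre, psiV]
  · funext m
    rw [Vtx.A, ← expCoeff_onFock]
    congr 1
    funext k
    simp [fockCurrents, Vtx.ann, psiV]

theorem x_single (s : Kˣ) (σ : ℤˣ) (j : Fin (n - 1)) (l : ℤ) (β : Coset n i) (f : FockPoly K n) :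
    (fockCurrents s n i).x σ j l (Finsupp.single β f) =
      (((sign n ((σ : ℤ) • root n j) β.1 : ℤˣ) : ℤ) : K⟦X⟧) • Finsupp.single (β.shift σ j)
        ((xV s σ j).mode s (-(l + ((σ : ℤ) * pairing n j β.1 + 1))) f) := by
  have h : (fockCurrents s n i).x σ j l = xMode s σ j l := rfl
  rw [h, xMode, Finsupp.lsum_single, LinearMap.smul_apply, LinearMap.comp_apply,
    Finsupp.lsingle_apply]
  congr 2
  simp only [Vtx.mode, neg_neg, Vtx.A, xCre_eq, xAnn_eq]

end Vertex

end

end EllipticAlgebra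


set_option linter.unusedSectionVars false

namespace EllipticAlgebra

noncomputable section

/-! ### The weight lattice -/

section LatticeLemmas

theorem cartan_symm {N : ℕ} (i j : Fin N) : CartanMatrix.A N i j = CartanMatrix.A N j i :=
  (CartanMatrix.A_isSymm N).apply j i

theorem cartan_self {N : ℕ} (j : Fin N) : CartanMatrix.A N j j = 2 := by simp [CartanMatrix.A]

theorem cartan_sum {N : ℕ} (j : Fin N) (g : ℕ → ℤ) :
    ∑ t : Fin N, CartanMatrix.A N j t * g t =
      2 * g j - (if (j : ℕ) + 1 < N then g (j + 1) else 0) - (if 0 < (j : ℕ) then g (j - 1) else 0) := by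
  have h : ∀ t : Fin N, CartanMatrix.A N j t * g t = (if j = t then 2 * g j else 0) -
      (if (j : ℕ) + 1 = t then g (j + 1) else 0) -
      (if (t : ℕ) + 1 = j then g (j - 1) else 0) := by
    intro t
    simp only [CartanMatrix.A, Matrix.of_apply]
    by_cases h1 : j = t
    · subst h1; simp
    · have h1' : (j : ℕ) ≠ t := fun h => h1 (Fin.ext h)
      by_cases h2 : (j : ℕ) + 1 = t
      · simp [h1, h2, show ¬ (t : ℕ) + 1 = j by omega]
      · by_cases h3 : (t : ℕ) + 1 = j
        · rw [if_neg h1, if_neg h1, if_neg h2, if_pos h3, if_pos (Or.inr h3), ← h3]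
          simp
        · simp [h1, h2, h3]
  simp only [h, Finset.sum_sub_distrib, Finset.sum_ite_eq, Finset.mem_univ, if_true]
  congr 1
  · congr 1
    split_ifs with hj
    · rw [Finset.sum_eq_single ⟨j + 1, hj⟩]
      · simp
      · intro t _ ht
        rw [if_neg]
        rintro h
        exact ht (Fin.ext h.symm)
      · simp
    · exact Finset.sum_eq_zero fun t _ => if_neg (by omega)
  · split_ifs with hj
    · rw [Finset.sum_eq_single ⟨j - 1, by omega⟩]
      · simp; omega
      · intro t _ ht
        rw [if_neg]
        rintro h
        exact ht (Fin.ext (by simp; omega))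
      · simp
    · exact Finset.sum_eq_zero fun t _ => if_neg (by omega)

theorem pairing_add (n : ℕ) (j : Fin (n - 1)) (α β : WeightLattice n) :
    pairing n j (α + β) = pairing n j α + pairing n j β := by
  simp only [pairing, Pi.add_apply, add_mul, Finset.sum_add_distrib]

theorem pairing_zsmul (n : ℕ) (j : Fin (n - 1)) (m : ℤ) (β : WeightLattice n) :
    pairing n j (m • β) = m * pairing n j β := by
  simp only [pairing, Pi.smul_apply, smul_eq_mul, mul_assoc, Finset.mul_sum]

/-- Both α_1 and the fundamental weights have the coordinates -g(1), ..., -g(n-2), g(n-1) for a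
suitable function g. Their pairings are then second differences of g, up to the term t = 0 (there is
no basis vector α_1) and a boundary term. -/
theorem pairing_of {n : ℕ} (j : Fin (n - 1)) (g : ℕ → ℤ) (β : WeightLattice n)
    (hβ : ∀ k : Fin (n - 1), β k = if (k : ℕ) + 2 = n then g (n - 1) else -g (k + 1)) :
    pairing n j β = -(2 * g j - (if (j : ℕ) + 1 < n - 1 then g (j + 1) else 0) -
        (if 0 < (j : ℕ) then g (j - 1) else 0)) +
      CartanMatrix.A (n - 1) j ⟨0, j.pos⟩ * g 0 + if (j : ℕ) + 2 = n then g (n - 1) else 0 := by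
  rw [← cartan_sum]
  obtain ⟨N, rfl⟩ : ∃ N, n = N + 2 := ⟨n - 2, by have := j.pos; omega⟩
  change Fin (N + 1) at j
  change (∑ k : Fin (N + 1), _) = -(∑ t : Fin (N + 1), CartanMatrix.A (N + 1) j t * g t) + _ + _
  rw [Fin.sum_univ_succ (fun t : Fin (N + 1) => CartanMatrix.A (N + 1) j t * g t),
    Fin.sum_univ_castSucc]
  have hl : (((Fin.last N : Fin (N + 1)) : ℕ) + 2 = N + 2) := rfl
  rw [dif_pos hl, hβ, if_pos hl]
  have h1 : ∀ k : Fin N, β k.castSucc * (if h : ((k.castSucc : Fin (N + 1)) : ℕ) + 2 = N + 2 then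
        (if (j : ℕ) + 2 = N + 2 then 1 else 0) else
        CartanMatrix.A (N + 2 - 1) j (⟨k.castSucc + 1, by simp⟩ : Fin (N + 1))) =
      -(CartanMatrix.A (N + 1) j k.succ * g k.succ) := by
    intro k
    have hk : ¬ ((k.castSucc : Fin (N + 1)) : ℕ) + 2 = N + 2 := by simp; omega
    rw [hβ, if_neg hk, dif_neg hk, neg_mul, mul_comm]
    rfl
  rw [Finset.sum_congr rfl fun k _ => h1 k, Finset.sum_neg_distrib]
  change _ = -(CartanMatrix.A (N + 1) j 0 * g 0 + _) + CartanMatrix.A (N + 1) j 0 * g 0 + _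
  split_ifs <;> ring

theorem pairing_root {n : ℕ} (j i : Fin (n - 1)) :
    pairing n j (root n i) = CartanMatrix.A (n - 1) j i := by
  by_cases hi : (i : ℕ) = 0
  -- Here α_1 corresponds to g(t) = t + 1, which is linear, so only the boundary terms survive.
  · refine (pairing_of j (fun t => (t : ℤ) + 1) _ ?_).trans ?_
    rotate_left
    · have : i = ⟨0, j.pos⟩ := Fin.ext hi
      rw [this]
      have hj := j.2
      by_cases h1 : (j : ℕ) + 2 = n
      · rw [if_neg (by omega), if_pos h1]
        split_ifs <;> push_cast <;> omega
      · rw [if_pos (by omega), if_neg h1]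
        split_ifs <;> push_cast <;> omega
    · intro k
      simp only [root, if_pos hi]
      have := k.2
      split_ifs <;> push_cast <;> omega
  · rw [pairing, Finset.sum_eq_single ⟨i - 1, by omega⟩]
    · rw [dif_neg (by dsimp only; omega)]
      simp only [root, if_neg hi]
      rw [if_pos (by omega), one_mul]
      congr 1
      exact Fin.ext (by simp; omega)
    · intro k _ hk
      simp only [root, if_neg hi]
      rw [if_neg, zero_mul]
      intro h
      exact hk (Fin.ext (by simp; omega))
    · simp

theorem pairing_fundWeight {n : ℕ} (j : Fin (n - 1)) (i : ℕ) (hi : i < n) :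
    pairing n j (fundWeight n i) = if (j : ℕ) + 1 = i then 1 else 0 := by
  have hj := j.2
  by_cases h0 : i = 0
  · subst h0
    simp [pairing, fundWeight]
  -- For Λ̄_i the function g is piecewise linear with a single kink, and the second difference
  -- detects the kink.
  · refine (pairing_of j (fun t => max ((t : ℤ) + 1 - i) 0) _ ?_).trans ?_
    rotate_left
    · have : max ((((0 : ℕ) : ℤ)) + 1 - (i : ℤ)) 0 = 0 := by omega
      rw [this, mul_zero, add_zero]
      split_ifs <;> push_cast <;> omega
    · intro k
      have := k.2
      simp only [fundWeight, if_neg h0]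
      split_ifs <;> push_cast <;> omega

theorem neg_one_zpow_congr {a b : ℤ} (h : (a : ZMod 2) = b) : (-1 : ℤˣ) ^ a = (-1) ^ b := by
  rw [ZMod.intCast_eq_intCast_iff, Int.modEq_iff_dvd] at h
  obtain ⟨c, hc⟩ := h
  have : b = a + 2 * c := by push_cast at hc; omega
  rw [this, zpow_add, zpow_mul]
  simp

/-- In the basis α_2, ..., α_{n-1}, Λ̄_{n-1} two exponentials anticommute exactly when they are
neighbours; the last vector behaves like one more simple root modulo 2. -/
theorem intCast_commSign {n : ℕ} (k l : Fin (n - 1)) (h : l < k) :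
    (commSign n k l h : ZMod 2) = if (l : ℕ) + 1 = k then 1 else 0 := by
  have h' : (l : ℕ) < k := h
  unfold commSign
  by_cases h1 : (k : ℕ) + 2 = n
  · rw [dif_pos h1]
    by_cases h2 : (l : ℕ) + 3 = n
    · rw [if_pos h2, if_pos (by omega), Int.cast_one]
    · rw [if_neg h2, if_neg (by omega), Int.cast_zero]
  · rw [dif_neg h1]
    by_cases h2 : (l : ℕ) + 1 = k
    · have : ((-1 : ℤ) : ZMod 2) = 1 := by decide
      rw [if_pos h2, ← this]
      simp [CartanMatrix.A, h2, Fin.ext_iff]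
    · simp only [CartanMatrix.A, Matrix.of_apply, Fin.ext_iff]
      rw [if_neg (by omega), if_neg (by omega), if_neg h2, Int.cast_zero]

/-- The exponent of the sign, modulo two. -/
def parity {n : ℕ} (α β : WeightLattice n) : ZMod 2 :=
  ∑ k : Fin (n - 1), ∑ l : Fin (n - 1), if (l : ℕ) + 1 = k then (α k : ZMod 2) * β l else 0

theorem sign_exponent {n : ℕ} (α β : WeightLattice n) :
    ((∑ k : Fin (n - 1), ∑ l : Fin (n - 1),
      if h : l < k then α k * β l * commSign n k l h else 0 : ℤ) : ZMod 2) = parity α β := by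
  rw [parity, Int.cast_sum]
  refine Finset.sum_congr rfl fun k _ => ?_
  rw [Int.cast_sum]
  refine Finset.sum_congr rfl fun l _ => ?_
  by_cases h : l < k
  · rw [dif_pos h, Int.cast_mul, intCast_commSign, Int.cast_mul]
    split_ifs <;> simp
  · have h' : ¬ (l : ℕ) < k := h
    rw [dif_neg h, if_neg (by omega), Int.cast_zero]

theorem parity_add_right {n : ℕ} (α β γ : WeightLattice n) :
    parity α (β + γ) = parity α β + parity α γ := by
  simp only [parity, ← Finset.sum_add_distrib]
  refine Finset.sum_congr rfl fun k _ => Finset.sum_congr rfl fun l _ => ?_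
  split_ifs <;> simp [mul_add]

theorem parity_unit_left {n : ℕ} (σ : ℤˣ) (α β : WeightLattice n) :
    parity ((σ : ℤ) • α) β = parity α β := by
  have h : (((-1 : ℤˣ) : ℤ) : ZMod 2) = 1 := by decide
  simp only [parity]
  refine Finset.sum_congr rfl fun k _ => Finset.sum_congr rfl fun l _ => ?_
  rcases Int.units_eq_one_or σ with rfl | rfl
  · simp
  · rw [Pi.smul_apply, smul_eq_mul, Int.cast_mul, h, one_mul]

theorem parity_unit_right {n : ℕ} (σ : ℤˣ) (α β : WeightLattice n) :
    parity α ((σ : ℤ) • β) = parity α β := by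
  have h : (((-1 : ℤˣ) : ℤ) : ZMod 2) = 1 := by decide
  simp only [parity]
  refine Finset.sum_congr rfl fun k _ => Finset.sum_congr rfl fun l _ => ?_
  rcases Int.units_eq_one_or σ with rfl | rfl
  · simp
  · rw [Pi.smul_apply, smul_eq_mul, Int.cast_mul, h, one_mul]

theorem intCast_root {n : ℕ} (j k : Fin (n - 1)) : (root n j k : ZMod 2) =
    if (j : ℕ) = 0 then ((k : ℕ) : ZMod 2) else if (k : ℕ) + 1 = j then 1 else 0 := by
  have h2 : (2 : ZMod 2) = 0 := by decide
  unfold root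
  split_ifs with h0 h1 h2
  · have : (n : ℤ) = ((k : ℕ) : ℤ) + 2 := by omega
    rw [this]; simp [h2]
  · push_cast
    rw [h2, add_zero, ZModModule.neg_eq_self]
  · simp
  · simp

theorem parity_eq {n : ℕ} (α β : WeightLattice n) (f g : ℕ → ZMod 2)
    (hf : ∀ k, (α k : ZMod 2) = f k) (hg : ∀ k, (β k : ZMod 2) = g k) :
    parity α β = ∑ l ∈ Finset.range (n - 2), f (l + 1) * g l := by
  rcases Nat.lt_or_ge n 2 with hn | hn
  · have : n - 1 = 0 := by omega
    have h2 : n - 2 = 0 := by omega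
    rw [h2, Finset.sum_range_zero, parity]
    exact Finset.sum_eq_zero fun k _ => absurd k.2 (by omega)
  obtain ⟨N, rfl⟩ : ∃ N, n = N + 2 := ⟨n - 2, by omega⟩
  simp only [parity, hf, hg]
  change ∑ k : Fin (N + 1), ∑ l : Fin (N + 1), _ = _
  rw [Fin.sum_univ_succ, Finset.sum_eq_zero, zero_add, Nat.add_sub_cancel, Finset.sum_range]
  · refine Finset.sum_congr rfl fun k _ => ?_
    rw [Finset.sum_eq_single k.castSucc]
    · simp
    · intro l _ hl
      rw [if_neg]
      intro h
      exact hl (Fin.ext (by simpa using h))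
    · simp
  · intro l _
    simp

theorem zmod_two_mul_succ (a : ZMod 2) : (a + 1) * a = 0 := by decide +revert

theorem parity_root_zero {n : ℕ} (i j : Fin (n - 1)) (hi : (i : ℕ) = 0) (hj : (j : ℕ) ≠ 0) :
    parity (root n i) (root n j) + parity (root n j) (root n i) =
      if (j : ℕ) = 1 then 1 else 0 := by
  have h2 : (2 : ZMod 2) = 0 := by decide
  have hfi : ∀ k : Fin (n - 1), (root n i k : ZMod 2) = ((k : ℕ) : ZMod 2) := fun k => by
    rw [intCast_root, if_pos hi]
  have hfj : ∀ k : Fin (n - 1), (root n j k : ZMod 2) = if (k : ℕ) + 1 = j then 1 else 0 := fun k => by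
    rw [intCast_root, if_neg hj]
  have hjn := j.2
  rw [parity_eq _ _ (fun k => (k : ZMod 2)) (fun k => if k + 1 = j then 1 else 0) hfi hfj,
    parity_eq _ _ (fun k => if k + 1 = j then 1 else 0) (fun k => (k : ZMod 2)) hfj hfi]
  rw [Finset.sum_eq_single (j - 1 : ℕ)]
  · by_cases h1 : (j : ℕ) = 1
    · rw [Finset.sum_eq_zero]
      · simp [h1]
      · intro l _; simp [h1]
    · rw [Finset.sum_eq_single (j - 2 : ℕ)]
      · obtain ⟨m, hm⟩ : ∃ m, (j : ℕ) = m + 2 := ⟨j - 2, by omega⟩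
        simp [hm]
        linear_combination (m + 1 : ZMod 2) * h2
      · intro l _ hl
        rw [if_neg (by omega), zero_mul]
      · intro h; exact absurd (Finset.mem_range.2 (by omega)) h
  · intro l _ hl
    rw [if_neg (by omega), mul_zero]
  · intro h; exact absurd (Finset.mem_range.2 (by omega)) h

theorem parity_root_pos {n : ℕ} (i j : Fin (n - 1)) (hi : (i : ℕ) ≠ 0) (hj : (j : ℕ) ≠ 0) :
    parity (root n i) (root n j) = if (j : ℕ) + 1 = i then 1 else 0 := by
  have hin := i.2
  have hjn := j.2
  rw [parity_eq _ _ (fun k => if k + 1 = i then 1 else 0) (fun k => if k + 1 = j then 1 else 0)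
    (fun k => by rw [intCast_root, if_neg hi]) (fun k => by rw [intCast_root, if_neg hj])]
  rw [Finset.sum_eq_single (j - 1 : ℕ)]
  · rw [if_pos (show (j : ℕ) - 1 + 1 = j by omega), mul_one]
    simp only [show (j : ℕ) - 1 + 1 = j by omega]
  · intro l _ hl
    rw [if_neg (show ¬ l + 1 = (j : ℕ) by omega), mul_zero]
  · intro h; exact absurd (Finset.mem_range.2 (by omega)) h

/-- For α_1 this holds because the coordinates modulo 2 are k, and l(l + 1) is even. It implies that
e^{α_i} and e^{-α_i} are inverse to each other without a sign. -/
theorem parity_root_self {n : ℕ} (i : Fin (n - 1)) : parity (root n i) (root n i) = 0 := by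
  by_cases hi : (i : ℕ) = 0
  · have hfi : ∀ k : Fin (n - 1), (root n i k : ZMod 2) = ((k : ℕ) : ZMod 2) := fun k => by
      rw [intCast_root, if_pos hi]
    rw [parity_eq _ _ (fun k => (k : ZMod 2)) (fun k => (k : ZMod 2)) hfi hfi]
    refine Finset.sum_eq_zero fun l _ => ?_
    push_cast
    exact zmod_two_mul_succ _
  · rw [parity_root_pos i i hi hi, if_neg (by omega)]

/-- The commutator of the cocycle is the Cartan form modulo 2. The case of α_1, which is not a basis
vector, is treated separately through its coordinates modulo 2. -/
theorem parity_root {n : ℕ} (i j : Fin (n - 1)) :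
    parity (root n i) (root n j) + parity (root n j) (root n i) =
      (CartanMatrix.A (n - 1) i j : ZMod 2) := by
  have h2 : (2 : ZMod 2) = 0 := by decide
  have h1 : (((-1 : ℤ)) : ZMod 2) = 1 := by decide
  by_cases hij : i = j
  · subst hij
    rw [parity_root_self, cartan_self]
    simp [h2]
  have hij' : (i : ℕ) ≠ j := fun h => hij (Fin.ext h)
  have hA : ((CartanMatrix.A (n - 1) i j : ℤ) : ZMod 2) =
      if (i : ℕ) + 1 = j ∨ (j : ℕ) + 1 = i then 1 else 0 := by
    simp only [CartanMatrix.A, Matrix.of_apply, if_neg hij]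
    split_ifs <;> simp [h1]
  rw [hA]
  by_cases hi : (i : ℕ) = 0
  · rw [parity_root_zero i j hi (by omega)]
    refine if_congr ?_ rfl rfl
    omega
  · by_cases hj : (j : ℕ) = 0
    · rw [add_comm, parity_root_zero j i hj hi]
      refine if_congr ?_ rfl rfl
      omega
    · rw [parity_root_pos i j hi hj, parity_root_pos j i hj hi]
      split_ifs <;> first | omega | simp

/-- The signs in the product of two operators `e^{±α_i}`, `e^{±α_j}`. -/
theorem sign_swap {n : ℕ} (σ τ : ℤˣ) (i j : Fin (n - 1)) (β : WeightLattice n) :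
    sign n ((σ : ℤ) • root n i) ((τ : ℤ) • root n j + β) * sign n ((τ : ℤ) • root n j) β =
      (-1) ^ CartanMatrix.A (n - 1) i j *
        (sign n ((τ : ℤ) • root n j) ((σ : ℤ) • root n i + β) * sign n ((σ : ℤ) • root n i) β) := by
  have h2 : ∀ a : ZMod 2, a + a = 0 := by decide
  simp only [sign, ← zpow_add]
  refine neg_one_zpow_congr ?_
  simp only [Int.cast_add, sign_exponent, parity_add_right, parity_unit_left, parity_unit_right,
    ← parity_root]
  linear_combination -h2 (parity (root n j) (root n i))

theorem sign_cancel {n : ℕ} (σ : ℤˣ) (i : Fin (n - 1)) (β : WeightLattice n) :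
    sign n ((σ : ℤ) • root n i) (((-σ : ℤˣ) : ℤ) • root n i + β) *
      sign n (((-σ : ℤˣ) : ℤ) • root n i) β = 1 := by
  have h2 : ∀ a : ZMod 2, a + a = 0 := by decide
  rw [← zpow_zero (-1 : ℤˣ)]
  simp only [sign, ← zpow_add]
  refine neg_one_zpow_congr ?_
  simp only [Int.cast_add, sign_exponent, parity_add_right, parity_unit_left, parity_unit_right,
    parity_root_self, zero_add, Int.cast_zero, h2]

end LatticeLemmas

section Shift

variable {n i : ℕ}

theorem Coset.shift_comm (σ τ : ℤˣ) (j l : Fin (n - 1)) (β : Coset n i) :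
    (β.shift σ j).shift τ l = (β.shift τ l).shift σ j :=
  Subtype.ext (add_left_comm _ _ _)

theorem Coset.shift_neg (σ : ℤˣ) (j : Fin (n - 1)) (β : Coset n i) :
    (β.shift (-σ) j).shift σ j = β :=
  Subtype.ext (by simp [Coset.shift])

theorem pairing_shift (σ : ℤˣ) (j l : Fin (n - 1)) (β : Coset n i) :
    pairing n j (β.shift σ l).1 = σ * CartanMatrix.A (n - 1) j l + pairing n j β.1 := by
  rw [Coset.shift, pairing_add, pairing_zsmul, pairing_root]

end Shift

end

end EllipticAlgebra


set_option linter.unusedSectionVars false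

namespace EllipticAlgebra

noncomputable section

/-! ### The relations between the currents `φ`, `ψ`, `x^±` -/

section Exchange

variable {K : Type*} [Field K] [CharZero K] {n : ℕ} {i : ℕ} (s : Kˣ)

theorem hasAdicSum_fock {ι : Type*} (T : ι → Module.End K⟦X⟧ (Fock K n i))
    (T' : Module.End K⟦X⟧ (Fock K n i))
    (h : ∀ β f, HasAdicSum K (fun t => T t (Finsupp.single β f)) (T' (Finsupp.single β f)))
    (u : Fock K n i) : HasAdicSum K (fun t => T t u) (T' u) := by
  induction u using Finsupp.induction_linear with
  | zero => simpa using hasAdicSum_zero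
  | add u v hu hv => simpa using hu.add hv
  | single β f => exact h β f

namespace Vtx

/-- The normally ordered products of fixed total degree. -/
def nord (V V' : Vtx K n) (E : ℤ) (f : FockPoly K n) (γ : ℤ) : FockPoly K n :=
  no2 s V V' γ (E - γ) f

theorem nord_finite (V V' : Vtx K n) (E : ℤ) (f : FockPoly K n) :
    ∃ S : Finset ℤ, ∀ t ∉ S, nord s V V' E f t = 0 := by
  obtain ⟨D, hD⟩ := exists_mem f
  refine ⟨Finset.Icc (-D) (E + D), fun t ht => no2_eq_zero s V V' (hD D le_rfl) ?_⟩
  rw [Finset.mem_Icc] at ht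
  omega

theorem mode_mode_eq_conv (V V' : Vtx K n) (E : ℤ) (f : FockPoly K n) (γ : ℤ) :
    V.mode s γ (V'.mode s (E - γ) f) = conv (-1) (expS (V.contr s V')) (nord s V V' E f) γ := by
  rw [mode_mode, conv]
  refine finsum_congr fun k => ?_
  rw [nord, C]
  congr 2 <;> simp
  ring

theorem mode_mode_eq_conv' (V V' : Vtx K n) (E : ℤ) (f : FockPoly K n) (γ : ℤ) :
    V'.mode s (E - γ) (V.mode s γ f) = conv 1 (expS (V'.contr s V)) (nord s V V' E f) γ := by
  rw [mode_mode, conv]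
  refine finsum_congr fun k => ?_
  rw [nord, C, no2_symm]
  congr 2 <;> simp
  ring

/-- Both products are contractions times the same finitely supported distribution. If g times the
contraction of one order equals c times that of the other, the relation follows by multiplying
expansions in K((z))[[p^{1/2}]]. -/
theorem hasAdicSum_exchange {V V' : Vtx K n} {U : (K⟦X⟧)⟦X⟧} {c : K} {g : (LaurentSeries K)⟦X⟧}
    (hU : expS (V.contr s V') = PowerSeries.rescale (pp K) U)
    (hg : g * sw (expS (V'.contr s V)) = PowerSeries.C (HahnSeries.C c : LaurentSeries K) *
      sub (HahnSeries.single (-1 : ℤ) (1 : K)) U) (E e : ℤ) (f : FockPoly K n) :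
    HasAdicSum K (fun r => laurentCoeff g r • V'.mode s (E - (e - r)) (V.mode s (e - r) f))
      ((PowerSeries.C c : K⟦X⟧) • V.mode s e (V'.mode s (E - e) f)) := by
  obtain ⟨S, hS⟩ := nord_finite s V V' E f
  refine hasAdicSum_star hg (S := S) (η := nord s V V' E f)
    (F := fun γ => V'.mode s (E - γ) (V.mode s γ f))
    (F' := fun γ => (PowerSeries.C c : K⟦X⟧) • V.mode s γ (V'.mode s (E - γ) f))
    (fun γ => ?_) (fun γ => ?_) e
  · rw [mode_mode_eq_conv']
    refine (conv_int 1 _ hS γ).trans (Finset.sum_congr rfl fun t _ => ?_)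
    rw [laurentCoeff_sw, Units.val_one, one_mul]
  · rw [mode_mode_eq_conv, hU]
    refine (congrArg _ (conv_int (-1) _ hS γ)).trans ?_
    rw [Finset.smul_sum]
    refine Finset.sum_congr rfl fun t _ => ?_
    rw [smul_smul]
    congr 1
    rw [← laurentCoeff_sub]
    ext N
    simp [laurentCoeff, HahnSeries.C_apply]

/-- The reverse direction, needed for ψ: there the order with x on the left has the contraction in
positive powers of p. -/
theorem hasAdicSum_exchange' {V V' : Vtx K n} {U : (K⟦X⟧)⟦X⟧} {c : K} {g : (LaurentSeries K)⟦X⟧}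
    (hU : expS (V.contr s V') = PowerSeries.rescale (pp K) U)
    (hg : g * (PowerSeries.C (HahnSeries.C c : LaurentSeries K) *
      sub (HahnSeries.single (-1 : ℤ) (1 : K)) U) = sw (expS (V'.contr s V)))
    (E e : ℤ) (f : FockPoly K n) :
    HasAdicSum K (fun r => laurentCoeff g r •
      ((PowerSeries.C c : K⟦X⟧) • V.mode s (e - r) (V'.mode s (E - (e - r)) f)))
      (V'.mode s (E - e) (V.mode s e f)) := by
  obtain ⟨S, hS⟩ := nord_finite s V V' E f
  refine hasAdicSum_star hg (S := S) (η := nord s V V' E f)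
    (F' := fun γ => V'.mode s (E - γ) (V.mode s γ f))
    (F := fun γ => (PowerSeries.C c : K⟦X⟧) • V.mode s γ (V'.mode s (E - γ) f))
    (fun γ => ?_) (fun γ => ?_) e
  · rw [mode_mode_eq_conv, hU]
    refine (congrArg _ (conv_int (-1) _ hS γ)).trans ?_
    rw [Finset.smul_sum]
    refine Finset.sum_congr rfl fun t _ => ?_
    rw [smul_smul]
    congr 1
    rw [← laurentCoeff_sub]
    ext N
    simp [laurentCoeff, HahnSeries.C_apply]
  · rw [mode_mode_eq_conv']
    refine (conv_int 1 _ hS γ).trans (Finset.sum_congr rfl fun t _ => ?_)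
    rw [laurentCoeff_sw, Units.val_one, one_mul]

end Vtx

variable {s} (hs : ∀ k : ℕ, 0 < k → s ^ k ≠ 1)

include hs in
theorem q_zpow_sub_ne_zero {k : ℕ} (hk : 0 < k) :
    ((q s ^ (k : ℤ) : Kˣ) : K) - ((q s ^ (-(k : ℤ)) : Kˣ) : K) ≠ 0 := by
  intro h
  have h1 : q s ^ (k : ℤ) = q s ^ (-(k : ℤ)) := Units.ext (sub_eq_zero.1 h)
  refine hs (4 * k) (by omega) ?_
  have h2 : q s ^ (2 * (k : ℤ)) = 1 := by
    rw [two_mul, zpow_add]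
    nth_rw 2 [h1]
    rw [← zpow_add, add_neg_cancel, zpow_zero]
  rw [q, ← zpow_natCast s 2, ← zpow_mul] at h2
  rw [← h2, ← zpow_natCast]
  congr 1
  push_cast
  ring

include hs in
theorem q_sub_ne_zero : (q s : K) - ((q s)⁻¹ : Kˣ) ≠ 0 := by
  simpa using q_zpow_sub_ne_zero hs one_pos

include hs in
theorem qInt_ne_zero (k : ℕ+) : qInt s ((k : ℕ) : ℤ) ≠ 0 :=
  div_ne_zero (q_zpow_sub_ne_zero hs k.pos) (q_sub_ne_zero hs)

include hs in
theorem qInt_mul (k : ℤ) : ((q s : K) - ((q s)⁻¹ : Kˣ)) * qInt s k =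
    ((q s ^ k : Kˣ) : K) - ((q s ^ (-k) : Kˣ) : K) := by
  rw [qInt, mul_div_cancel₀ _ (q_sub_ne_zero hs)]

include hs in
-- The factor q - q^{-1} in φ and ψ turns [ak] into q^{ak} - q^{-ak}, so that the exponents become
-- those of a quotient of two infinite products.
theorem heisCoeff_eq_ell (i j : Fin (n - 1)) (κ : Kˣ) (k : ℕ+) :
    PowerSeries.C (((q s : K) - ((q s)⁻¹ : Kˣ)) / qInt s (k : ℤ)) *
      PowerSeries.C ((κ ^ (k : ℤ) : Kˣ) : K) * heisCoeff s i j k =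
    ell ((q s ^ (-CartanMatrix.A (n - 1) i j) * κ : Kˣ) : K) k -
      ell ((q s ^ CartanMatrix.A (n - 1) i j * κ : Kˣ) : K) k := by
  have h0 := qInt_ne_zero hs k
  have hk : ((k : ℕ) : K) ≠ 0 := by exact_mod_cast k.ne_zero
  have h1 := qInt_mul hs (CartanMatrix.A (n - 1) i j * (k : ℤ))
  rw [heisCoeff, ell, ell, ← mul_assoc, ← map_mul, ← map_mul]
  have h2 : (((q s : K) - ((q s)⁻¹ : Kˣ)) / qInt s (k : ℤ)) * ((κ ^ (k : ℤ) : Kˣ) : K) *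
      (qInt s (CartanMatrix.A (n - 1) i j * (k : ℤ)) * qInt s (k : ℤ) / ((k : ℕ) : K)) =
      ((q s ^ CartanMatrix.A (n - 1) i j * κ : Kˣ) : K) ^ (k : ℕ) / ((k : ℕ) : K) -
      ((q s ^ (-CartanMatrix.A (n - 1) i j) * κ : Kˣ) : K) ^ (k : ℕ) / ((k : ℕ) : K) := by
    generalize CartanMatrix.A (n - 1) i j = a at *
    rw [← Units.val_pow_eq_pow_val, ← Units.val_pow_eq_pow_val, mul_pow, mul_pow,
      ← zpow_natCast (q s ^ a), ← zpow_natCast (q s ^ (-a)), ← zpow_mul, ← zpow_mul, neg_mul,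
      Units.val_mul, Units.val_mul, zpow_natCast κ]
    field_simp
    linear_combination h1
  rw [h2, map_sub]
  ring

theorem s_zpow_mul (σ : ℤˣ) (k : ℕ+) :
    PowerSeries.C ((s ^ ((σ : ℤ) * ((k : ℕ) : ℤ)) : Kˣ) : K) =
      PowerSeries.C (((s ^ (σ : ℤ)) ^ ((k : ℕ) : ℤ) : Kˣ) : K) := by rw [zpow_mul]

include hs in
-- The annihilation part of φ consists of the b's weighted by p^{k/2}, and x carries another p^{k/2}
-- at the b's. Hence p^k appears, a rescaling by p. In the opposite order only the a's are
-- contracted and p does not appear outside `pochQuot`; for ψ the two roles are exchanged.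
theorem contr_phi_x (σ : ℤˣ) (i j : Fin (n - 1)) :
    expS ((phiV s i).contr s (xV s σ j)) = PowerSeries.rescale (pp K)
      (pochQuot s (CartanMatrix.A (n - 1) i j) (s ^ (σ : ℤ)) σ) := by
  rw [pochQuot, ← expS_pow_mul]
  congr 1
  funext k
  rw [← heisCoeff_eq_ell hs i j _ k, Vtx.contr, ← s_zpow_mul, pp_pow, div_eq_mul_inv, map_mul,
    zsmul_eq_mul]
  simp only [phiV, xV, div_eq_mul_inv, map_mul, map_intCast]
  ring

include hs in
theorem contr_x_phi (σ : ℤˣ) (i j : Fin (n - 1)) :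
    expS ((xV s σ j).contr s (phiV s i)) =
      pochQuot s (CartanMatrix.A (n - 1) i j) (s ^ (-(σ : ℤ))) σ := by
  rw [pochQuot]
  congr 1
  funext k
  rw [cartan_symm i j, ← heisCoeff_eq_ell hs j i _ k, Vtx.contr, ← zpow_mul, div_eq_mul_inv, map_mul,
    zsmul_eq_mul]
  simp only [phiV, xV, div_eq_mul_inv, map_mul, map_intCast]
  ring

include hs in
theorem contr_psi_x (σ : ℤˣ) (i j : Fin (n - 1)) :
    expS ((psiV s i).contr s (xV s σ j)) =
      pochQuot s (CartanMatrix.A (n - 1) i j) (s ^ (-(σ : ℤ))) σ := by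
  rw [pochQuot]
  congr 1
  funext k
  rw [← heisCoeff_eq_ell hs i j _ k, Vtx.contr, ← zpow_mul, div_eq_mul_inv, map_mul,
    zsmul_eq_mul]
  simp only [psiV, xV, div_eq_mul_inv, map_mul, map_intCast]
  ring

include hs in
theorem contr_x_psi (σ : ℤˣ) (i j : Fin (n - 1)) :
    expS ((xV s σ j).contr s (psiV s i)) = PowerSeries.rescale (pp K)
      (pochQuot s (CartanMatrix.A (n - 1) i j) (s ^ (σ : ℤ)) σ) := by
  rw [pochQuot, ← expS_pow_mul]
  congr 1
  funext k
  rw [cartan_symm i j, ← heisCoeff_eq_ell hs j i _ k, Vtx.contr, ← s_zpow_mul, pp_pow, div_eq_mul_inv,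
    map_mul, zsmul_eq_mul]
  simp only [psiV, xV, div_eq_mul_inv, map_mul, map_intCast]
  ring

include hs in
theorem C_qInt_sub (k : ℕ+) :
    (PowerSeries.C ((q s : K) - ((q s)⁻¹ : Kˣ)) : K⟦X⟧) =
      PowerSeries.C (((q s : K) - ((q s)⁻¹ : Kˣ)) / qInt s (k : ℤ)) * PowerSeries.C (qInt s (k : ℤ)) := by
  rw [← map_mul, div_mul_cancel₀ _ (qInt_ne_zero hs k)]

include hs in
theorem C_sub_mul_C_sub (k : ℕ+) :
    (PowerSeries.C ((q s : K) - ((q s)⁻¹ : Kˣ)) : K⟦X⟧) * PowerSeries.C ((q s : K) - ((q s)⁻¹ : Kˣ)) =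
      PowerSeries.C (((q s : K) - ((q s)⁻¹ : Kˣ)) / qInt s (k : ℤ)) *
        (PowerSeries.C ((q s ^ (k : ℤ) : Kˣ) : K) - PowerSeries.C (((q s)⁻¹ ^ (k : ℤ) : Kˣ) : K)) := by
  nth_rw 2 [C_qInt_sub hs k]
  rw [mul_left_comm, ← map_mul _ _ (qInt s (k : ℤ)), qInt_mul hs, map_sub, inv_zpow', mul_comm]

include hs in
theorem contr_phi_psi (i j : Fin (n - 1)) :
    expS ((phiV s i).contr s (psiV s j)) = PowerSeries.rescale (pp K)
      (pochQuot s (CartanMatrix.A (n - 1) i j) (q s) 1 *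
        pochQuot s (CartanMatrix.A (n - 1) i j) (q s)⁻¹ (-1)) := by
  rw [pochQuot, pochQuot, ← expS_add, ← expS_pow_mul]
  congr 1
  funext k
  rw [Pi.add_apply, ← heisCoeff_eq_ell hs i j _ k, ← heisCoeff_eq_ell hs i j _ k, Vtx.contr, pp_pow]
  simp only [phiV, psiV, Units.val_one, one_smul, Units.val_neg, neg_smul]
  linear_combination (PowerSeries.X ^ (2 * (k : ℕ)) * heisCoeff s i j k) * C_sub_mul_C_sub hs k

include hs in
theorem contr_psi_phi (i j : Fin (n - 1)) :
    expS ((psiV s j).contr s (phiV s i)) =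
      pochQuot s (CartanMatrix.A (n - 1) i j) (q s)⁻¹ 1 *
        pochQuot s (CartanMatrix.A (n - 1) i j) (q s) (-1) := by
  rw [pochQuot, pochQuot, ← expS_add]
  congr 1
  funext k
  rw [Pi.add_apply, cartan_symm i j, ← heisCoeff_eq_ell hs j i _ k, ← heisCoeff_eq_ell hs j i _ k,
    Vtx.contr]
  simp only [phiV, psiV, Units.val_one, one_smul, Units.val_neg, neg_smul]
  linear_combination (- heisCoeff s j i k) * C_sub_mul_C_sub hs k

include hs in
theorem fock_phi_psi (a b : Fin (n - 1)) (m l : ℤ) (u : Fock K n i) : HasAdicSum K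
    (fun r : ℤ => laurentCoeff (gLaurent s (CartanMatrix.A (n - 1) a b) (q s ^ (-1 : ℤ)) *
        (gLaurent s (CartanMatrix.A (n - 1) a b) (q s ^ (1 : ℤ)))⁻¹) r •
      (fockCurrents s n i).psi b (l - r) ((fockCurrents s n i).phi a (m + r) u))
    ((fockCurrents s n i).phi a m ((fockCurrents s n i).psi b l u)) := by
  have hg : gLaurent s (CartanMatrix.A (n - 1) a b) (q s ^ (-1 : ℤ)) *
        (gLaurent s (CartanMatrix.A (n - 1) a b) (q s ^ (1 : ℤ)))⁻¹ *
        sw (expS ((psiV s b).contr s (phiV s a))) =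
      PowerSeries.C (HahnSeries.C (1 : K) : LaurentSeries K) *
      sub (HahnSeries.single (-1 : ℤ) (1 : K)) (pochQuot s (CartanMatrix.A (n - 1) a b) (q s) 1 *
        pochQuot s (CartanMatrix.A (n - 1) a b) (q s)⁻¹ (-1)) := by
    have h1 := gLaurentPow_mul_sw s (CartanMatrix.A (n - 1) a b) (q s)⁻¹ 1
    have h2 := gLaurentPow_mul_sw s (CartanMatrix.A (n - 1) a b) (q s) (-1)
    have hc : (PowerSeries.C (HahnSeries.C ((q s ^ (-((1 : ℤˣ) : ℤ) *
        CartanMatrix.A (n - 1) a b) : Kˣ) : K) : LaurentSeries K) : (LaurentSeries K)⟦X⟧) *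
        PowerSeries.C (HahnSeries.C ((q s ^ (-((-1 : ℤˣ) : ℤ) *
        CartanMatrix.A (n - 1) a b) : Kˣ) : K) : LaurentSeries K) = 1 := by
      rw [← map_mul PowerSeries.C, ← map_mul HahnSeries.C, ← Units.val_mul, ← zpow_add]; simp
    rw [contr_psi_phi hs, map_mul, sub_mul, zpow_neg_one, zpow_one, map_one HahnSeries.C,
      map_one PowerSeries.C, one_mul]
    rw [inv_inv] at h1
    have e1 : gLaurentPow s (CartanMatrix.A (n - 1) a b) (q s)⁻¹ 1 =
      gLaurent s (CartanMatrix.A (n - 1) a b) (q s)⁻¹ := if_pos rfl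
    have e2 : gLaurentPow s (CartanMatrix.A (n - 1) a b) (q s) (-1) =
      (gLaurent s (CartanMatrix.A (n - 1) a b) (q s))⁻¹ := if_neg (by decide)
    rw [← e1, ← e2, mul_mul_mul_comm, h1, h2, mul_mul_mul_comm, hc, one_mul]
  generalize gLaurent s (CartanMatrix.A (n - 1) a b) (q s ^ (-1 : ℤ)) *
        (gLaurent s (CartanMatrix.A (n - 1) a b) (q s ^ (1 : ℤ)))⁻¹ = g at *
  refine hasAdicSum_fock (fun r : ℤ => laurentCoeff g r •
      ((fockCurrents s n i).psi b (l - r) * (fockCurrents s n i).phi a (m + r)))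
    ((fockCurrents s n i).phi a m * (fockCurrents s n i).psi b l) (fun β f => ?_) u
  have h := Vtx.hasAdicSum_exchange s (c := 1) (contr_phi_psi hs a b) hg (-m + -l) (-m) f
  have h' := h.map ((PowerSeries.C ((q s ^ (-pairing n a β.1) : Kˣ) : K) *
      PowerSeries.C ((q s ^ (pairing n b β.1) : Kˣ) : K) : K⟦X⟧) • Finsupp.lsingle β)
  convert h' using 2 with r
  · rw [LinearMap.smul_apply, Module.End.mul_apply, phi_single, map_smul, psi_single, map_smul,
      LinearMap.smul_apply, Finsupp.lsingle_apply, smul_smul,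
      show -m + -l - (-m - r) = -(l - r) by ring, show -m - r = -(m + r) by ring]
    simp only [smul_smul]
    congr 1
    ring
  · rw [Module.End.mul_apply, psi_single, map_smul, phi_single,
      LinearMap.smul_apply, Finsupp.lsingle_apply, smul_smul, map_one, one_smul, mul_comm,
      add_sub_cancel_left]

theorem C_q_zpow_add (x y : ℤ) : (PowerSeries.C ((q s ^ (x + y) : Kˣ) : K) : K⟦X⟧) =
    PowerSeries.C ((q s ^ x : Kˣ) : K) * PowerSeries.C ((q s ^ y : Kˣ) : K) := by
  rw [zpow_add, Units.val_mul, map_mul]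

/-- The exponent of `z` in `x_j^σ(l)` on `f ⊗ e^β`. -/
def xExp {n i : ℕ} (σ : ℤˣ) (j : Fin (n - 1)) (l : ℤ) (β : Coset n i) : ℤ :=
  -(l + ((σ : ℤ) * pairing n j β.1 + 1))

/-- The sign in `x_j^σ(l)` on `f ⊗ e^β`. -/
def xSign {n i : ℕ} (K : Type*) [Field K] (σ : ℤˣ) (j : Fin (n - 1)) (β : Coset n i) : K⟦X⟧ :=
  (((sign n ((σ : ℤ) • root n j) β.1 : ℤˣ) : ℤ) : K⟦X⟧)

theorem x_single' (s : Kˣ) (σ : ℤˣ) (j : Fin (n - 1)) (l : ℤ) (β : Coset n i) (f : FockPoly K n) :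
    (fockCurrents s n i).x σ j l (Finsupp.single β f) =
      xSign K σ j β • Finsupp.single (β.shift σ j) ((xV s σ j).mode s (xExp σ j l β) f) :=
  x_single s σ j l β f

include hs in
theorem fock_phi_x (σ : ℤˣ) (a b : Fin (n - 1)) (m l : ℤ) (u : Fock K n i) : HasAdicSum K
    (fun r : ℤ => laurentCoeff
        (gLaurentPow s (CartanMatrix.A (n - 1) a b) (s ^ (-(σ : ℤ) * 1)) σ) r •
      (fockCurrents s n i).x σ b (l - r) ((fockCurrents s n i).phi a (m + r) u))
    ((fockCurrents s n i).phi a m ((fockCurrents s n i).x σ b l u)) := by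
  have hg := gLaurentPow_mul_sw s (CartanMatrix.A (n - 1) a b) (s ^ (-(σ : ℤ))) σ
  rw [← contr_x_phi hs, zpow_neg, inv_inv, ← zpow_neg] at hg
  rw [mul_one]
  generalize gLaurentPow s (CartanMatrix.A (n - 1) a b) (s ^ (-(σ : ℤ))) σ = g at *
  refine hasAdicSum_fock (fun r : ℤ => laurentCoeff g r •
      ((fockCurrents s n i).x σ b (l - r) * (fockCurrents s n i).phi a (m + r)))
    ((fockCurrents s n i).phi a m * (fockCurrents s n i).x σ b l) (fun β f => ?_) u
  have h := Vtx.hasAdicSum_exchange s (contr_phi_x hs σ a b) hg (-m + xExp σ b l β) (-m) f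
  have h' := h.map ((xSign K σ b β * PowerSeries.C ((q s ^ (-pairing n a β.1) : Kˣ) : K) : K⟦X⟧) •
    Finsupp.lsingle (β.shift σ b))
  convert h' using 2 with r
  · rw [LinearMap.smul_apply, Module.End.mul_apply, phi_single, map_smul, x_single', map_smul,
      LinearMap.smul_apply, Finsupp.lsingle_apply,
      show -m + xExp σ b l β - (-m - r) = xExp σ b (l - r) β by simp only [xExp]; ring,
      show -m - r = -(m + r) by ring]
    simp only [smul_smul]
    congr 1
    ring
  · rw [Module.End.mul_apply, x_single', map_smul, phi_single, map_smul, smul_smul,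
      LinearMap.smul_apply, Finsupp.lsingle_apply, smul_smul, pairing_shift, add_sub_cancel_left,
      neg_add, C_q_zpow_add, ← neg_mul]
    congr 1
    ring

include hs in
theorem fock_psi_x (σ : ℤˣ) (a b : Fin (n - 1)) (m l : ℤ) (u : Fock K n i) : HasAdicSum K
    (fun r : ℤ => laurentCoeff
        (gLaurentPow s (CartanMatrix.A (n - 1) a b) (s ^ (-(σ : ℤ) * 1)) (-σ)) r •
      (fockCurrents s n i).x σ b (l + r) ((fockCurrents s n i).psi a (m - r) u))
    ((fockCurrents s n i).psi a m ((fockCurrents s n i).x σ b l u)) := by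
  have hg := gLaurentPow_mul_sw s (CartanMatrix.A (n - 1) a b) (s ^ (-(σ : ℤ))) σ
  have hg' := gLaurentPow_mul s (CartanMatrix.A (n - 1) a b) (s ^ (-(σ : ℤ))) σ
  rw [zpow_neg, inv_inv, ← zpow_neg] at hg
  rw [mul_one]
  have hg2 := congrArg (gLaurentPow s (CartanMatrix.A (n - 1) a b) (s ^ (-(σ : ℤ))) (-σ) * ·) hg
  beta_reduce at hg2
  rw [← mul_assoc, mul_comm (gLaurentPow _ _ _ (-σ)) (gLaurentPow _ _ _ σ), hg', one_mul,
    ← contr_psi_x hs] at hg2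
  clear hg hg'
  generalize gLaurentPow s (CartanMatrix.A (n - 1) a b) (s ^ (-(σ : ℤ))) (-σ) = g at *
  refine hasAdicSum_fock (fun r : ℤ => laurentCoeff g r •
      ((fockCurrents s n i).x σ b (l + r) * (fockCurrents s n i).psi a (m - r)))
    ((fockCurrents s n i).psi a m * (fockCurrents s n i).x σ b l) (fun β f => ?_) u
  have h := Vtx.hasAdicSum_exchange' s (contr_x_psi hs σ a b) hg2.symm (-m + xExp σ b l β)
    (xExp σ b l β) f
  have h' := h.map ((xSign K σ b β * PowerSeries.C ((q s ^ ((σ : ℤ) *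
    CartanMatrix.A (n - 1) a b + pairing n a β.1) : Kˣ) : K) : K⟦X⟧) •
    Finsupp.lsingle (β.shift σ b))
  convert h' using 2 with r
  · rw [LinearMap.smul_apply, Module.End.mul_apply, psi_single, map_smul, x_single', map_smul,
      map_smul, LinearMap.smul_apply, Finsupp.lsingle_apply,
      show -m + xExp σ b l β - (xExp σ b l β - r) = -(m - r) by ring,
      show xExp σ b l β - r = xExp σ b (l + r) β by simp only [xExp]; ring]
    -- The constant q^{-σa} in the expansion of g compensates the change of (α_i, β) when β is moved
    -- by σ α_j.
    have hp := C_q_zpow_add (s := s) (-(σ : ℤ) * CartanMatrix.A (n - 1) a b)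
      ((σ : ℤ) * CartanMatrix.A (n - 1) a b + pairing n a β.1)
    rw [neg_mul, neg_add_cancel_left] at hp
    simp only [smul_smul, neg_mul, hp]
    congr 1
    ring
  · rw [Module.End.mul_apply, x_single', map_smul, psi_single, smul_smul,
      LinearMap.smul_apply, Finsupp.lsingle_apply, pairing_shift, add_sub_cancel_right]

end Exchange

end

end EllipticAlgebra


set_option linter.unusedSectionVars false

namespace EllipticAlgebra

noncomputable section

/-! ### The relation between `x^+` and `x^-` -/

section PlusMinus

variable {K : Type*} [Field K] [CharZero K] {n : ℕ} {i : ℕ} {s : Kˣ}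

theorem Vtx.mode_rescale (s c : Kˣ) {V W : Vtx K n} (hj : W.j = V.j)
    (hp : ∀ k : ℕ+, W.p k = PowerSeries.C ((c : Kˣ) : K) ^ (k : ℕ) * V.p k)
    (hr : ∀ k : ℕ+, W.r k = PowerSeries.C ((c : Kˣ) : K) ^ (k : ℕ) * V.r k)
    (hp' : ∀ k : ℕ+, W.p' k = PowerSeries.C ((c⁻¹ : Kˣ) : K) ^ (k : ℕ) * V.p' k)
    (hr' : ∀ k : ℕ+, W.r' k = PowerSeries.C ((c⁻¹ : Kˣ) : K) ^ (k : ℕ) * V.r' k)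
    (e : ℤ) (f : FockPoly K n) :
    W.mode s e f = (PowerSeries.C ((c ^ e : Kˣ) : K) : K⟦X⟧) • V.mode s e f := by
  have hcre : W.cre = fun k : ℕ+ => PowerSeries.C ((c : Kˣ) : K) ^ (k : ℕ) • V.cre k := by
    funext k
    rw [Vtx.cre, Vtx.cre, hp, hr, hj, mul_smul, mul_smul, smul_add]
  have hann : W.ann s = fun k : ℕ+ => PowerSeries.C ((c⁻¹ : Kˣ) : K) ^ (k : ℕ) • V.ann s k := by
    funext k
    rw [Vtx.ann, Vtx.ann, hp', hr', hj, mul_smul, mul_smul, smul_add]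
  have hA : ∀ m, W.A s m = PowerSeries.C ((c⁻¹ : Kˣ) : K) ^ m • V.A s m := fun m => by
    rw [Vtx.A, hann, expCoeff_pow_smul (V.ann_comm s V)]; rfl
  obtain ⟨N, hN⟩ := V.A_locallyFinite s f
  rw [Vtx.mode_apply s V e hN, Vtx.mode_apply s W e (N := N) fun m hm => by
    rw [hA, LinearMap.smul_apply, hN m hm, smul_zero], Finset.smul_sum]
  refine Finset.sum_congr rfl fun m _ => ?_
  rw [hA, LinearMap.smul_apply, map_smul, Vtx.B, Vtx.B, zext, zext]
  split_ifs with h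
  · obtain ⟨k, hk⟩ := Int.eq_ofNat_of_zero_le h
    rw [hcre, expCoeff_pow_smul (V.cre_comm V), LinearMap.smul_apply, smul_smul, hk,
      Int.toNat_natCast, ← map_pow, ← map_pow, ← map_mul, ← Units.val_pow_eq_pow_val,
      ← Units.val_pow_eq_pow_val, ← Units.val_mul]
    congr 4
    rw [inv_pow, ← zpow_natCast, ← zpow_natCast, ← zpow_neg, ← zpow_add]
    congr 1
    have : (m : ℤ) + e = k := hk
    omega
  · simp

/-- The coefficients of `1 / ((1 - q x) (1 - q^{-1} x))`. -/
theorem mk_qInt_mul (hs : ∀ k : ℕ, 0 < k → s ^ k ≠ 1) :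
    PowerSeries.mk (fun k : ℕ => PowerSeries.C (qInt s ((k : ℤ) + 1))) *
      ((1 - PowerSeries.C (PowerSeries.C ((q s : Kˣ) : K)) * PowerSeries.X) *
      (1 - PowerSeries.C (PowerSeries.C (((q s)⁻¹ : Kˣ) : K)) * PowerSeries.X)) =
    (1 : (K⟦X⟧)⟦X⟧) := by
  have h1 : PowerSeries.mk (fun k : ℕ => (PowerSeries.C (qInt s ((k : ℤ) + 1)) : K⟦X⟧)) *
      (1 - PowerSeries.C (PowerSeries.C ((q s : Kˣ) : K)) * PowerSeries.X) =
      PowerSeries.mk fun k : ℕ => PowerSeries.C ((q s ^ (-(k : ℤ)) : Kˣ) : K) := by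
    ext1 k
    rw [mul_sub, mul_one, map_sub, mul_left_comm, PowerSeries.coeff_C_mul, PowerSeries.coeff_mk,
      PowerSeries.coeff_mk]
    rcases k with _ | k
    · rw [PowerSeries.coeff_zero_mul_X, mul_zero, sub_zero]
      congr 1
      have := div_self (q_sub_ne_zero hs)
      simpa [qInt] using this
    · rw [PowerSeries.coeff_succ_mul_X, PowerSeries.coeff_mk, ← map_mul, ← map_sub]
      congr 1
      have h0 := q_sub_ne_zero hs
      rw [qInt, qInt]
      field_simp
      push_cast [zpow_add, zpow_neg, Units.val_mul, zpow_one, Units.val_inv_eq_inv_val, neg_add]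
      have := (q s).ne_zero
      field_simp
      ring
  have h2 : PowerSeries.mk (fun k : ℕ => (PowerSeries.C ((q s ^ (-(k : ℤ)) : Kˣ) : K) : K⟦X⟧)) *
      (1 - PowerSeries.C (PowerSeries.C (((q s)⁻¹ : Kˣ) : K)) * PowerSeries.X) = 1 := by
    ext1 k
    rw [mul_sub, mul_one, map_sub, mul_left_comm, PowerSeries.coeff_C_mul, PowerSeries.coeff_mk]
    rcases k with _ | k
    · rw [PowerSeries.coeff_zero_mul_X, mul_zero, sub_zero]
      simp
    · rw [PowerSeries.coeff_succ_mul_X, PowerSeries.coeff_mk, ← map_mul, ← map_sub,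
        PowerSeries.coeff_one, if_neg (by omega), ← Units.val_mul, ← zpow_neg_one, ← zpow_add,
        show -1 + -(k : ℤ) = -((k + 1 : ℕ) : ℤ) by push_cast; ring, sub_self, map_zero]
  rw [← mul_assoc, h1, h2]

variable (hs : ∀ k : ℕ, 0 < k → s ^ k ≠ 1)

include hs in
-- For opposite signs the powers of q^{1/2} cancel. The a-part contributes 1 and the b-part -p^k, so
-- together they cancel the denominator 1 - p^k.
theorem contr_opposite (σ : ℤˣ) (a b : Fin (n - 1)) (k : ℕ+) :
    (xV s σ a).contr s (xV s (-σ) b) k = PowerSeries.C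
      (qInt s (CartanMatrix.A (n - 1) a b * (k : ℤ)) / (qInt s (k : ℤ) * ((k : ℕ) : K))) := by
  have h0 := qInt_ne_zero hs k
  have hk : ((k : ℕ) : K) ≠ 0 := by exact_mod_cast k.ne_zero
  have hσ : (((σ : ℤ) : K)) * (((σ : ℤ) : K)) = 1 := by
    rcases Int.units_eq_one_or σ with rfl | rfl <;> simp
  have hz : (PowerSeries.C ((s ^ (-(σ : ℤ) * (k : ℤ)) : Kˣ) : K) : K⟦X⟧) *
      PowerSeries.C ((s ^ ((σ : ℤ) * (k : ℤ)) : Kˣ) : K) = 1 := by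
    rw [← map_mul, ← Units.val_mul, ← zpow_add]; simp
  have h1 : (PowerSeries.C (((σ : ℤ) : K) / qInt s (k : ℤ)) : K⟦X⟧) *
      PowerSeries.C (((σ : ℤ) : K) / qInt s (k : ℤ)) * PowerSeries.C
        (qInt s (CartanMatrix.A (n - 1) a b * (k : ℤ)) * qInt s (k : ℤ) / ((k : ℕ) : K)) =
      PowerSeries.C
        (qInt s (CartanMatrix.A (n - 1) a b * (k : ℤ)) / (qInt s (k : ℤ) * ((k : ℕ) : K))) := by
    rw [← map_mul, ← map_mul]
    congr 1
    field_simp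
    linear_combination (qInt s (CartanMatrix.A (n - 1) a b * (k : ℤ))) * hσ
  rw [Vtx.contr, ← h1, heisCoeff]
  have h2 := one_sub_mul_inv (K := K) k
  simp only [xV, Units.val_neg, Int.cast_neg, neg_neg, neg_div, map_neg]
  generalize PowerSeries.C ((s ^ (-(σ : ℤ) * (k : ℤ)) : Kˣ) : K) = z at *
  generalize PowerSeries.C ((s ^ ((σ : ℤ) * (k : ℤ)) : Kˣ) : K) = z' at *
  generalize PowerSeries.C (((σ : ℤ) : K) / qInt s (k : ℤ)) = c at *
  generalize PowerSeries.C
        (qInt s (CartanMatrix.A (n - 1) a b * (k : ℤ)) * qInt s (k : ℤ) / ((k : ℕ) : K)) = d at *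
  generalize (1 - PowerSeries.X ^ (2 * (k : ℕ)) : K⟦X⟧)⁻¹ = v at *
  linear_combination c * c * d * (1 - PowerSeries.X ^ (2 * (k : ℕ))) * v * hz + c * c * d * h2

include hs in
-- Since [2k]/[k] = q^k + q^{-k}, the contraction is 1/((1 - qx)(1 - q^{-1}x)), whose coefficients
-- are quantum integers.
theorem expS_contr_opposite_self (σ : ℤˣ) (a : Fin (n - 1)) :
    expS ((xV s σ a).contr s (xV s (-σ) a)) =
      PowerSeries.mk fun k : ℕ => PowerSeries.C (qInt s ((k : ℤ) + 1)) := by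
  have h : (xV s σ a).contr s (xV s (-σ) a) = -((fun k : ℕ+ => -PowerSeries.C
        (((q s : Kˣ) : K) ^ (k : ℕ) / ((k : ℕ) : K))) +
      fun k : ℕ+ => -PowerSeries.C ((((q s)⁻¹ : Kˣ) : K) ^ (k : ℕ) / ((k : ℕ) : K))) := by
    funext k
    have h0 := qInt_ne_zero hs k
    have hk : ((k : ℕ) : K) ≠ 0 := by exact_mod_cast k.ne_zero
    have hd := q_sub_ne_zero hs
    have h1 := qInt_mul hs ((k : ℕ) : ℤ)
    have h2 := qInt_mul hs (2 * ((k : ℕ) : ℤ))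
    rw [contr_opposite hs, cartan_self, Pi.neg_apply, Pi.add_apply, ← neg_add, neg_neg, ← map_add]
    congr 1
    rw [← Units.val_pow_eq_pow_val, ← Units.val_pow_eq_pow_val, ← zpow_natCast, ← zpow_natCast,
      inv_zpow', ← add_div]
    have h3 : (((q s ^ ((k : ℕ) : ℤ) : Kˣ) : K) + ((q s ^ (-((k : ℕ) : ℤ)) : Kˣ) : K)) *
        qInt s ((k : ℕ) : ℤ) = qInt s (2 * ((k : ℕ) : ℤ)) := by
      refine mul_left_cancel₀ hd ?_
      rw [mul_left_comm, h1, h2, two_mul, neg_add, zpow_add, zpow_add, Units.val_mul, Units.val_mul]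
      ring
    rw [← h3]
    field_simp
  rw [h]
  set c := ((fun k : ℕ+ => -PowerSeries.C (((q s : Kˣ) : K) ^ (k : ℕ) / ((k : ℕ) : K))) +
      fun k : ℕ+ => -PowerSeries.C ((((q s)⁻¹ : Kˣ) : K) ^ (k : ℕ) / ((k : ℕ) : K)))
  have h1 := expS_mul_neg c
  have h2 : expS c = _ := expS_add _ _
  rw [expS_log, expS_log] at h2
  have h3 := mk_qInt_mul hs
  rw [← h2] at h3
  rw [← mul_one (expS (-c)), ← h3, mul_left_comm, mul_comm (expS (-c)), h1, mul_one]

include hs in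
theorem expS_contr_opposite_neg_one (σ : ℤˣ) (a b : Fin (n - 1))
    (hab : CartanMatrix.A (n - 1) a b = -1) :
    expS ((xV s σ a).contr s (xV s (-σ) b)) = 1 - PowerSeries.X := by
  have h := expS_log (1 : K)
  rw [map_one, map_one, one_mul] at h
  rw [← h]
  congr 1
  funext k
  have h0 := qInt_ne_zero hs k
  rw [contr_opposite hs, hab, ← map_neg, neg_one_mul, one_pow]
  congr 1
  have : qInt s (-((k : ℕ) : ℤ)) = -qInt s ((k : ℕ) : ℤ) := by
    rw [qInt, qInt, neg_neg]; ring
  rw [this]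
  field_simp

include hs in
theorem expS_contr_opposite_zero (σ : ℤˣ) (a b : Fin (n - 1))
    (hab : CartanMatrix.A (n - 1) a b = 0) :
    expS ((xV s σ a).contr s (xV s (-σ) b)) = 1 := by
  rw [← expS_zero]
  congr 1
  funext k
  rw [contr_opposite hs, hab, zero_mul]
  simp [qInt]

theorem xV_plus (a : Fin (n - 1)) (k : ℕ+) :
    (xV s 1 a).p k = PowerSeries.C (1 / qInt s (k : ℤ)) * PowerSeries.C ((s⁻¹ : Kˣ) : K) ^ (k : ℕ) ∧
    (xV s 1 a).r k = -(PowerSeries.C (1 / qInt s (k : ℤ)) *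
      (PowerSeries.C (s : K) ^ (k : ℕ) * PowerSeries.X ^ (k : ℕ))) ∧
    (xV s 1 a).p' k = -(PowerSeries.C (1 / qInt s (k : ℤ)) * PowerSeries.C ((s⁻¹ : Kˣ) : K) ^ (k : ℕ)) ∧
    (xV s 1 a).r' k = PowerSeries.C (1 / qInt s (k : ℤ)) *
      (PowerSeries.C (s : K) ^ (k : ℕ) * PowerSeries.X ^ (k : ℕ)) := by
  simp [xV]
  left
  rw [← map_pow, inv_pow]

theorem xV_minus (a : Fin (n - 1)) (k : ℕ+) :
    (xV s (-1) a).p k = -(PowerSeries.C (1 / qInt s (k : ℤ)) * PowerSeries.C (s : K) ^ (k : ℕ)) ∧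
    (xV s (-1) a).r k = PowerSeries.C (1 / qInt s (k : ℤ)) *
      (PowerSeries.C ((s⁻¹ : Kˣ) : K) ^ (k : ℕ) * PowerSeries.X ^ (k : ℕ)) ∧
    (xV s (-1) a).p' k = PowerSeries.C (1 / qInt s (k : ℤ)) * PowerSeries.C (s : K) ^ (k : ℕ) ∧
    (xV s (-1) a).r' k = -(PowerSeries.C (1 / qInt s (k : ℤ)) *
      (PowerSeries.C ((s⁻¹ : Kˣ) : K) ^ (k : ℕ) * PowerSeries.X ^ (k : ℕ))) := by
  simp [xV, neg_div]
  left
  rw [← map_pow, inv_pow]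

include hs in
theorem C_q_sub (k : ℕ+) : (PowerSeries.C ((q s : K) - ((q s)⁻¹ : Kˣ)) : K⟦X⟧) =
    PowerSeries.C (1 / qInt s (k : ℤ)) * ((PowerSeries.C (s : K) ^ (k : ℕ)) ^ 2 -
      (PowerSeries.C ((s⁻¹ : Kˣ) : K) ^ (k : ℕ)) ^ 2) := by
  have h0 := qInt_ne_zero hs k
  have h1 := qInt_mul hs ((k : ℕ) : ℤ)
  simp only [← map_pow, ← map_sub, ← map_mul]
  congr 1
  rw [eq_comm, one_div, inv_mul_eq_iff_eq_mul₀ h0, mul_comm, h1, ← Units.val_pow_eq_pow_val,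
    ← Units.val_pow_eq_pow_val, ← Units.val_pow_eq_pow_val, ← Units.val_pow_eq_pow_val, q]
  congr 2
  · rw [zpow_natCast, ← pow_mul, ← pow_mul, mul_comm]
  · rw [zpow_neg, zpow_natCast, ← pow_mul, ← pow_mul, mul_comm, inv_pow]

theorem C_pow_mul_C_inv_pow (k : ℕ) : (PowerSeries.C (s : K) : K⟦X⟧) ^ k *
    PowerSeries.C ((s⁻¹ : Kˣ) : K) ^ k = 1 := by
  rw [← mul_pow, ← map_mul, ← Units.val_mul, mul_inv_cancel]; simp

theorem C_q_pow (k : ℕ) : (PowerSeries.C (q s : K) : K⟦X⟧) ^ k = (PowerSeries.C (s : K) ^ k) ^ 2 := by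
  rw [q, Units.val_pow_eq_pow_val, map_pow, pow_right_comm]

theorem C_q_inv_pow (k : ℕ) : (PowerSeries.C (((q s)⁻¹ : Kˣ) : K) : K⟦X⟧) ^ k =
    (PowerSeries.C ((s⁻¹ : Kˣ) : K) ^ k) ^ 2 := by
  rw [q, ← inv_pow, Units.val_pow_eq_pow_val, map_pow, pow_right_comm]

include hs in
-- At z = qw the creation operators a_{-k} and the annihilation operators b_k cancel. The remaining
-- exponents are those of ψ at the argument w q^{1/2}; at z = q^{-1}w the other halves cancel and φ
-- remains.
theorem fuse_plus_minus (a : Fin (n - 1)) (E : ℤ) (f : FockPoly K n) :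
    (Vtx.fuse (q s) (xV s 1 a) (xV s (-1) a)).mode s E f =
      (PowerSeries.C ((s ^ E : Kˣ) : K) : K⟦X⟧) • (psiV s a).mode s E f := by
  refine Vtx.mode_rescale s s (V := psiV s a) (W := Vtx.fuse (q s) (xV s 1 a) (xV s (-1) a)) rfl (fun k => ?_) (fun k => ?_) (fun k => ?_) (fun k => ?_) E f
  all_goals
    obtain ⟨h1, h2, h3, h4⟩ := xV_plus (s := s) a k
    obtain ⟨h5, h6, h7, h8⟩ := xV_minus (s := s) a k
    have h9 := C_q_sub hs k
    have h10 := C_pow_mul_C_inv_pow (s := s) k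
    simp only [Vtx.fuse, psiV, h1, h2, h3, h4, h5, h6, h7, h8, h9, C_q_pow, C_q_inv_pow]
    generalize PowerSeries.C (s : K) ^ (k : ℕ) = z at *
    generalize PowerSeries.C ((s⁻¹ : Kˣ) : K) ^ (k : ℕ) = z' at *
    generalize PowerSeries.C (1 / qInt s (k : ℤ)) = c at *
  · linear_combination c * z * h10
  · linear_combination -c * PowerSeries.X ^ (k : ℕ) * z' * h10
  · linear_combination -c * z * h10
  · linear_combination c * PowerSeries.X ^ (k : ℕ) * z' * h10

include hs in
theorem fuse_plus_minus' (a : Fin (n - 1)) (E : ℤ) (f : FockPoly K n) :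
    (Vtx.fuse (q s)⁻¹ (xV s 1 a) (xV s (-1) a)).mode s E f =
      (PowerSeries.C ((s⁻¹ ^ E : Kˣ) : K) : K⟦X⟧) • (phiV s a).mode s E f := by
  refine Vtx.mode_rescale s s⁻¹ (V := phiV s a) (W := Vtx.fuse (q s)⁻¹ (xV s 1 a) (xV s (-1) a)) rfl (fun k => ?_) (fun k => ?_) (fun k => ?_) (fun k => ?_) E f
  all_goals
    obtain ⟨h1, h2, h3, h4⟩ := xV_plus (s := s) a k
    obtain ⟨h5, h6, h7, h8⟩ := xV_minus (s := s) a k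
    have h9 := C_q_sub hs k
    have h10 := C_pow_mul_C_inv_pow (s := s) k
    simp only [Vtx.fuse, phiV, inv_inv, h1, h2, h3, h4, h5, h6, h7, h8, h9, C_q_pow, C_q_inv_pow]
    generalize PowerSeries.C (s : K) ^ (k : ℕ) = z at *
    generalize PowerSeries.C ((s⁻¹ : Kˣ) : K) ^ (k : ℕ) = z' at *
    generalize PowerSeries.C (1 / qInt s (k : ℤ)) = c at *
  · linear_combination c * z * h10
  · linear_combination (-c) * PowerSeries.X ^ (k : ℕ) * z' * h10
  · linear_combination -c * z * h10
  · linear_combination c * PowerSeries.X ^ (k : ℕ) * z' * h10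

theorem Vtx.fuse_mode_eq_sum (s : Kˣ) {V V' : Vtx K n} (hj : V.j = V'.j) {S : Finset ℤ} {E : ℤ}
    {f : FockPoly K n} (hS : ∀ t ∉ S, Vtx.nord s V V' E f t = 0) (κ : Kˣ) :
    (Vtx.fuse κ V V').mode s E f =
      ∑ t ∈ S, (PowerSeries.C ((κ ^ t : Kˣ) : K) : K⟦X⟧) • Vtx.nord s V V' E f t := by
  rw [Vtx.fuse_mode s hj, finsum_eq_sum_of_support_subset]
  · exact Finset.sum_congr rfl fun t _ => by rw [Vtx.nord]
  · intro t ht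
    by_contra h
    have h0 := hS t h
    rw [Vtx.nord] at h0
    exact ht (by simp only [h0, smul_zero])

theorem qInt_neg (k : ℤ) : qInt s (-k) = -qInt s k := by
  rw [qInt, qInt, neg_neg]; ring

include hs in
-- The difference of the two expansions has coefficient [t - b - 1] for every integer t, because [0]
-- = 0 and [-k] = -[k]. Written as a combination of q^t and q^{-t}, it is a sum of two delta
-- functions.
theorem commutator_coeff (b t : ℤ) :
    zext (fun k => PowerSeries.coeff k (PowerSeries.mk fun k : ℕ =>
        (PowerSeries.C (qInt s ((k : ℤ) + 1)) : K⟦X⟧))) (-1 * (b + 2 - t)) +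
      (PowerSeries.C ((q s : K) - ((q s)⁻¹ : Kˣ))⁻¹ : K⟦X⟧) *
        (PowerSeries.C ((q s ^ (b + 1) : Kˣ) : K) * PowerSeries.C (((q s)⁻¹ ^ t : Kˣ) : K)) =
    zext (fun k => PowerSeries.coeff k (PowerSeries.mk fun k : ℕ =>
        (PowerSeries.C (qInt s ((k : ℤ) + 1)) : K⟦X⟧))) (1 * (b - t)) +
      (PowerSeries.C ((q s : K) - ((q s)⁻¹ : Kˣ))⁻¹ : K⟦X⟧) *
        (PowerSeries.C ((q s ^ (-(b + 1)) : Kˣ) : K) * PowerSeries.C ((q s ^ t : Kˣ) : K)) := by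
  have h2 : zext (fun k => PowerSeries.coeff k (PowerSeries.mk fun k : ℕ =>
        (PowerSeries.C (qInt s ((k : ℤ) + 1)) : K⟦X⟧))) (-1 * (b + 2 - t)) -
      zext (fun k => PowerSeries.coeff k (PowerSeries.mk fun k : ℕ =>
        (PowerSeries.C (qInt s ((k : ℤ) + 1)) : K⟦X⟧))) (1 * (b - t)) =
      PowerSeries.C (qInt s (t - (b + 1))) := by
    simp only [PowerSeries.coeff_mk, zext]
    split_ifs with h1 h2 h2
    · omega
    · rw [sub_zero, Int.toNat_of_nonneg h1]; congr 2; ring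
    · rw [zero_sub, Int.toNat_of_nonneg h2, ← map_neg, ← qInt_neg]; congr 2; ring
    · rw [show t - (b + 1) = 0 by omega]; simp [qInt]
  have h3 : (PowerSeries.C (qInt s (t - (b + 1))) : K⟦X⟧) =
      PowerSeries.C ((q s : K) - ((q s)⁻¹ : Kˣ))⁻¹ *
        (PowerSeries.C ((q s ^ (-(b + 1)) : Kˣ) : K) * PowerSeries.C ((q s ^ t : Kˣ) : K)) -
      PowerSeries.C ((q s : K) - ((q s)⁻¹ : Kˣ))⁻¹ *
        (PowerSeries.C ((q s ^ (b + 1) : Kˣ) : K) * PowerSeries.C (((q s)⁻¹ ^ t : Kˣ) : K)) := by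
    rw [← mul_sub, ← map_mul, ← map_mul, ← map_sub, ← map_mul]
    congr 1
    rw [qInt, div_eq_inv_mul, ← Units.val_mul, ← Units.val_mul, inv_zpow', ← zpow_add, ← zpow_add]
    congr 4 <;> ring
  linear_combination h2 + h3

theorem sum_smul_add_smul {R M ι : Type*} [CommRing R] [AddCommMonoid M] [Module R M]
    {S : Finset ι} {η : ι → M} {x x' w w' : ι → R} {c d d' : R}
    (h : ∀ t, x t + c * (d * w t) = x' t + c * (d' * w' t)) :
    ∑ t ∈ S, x t • η t + c • d • ∑ t ∈ S, w t • η t =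
      ∑ t ∈ S, x' t • η t + c • d' • ∑ t ∈ S, w' t • η t := by
  simp only [Finset.smul_sum, smul_smul, ← Finset.sum_add_distrib, ← add_smul, h]

include hs in
/-- The commutator of `x^+` and `x^-` in terms of `ψ` and `φ`. -/
theorem commutator_self (a : Fin (n - 1)) (b E : ℤ) (f : FockPoly K n) :
    (xV s 1 a).mode s (b + 2) ((xV s (-1) a).mode s (E - (b + 2)) f) +
      (PowerSeries.C ((q s : K) - ((q s)⁻¹ : Kˣ))⁻¹ : K⟦X⟧) •
        (PowerSeries.C ((q s ^ (b + 1) : Kˣ) : K) : K⟦X⟧) •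
          (PowerSeries.C ((s⁻¹ ^ E : Kˣ) : K) : K⟦X⟧) • (phiV s a).mode s E f =
    (xV s (-1) a).mode s (E - b) ((xV s 1 a).mode s b f) +
      (PowerSeries.C ((q s : K) - ((q s)⁻¹ : Kˣ))⁻¹ : K⟦X⟧) •
        (PowerSeries.C ((q s ^ (-(b + 1)) : Kˣ) : K) : K⟦X⟧) •
          (PowerSeries.C ((s ^ E : Kˣ) : K) : K⟦X⟧) • (psiV s a).mode s E f := by
  have hc := expS_contr_opposite_self hs 1 a
  have hc' := expS_contr_opposite_self hs (-1) a
  rw [neg_neg] at hc'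
  rw [Vtx.mode_mode_eq_conv, Vtx.mode_mode_eq_conv', hc, hc', ← fuse_plus_minus hs,
    ← fuse_plus_minus' hs]
  have hj : (xV s 1 a).j = (xV s (-1) a).j := rfl
  generalize xV s 1 a = V at *
  generalize xV s (-1) a = V' at *
  obtain ⟨S, hS⟩ := Vtx.nord_finite s V V' E f
  have hfuse := Vtx.fuse_mode_eq_sum s hj hS
  have e1 := conv_int (-1) (PowerSeries.mk fun k : ℕ => (PowerSeries.C (qInt s ((k : ℤ) + 1)) : K⟦X⟧))
    hS (b + 2)
  have e2 := conv_int 1 (PowerSeries.mk fun k : ℕ => (PowerSeries.C (qInt s ((k : ℤ) + 1)) : K⟦X⟧))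
    hS b
  rw [Units.val_neg, Units.val_one] at e1
  rw [Units.val_one] at e2
  rw [e1, e2, hfuse, hfuse]
  exact sum_smul_add_smul fun t => commutator_coeff hs b t

include hs in
-- The contractions 1 - w/z and 1 - z/w differ by the unit -w/z. This accounts for the shift by one
-- and for the sign, which the lattice part will cancel.
theorem commutator_neg_one {a b : Fin (n - 1)} (hab : CartanMatrix.A (n - 1) a b = -1) (σ : ℤˣ)
    (e E : ℤ) (f : FockPoly K n) :
    (xV s σ a).mode s (e - 1) ((xV s (-σ) b).mode s (E - (e - 1)) f) =
      -(xV s (-σ) b).mode s (E - e) ((xV s σ a).mode s e f) := by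
  obtain ⟨S, hS⟩ := Vtx.nord_finite s (xV s σ a) (xV s (-σ) b) E f
  have hc := expS_contr_opposite_neg_one hs σ a b hab
  have hc' := expS_contr_opposite_neg_one hs (-σ) b a (by rw [cartan_symm, hab])
  rw [neg_neg] at hc'
  have hconv : ∀ δ γ : ℤ, conv δ (1 - PowerSeries.X : (K⟦X⟧)⟦X⟧)
      (Vtx.nord s (xV s σ a) (xV s (-σ) b) E f) γ =
      Vtx.nord s (xV s σ a) (xV s (-σ) b) E f γ -
        Vtx.nord s (xV s σ a) (xV s (-σ) b) E f (γ - δ) := by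
    intro δ γ
    rw [conv, finsum_eq_sum_of_support_subset (s := Finset.range 2)]
    · simp [Finset.sum_range_succ, PowerSeries.coeff_one, sub_eq_add_neg]
    · intro k hk
      by_contra hk'
      have hk2 : ¬ k < 2 := by simpa using hk'
      refine hk ?_
      change PowerSeries.coeff k _ • _ = _
      rw [map_sub, PowerSeries.coeff_one, if_neg (by omega),
        PowerSeries.coeff_X, if_neg (by omega)]
      simp
  rw [Vtx.mode_mode_eq_conv, Vtx.mode_mode_eq_conv', hc, hc', hconv, hconv, sub_neg_eq_add,
    sub_add_cancel, neg_sub]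

include hs in
theorem commutator_zero {a b : Fin (n - 1)} (hab : CartanMatrix.A (n - 1) a b = 0) (σ : ℤˣ)
    (e E : ℤ) (f : FockPoly K n) :
    (xV s σ a).mode s e ((xV s (-σ) b).mode s (E - e) f) =
      (xV s (-σ) b).mode s (E - e) ((xV s σ a).mode s e f) := by
  have hc := expS_contr_opposite_zero hs σ a b hab
  have hc' := expS_contr_opposite_zero hs (-σ) b a (by rw [cartan_symm, hab])
  rw [neg_neg] at hc'
  rw [Vtx.mode_mode_eq_conv, Vtx.mode_mode_eq_conv', hc, hc', conv_one, conv_one]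

theorem x_x_single (σ τ : ℤˣ) (a b : Fin (n - 1)) (m l : ℤ) (β : Coset n i) (f : FockPoly K n) :
    (fockCurrents s n i).x σ a m ((fockCurrents s n i).x τ b l (Finsupp.single β f)) =
      (xSign K σ a (β.shift τ b) * xSign K τ b β) • Finsupp.single ((β.shift τ b).shift σ a)
        ((xV s σ a).mode s (xExp σ a m β - σ * τ * CartanMatrix.A (n - 1) a b)
          ((xV s τ b).mode s (xExp τ b l β) f)) := by
  rw [x_single', map_smul, x_single', smul_smul, mul_comm]
  congr 4
  rw [xExp, xExp, pairing_shift]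
  ring

theorem xSign_swap (σ τ : ℤˣ) (a b : Fin (n - 1)) (β : Coset n i) :
    xSign K σ a (β.shift τ b) * xSign K τ b β =
      ((((-1 : ℤˣ) ^ CartanMatrix.A (n - 1) a b : ℤˣ) : ℤ) : K⟦X⟧) *
        (xSign K τ b (β.shift σ a) * xSign K σ a β) := by
  have := congrArg (fun u : ℤˣ => ((u : ℤ) : K⟦X⟧)) (sign_swap σ τ a b β.1)
  simp only [Units.val_mul, Int.cast_mul] at this
  exact this

theorem xSign_cancel (σ : ℤˣ) (a : Fin (n - 1)) (β : Coset n i) :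
    xSign K σ a (β.shift (-σ) a) * xSign K (-σ) a β = 1 := by
  have := congrArg (fun u : ℤˣ => ((u : ℤ) : K⟦X⟧)) (sign_cancel σ a β.1)
  simp only [Units.val_mul, Int.cast_mul, Units.val_one, Int.cast_one] at this
  exact this

theorem cartan_cases {N : ℕ} {a b : Fin N} (h : a ≠ b) :
    CartanMatrix.A N a b = -1 ∨ CartanMatrix.A N a b = 0 := by
  simp only [CartanMatrix.A, Matrix.of_apply, if_neg h]
  split_ifs <;> simp

theorem commutator_add {R M : Type*} [CommRing R] [AddCommMonoid M] [Module R M]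
    (A B U V : M →ₗ[R] M) (c d e : R) {u v : M}
    (hu : A (B u) + c • d • U u = B (A u) + c • e • V u)
    (hv : A (B v) + c • d • U v = B (A v) + c • e • V v) :
    A (B (u + v)) + c • d • U (u + v) = B (A (u + v)) + c • e • V (u + v) := by
  simp only [map_add, smul_add]
  rw [add_add_add_comm, hu, hv, ← add_add_add_comm]

theorem commutator_single {R M ι : Type*} [CommRing R] [AddCommMonoid M] [Module R M]
    {A B U V : M} {c d e d' e' : R} (h : A + c • d • d' • U = B + c • e • e' • V) (β : ι) :
    Finsupp.single β A + c • (d * d') • Finsupp.single β U =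
      Finsupp.single β B + c • (e * e') • Finsupp.single β V := by
  simp only [Finsupp.smul_single, mul_smul, ← Finsupp.single_add, h]

include hs in
theorem fock_plus_minus_self (a : Fin (n - 1)) (m l : ℤ) (u : Fock K n i) :
    (fockCurrents s n i).x 1 a m ((fockCurrents s n i).x (-1) a l u) +
      (PowerSeries.C ((q s : K) - ((q s)⁻¹ : Kˣ))⁻¹ : K⟦X⟧) •
        (PowerSeries.C ((s ^ (1 * (l - m)) : Kˣ) : K) : K⟦X⟧) •
          (fockCurrents s n i).phi a (m + l) u =
      (fockCurrents s n i).x (-1) a l ((fockCurrents s n i).x 1 a m u) +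
      (PowerSeries.C ((q s : K) - ((q s)⁻¹ : Kˣ))⁻¹ : K⟦X⟧) •
        (PowerSeries.C ((s ^ (1 * (m - l)) : Kˣ) : K) : K⟦X⟧) •
          (fockCurrents s n i).psi a (m + l) u := by
  induction u using Finsupp.induction_linear with
  | zero => simp only [map_zero, smul_zero, add_zero]
  | add u v hu hv => exact commutator_add _ _ _ _ _ _ _ hu hv
  | single β f =>
    rw [x_x_single, x_x_single, Coset.shift_comm 1 (-1) a a, Units.val_one, Units.val_neg,
      Units.val_one]
    have h1 := xSign_cancel (K := K) 1 a β
    have h2 := xSign_cancel (K := K) (-1) a β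
    have h3 := commutator_self hs a (xExp 1 a m β) (-(m + l)) f
    have e1 : xExp 1 a m β + xExp (-1) a l β + 2 = -(m + l) := by
      simp only [xExp, Units.val_one, Units.val_neg]; ring
    rw [neg_neg] at h2
    rw [h1, h2, Coset.shift_neg, one_smul, one_smul, cartan_self]
    have e2 : xExp 1 a m β - 1 * -1 * 2 = xExp 1 a m β + 2 := by ring
    have e3 : xExp (-1) a l β - -1 * 1 * 2 = -(m + l) - xExp 1 a m β := by omega
    have e4 : xExp (-1) a l β = -(m + l) - (xExp 1 a m β + 2) := by omega
    -- The powers of q collected from the delta function and from the argument w q^{1/2} are matched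
    -- with the mode factor in the relation and with the zero mode q^{∂}; `e6` does the same for φ.
    have e5 : q s ^ (-(xExp 1 a m β + 1)) * s ^ (-(m + l)) =
        s ^ (1 * (m - l)) * q s ^ pairing n a β.1 := by
      rw [q, ← zpow_natCast s 2, ← zpow_mul, ← zpow_mul, ← zpow_add, ← zpow_add]
      congr 1
      simp only [xExp, Units.val_one]; push_cast; ring
    have e6 : q s ^ (xExp 1 a m β + 1) * s⁻¹ ^ (-(m + l)) =
        s ^ (1 * (l - m)) * q s ^ (-pairing n a β.1) := by
      rw [q, ← zpow_natCast s 2, ← zpow_mul, ← zpow_mul, inv_zpow', ← zpow_add, ← zpow_add]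
      congr 1
      simp only [xExp, Units.val_one]; push_cast; ring
    have e7 := congrArg (fun u : Kˣ => (PowerSeries.C (u : K) : K⟦X⟧)) e5
    have e8 := congrArg (fun u : Kˣ => (PowerSeries.C (u : K) : K⟦X⟧)) e6
    simp only [Units.val_mul, map_mul] at e7 e8
    rw [e2, e3, e4, psi_single, phi_single, smul_smul (PowerSeries.C ((s ^ (1 * (m - l)) : Kˣ) : K) : K⟦X⟧),
      smul_smul (PowerSeries.C ((s ^ (1 * (l - m)) : Kˣ) : K) : K⟦X⟧), ← e7, ← e8]
    exact commutator_single h3 β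

theorem neg_smul_single_neg {R M ι : Type*} [CommRing R] [AddCommGroup M] [Module R M] (c : R)
    (β : ι) (A : M) : (-c) • Finsupp.single β (-A) = c • Finsupp.single β A := by
  rw [Finsupp.single_neg, neg_smul_neg]

include hs in
theorem fock_plus_minus_of_ne {a b : Fin (n - 1)} (hab : a ≠ b) (m l : ℤ) (u : Fock K n i) :
    (fockCurrents s n i).x 1 a m ((fockCurrents s n i).x (-1) b l u) =
      (fockCurrents s n i).x (-1) b l ((fockCurrents s n i).x 1 a m u) := by
  induction u using Finsupp.induction_linear with
  | zero => simp
  | add u v hu hv => simp only [map_add, hu, hv]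
  | single β f =>
    rw [x_x_single, x_x_single, Coset.shift_comm 1 (-1) a b, Units.val_one, Units.val_neg,
      Units.val_one, xSign_swap, cartan_symm b a]
    rcases cartan_cases hab with h | h
    · have h1 := commutator_neg_one hs h 1 (xExp 1 a m β) (xExp 1 a m β + xExp (-1) b l β - 1) f
      rw [h]
      have e1 : xExp 1 a m β - 1 * -1 * -1 = xExp 1 a m β - 1 := by ring
      have e2 : xExp (-1) b l β - -1 * 1 * -1 =
        xExp 1 a m β + xExp (-1) b l β - 1 - xExp 1 a m β := by ring
      have e3 : xExp 1 a m β + xExp (-1) b l β - 1 - (xExp 1 a m β - 1) = xExp (-1) b l β := by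
        ring
      rw [e3] at h1
      rw [e1, e2, h1]
      rw [zpow_neg, zpow_one, inv_neg, inv_one, Units.val_neg, Units.val_one, Int.cast_neg,
        Int.cast_one, neg_one_mul]
      exact neg_smul_single_neg _ _ _
    · have h1 := commutator_zero hs h 1 (xExp 1 a m β) (xExp 1 a m β + xExp (-1) b l β) f
      rw [add_sub_cancel_left] at h1
      rw [h, mul_zero, mul_zero, sub_zero, sub_zero, h1]
      simp

end PlusMinus

end

end EllipticAlgebra


set_option linter.unusedSectionVars false

namespace EllipticAlgebra

noncomputable section

/-! ### Contractions of the currents `x^±` of equal sign -/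

section SameSign

variable {K : Type*} [Field K] [CharZero K] {n : ℕ} {i : ℕ} {s : Kˣ}

/-- The part of the contraction of `x_i`, `x_i` in positive powers of `p`. -/
def selfTail (Q : Kˣ) : (K⟦X⟧)⟦X⟧ :=
  expS (ell ((Q ^ (-2 : ℤ) : Kˣ) : K) - ell ((Q ^ (2 : ℤ) : Kˣ) : K))

/-- The part of the contraction of `x_i`, `x_j`, `a_ij = -1`, in positive powers of `p`. -/
def linkTail (Q : Kˣ) : (K⟦X⟧)⟦X⟧ := expS (ell ((Q : Kˣ) : K) - ell ((Q⁻¹ : Kˣ) : K))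

theorem selfTail_mul (Q : Kˣ) : selfTail Q * poch ((Q ^ (2 : ℤ) : Kˣ) : K) =
    poch ((Q ^ (-2 : ℤ) : Kˣ) : K) := expS_sub_mul _ _

theorem linkTail_mul (Q : Kˣ) : linkTail Q * poch ((Q⁻¹ : Kˣ) : K) = poch (Q : K) :=
  expS_sub_mul _ _

/-- The geometric series `1 / (1 - κ x)`. -/
def geom (κ : K) : (K⟦X⟧)⟦X⟧ := expS (-fun k : ℕ+ => -PowerSeries.C (κ ^ (k : ℕ) / ((k : ℕ) : K)))

theorem one_sub_mul_geom (κ : K) :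
    (1 - PowerSeries.C (PowerSeries.C κ) * PowerSeries.X) * geom κ = (1 : (K⟦X⟧)⟦X⟧) := by
  rw [← expS_log, geom, expS_mul_neg]

variable (hs : ∀ k : ℕ, 0 < k → s ^ k ≠ 1)

theorem q_zpow_zpow (σ : ℤˣ) (k : ℕ) :
    (PowerSeries.C ((s ^ ((σ : ℤ) * (k : ℤ)) : Kˣ) : K) : K⟦X⟧) ^ 2 =
      PowerSeries.C ((((q s ^ (σ : ℤ)) : Kˣ) : K) ^ k) := by
  rw [← map_pow, ← Units.val_pow_eq_pow_val, ← Units.val_pow_eq_pow_val, q]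
  congr 2
  rw [← zpow_natCast, ← zpow_natCast, ← zpow_natCast, ← zpow_mul, ← zpow_mul, ← zpow_mul]
  congr 1
  push_cast; ring

include hs in
-- For equal signs the powers of q^{1/2} add up: the a-part gives Q^{-k} and the b-part p^k Q^k,
-- with Q = q^σ. The denominator 1 - p^k remains inside `ell`.
theorem contr_same (σ : ℤˣ) (a b : Fin (n - 1)) (k : ℕ+) :
    (xV s σ a).contr s (xV s σ b) k =
      PowerSeries.C (qInt s (CartanMatrix.A (n - 1) a b * (k : ℤ)) / qInt s (k : ℤ)) *
        (ell (((q s ^ (σ : ℤ))⁻¹ : Kˣ) : K) k -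
          pp K ^ (k : ℕ) * ell ((q s ^ (σ : ℤ) : Kˣ) : K) k) := by
  have h0 := qInt_ne_zero hs k
  have hk : ((k : ℕ) : K) ≠ 0 := by exact_mod_cast k.ne_zero
  have hσ : (((σ : ℤ) : K)) * (((σ : ℤ) : K)) = 1 := by
    rcases Int.units_eq_one_or σ with rfl | rfl <;> simp
  have h1 : (PowerSeries.C (((σ : ℤ) : K) / qInt s (k : ℤ)) : K⟦X⟧) *
      PowerSeries.C (((σ : ℤ) : K) / qInt s (k : ℤ)) * PowerSeries.C
        (qInt s (CartanMatrix.A (n - 1) a b * (k : ℤ)) * qInt s (k : ℤ) / ((k : ℕ) : K)) =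
      PowerSeries.C (qInt s (CartanMatrix.A (n - 1) a b * (k : ℤ)) / qInt s (k : ℤ)) *
        PowerSeries.C (((k : ℕ) : K)⁻¹) := by
    rw [← map_mul, ← map_mul, ← map_mul]
    congr 1
    field_simp
    linear_combination (qInt s (CartanMatrix.A (n - 1) a b * (k : ℤ))) * hσ
  have h2 := q_zpow_zpow (s := s) σ k
  have h3 := q_zpow_zpow (s := s) (-σ) k
  rw [Units.val_neg, zpow_neg] at h3
  have h4 : (PowerSeries.X : K⟦X⟧) ^ (2 * (k : ℕ)) = (PowerSeries.X ^ (k : ℕ)) ^ 2 := by ring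
  rw [Vtx.contr, heisCoeff, ell, ell, div_eq_mul_inv (_ ^ _), div_eq_mul_inv (_ ^ _), map_mul,
    map_mul, pp_pow, ← h2, ← h3]
  simp only [xV]
  linear_combination (-(PowerSeries.C ((s ^ (-(σ : ℤ) * (k : ℤ)) : Kˣ) : K) : K⟦X⟧) ^ 2 +
    (PowerSeries.C ((s ^ ((σ : ℤ) * (k : ℤ)) : Kˣ) : K) : K⟦X⟧) ^ 2 *
      PowerSeries.X ^ (2 * (k : ℕ))) * (1 - PowerSeries.X ^ (2 * (k : ℕ)))⁻¹ * h1

theorem pow_add_pow_inv_pow (hs : ∀ k : ℕ, 0 < k → s ^ k ≠ 1) (σ : ℤˣ) (k : ℕ+) :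
    qInt s (2 * (k : ℤ)) / qInt s (k : ℤ) =
      ((q s ^ (σ : ℤ) : Kˣ) : K) ^ (k : ℕ) + (((q s ^ (σ : ℤ))⁻¹ : Kˣ) : K) ^ (k : ℕ) := by
  have h0 := qInt_ne_zero hs k
  have hd := q_sub_ne_zero hs
  have h1 := qInt_mul hs ((k : ℕ) : ℤ)
  have h2 := qInt_mul hs (2 * ((k : ℕ) : ℤ))
  have h3 : (((q s ^ ((k : ℕ) : ℤ) : Kˣ) : K) + ((q s ^ (-((k : ℕ) : ℤ)) : Kˣ) : K)) *
      qInt s ((k : ℕ) : ℤ) = qInt s (2 * ((k : ℕ) : ℤ)) := by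
    refine mul_left_cancel₀ hd ?_
    rw [mul_left_comm, h1, h2, two_mul, neg_add, zpow_add, zpow_add, Units.val_mul, Units.val_mul]
    ring
  rw [div_eq_iff h0, ← h3]
  congr 1
  rw [← Units.val_pow_eq_pow_val, ← Units.val_pow_eq_pow_val, ← zpow_natCast, ← zpow_natCast]
  rcases Int.units_eq_one_or σ with rfl | rfl
  · simp [zpow_neg]
  · simp [zpow_neg, add_comm]

include hs in
-- With [2k]/[k] = Q^k + Q^{-k} the exponents become those of the products (x), (Q^{-2}x) over (px),
-- (Q^2 px). The quotient of the first by the third is 1 - x, and `poch_eq` extracts 1 - Q^{-2}x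
-- from the second.
theorem expS_contr_self (σ : ℤˣ) (a : Fin (n - 1)) :
    expS ((xV s σ a).contr s (xV s σ a)) =
      (1 - PowerSeries.C (PowerSeries.C 1) * PowerSeries.X) *
      (1 - PowerSeries.C (PowerSeries.C (((q s ^ (σ : ℤ)) ^ (-2 : ℤ) : Kˣ) : K)) *
        PowerSeries.X) * PowerSeries.rescale (pp K) (selfTail (q s ^ (σ : ℤ))) := by
  rw [selfTail, ← expS_pow_mul, ← expS_log, ← expS_log, ← expS_add, ← expS_add]
  congr 1
  funext k
  rw [contr_same hs, cartan_self, pow_add_pow_inv_pow hs σ]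
  simp only [Pi.add_apply, Pi.sub_apply, ← ell_sub]
  generalize q s ^ (σ : ℤ) = Q
  have h1 : (((Q ^ (2 : ℤ) : Kˣ) : K)) ^ (k : ℕ) = ((Q : K) ^ (k : ℕ)) ^ 2 := by
    rw [zpow_ofNat, Units.val_pow_eq_pow_val, pow_right_comm]
  have h2 : (((Q ^ (-2 : ℤ) : Kˣ) : K)) ^ (k : ℕ) = (((Q⁻¹ : Kˣ) : K) ^ (k : ℕ)) ^ 2 := by
    rw [zpow_neg, ← inv_zpow, zpow_ofNat, Units.val_pow_eq_pow_val, pow_right_comm]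
  have h3 : (Q : K) ^ (k : ℕ) * ((Q⁻¹ : Kˣ) : K) ^ (k : ℕ) = 1 := by
    rw [← mul_pow, ← Units.val_mul, mul_inv_cancel, Units.val_one, one_pow]
  have h4 := congrArg (fun x : K => (PowerSeries.C x : K⟦X⟧)) h3
  rw [map_mul, map_one, map_pow, map_pow] at h4
  simp only [ell, h1, h2, one_pow, div_eq_mul_inv, map_mul, map_add, map_pow, map_one]
  generalize (PowerSeries.C (Q : K) : K⟦X⟧) ^ (k : ℕ) = z at *
  generalize (PowerSeries.C ((Q⁻¹ : Kˣ) : K) : K⟦X⟧) ^ (k : ℕ) = z' at *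
  linear_combination (PowerSeries.C (((k : ℕ) : K)⁻¹) : K⟦X⟧) *
    (1 - PowerSeries.X ^ (2 * (k : ℕ)))⁻¹ * (pp K ^ (k : ℕ) - 1) * h4

include hs in
theorem expS_contr_link (σ : ℤˣ) {a b : Fin (n - 1)} (hab : CartanMatrix.A (n - 1) a b = -1) :
    expS ((xV s σ a).contr s (xV s σ b)) =
      PowerSeries.rescale (pp K) (linkTail (q s ^ (σ : ℤ))) *
        geom (((q s ^ (σ : ℤ))⁻¹ : Kˣ) : K) := by
  rw [linkTail, ← expS_pow_mul, geom, ← expS_add]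
  congr 1
  funext k
  have h0 := qInt_ne_zero hs k
  rw [contr_same hs, hab, neg_one_mul, qInt_neg, neg_div, div_self h0]
  simp only [Pi.add_apply, Pi.sub_apply, Pi.neg_apply, ← ell_sub, map_neg, map_one]
  ring

include hs in
theorem expS_contr_zero (σ : ℤˣ) {a b : Fin (n - 1)} (hab : CartanMatrix.A (n - 1) a b = 0) :
    expS ((xV s σ a).contr s (xV s σ b)) = 1 := by
  rw [← expS_zero]
  congr 1
  funext k
  rw [contr_same hs, hab, zero_mul]
  simp [qInt]

end SameSign

/-! ### Entire functions -/

section EntireFunctions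

variable {K : Type*} [Field K] [CharZero K] {Γ : Type*} [AddCommGroup Γ]

/-- The function `κ z^δ`. -/
def mono (κ : K) (δ : Γ) : Entire K Γ := PowerSeries.C (AddMonoidAlgebra.single δ κ)

theorem mono_mul (κ κ' : K) (δ δ' : Γ) : mono κ δ * mono κ' δ' = mono (κ * κ') (δ + δ') := by
  rw [mono, mono, mono, ← map_mul, AddMonoidAlgebra.single_mul_single]

theorem mono_one : mono (1 : K) (0 : Γ) = 1 := by
  rw [mono, ← AddMonoidAlgebra.one_def, map_one]

theorem mono_mul_neg (δ : Γ) : mono (1 : K) δ * mono (1 : K) (-δ) = 1 := by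
  rw [mono_mul, one_mul, add_neg_cancel, mono_one]

theorem mono_eq (κ : K) (δ : Γ) : mono κ δ = mono κ 0 * mono 1 δ := by
  rw [mono_mul, mul_one, zero_add]

/-- The contraction factor `(1 - z^δ) (1 - Q^{-2} z^δ) U(p z^δ)` of two currents `x_i`. -/
def selfFun (Q : Kˣ) (δ : Γ) : Entire K Γ :=
  (1 - mono 1 δ) * (1 - mono ((Q ^ (-2 : ℤ) : Kˣ) : K) δ) *
    sub (AddMonoidAlgebra.single δ (1 : K)) (selfTail Q)

/-- The contraction factor of the currents `x_i`, `x_j`, `a_ij = -1`, without its denominator. -/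
def linkFun (Q : Kˣ) (δ : Γ) : Entire K Γ :=
  sub (AddMonoidAlgebra.single δ (1 : K)) (linkTail Q)

/-- The denominator `1 - Q^{-1} z^δ`. -/
def linkDen (Q : Kˣ) (δ : Γ) : Entire K Γ := 1 - mono ((Q⁻¹ : Kˣ) : K) δ

theorem thetaEntire_eq (κ : Kˣ) (δ : Γ) : thetaEntire κ δ =
    sub 1 (poch (1 : K)) * (1 - mono (κ : K) δ) *
      sub (AddMonoidAlgebra.single δ (1 : K)) (poch (κ : K)) *
      sub (AddMonoidAlgebra.single (-δ) (1 : K)) (poch ((κ⁻¹ : Kˣ) : K)) := by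
  have h := theta_eq (AddMonoidAlgebra.single δ (1 : K)) (AddMonoidAlgebra.single (-δ) (1 : K))
    (κ : K) ((κ⁻¹ : Kˣ) : K)
  rw [AddMonoidAlgebra.smul_single, AddMonoidAlgebra.smul_single, smul_eq_mul, smul_eq_mul, mul_one,
    mul_one] at h
  exact h

/-- The factor common to `G^±`. -/
def gUnit (s : Kˣ) (σ : ℤˣ) (a : ℤ) : Kˣ := if σ = 1 then 1 else (q s ^ (σ : ℤ)) ^ a

theorem G_neg (s : Kˣ) (σ : ℤˣ) (a : ℤ) (δ : Γ) : G s (-σ) a δ =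
    mono (gUnit s σ a : K) 0 * thetaEntire ((q s ^ (σ : ℤ)) ^ (-a)) δ := by
  rcases Int.units_eq_one_or σ with rfl | rfl
  · rw [G, if_neg (by decide), gUnit, if_pos rfl, Units.val_one, mono_one, one_mul, Units.val_one,
      zpow_one]
  · rw [neg_neg, G, if_pos rfl, gUnit, if_neg (by decide), mono, Units.val_neg, Units.val_one,
      ← zpow_mul, ← zpow_mul]
    simp

theorem G_pos (s : Kˣ) (σ : ℤˣ) (a : ℤ) (δ : Γ) : G s σ a δ =
    mono (gUnit s σ a : K) 0 * (mono (((q s ^ (σ : ℤ)) ^ (-a) : Kˣ) : K) 0 *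
      thetaEntire ((q s ^ (σ : ℤ)) ^ a) δ) := by
  rcases Int.units_eq_one_or σ with rfl | rfl
  · rw [G, if_pos rfl, gUnit, if_pos rfl, Units.val_one, mono_one, one_mul, Units.val_one,
      zpow_one, mono]
  · rw [G, if_neg (by decide), gUnit, if_neg (by decide), ← mul_assoc, mono_mul, ← Units.val_mul,
      ← zpow_add, add_neg_cancel, zpow_zero, Units.val_one, add_zero, mono_one, one_mul,
      Units.val_neg, Units.val_one, ← zpow_mul]
    simp

/-- After expanding the theta functions all infinite products agree on the two sides. The remaining
identity `key` concerns elementary factors; the monomial compensates 1 - z^{-δ} against 1 - z^δ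
twice. -/
theorem G_mul_selfFun (s : Kˣ) (σ : ℤˣ) (δ : Γ) :
    G s (-σ) 2 δ * (mono 1 (δ + δ) * selfFun (q s ^ (σ : ℤ)) (-δ)) =
      G s σ 2 δ * selfFun (q s ^ (σ : ℤ)) δ := by
  rw [G_neg, G_pos, mul_assoc, mul_assoc]
  congr 1
  generalize q s ^ (σ : ℤ) = Q
  rw [thetaEntire_eq, thetaEntire_eq, selfFun, selfFun]
  have hU := congrArg (sub (AddMonoidAlgebra.single δ (1 : K))) (selfTail_mul Q)
  have hU' := congrArg (sub (AddMonoidAlgebra.single (-δ) (1 : K))) (selfTail_mul Q)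
  rw [sub_mul] at hU hU'
  have hy := mono_mul_neg (K := K) δ
  have hq : mono ((Q ^ (2 : ℤ) : Kˣ) : K) (0 : Γ) * mono ((Q ^ (-2 : ℤ) : Kˣ) : K) 0 = 1 := by
    rw [mono_mul, ← Units.val_mul, ← zpow_add]; simp [mono_one]
  have hi : (Q ^ (-2 : ℤ))⁻¹ = Q ^ (2 : ℤ) := by rw [zpow_neg, inv_inv]
  have hi' : (Q ^ (2 : ℤ))⁻¹ = Q ^ (-2 : ℤ) := by rw [zpow_neg]
  have hyy : mono (1 : K) (δ + δ) = mono 1 δ * mono 1 δ := by rw [mono_mul, one_mul]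
  rw [hi, hi', hyy, mono_eq ((Q ^ (2 : ℤ) : Kˣ) : K) δ, mono_eq ((Q ^ (-2 : ℤ) : Kˣ) : K) δ,
    mono_eq ((Q ^ (-2 : ℤ) : Kˣ) : K) (-δ), ← hU, ← hU']
  generalize mono ((Q ^ (2 : ℤ) : Kˣ) : K) (0 : Γ) = z at *
  generalize mono ((Q ^ (-2 : ℤ) : Kˣ) : K) (0 : Γ) = z' at *
  generalize mono (1 : K) δ = y at *
  generalize mono (1 : K) (-δ) = x at *
  generalize sub (AddMonoidAlgebra.single δ (1 : K)) (selfTail Q) = A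
  generalize sub (AddMonoidAlgebra.single (-δ) (1 : K)) (selfTail Q) = A'
  generalize sub (AddMonoidAlgebra.single δ (1 : K)) (poch ((Q ^ (2 : ℤ) : Kˣ) : K)) = B
  generalize sub (AddMonoidAlgebra.single (-δ) (1 : K)) (poch ((Q ^ (2 : ℤ) : Kˣ) : K)) = B'
  generalize sub (1 : AddMonoidAlgebra K Γ) (poch (1 : K)) = P
  have key : y * y * (1 - x) * (1 - z' * x) = z' * (1 - z * y) * (1 - y) := by
    linear_combination (-y - z' * y + z' * (y * x + 1)) * hy + (y - y * y) * hq
  linear_combination P * A * B * B' * A' * (1 - z' * y) * key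

/-- `1 - Q z^δ` is a unit multiple of `1 - Q^{-1} z^{-δ}`. -/
theorem one_sub_mono (Q : Kˣ) (δ : Γ) :
    1 - mono (Q : K) δ = -(mono (Q : K) δ * linkDen Q (-δ)) := by
  rw [linkDen, mul_sub, mul_one, mono_mul, ← Units.val_mul, mul_inv_cancel, add_neg_cancel,
    Units.val_one, mono_one]
  ring

/-- Up to a unit, the theta function vanishing at z^δ = Q^{-1} contains the denominator of one of
the two orderings, so multiplying by it removes the pole. -/
theorem G_link_neg (s : Kˣ) (σ : ℤˣ) (δ : Γ) : ∃ g : Entire K Γ,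
    G s (-σ) (-1) δ = g * linkDen (q s ^ (σ : ℤ)) (-δ) := by
  rw [G_neg, thetaEntire_eq, neg_neg, zpow_one, one_sub_mono]
  exact ⟨-(mono (gUnit s σ (-1) : K) 0 * sub 1 (poch (1 : K)) * mono ((q s ^ (σ : ℤ) : Kˣ) : K) δ *
    sub (AddMonoidAlgebra.single δ (1 : K)) (poch ((q s ^ (σ : ℤ) : Kˣ) : K)) *
    sub (AddMonoidAlgebra.single (-δ) (1 : K)) (poch (((q s ^ (σ : ℤ))⁻¹ : Kˣ) : K))), by ring⟩

theorem G_mul_linkFun (s : Kˣ) (σ : ℤˣ) (δ : Γ) :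
    G s (-σ) (-1) δ * (mono 1 (-δ) * linkFun (q s ^ (σ : ℤ)) (-δ) * linkDen (q s ^ (σ : ℤ)) δ) =
      -(G s σ (-1) δ * (linkFun (q s ^ (σ : ℤ)) δ * linkDen (q s ^ (σ : ℤ)) (-δ))) := by
  rw [G_neg, G_pos, mul_assoc (mono (gUnit s σ (-1) : K) (0 : Γ)),
    mul_assoc (mono (gUnit s σ (-1) : K) (0 : Γ)), ← mul_neg]
  congr 1
  generalize q s ^ (σ : ℤ) = Q
  rw [neg_neg, zpow_one, zpow_neg_one, thetaEntire_eq, thetaEntire_eq, inv_inv, linkFun, linkFun,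
    linkDen, linkDen]
  have hU := congrArg (sub (AddMonoidAlgebra.single δ (1 : K))) (linkTail_mul Q)
  have hU' := congrArg (sub (AddMonoidAlgebra.single (-δ) (1 : K))) (linkTail_mul Q)
  rw [sub_mul] at hU hU'
  have hy := mono_mul_neg (K := K) δ
  have hq : mono (Q : K) (0 : Γ) * mono ((Q⁻¹ : Kˣ) : K) 0 = 1 := by
    rw [mono_mul, ← Units.val_mul, mul_inv_cancel]; simp [mono_one]
  rw [mono_eq (Q : K) δ, mono_eq ((Q⁻¹ : Kˣ) : K) δ, mono_eq ((Q⁻¹ : Kˣ) : K) (-δ), ← hU, ← hU']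
  generalize mono (Q : K) (0 : Γ) = z at *
  generalize mono ((Q⁻¹ : Kˣ) : K) (0 : Γ) = z' at *
  generalize mono (1 : K) δ = y at *
  generalize mono (1 : K) (-δ) = x at *
  generalize sub (AddMonoidAlgebra.single δ (1 : K)) (linkTail Q) = A
  generalize sub (AddMonoidAlgebra.single (-δ) (1 : K)) (linkTail Q) = A'
  generalize sub (AddMonoidAlgebra.single δ (1 : K)) (poch ((Q⁻¹ : Kˣ) : K)) = B
  generalize sub (AddMonoidAlgebra.single (-δ) (1 : K)) (poch ((Q⁻¹ : Kˣ) : K)) = B'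
  generalize sub (1 : AddMonoidAlgebra K Γ) (poch (1 : K)) = P
  have key : (1 - z * y) * x = -(z * (1 - z' * x)) := by
    linear_combination -z * hy - x * hq
  linear_combination P * A * B * B' * A' * (1 - z' * y) * key

end EntireFunctions

end

end EllipticAlgebra


set_option linter.unusedSectionVars false

namespace EllipticAlgebra

noncomputable section

/-! ### Contractions acting on distributions -/

section Contraction

variable {K : Type*} [Field K] [CharZero K] {Γ : Type*} [AddCommGroup Γ]
variable {M : Type*} [AddCommGroup M] [Module K⟦X⟧ M] {N : ℕ}
  (hM : ∀ u : M, (PowerSeries.X ^ N : K⟦X⟧) • u = 0)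

theorem distAct_mul (f g : Entire K Γ) (F : Γ → M) :
    distAct Γ hM (f * g) F = distAct Γ hM f (distAct Γ hM g F) := by
  rw [map_mul]; rfl

theorem distAct_add (f g : Entire K Γ) (F : Γ → M) :
    distAct Γ hM (f + g) F = distAct Γ hM f F + distAct Γ hM g F := by
  rw [map_add]; rfl

theorem distAct_neg (f : Entire K Γ) (F : Γ → M) :
    distAct Γ hM (-f) F = -distAct Γ hM f F := by
  rw [map_neg]; rfl

theorem distAct_one (F : Γ → M) : distAct Γ hM 1 F = F := by
  rw [map_one]; rfl

theorem distAct_comm (f g : Entire K Γ) (F : Γ → M) :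
    distAct Γ hM f (distAct Γ hM g F) = distAct Γ hM g (distAct Γ hM f F) := by
  rw [← distAct_mul, mul_comm, distAct_mul]

theorem distAct_mono (δ : Γ) (F : Γ → M) :
    distAct Γ hM (mono 1 δ) F = fun γ => F (γ - δ) := by
  funext γ
  rw [mono, distAct_C_single, map_one, one_smul]

variable {lam : Γ →+ ℤ} {δ : Γ} {F : Γ → M}

include hM in
theorem conv_self (Q : Kˣ) (hF : Bdd lam F) (hδ : 0 < lam δ) :
    conv δ ((1 - PowerSeries.C (PowerSeries.C 1) * PowerSeries.X) *
      (1 - PowerSeries.C (PowerSeries.C ((Q ^ (-2 : ℤ) : Kˣ) : K)) *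
        PowerSeries.X) * PowerSeries.rescale (pp K) (selfTail Q)) F =
      distAct Γ hM (selfFun Q δ) F := by
  have h1 : Bdd lam (conv δ (PowerSeries.rescale (pp K) (selfTail Q)) F) := hF.series hδ _
  rw [mul_assoc, conv_mul hF hδ, conv_mul hF hδ, conv_one_sub hM, conv_one_sub hM,
    conv_rescale hM, selfFun, distAct_mul, distAct_mul]
  rfl

/-- Division by `1 - Q^{-1} z^δ`. -/
def linkInv (Q : Kˣ) (δ : Γ) (F : Γ → M) : Γ → M := conv δ (geom ((Q⁻¹ : Kˣ) : K)) F

include hM in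
theorem conv_link (Q : Kˣ) (hF : Bdd lam F) (hδ : 0 < lam δ) :
    conv δ (PowerSeries.rescale (pp K) (linkTail Q) * geom ((Q⁻¹ : Kˣ) : K)) F =
      distAct Γ hM (linkFun Q δ) (linkInv Q δ F) := by
  rw [conv_mul hF hδ, conv_rescale hM]
  rfl

theorem Bdd.linkInv (Q : Kˣ) (hF : Bdd lam F) (hδ : 0 < lam δ) :
    Bdd lam (linkInv Q δ F) := hF.series hδ _

theorem linkDen_linkInv (Q : Kˣ) (hF : Bdd lam F) (hδ : 0 < lam δ) :
    distAct Γ hM (linkDen Q δ) (linkInv Q δ F) = F := by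
  have h := conv_one_sub (δ := δ) hM ((Q⁻¹ : Kˣ) : K) (linkInv Q δ F)
  rw [linkInv, ← conv_mul hF hδ, one_sub_mul_geom, conv_one] at h
  exact h.symm

/-- Both sides are bounded in the same direction and agree after multiplication by the denominator,
which is injective there. -/
theorem linkInv_distAct (Q : Kˣ) (hF : Bdd lam F) (hδ : 0 < lam δ) (f : Entire K Γ) :
    linkInv Q δ (distAct Γ hM f F) = distAct Γ hM f (linkInv Q δ F) := by
  refine Bdd.injective hM ((hF.entire hM f).linkInv Q hδ) ((hF.linkInv Q hδ).entire hM f) hδ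
    ((Q⁻¹ : Kˣ) : K) ?_
  refine (linkDen_linkInv hM Q (hF.entire hM f) hδ).trans ?_
  rw [distAct_comm]
  exact congrArg _ (linkDen_linkInv hM Q hF hδ).symm

include hM in
theorem linkInv_comm {δ' : Γ} (Q : Kˣ) (hF : Bdd lam F) (hδ : 0 < lam δ) (hδ' : 0 < lam δ') :
    linkInv Q δ (linkInv Q δ' F) = linkInv Q δ' (linkInv Q δ F) := by
  refine Bdd.injective hM ((hF.linkInv Q hδ').linkInv Q hδ) ((hF.linkInv Q hδ).linkInv Q hδ') hδ
    ((Q⁻¹ : Kˣ) : K) ?_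
  refine (linkDen_linkInv hM Q (hF.linkInv Q hδ') hδ).trans ?_
  refine Eq.trans ?_ (linkInv_distAct hM Q (hF.linkInv Q hδ) hδ' _)
  exact congrArg _ (linkDen_linkInv hM Q hF hδ).symm

/-- The zeros z^δ = Q^{-1} and z^δ = Q of the two denominators are distinct because Q² ≠ 1;
explicitly, (1 - Q^{-1}y) + Q^{-1}y (1 - Q^{-1}y^{-1}) = 1 - Q^{-2}. -/
theorem exists_bezout {Q : Kˣ} (hQ : Q ^ 2 ≠ 1) (δ : Γ) : ∃ a b : Entire K Γ,
    a * linkDen Q (-δ) + b * linkDen Q δ = 1 := by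
  set c : K := 1 - ((Q⁻¹ : Kˣ) : K) * ((Q⁻¹ : Kˣ) : K) with hc
  have hc0 : c ≠ 0 := by
    intro h
    rw [hc, sub_eq_zero, ← Units.val_mul, ← Units.val_one, Units.val_inj] at h
    exact hQ (by rw [pow_two, ← inv_inj, mul_inv, ← h, inv_one])
  have h1 : mono c⁻¹ (0 : Γ) * (1 - mono (((Q⁻¹ : Kˣ) : K) * ((Q⁻¹ : Kˣ) : K)) 0) = 1 := by
    rw [mul_sub, mul_one, mono_mul, add_zero, mono, mono, ← map_sub, ← AddMonoidAlgebra.single_sub]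
    rw [← mul_one_sub, ← hc, inv_mul_cancel₀ hc0]
    exact mono_one
  refine ⟨mono c⁻¹ 0 * mono ((Q⁻¹ : Kˣ) : K) δ, mono c⁻¹ 0, ?_⟩
  have h2 : mono ((Q⁻¹ : Kˣ) : K) δ * mono ((Q⁻¹ : Kˣ) : K) (-δ) =
      mono (((Q⁻¹ : Kˣ) : K) * ((Q⁻¹ : Kˣ) : K)) 0 := by rw [mono_mul, add_neg_cancel]
  rw [linkDen, linkDen]
  linear_combination h1 - mono c⁻¹ 0 * h2

/-- Two distributions which agree after multiplication by coprime functions have a common divisor. -/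
theorem exists_divisor {u v a b : Entire K Γ} (h : a * u + b * v = 1) {F G : Γ → M}
    (hFG : distAct Γ hM u F = distAct Γ hM v G) :
    F = distAct Γ hM v (distAct Γ hM b F + distAct Γ hM a G) ∧
      G = distAct Γ hM u (distAct Γ hM b F + distAct Γ hM a G) := by
  constructor
  · rw [map_add, distAct_comm hM v a, ← hFG, ← distAct_mul, ← distAct_mul, ← distAct_add, mul_comm v,
      add_comm, h, distAct_one]
  · rw [map_add, distAct_comm hM u b, hFG, ← distAct_mul, ← distAct_mul, ← distAct_add, mul_comm u,
      add_comm, h, distAct_one]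

/-- The two quotients of η by `u` and by `v` are different expansions and cannot be compared
directly. Coprimality provides ρ with F = vρ and F' = uρ, after which the claim is an identity of
entire functions acting on ρ. -/
theorem distAct_exchange {Gm Gp g m l l' u v a b : Entire K Γ} (hab : a * u + b * v = 1)
    (hg : Gm = g * u) (hG : Gm * (m * l * v) = -(Gp * (l' * u))) {F F' η : Γ → M}
    (hF : distAct Γ hM u F = η) (hF' : distAct Γ hM v F' = η) :
    distAct Γ hM Gp (distAct Γ hM l' F') = -distAct Γ hM (g * (m * l)) η := by
  obtain ⟨h2, h3⟩ := exists_divisor hM hab (hF.trans hF'.symm)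
  generalize distAct Γ hM b F + distAct Γ hM a F' = ρ at h2 h3
  rw [h3, ← hF, h2, ← distAct_mul, ← distAct_mul, ← distAct_mul, ← distAct_mul, ← distAct_neg]
  congr 1
  have h : Gp * l' * u = -(g * (m * l) * u * v) := by
    rw [hg] at hG
    linear_combination hG
  rw [h]

end Contraction

theorem HasAdicSum.smul_single {K : Type*} [Field K] {M : Type*} [AddCommGroup M] [Module K⟦X⟧ M]
    {ι κ : Type*} {f : ι → M} {v : M} (hf : HasAdicSum K f v) (c : K⟦X⟧) (β : κ) :
    HasAdicSum K (fun t => c • Finsupp.single β (f t)) (c • Finsupp.single β v) := by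
  have h := hf.map (c • Finsupp.lsingle β : M →ₗ[K⟦X⟧] κ →₀ M)
  simpa only [LinearMap.smul_apply, Finsupp.lsingle_apply] using h

/-! ### The quadratic relations -/

section Quadratic

variable {K : Type*} [Field K] [CharZero K] {n : ℕ} {i : ℕ} {s : Kˣ}
  (hs : ∀ k : ℕ, 0 < k → s ^ k ≠ 1)

theorem Vtx.nord_bdd (s : Kˣ) (V V' : Vtx K n) (E : ℤ) (f : FockPoly K n) (lam : ℤ →+ ℤ) :
    Bdd lam (Vtx.nord s V V' E f) := by
  obtain ⟨S, hS⟩ := Vtx.nord_finite s V V' E f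
  refine bdd_of_finite lam (S.finite_toSet.subset fun t ht => ?_)
  by_contra h
  exact ht (hS t h)

theorem Vtx.nord_support_finite (s : Kˣ) (V V' : Vtx K n) (E : ℤ) (f : FockPoly K n) :
    (Function.support (Vtx.nord s V V' E f)).Finite := by
  obtain ⟨S, hS⟩ := Vtx.nord_finite s V V' E f
  refine S.finite_toSet.subset fun t ht => ?_
  by_contra h
  exact ht (hS t h)

theorem q_zpow_sq_ne_one (hs : ∀ k : ℕ, 0 < k → s ^ k ≠ 1) (σ : ℤˣ) : (q s ^ (σ : ℤ)) ^ 2 ≠ 1 := by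
  have h : (q s) ^ 2 ≠ 1 := by rw [q, ← pow_mul]; exact hs 4 (by norm_num)
  rcases Int.units_eq_one_or σ with rfl | rfl
  · simpa using h
  · simpa using h

include hs in
-- Here the contractions have no poles, so both sides are the same entire function applied to a
-- finitely supported distribution, which also yields the common limit.
theorem quadratic_self (σ : ℤˣ) (a : Fin (n - 1)) (E γ : ℤ) (f : FockPoly K n) : ∃ v,
    HasAdicSum K (fun r : ℤ => (G s (-σ) 2 (1 : ℤ)).coeffAt r •
      (xV s σ a).mode s (γ - 2 - r) ((xV s σ a).mode s (E - (γ - 2 - r)) f)) v ∧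
    HasAdicSum K (fun r : ℤ => (G s σ 2 (1 : ℤ)).coeffAt r •
      (xV s σ a).mode s (E - (γ - r)) ((xV s σ a).mode s (γ - r) f)) v := by
  have hc := expS_contr_self hs σ a
  generalize xV s σ a = V at *
  set η := Vtx.nord s V V E f with hη
  obtain ⟨v, hv⟩ := exists_distAct (K := K) (G s σ 2 (1 : ℤ) * selfFun (q s ^ (σ : ℤ)) 1)
    (Vtx.nord_support_finite s V V E f) γ
  have hb : ∀ (N : ℕ) (lam : ℤ →+ ℤ), Bdd lam fun γ => red K N (η γ) := fun N lam =>
    (Vtx.nord_bdd s V V E f lam).map _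
  have hpos : (0 : ℤ) < AddMonoidHom.id ℤ 1 := by simp
  have hneg : (0 : ℤ) < (-AddMonoidHom.id ℤ) (-1) := by simp
  refine ⟨v, ?_, ?_⟩
  · have := hasAdicSum_of_distAct (K := K) (G s (-σ) 2 (1 : ℤ))
      (fun γ => V.mode s (γ - 2) (V.mode s (E - (γ - 2)) f)) γ v fun N => ?_
    · convert this using 4 <;> ring_nf
    · rw [← hv]
      have h1 : (fun γ => red K N (V.mode s (γ - 2) (V.mode s (E - (γ - 2)) f))) =
          distAct ℤ (red_pow_smul N) (mono 1 2 * selfFun (q s ^ (σ : ℤ)) (-1))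
            fun γ => red K N (η γ) := by
        rw [distAct_mul, ← conv_self _ _ (hb N _) hneg, ← hc,
          ← conv_map (red K N) (Vtx.nord_bdd s V V E f _) hneg, distAct_mono]
        funext γ
        rw [Vtx.mode_mode_eq_conv]
      rw [h1, ← distAct_mul]
      have h2 := G_mul_selfFun s σ (1 : ℤ)
      rw [show (1 : ℤ) + 1 = 2 by norm_num] at h2
      rw [h2]
  · have := hasAdicSum_of_distAct (K := K) (G s σ 2 (1 : ℤ))
      (fun γ => V.mode s (E - γ) (V.mode s γ f)) γ v fun N => ?_
    · exact this
    · rw [← hv]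
      have h1 : (fun γ => red K N (V.mode s (E - γ) (V.mode s γ f))) =
          distAct ℤ (red_pow_smul N) (selfFun (q s ^ (σ : ℤ)) 1)
            fun γ => red K N (η γ) := by
        rw [← conv_self _ _ (hb N _) hpos, ← hc,
          ← conv_map (red K N) (Vtx.nord_bdd s V V E f _) hpos]
        funext γ
        rw [Vtx.mode_mode_eq_conv']
      rw [h1, ← distAct_mul]

include hs in
-- The factor G^{∓} cancels the pole of the first product outright; for the second product the
-- common divisor of the two expansions is used. The limits differ by a sign, which is cancelled
-- later by the lattice part.
theorem quadratic_link (σ : ℤˣ) {a b : Fin (n - 1)} (hab : CartanMatrix.A (n - 1) a b = -1)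
    (E γ : ℤ) (f : FockPoly K n) : ∃ v,
    HasAdicSum K (fun r : ℤ => (G s (-σ) (-1) (1 : ℤ)).coeffAt r •
      (xV s σ a).mode s (γ + 1 - r) ((xV s σ b).mode s (E - (γ + 1 - r)) f)) v ∧
    HasAdicSum K (fun r : ℤ => (G s σ (-1) (1 : ℤ)).coeffAt r •
      (xV s σ b).mode s (E - (γ - r)) ((xV s σ a).mode s (γ - r) f)) (-v) := by
  have hc := expS_contr_link hs σ hab
  have hc' := expS_contr_link hs σ (a := b) (b := a) (by rw [cartan_symm, hab])
  have hQ := q_zpow_sq_ne_one hs σ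
  obtain ⟨g, hg⟩ := G_link_neg s σ (1 : ℤ)
  have hG := G_mul_linkFun s σ (1 : ℤ)
  generalize xV s σ a = V at *
  generalize xV s σ b = V' at *
  generalize q s ^ (σ : ℤ) = Q at *
  set η := Vtx.nord s V V' E f with hη
  obtain ⟨v, hv⟩ := exists_distAct (K := K) (g * (mono 1 (-1) * linkFun Q (-1)))
    (Vtx.nord_support_finite s V V' E f) γ
  have hb : ∀ (N : ℕ) (lam : ℤ →+ ℤ), Bdd lam fun γ => red K N (η γ) := fun N lam =>
    (Vtx.nord_bdd s V V' E f lam).map _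
  have hpos : (0 : ℤ) < AddMonoidHom.id ℤ 1 := by simp
  have hneg : (0 : ℤ) < (-AddMonoidHom.id ℤ) (-1) := by simp
  obtain ⟨A, B, hAB⟩ := exists_bezout (K := K) hQ (1 : ℤ)
  have e1 : ∀ N, (fun γ => red K N (V.mode s (γ + 1) (V'.mode s (E - (γ + 1)) f))) =
      distAct ℤ (red_pow_smul N) (mono 1 (-1) * linkFun Q (-1))
        (linkInv Q (-1) fun γ => red K N (η γ)) := fun N => by
    rw [distAct_mul, ← conv_link _ _ (hb N _) hneg, ← hc,
      ← conv_map (red K N) (Vtx.nord_bdd s V V' E f _) hneg, distAct_mono]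
    funext γ
    rw [Vtx.mode_mode_eq_conv, sub_neg_eq_add]
  refine ⟨v, ?_, ?_⟩
  · have := hasAdicSum_of_distAct (K := K) (G s (-σ) (-1) (1 : ℤ))
      (fun γ => V.mode s (γ + 1) (V'.mode s (E - (γ + 1)) f)) γ v fun N => ?_
    · convert this using 4 <;> ring_nf
    · rw [← hv, e1, ← distAct_mul, hg, mul_right_comm, distAct_mul _ _ (linkDen Q (-1)),
        linkDen_linkInv _ _ (hb N _) hneg]
  · have := hasAdicSum_of_distAct (K := K) (G s σ (-1) (1 : ℤ))
      (fun γ => V'.mode s (E - γ) (V.mode s γ f)) γ (-v) fun N => ?_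
    · exact this
    · rw [map_neg, ← hv]
      have h1 : (fun γ => red K N (V'.mode s (E - γ) (V.mode s γ f))) =
          distAct ℤ (red_pow_smul N) (linkFun Q 1) (linkInv Q 1 fun γ => red K N (η γ)) := by
        rw [← conv_link _ _ (hb N _) hpos, ← hc',
          ← conv_map (red K N) (Vtx.nord_bdd s V V' E f _) hpos]
        funext γ
        rw [Vtx.mode_mode_eq_conv']
      rw [h1]
      exact congrFun (distAct_exchange _ hAB hg hG (linkDen_linkInv _ _ (hb N _) hneg)
        (linkDen_linkInv _ _ (hb N _) hpos)) γ

theorem hasAdicSum_x_x_single {ι : Type*} (σ τ : ℤˣ) (a b : Fin (n - 1)) (β : Coset n i)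
    (f : FockPoly K n) (c : ι → K⟦X⟧) (m l : ι → ℤ) {v : FockPoly K n}
    (h : HasAdicSum K (fun r => c r • (xV s σ a).mode s
      (xExp σ a (m r) β - σ * τ * CartanMatrix.A (n - 1) a b)
        ((xV s τ b).mode s (xExp τ b (l r) β) f)) v) :
    HasAdicSum K (fun r => c r • (fockCurrents s n i).x σ a (m r)
      ((fockCurrents s n i).x τ b (l r) (Finsupp.single β f)))
      ((xSign K σ a (β.shift τ b) * xSign K τ b β) •
        Finsupp.single ((β.shift τ b).shift σ a) v) := by
  have h1 := h.smul_single (xSign K σ a (β.shift τ b) * xSign K τ b β)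
    ((β.shift τ b).shift σ a)
  refine Eq.mp (congrArg (fun F => HasAdicSum K F _) (funext fun r => ?_)) h1
  rw [x_x_single, smul_comm (c r), Finsupp.smul_single (c r)]

include hs in
theorem fock_x_x (σ : ℤˣ) (a b : Fin (n - 1)) (m l : ℤ) (u : Fock K n i)
    (hab : CartanMatrix.A (n - 1) a b ≠ 0) : ∃ v : Fock K n i,
    HasAdicSum K (fun r : ℤ => (G s (-σ) (CartanMatrix.A (n - 1) a b) (1 : ℤ)).coeffAt r •
      (fockCurrents s n i).x σ a (m + r) ((fockCurrents s n i).x σ b (l - r) u)) v ∧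
    HasAdicSum K (fun r : ℤ => (G s σ (CartanMatrix.A (n - 1) a b) (1 : ℤ)).coeffAt r •
      (fockCurrents s n i).x σ b (l - r) ((fockCurrents s n i).x σ a (m + r) u)) v := by
  induction u using Finsupp.induction_linear with
  | zero => exact ⟨0, by simpa using hasAdicSum_zero, by simpa using hasAdicSum_zero⟩
  | add u v hu hv =>
    obtain ⟨u', hu, hu'⟩ := hu
    obtain ⟨v', hv, hv'⟩ := hv
    exact ⟨u' + v', by simpa using hu.add hv, by simpa using hu'.add hv'⟩
  | single β f =>
    have hσ : (σ : ℤ) * σ = 1 := by rw [← Units.val_mul, Int.units_mul_self, Units.val_one]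
    have e1 : ∀ r, xExp σ a (m + r) β = xExp σ a m β - r := fun r => by
      simp only [xExp]; ring
    have e2 : ∀ r, xExp σ b (l - r) β = xExp σ b l β + r := fun r => by
      simp only [xExp]; ring
    by_cases h : a = b
    · subst h
      rw [cartan_self]
      obtain ⟨v, hv, hv'⟩ := quadratic_self hs σ a (xExp σ a m β + xExp σ a l β - 2)
        (xExp σ a m β) f
      refine ⟨_, hasAdicSum_x_x_single σ σ a a β f _ _ _ (v := v) ?_,
        hasAdicSum_x_x_single σ σ a a β f _ _ _ (v := v) ?_⟩
      · convert hv using 5 with r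
        · rw [e1, cartan_self, hσ]; ring
        · rw [e2]; ring_nf
      · convert hv' using 5 with r
        · rw [e2, cartan_self, hσ]; ring
        · rw [e1]
    · have hA : CartanMatrix.A (n - 1) a b = -1 := (cartan_cases h).resolve_right hab
      have hA' : CartanMatrix.A (n - 1) b a = -1 := by rw [cartan_symm, hA]
      rw [hA]
      obtain ⟨v, hv, hv'⟩ := quadratic_link hs σ hA (xExp σ a m β + xExp σ b l β + 1)
        (xExp σ a m β) f
      refine ⟨_, hasAdicSum_x_x_single σ σ a b β f _ _ _ (v := v) ?_, ?_⟩
      · convert hv using 5 with r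
        · rw [e1, hA, hσ]; ring
        · rw [e2]; ring_nf
      -- The lattice sign (-1)^{a_ij} = -1 from exchanging the two exponentials turns the limit -v
      -- into v.
      · have h1 := hasAdicSum_x_x_single (s := s) σ σ b a β f
          (fun r => (G s σ (-1) (1 : ℤ)).coeffAt r) (fun r => l - r) (fun r => m + r) (v := -v) ?_
        · convert h1 using 1
          rw [xSign_swap, hA, Coset.shift_comm, zpow_neg, zpow_one, inv_neg, inv_one, Units.val_neg,
            Units.val_one, Int.cast_neg, Int.cast_one, neg_one_mul]
          exact (neg_smul_single_neg _ _ _).symm.trans (by rw [neg_neg])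
        · convert hv' using 5 with r
          · rw [e2, hA', hσ]; ring
          · rw [e1]

include hs in
theorem fock_x_x_zero (σ : ℤˣ) (a b : Fin (n - 1)) (m l : ℤ)
    (hab : CartanMatrix.A (n - 1) a b = 0) :
    Commute ((fockCurrents (K := K) s n i).x σ a m) ((fockCurrents s n i).x σ b l) := by
  refine Finsupp.lhom_ext fun β f => ?_
  rw [Module.End.mul_apply, Module.End.mul_apply, x_x_single, x_x_single, xSign_swap, cartan_symm b a,
    hab, Coset.shift_comm, mul_zero, sub_zero, sub_zero, zpow_zero, Units.val_one, Int.cast_one,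
    one_mul]
  congr 2
  have h1 := Vtx.mode_mode_eq_conv s (xV s σ a) (xV s σ b)
    (xExp σ a m β + xExp σ b l β) f (xExp σ a m β)
  have h2 := Vtx.mode_mode_eq_conv' s (xV s σ a) (xV s σ b)
    (xExp σ a m β + xExp σ b l β) f (xExp σ a m β)
  rw [expS_contr_zero hs σ hab, conv_one, add_sub_cancel_left] at h1
  rw [expS_contr_zero hs σ (by rw [cartan_symm, hab]), conv_one, add_sub_cancel_left] at h2
  rw [h1, h2]

end Quadratic

end

end EllipticAlgebra


set_option linter.unusedSectionVars false

namespace EllipticAlgebra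

noncomputable section

/-! ### The function identity behind the cubic relation -/

section CubicIdentity

/-- Eliminating S, t₁, t₂ (or S', t₁', t₂') leaves h₀ (g + 1)(g₁g₂ + 1) - h (g₂ + g g₁) as a factor,
and h is defined so that this vanishes. The two alternatives in `hor` correspond to the two signs of
the currents. -/
theorem cubic_identity_field {F : Type*} [Field F] {g g' g₁ g₂ h₀ h h' S S' t₁ t₂ t₁' t₂' : F}
    (hden : g₂ + g * g₁ ≠ 0)
    (hh : h = h₀ * (((g + 1) * (g₁ * g₂ + 1)) / (g₂ + g * g₁)))
    (hh' : h' = h₀ * (((g' + 1) * (g₂ * g₁ + 1)) / (g₁ + g' * g₂)))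
    (hor : (S = g * S' ∧ S' = g' * S ∧ t₁ = -(g₁ * t₁') ∧ t₂ = -(g₂ * t₂')) ∨
      (S' = g * S ∧ S = g' * S' ∧ t₁' = -(g₁ * t₁) ∧ t₂' = -(g₂ * t₂))) :
    h₀ * (S + S') * (t₁ * t₂ + t₁' * t₂') + h * (S * (t₁ * t₂')) + h' * (S' * (t₂ * t₁')) = 0 := by
  -- If S = 0 then S' = 0 and every term vanishes; otherwise S = g g' S forces g g' = 1.
  by_cases hS : S = 0
  · have hS' : S' = 0 := by
      rcases hor with ⟨-, h2, -⟩ | ⟨h2, -⟩ <;> rw [h2, hS, mul_zero]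
    rw [hS, hS']; ring
  have hg : g * g' = 1 := by
    refine mul_right_cancel₀ hS ?_
    rcases hor with ⟨h1, h2, -⟩ | ⟨h1, h2, -⟩
    · rw [mul_assoc, ← h2, ← h1, one_mul]
    · rw [mul_right_comm, ← h1, mul_comm, ← h2, one_mul]
  have hg0 : g ≠ 0 := left_ne_zero_of_mul_eq_one hg
  have hden' : g₁ + g' * g₂ ≠ 0 := by
    intro h0
    refine hden ?_
    linear_combination g * h0 - g₂ * hg
  have e : h * (g₂ + g * g₁) = h₀ * ((g + 1) * (g₁ * g₂ + 1)) := by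
    rw [hh, mul_assoc, div_mul_cancel₀ _ hden]
  have e' : h' * (g₁ + g' * g₂) = h₀ * ((g' + 1) * (g₂ * g₁ + 1)) := by
    rw [hh', mul_assoc, div_mul_cancel₀ _ hden']
  -- Since g' = 1/g, multiplying numerator and denominator of the second fraction by g gives the
  -- first, so h is symmetric in z₁ and z₂.
  have e'' : h' = h := by
    refine mul_right_cancel₀ hden ?_
    linear_combination g * e' - e + (h₀ * (g₂ * g₁ + 1) - h' * g₂) * hg
  rw [e'']
  rcases hor with ⟨h1, -, h3, h4⟩ | ⟨h1, -, h3, h4⟩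
  · rw [h1, h3, h4]
    linear_combination -(S' * t₁' * t₂') * e
  · rw [h1, h3, h4]
    linear_combination -(S * t₁ * t₂) * e

variable {K : Type*} [Field K] [CharZero K] {s : Kˣ}

/-- Evaluation at `p = 0`, `z₁ / w = c`, `z₂ / w = 1`. -/
def evalLead (c : Kˣ) : Entire K (ℤ × ℤ) →+* K :=
  ((AddMonoidAlgebra.lift K K (ℤ × ℤ)
    { toFun := fun d => ((c ^ d.toAdd.1 : Kˣ) : K)
      map_one' := by simp
      map_mul' := fun d e => by simp [zpow_add] }).toRingHom).comp
    (PowerSeries.constantCoeff (R := AddMonoidAlgebra K (ℤ × ℤ)))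

theorem evalLead_thetaEntire (c κ : Kˣ) (d : ℤ × ℤ) :
    evalLead c (thetaEntire κ d) = 1 - ((κ * c ^ d.1 : Kˣ) : K) := by
  have h : PowerSeries.constantCoeff (thetaEntire κ d) =
      1 - AddMonoidAlgebra.single d (κ : K) := by
    rw [← PowerSeries.coeff_zero_eq_constantCoeff_apply, thetaEntire, theta, PowerSeries.coeff_mk]
    simp
  rw [evalLead, RingHom.comp_apply, h, map_sub, map_one]
  simp

theorem evalLead_G_neg_one (c : Kˣ) (a : ℤ) (d : ℤ × ℤ) :
    evalLead c (G s (-1) a d) = 1 - ((q s ^ (-a) * c ^ d.1 : Kˣ) : K) := by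
  rw [G, if_neg (by decide), evalLead_thetaEntire]

theorem evalLead_G_one (c : Kˣ) (a : ℤ) (d : ℤ × ℤ) :
    evalLead c (G s 1 a d) = ((q s ^ (-a) : Kˣ) : K) * (1 - ((q s ^ a * c ^ d.1 : Kˣ) : K)) := by
  rw [G, if_pos rfl, map_mul, evalLead_thetaEntire]
  congr 1
  rw [evalLead, RingHom.comp_apply, PowerSeries.constantCoeff_C]
  simp

variable (hs : ∀ k : ℕ, 0 < k → s ^ k ≠ 1)

theorem q_zpow_ne_one (hs : ∀ k : ℕ, 0 < k → s ^ k ≠ 1) {k : ℤ} (hk : k ≠ 0) : q s ^ k ≠ 1 := by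
  have h : ∀ m : ℕ, 0 < m → q s ^ m ≠ 1 := fun m hm => by
    rw [q, ← pow_mul]; exact hs _ (by omega)
  rcases Int.natAbs_eq k with h1 | h1
  · rw [h1, zpow_natCast]; exact h _ (by omega)
  · rw [h1, zpow_neg, zpow_natCast]
    intro h2
    exact h _ (by omega) (inv_eq_one.1 h2)

theorem one_sub_q_zpow_ne_zero (hs : ∀ k : ℕ, 0 < k → s ^ k ≠ 1) {k : ℤ} (hk : k ≠ 0) :
    (1 : K) - ((q s ^ k : Kˣ) : K) ≠ 0 := by
  intro h
  refine q_zpow_ne_one hs hk (Units.ext ?_)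
  rw [Units.val_one]
  exact (sub_eq_zero.1 h).symm

include hs in
theorem G_ne_zero {a : ℤ} (ha : a ≠ 0) (d : ℤ × ℤ) (σ : ℤˣ) : G s σ a d ≠ 0 := by
  intro h
  have h' := congrArg (evalLead 1) h
  rw [map_zero] at h'
  rcases Int.units_eq_one_or σ with rfl | rfl
  · rw [evalLead_G_one, one_zpow, mul_one] at h'
    exact mul_ne_zero (Units.ne_zero _) (one_sub_q_zpow_ne_zero hs ha) h'
  · rw [evalLead_G_neg_one, one_zpow, mul_one] at h'
    exact one_sub_q_zpow_ne_zero hs (neg_ne_zero.2 ha) h'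

include hs in
-- Division by zero in the definition of h must be excluded. After clearing denominators it suffices
-- to find one specialization at p = 0 at which the numerator does not vanish.
theorem hFrac_den_ne_zero : gFrac s (-1) (0, 1) +
    gFrac (K := K) s 2 ((1, 0) - (0, 1)) * gFrac s (-1) (1, 0) ≠ 0 := by
  have hB : ∀ {a : ℤ}, a ≠ 0 → ∀ d : ℤ × ℤ,
      algebraMap (Entire K (ℤ × ℤ)) (FractionRing (Entire K (ℤ × ℤ))) (G s (-1) a d) ≠ 0 := by
    intro a ha d h
    rw [FaithfulSMul.algebraMap_eq_zero_iff] at h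
    exact G_ne_zero hs ha d _ h
  have h0 := hB (a := 2) (by norm_num) ((1, 0) - (0, 1))
  have h1 := hB (a := -1) (by norm_num) (1, 0)
  have h2 := hB (a := -1) (by norm_num) (0, 1)
  rw [gFrac, gFrac, gFrac, div_mul_div_comm, div_add_div _ _ h2 (mul_ne_zero h0 h1)]
  refine div_ne_zero ?_ (mul_ne_zero h2 (mul_ne_zero h0 h1))
  rw [← map_mul, ← map_mul, ← map_mul, ← map_mul, ← map_add, Ne, FaithfulSMul.algebraMap_eq_zero_iff]
  intro h
  -- At z₁/w = q the factor G⁺ with entry -1 vanishes. Only one summand survives, a product of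
  -- factors 1 - q^k with k ≠ 0 and a unit.
  have h' := congrArg (evalLead (q s)) h
  rw [map_zero, map_add, map_mul, map_mul, map_mul, map_mul, evalLead_G_one, evalLead_G_neg_one,
    evalLead_G_neg_one, evalLead_G_neg_one, evalLead_G_one, evalLead_G_one, ← zpow_add, ← zpow_add,
    ← zpow_add, ← zpow_add, ← zpow_add, ← zpow_add] at h'
  simp only [Prod.fst_sub, sub_zero, add_zero, neg_add_cancel, zpow_zero, Units.val_one, sub_self,
    mul_zero] at h'
  exact mul_ne_zero (mul_ne_zero (Units.ne_zero _) (one_sub_q_zpow_ne_zero hs (by norm_num)))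
    (mul_ne_zero (one_sub_q_zpow_ne_zero hs (by norm_num))
      (one_sub_q_zpow_ne_zero hs (by norm_num))) h'

theorem gFrac_mul {σ : ℤˣ} {a : ℤ} {d : ℤ × ℤ} {x y : Entire K (ℤ × ℤ)}
    (h0 : G s (-1) a d ≠ 0) (h : G s (-σ) a d * x = G s σ a d * y) :
    (σ = 1 → algebraMap _ (FractionRing (Entire K (ℤ × ℤ))) x = gFrac s a d * algebraMap _ _ y) ∧
    (σ = -1 → algebraMap _ (FractionRing (Entire K (ℤ × ℤ))) y = gFrac s a d * algebraMap _ _ x) := by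
  have h1 : algebraMap (Entire K (ℤ × ℤ)) (FractionRing (Entire K (ℤ × ℤ))) (G s (-1) a d) ≠ 0 := by
    rwa [Ne, FaithfulSMul.algebraMap_eq_zero_iff]
  have h2 := congrArg (algebraMap _ (FractionRing (Entire K (ℤ × ℤ)))) h
  rw [map_mul, map_mul] at h2
  constructor
  · rintro rfl
    rw [gFrac, div_mul_eq_mul_div, eq_div_iff h1, mul_comm]
    exact h2
  · rintro rfl
    rw [neg_neg] at h2
    rw [gFrac, div_mul_eq_mul_div, eq_div_iff h1, mul_comm]
    exact h2.symm

include hs in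
theorem cubic_identity (σ : ℤˣ) {H₀ H H' : Entire K (ℤ × ℤ)}
    (hH : algebraMap _ (FractionRing (Entire K (ℤ × ℤ))) H =
      algebraMap _ (FractionRing (Entire K (ℤ × ℤ))) H₀ * hFrac s (1, 0) (0, 1))
    (hH' : algebraMap _ (FractionRing (Entire K (ℤ × ℤ))) H' =
      algebraMap _ (FractionRing (Entire K (ℤ × ℤ))) H₀ * hFrac s (0, 1) (1, 0))
    {S S' t₁ t₂ t₁' t₂' : Entire K (ℤ × ℤ)}
    (hS : G s (-σ) 2 ((1, 0) - (0, 1)) * S = G s σ 2 ((1, 0) - (0, 1)) * S')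
    (hS' : G s (-σ) 2 ((0, 1) - (1, 0)) * S' = G s σ 2 ((0, 1) - (1, 0)) * S)
    (ht₁ : G s (-σ) (-1) (1, 0) * t₁ = -(G s σ (-1) (1, 0) * t₁'))
    (ht₂ : G s (-σ) (-1) (0, 1) * t₂ = -(G s σ (-1) (0, 1) * t₂')) :
    H₀ * (S + S') * (t₁ * t₂ + t₁' * t₂') + H * (S * (t₁ * t₂')) + H' * (S' * (t₂ * t₁')) = 0 := by
  have a1 := gFrac_mul (G_ne_zero hs (by norm_num) _ _) hS
  have a2 := gFrac_mul (G_ne_zero hs (by norm_num) _ _) hS'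
  have a3 := gFrac_mul (x := t₁) (y := -t₁') (G_ne_zero hs (a := -1) (by norm_num) (1, 0) (-1))
    (by rw [ht₁, mul_neg])
  have a4 := gFrac_mul (x := t₂) (y := -t₂') (G_ne_zero hs (a := -1) (by norm_num) (0, 1) (-1))
    (by rw [ht₂, mul_neg])
  rw [map_neg, mul_neg] at a3 a4
  rw [← FaithfulSMul.algebraMap_eq_zero_iff (Entire K (ℤ × ℤ)) (FractionRing (Entire K (ℤ × ℤ)))]
  simp only [map_add, map_mul]
  refine cubic_identity_field (hFrac_den_ne_zero hs) hH hH' ?_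
  rcases Int.units_eq_one_or σ with rfl | rfl
  · exact Or.inl ⟨a1.1 rfl, a2.1 rfl, a3.1 rfl, a4.1 rfl⟩
  · refine Or.inr ⟨a1.2 rfl, a2.2 rfl, ?_, ?_⟩
    · rw [← a3.2 rfl, neg_neg]
    · rw [← a4.2 rfl, neg_neg]

end CubicIdentity

end

end EllipticAlgebra


set_option linter.unusedSectionVars false

namespace EllipticAlgebra

noncomputable section

/-! ### Products of three currents as distributions -/

section Triple

variable {K : Type*} [Field K] [CharZero K] {Γ : Type*} [AddCommGroup Γ]
variable {M : Type*} [AddCommGroup M] [Module K⟦X⟧ M] {N : ℕ}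
  (hM : ∀ u : M, (PowerSeries.X ^ N : K⟦X⟧) • u = 0)

/-- The contraction of two currents `x_i`. -/
def selfContr (Q : Kˣ) : (K⟦X⟧)⟦X⟧ :=
  (1 - PowerSeries.C (PowerSeries.C 1) * PowerSeries.X) *
    (1 - PowerSeries.C (PowerSeries.C ((Q ^ (-2 : ℤ) : Kˣ) : K)) * PowerSeries.X) *
      PowerSeries.rescale (pp K) (selfTail Q)

/-- The contraction of two currents `x_i`, `x_j` with `a_ij = -1`. -/
def linkContr (Q : Kˣ) : (K⟦X⟧)⟦X⟧ :=
  PowerSeries.rescale (pp K) (linkTail Q) * geom ((Q⁻¹ : Kˣ) : K)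

variable {lam : Γ →+ ℤ} {δ₁ δ₂ δ₃ : Γ} {F : Γ → M}

include hM in
-- The three entire parts are moved to the outside, leaving only the divisions by the two
-- denominators. The companion lemmas do the same for the other positions of the current x_j, so all
-- three products have the same shape.
theorem conv_self_link_link (Q : Kˣ) (hF : Bdd lam F) (h₁ : 0 < lam δ₁) (h₂ : 0 < lam δ₂)
    (h₃ : 0 < lam δ₃) :
    conv δ₁ (selfContr Q) (conv δ₂ (linkContr Q) (conv δ₃ (linkContr Q) F)) =
      distAct Γ hM (selfFun Q δ₁ * (linkFun Q δ₂ * linkFun Q δ₃)) (linkInv Q δ₂ (linkInv Q δ₃ F)) := by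
  rw [linkContr, conv_link hM Q hF h₃, conv_link hM Q ((hF.linkInv Q h₃).entire hM _) h₂,
    linkInv_distAct hM Q (hF.linkInv Q h₃) h₂, selfContr, conv_self hM (lam := lam) Q ?_ h₁,
    distAct_mul, distAct_mul]
  exact (((hF.linkInv Q h₃).linkInv Q h₂).entire hM _).entire hM _

include hM in
theorem conv_link_self_link (Q : Kˣ) (hF : Bdd lam F) (h₁ : 0 < lam δ₁) (h₂ : 0 < lam δ₂)
    (h₃ : 0 < lam δ₃) :
    conv δ₂ (linkContr Q) (conv δ₁ (selfContr Q) (conv δ₃ (linkContr Q) F)) =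
      distAct Γ hM (selfFun Q δ₁ * (linkFun Q δ₂ * linkFun Q δ₃)) (linkInv Q δ₂ (linkInv Q δ₃ F)) := by
  have hb := hF.linkInv Q h₃
  rw [linkContr, conv_link hM Q hF h₃, selfContr, conv_self hM Q (hb.entire hM _) h₁,
    conv_link hM Q ((hb.entire hM _).entire hM _) h₂, linkInv_distAct hM Q (hb.entire hM _) h₂,
    linkInv_distAct hM Q hb h₂, distAct_mul, distAct_mul]
  exact distAct_comm hM _ _ _

include hM in
theorem conv_link_link_self (Q : Kˣ) (hF : Bdd lam F) (h₁ : 0 < lam δ₁) (h₂ : 0 < lam δ₂)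
    (h₃ : 0 < lam δ₃) :
    conv δ₂ (linkContr Q) (conv δ₃ (linkContr Q) (conv δ₁ (selfContr Q) F)) =
      distAct Γ hM (selfFun Q δ₁ * (linkFun Q δ₂ * linkFun Q δ₃)) (linkInv Q δ₂ (linkInv Q δ₃ F)) := by
  have hb := hF.linkInv Q h₃
  rw [linkContr, selfContr, conv_self hM Q hF h₁, conv_link hM Q (hF.entire hM _) h₃,
    linkInv_distAct hM Q hF h₃, conv_link hM Q ((hb.entire hM _).entire hM _) h₂,
    linkInv_distAct hM Q (hb.entire hM _) h₂, linkInv_distAct hM Q hb h₂, distAct_mul,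
    distAct_mul, distAct_comm hM (selfFun Q δ₁), distAct_comm hM (selfFun Q δ₁)]

/-- Expansions of `F / ((1 - Q^{-1} z^{±d₁}) (1 - Q^{-1} z^{±d₂}))` in the four possible regions have a
common divisor. -/
theorem exists_divisor₂ {Q : Kˣ} (hQ : Q ^ 2 ≠ 1) (d₁ d₂ : Γ) (hF : ∀ lam : Γ →+ ℤ, Bdd lam F)
    (hlam : ∀ x y : ℤ, ∃ lam : Γ →+ ℤ, lam d₁ = x ∧ lam d₂ = y) : ∃ ρ : Γ → M,
    linkInv Q (-d₁) (linkInv Q (-d₂) F) =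
      distAct Γ hM (linkDen Q d₁ * linkDen Q d₂) ρ ∧
    linkInv Q (-d₁) (linkInv Q d₂ F) =
      distAct Γ hM (linkDen Q d₁ * linkDen Q (-d₂)) ρ ∧
    linkInv Q d₁ (linkInv Q (-d₂) F) =
      distAct Γ hM (linkDen Q (-d₁) * linkDen Q d₂) ρ ∧
    linkInv Q d₁ (linkInv Q d₂ F) =
      distAct Γ hM (linkDen Q (-d₁) * linkDen Q (-d₂)) ρ := by
  obtain ⟨a, b, hab⟩ := exists_bezout hQ d₁
  obtain ⟨a', b', hab'⟩ := exists_bezout hQ d₂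
  -- One half space for each combination of expansion directions of the two denominators.
  obtain ⟨l₁, h₁, h₁'⟩ := hlam 1 1
  obtain ⟨l₂, h₂, h₂'⟩ := hlam 1 (-1)
  obtain ⟨l₃, h₃, h₃'⟩ := hlam (-1) 1
  obtain ⟨l₄, h₄, h₄'⟩ := hlam (-1) (-1)
  have eA := exists_divisor hM hab (F := linkInv Q (-d₁) (linkInv Q (-d₂) F))
    (G := linkInv Q d₁ (linkInv Q (-d₂) F)) (by
      rw [linkDen_linkInv hM (lam := l₄) Q ((hF _).linkInv Q (by simp [h₄'])) (by simp [h₄]),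
        linkDen_linkInv hM (lam := l₂) Q ((hF _).linkInv Q (by simp [h₂'])) (by simp [h₂])])
  have eB := exists_divisor hM hab (F := linkInv Q (-d₁) (linkInv Q d₂ F))
    (G := linkInv Q d₁ (linkInv Q d₂ F)) (by
      rw [linkDen_linkInv hM (lam := l₃) Q ((hF _).linkInv Q (by simp [h₃'])) (by simp [h₃]),
        linkDen_linkInv hM (lam := l₁) Q ((hF _).linkInv Q (by simp [h₁'])) (by simp [h₁])])
  have e1 : distAct Γ hM (linkDen Q (-d₂)) (linkInv Q (-d₁) (linkInv Q (-d₂) F)) =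
      linkInv Q (-d₁) F := by
    rw [← linkInv_distAct hM (lam := l₄) Q ((hF _).linkInv Q (by simp [h₄'])) (by simp [h₄]),
      linkDen_linkInv hM (lam := l₄) Q (hF _) (by simp [h₄'])]
  have e2 : distAct Γ hM (linkDen Q (-d₂)) (linkInv Q d₁ (linkInv Q (-d₂) F)) =
      linkInv Q d₁ F := by
    rw [← linkInv_distAct hM (lam := l₂) Q ((hF _).linkInv Q (by simp [h₂'])) (by simp [h₂]),
      linkDen_linkInv hM (lam := l₂) Q (hF _) (by simp [h₂'])]
  have e3 : distAct Γ hM (linkDen Q d₂) (linkInv Q (-d₁) (linkInv Q d₂ F)) =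
      linkInv Q (-d₁) F := by
    rw [← linkInv_distAct hM (lam := l₃) Q ((hF _).linkInv Q (by simp [h₃'])) (by simp [h₃]),
      linkDen_linkInv hM (lam := l₃) Q (hF _) (by simp [h₃'])]
  have e4 : distAct Γ hM (linkDen Q d₂) (linkInv Q d₁ (linkInv Q d₂ F)) =
      linkInv Q d₁ F := by
    rw [← linkInv_distAct hM (lam := l₁) Q ((hF _).linkInv Q (by simp [h₁'])) (by simp [h₁]),
      linkDen_linkInv hM (lam := l₁) Q (hF _) (by simp [h₁'])]
  -- For each expansion in the second variable, the two expansions in the first have a common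
  -- divisor. These two divisors are in turn two expansions in the second variable, and
  -- `exists_divisor` applies once more.
  have eC := exists_divisor hM hab'
    (F := distAct Γ hM b (linkInv Q (-d₁) (linkInv Q (-d₂) F)) +
      distAct Γ hM a (linkInv Q d₁ (linkInv Q (-d₂) F)))
    (G := distAct Γ hM b (linkInv Q (-d₁) (linkInv Q d₂ F)) +
      distAct Γ hM a (linkInv Q d₁ (linkInv Q d₂ F))) (by
      rw [map_add, map_add, distAct_comm hM _ b, distAct_comm hM _ a, distAct_comm hM _ b,
        distAct_comm hM _ a, e1, e2, e3, e4])
  obtain ⟨ρ, h5, h6⟩ : ∃ ρ, distAct Γ hM b (linkInv Q (-d₁) (linkInv Q (-d₂) F)) +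
      distAct Γ hM a (linkInv Q d₁ (linkInv Q (-d₂) F)) = distAct Γ hM (linkDen Q d₂) ρ ∧
      distAct Γ hM b (linkInv Q (-d₁) (linkInv Q d₂ F)) +
      distAct Γ hM a (linkInv Q d₁ (linkInv Q d₂ F)) = distAct Γ hM (linkDen Q (-d₂)) ρ := ⟨_, eC⟩
  rw [h5] at eA
  rw [h6] at eB
  simp only [distAct_mul]
  exact ⟨ρ, eA.1, eB.1, eA.2, eB.2⟩

theorem hasAdicSum_of_distAct₃ {M : Type*} [AddCommGroup M] [Module K⟦X⟧ M]
    (f g h : Entire K Γ) (F G H : Γ → M) (γ : Γ)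
    (h0 : ∀ N, distAct Γ (red_pow_smul N) f (fun γ => red K N (F γ)) γ +
      distAct Γ (red_pow_smul N) g (fun γ => red K N (G γ)) γ +
      distAct Γ (red_pow_smul N) h (fun γ => red K N (H γ)) γ = 0) :
    HasAdicSum K (fun d => f.coeffAt d • F (γ - d) + g.coeffAt d • G (γ - d) +
      h.coeffAt d • H (γ - d)) 0 := by
  classical
  refine (hasAdicSum_iff _ _).2 fun N => ?_
  obtain ⟨S, h1, hS⟩ := distAct_apply (red_pow_smul (M := M) N) f
  obtain ⟨S', h1', hS'⟩ := distAct_apply (red_pow_smul (M := M) N) g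
  obtain ⟨S'', h1'', hS''⟩ := distAct_apply (red_pow_smul (M := M) N) h
  refine ⟨S ∪ S' ∪ S'', fun d hd => ?_, ?_⟩
  · simp only [Finset.mem_union, not_or] at hd
    rw [map_add, map_add, map_smul, map_smul, map_smul, h1 d hd.1.1, h1' d hd.1.2, h1'' d hd.2,
      add_zero, add_zero]
  · rw [map_zero, ← h0 N, hS (S ∪ S' ∪ S'') (fun x hx => by simp [hx]),
      hS' (S ∪ S' ∪ S'') (fun x hx => by simp [hx]), hS'' (S ∪ S' ∪ S'') (fun x hx => by simp [hx]),
      ← Finset.sum_add_distrib, ← Finset.sum_add_distrib]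
    simp only [map_add, map_smul]

end Triple

/-! ### Modes of products of three vertex operators -/

section TripleModes

variable {K : Type*} [Field K] [CharZero K] {n : ℕ} (s : Kˣ) {Γ : Type*} [AddCommGroup Γ]

/-- Wick's theorem for three factors in convolution form. The hypotheses state that translation by
each δ moves degree between the two operators concerned. -/
theorem Vtx.mode_mode_mode (V V' V'' : Vtx K n) (f : FockPoly K n) (e₁ e₂ e₃ : Γ → ℤ)
    {δ₁₂ δ₁₃ δ₂₃ : Γ} (h₁₂ : ∀ γ (k : ℕ), e₁ (γ - k • δ₁₂) = e₁ γ + k ∧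
      e₂ (γ - k • δ₁₂) = e₂ γ - k ∧ e₃ (γ - k • δ₁₂) = e₃ γ)
    (h₁₃ : ∀ γ (k : ℕ), e₁ (γ - k • δ₁₃) = e₁ γ + k ∧
      e₂ (γ - k • δ₁₃) = e₂ γ ∧ e₃ (γ - k • δ₁₃) = e₃ γ - k)
    (h₂₃ : ∀ γ (k : ℕ), e₁ (γ - k • δ₂₃) = e₁ γ ∧
      e₂ (γ - k • δ₂₃) = e₂ γ + k ∧ e₃ (γ - k • δ₂₃) = e₃ γ - k) (γ : Γ) :
    V.mode s (e₁ γ) (V'.mode s (e₂ γ) (V''.mode s (e₃ γ) f)) =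
      conv δ₁₂ (expS (V.contr s V')) (conv δ₁₃ (expS (V.contr s V''))
        (conv δ₂₃ (expS (V'.contr s V'')) fun γ => no3 s V V' V'' (e₁ γ) (e₂ γ) (e₃ γ) f)) γ := by
  rw [mode_mode, conv]
  refine finsum_congr fun j => ?_
  rw [no2_mode, conv]
  refine congrArg _ (finsum_congr fun k => ?_)
  rw [conv]
  refine congrArg _ (finsum_congr fun l => ?_)
  obtain ⟨a1, a2, a3⟩ := h₁₂ γ j
  obtain ⟨b1, b2, b3⟩ := h₁₃ (γ - j • δ₁₂) k
  obtain ⟨c1, c2, c3⟩ := h₂₃ (γ - j • δ₁₂ - k • δ₁₃) l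
  rw [c1, c2, c3, b1, b2, b3, a1, a2, a3]
  rfl

/-- Reduction of an iterated product of one-sided series. -/
theorem red_conv {M : Type*} [AddCommGroup M] [Module K⟦X⟧ M] {lam : Γ →+ ℤ} {δ₁ δ₂ δ₃ : Γ}
    {F : Γ → M} (hF : Bdd lam F) (h₁ : 0 < lam δ₁) (h₂ : 0 < lam δ₂) (h₃ : 0 < lam δ₃)
    (C₁ C₂ C₃ : (K⟦X⟧)⟦X⟧) (N : ℕ) :
    (fun γ => red K N (conv δ₁ C₁ (conv δ₂ C₂ (conv δ₃ C₃ F)) γ)) =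
      conv δ₁ C₁ (conv δ₂ C₂ (conv δ₃ C₃ fun γ => red K N (F γ))) := by
  rw [conv_map (red K N) ((hF.series h₃ C₃).series h₂ C₂) h₁,
    conv_map (red K N) (hF.series h₃ C₃) h₂, conv_map (red K N) hF h₃]

end TripleModes

end

end EllipticAlgebra


set_option linter.unusedSectionVars false

namespace EllipticAlgebra

noncomputable section

/-! ### The cubic relation -/

section TripleReduction

variable {K : Type*} [Field K] [CharZero K] {n : ℕ} (s : Kˣ) {Γ : Type*} [AddCommGroup Γ]

/-- The reductions of the three products of two equal currents and a linked one. -/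
theorem red_triple {V V' : Vtx K n} {Q : Kˣ} (hVV : expS (V.contr s V) = selfContr Q)
    (hVV' : expS (V.contr s V') = linkContr Q) (hV'V : expS (V'.contr s V) = linkContr Q)
    (f : FockPoly K n) {π₁ π₂ : Γ →+ ℤ} {d₁ d₂ : Γ} (h11 : π₁ d₁ = 1) (h12 : π₁ d₂ = 0)
    (h21 : π₂ d₁ = 0) (h22 : π₂ d₂ = 1) {E : ℤ} {e : Γ → ℤ} (he : ∀ γ, e γ = E - π₁ γ - π₂ γ)
    {η : Γ → FockPoly K n} (hη : ∀ γ, η γ = Vtx.no3 s V V V' (π₁ γ) (π₂ γ) (e γ) f)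
    (hb : ∀ lam : Γ →+ ℤ, Bdd lam η) (N : ℕ) :
    (fun γ => red K N (V.mode s (π₁ γ) (V.mode s (π₂ γ) (V'.mode s (e γ) f)))) =
        distAct Γ (red_pow_smul N) (selfFun Q (d₂ - d₁) * (linkFun Q (-d₁) * linkFun Q (-d₂)))
          (linkInv Q (-d₁) (linkInv Q (-d₂) fun γ => red K N (η γ))) ∧
      (fun γ => red K N (V.mode s (π₁ γ) (V'.mode s (e γ) (V.mode s (π₂ γ) f)))) =
        distAct Γ (red_pow_smul N) (selfFun Q (d₂ - d₁) * (linkFun Q (-d₁) * linkFun Q d₂))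
          (linkInv Q (-d₁) (linkInv Q d₂ fun γ => red K N (η γ))) ∧
      (fun γ => red K N (V'.mode s (e γ) (V.mode s (π₁ γ) (V.mode s (π₂ γ) f)))) =
        distAct Γ (red_pow_smul N) (selfFun Q (d₂ - d₁) * (linkFun Q d₁ * linkFun Q d₂))
          (linkInv Q d₁ (linkInv Q d₂ fun γ => red K N (η γ))) := by
  have hr : ∀ lam : Γ →+ ℤ, Bdd lam fun γ => red K N (η γ) := fun lam => (hb lam).map _
  obtain rfl : η = _ := funext hη
  refine ⟨?_, ?_, ?_⟩
  -- The functional realizes the region |z₁| ≫ |z₂| ≫ |w| belonging to this order of the operators: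
  -- it is positive on the exponents of z₂/z₁, w/z₁ and w/z₂. The other two orders use different
  -- functionals.
  · have l1 : (0 : ℤ) < (-(2 : ℤ) • π₁ - π₂) (d₂ - d₁) := by simp [h11, h12, h21, h22]
    have l2 : (0 : ℤ) < (-(2 : ℤ) • π₁ - π₂) (-d₁) := by simp [h11, h21]
    have l3 : (0 : ℤ) < (-(2 : ℤ) • π₁ - π₂) (-d₂) := by simp [h12, h22]
    rw [← conv_self_link_link (red_pow_smul N) Q (hr _) l1 l2 l3, ← red_conv (hb _) l1 l2 l3]
    funext γ
    rw [Vtx.mode_mode_mode (δ₁₂ := d₂ - d₁) (δ₁₃ := -d₁) (δ₂₃ := -d₂) s V V V' f π₁ π₂ e, hVV, hVV']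
    all_goals
      intro γ k
      simp only [he, map_sub, map_nsmul, map_neg, h11, h12, h21, h22, nsmul_eq_mul]
      refine ⟨?_, ?_, ?_⟩ <;> ring
  · have l1 : (0 : ℤ) < (-π₁ + π₂) (d₂ - d₁) := by simp [h11, h12, h21, h22]
    have l2 : (0 : ℤ) < (-π₁ + π₂) (-d₁) := by simp [h11, h21]
    have l3 : (0 : ℤ) < (-π₁ + π₂) d₂ := by simp [h12, h22]
    rw [← conv_link_self_link (red_pow_smul N) Q (hr _) l1 l2 l3, ← red_conv (hb _) l2 l1 l3]
    funext γ
    rw [Vtx.mode_mode_mode (δ₁₂ := -d₁) (δ₁₃ := d₂ - d₁) (δ₂₃ := d₂) s V V' V f π₁ e π₂, hVV, hVV',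
      hV'V]
    · simp only [Vtx.no3_swap_right s V V V']
    all_goals
      intro γ k
      simp only [he, map_sub, map_nsmul, map_neg, h11, h12, h21, h22, nsmul_eq_mul]
      refine ⟨?_, ?_, ?_⟩ <;> ring
  · have l1 : (0 : ℤ) < (π₁ + (2 : ℤ) • π₂) (d₂ - d₁) := by simp [h11, h12, h21, h22]
    have l2 : (0 : ℤ) < (π₁ + (2 : ℤ) • π₂) d₁ := by simp [h11, h21]
    have l3 : (0 : ℤ) < (π₁ + (2 : ℤ) • π₂) d₂ := by simp [h12, h22]
    rw [← conv_link_link_self (red_pow_smul N) Q (hr _) l1 l2 l3, ← red_conv (hb _) l2 l3 l1]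
    funext γ
    rw [Vtx.mode_mode_mode (δ₁₂ := d₁) (δ₁₃ := d₂) (δ₂₃ := d₂ - d₁) s V' V V f e π₁ π₂, hVV, hV'V]
    · simp only [Vtx.no3_swap_left s V V' V, Vtx.no3_swap_right s V V V']
    all_goals
      intro γ k
      simp only [he, map_sub, map_nsmul, h11, h12, h21, h22, nsmul_eq_mul]
      refine ⟨?_, ?_, ?_⟩ <;> ring

theorem no3_support_finite (V V' V'' : Vtx K n) (E : ℤ) (f : FockPoly K n) :
    (Function.support fun γ : ℤ × ℤ => Vtx.no3 s V V' V'' γ.1 γ.2 (E - γ.1 - γ.2) f).Finite := by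
  obtain ⟨D, hD⟩ := Vtx.exists_mem f
  refine (((Set.finite_Icc (-(D : ℤ)) (E + 2 * D)).prod
    (Set.finite_Icc (-(D : ℤ)) (E + 2 * D)))).subset fun γ hγ => ?_
  by_contra h
  refine hγ (Vtx.no3_eq_zero s V V' V'' (hD D le_rfl) ?_)
  simp only [Set.mem_prod, Set.mem_Icc] at h
  omega

end TripleReduction

end

end EllipticAlgebra


set_option linter.unusedSectionVars false

namespace EllipticAlgebra

noncomputable section

/-! ### The cubic relation for vertex operators without their lattice part. -/

section Cubic

variable {K : Type*} [Field K] [CharZero K] {n i : ℕ} {s : Kˣ} (hs : ∀ k : ℕ, 0 < k → s ^ k ≠ 1)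

theorem G_mul_selfFun' (s : Kˣ) (σ : ℤˣ) {Γ : Type*} [AddCommGroup Γ] (δ δ' : Γ) :
    G s (-σ) 2 (δ - δ') * (mono 1 (δ + δ) * selfFun (q s ^ (σ : ℤ)) (δ' - δ)) =
      G s σ 2 (δ - δ') * (mono 1 (δ' + δ') * selfFun (q s ^ (σ : ℤ)) (δ - δ')) := by
  have h := G_mul_selfFun s σ (δ - δ')
  rw [neg_sub] at h
  have h1 : (mono 1 (δ + δ) : Entire K Γ) = mono 1 (δ' + δ') * mono 1 (δ - δ' + (δ - δ')) := by
    rw [mono_mul, mul_one]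
    congr 1
    abel
  rw [h1, mul_left_comm (G s σ 2 (δ - δ')), ← h]
  ring

theorem regroup₀ {R : Type*} [CommRing R] (m S l l' u u' : R) :
    m * S * (l * u * (l' * u')) = m * (S * (l * l') * (u * u')) := by
  ring

theorem regroup₁ {R : Type*} [CommRing R] {m m₁ m₂ S l l' u u' : R} (h : m₁ * m₂ = m) :
    m₁ * S * (m₂ * l * u * (l' * u')) = m * (S * (l * l') * (u * u')) := by
  rw [← h]; ring

theorem regroup₂ {R : Type*} [CommRing R] {m m₁ m₂ m₃ S l l' u u' : R} (h : m₁ * m₂ * m₃ = m) :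
    m₁ * S * (m₂ * l * u * (m₃ * l' * u')) = m * (S * (l * l') * (u * u')) := by
  rw [← h]; ring

theorem mono_shift₁ {Γ : Type*} [AddCommGroup Γ] (δ : Γ) :
    mono (1 : K) (δ + δ) * mono 1 (-δ) = mono 1 δ := by
  rw [mono_mul, mul_one, add_neg_cancel_right]

theorem mono_shift₂ {Γ : Type*} [AddCommGroup Γ] (δ δ' : Γ) :
    mono (1 : K) (δ + δ) * mono 1 (-δ) * mono 1 (-δ') = mono 1 (δ - δ') := by
  rw [mono_shift₁, mono_mul, mul_one, sub_eq_add_neg]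

theorem distAct_cubic {M : Type*} [AddCommGroup M] [Module K⟦X⟧ M] {N : ℕ}
    (hM : ∀ u : M, (PowerSeries.X ^ N : K⟦X⟧) • u = 0) {Γ : Type*} [AddCommGroup Γ]
    {H₀ H H' S S' t₁ t₂ t₁' t₂' : Entire K Γ}
    (h : H₀ * (S + S') * (t₁ * t₂ + t₁' * t₂') + H * (S * (t₁ * t₂')) + H' * (S' * (t₂ * t₁')) = 0)
    {ρ A A' B B' C C' : Γ → M} (hA : A = distAct Γ hM (S * (t₁ * t₂)) ρ)
    (hA' : A' = distAct Γ hM (S' * (t₂ * t₁)) ρ) (hB : B = distAct Γ hM (S * (t₁ * t₂')) ρ)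
    (hB' : B' = distAct Γ hM (S' * (t₂ * t₁')) ρ) (hC : C = distAct Γ hM (S * (t₁' * t₂')) ρ)
    (hC' : C' = distAct Γ hM (S' * (t₂' * t₁')) ρ) (γ : Γ) :
    distAct Γ hM H₀ (A + C + A' + C') γ + distAct Γ hM H B γ + distAct Γ hM H' B' γ = 0 := by
  rw [hA, hA', hB, hB', hC, hC', ← distAct_add, ← distAct_add, ← distAct_add, ← distAct_mul,
    ← distAct_mul, ← distAct_mul, ← Pi.add_apply, ← Pi.add_apply, ← distAct_add, ← distAct_add]
  rw [show H₀ * (S * (t₁ * t₂) + S * (t₁' * t₂') + S' * (t₂ * t₁) + S' * (t₂' * t₁')) +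
    H * (S * (t₁ * t₂')) + H' * (S' * (t₂ * t₁')) = 0 by rw [← h]; ring, map_zero]
  rfl

include hs in
-- All six orderings are entire multiples of one distribution ρ, so the relation follows from an
-- identity of entire functions. The shifted arguments in the hypotheses absorb the powers z^{∂}
-- coming from the lattice part.
theorem cubic_modes (σ : ℤˣ) {a b : Fin (n - 1)} (hab : CartanMatrix.A (n - 1) a b = -1)
    {H₀ H H' : Entire K (ℤ × ℤ)}
    (hH : algebraMap _ (FractionRing (Entire K (ℤ × ℤ))) H =
      algebraMap _ (FractionRing (Entire K (ℤ × ℤ))) H₀ * hFrac s (1, 0) (0, 1))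
    (hH' : algebraMap _ (FractionRing (Entire K (ℤ × ℤ))) H' =
      algebraMap _ (FractionRing (Entire K (ℤ × ℤ))) H₀ * hFrac s (0, 1) (1, 0))
    (E : ℤ) (f : FockPoly K n) {A A' B B' C C' : ℤ × ℤ → FockPoly K n}
    (hA : ∀ γ, A (γ + ((1, 0) - (0, 1))) = (xV s σ a).mode s γ.1 ((xV s σ a).mode s γ.2
      ((xV s σ b).mode s (E - γ.1 - γ.2) f)))
    (hA' : ∀ γ, A' (γ + ((0, 1) - (1, 0))) = (xV s σ a).mode s γ.2 ((xV s σ a).mode s γ.1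
      ((xV s σ b).mode s (E - γ.1 - γ.2) f)))
    (hB : ∀ γ, B (γ + (1, 0)) = (xV s σ a).mode s γ.1 ((xV s σ b).mode s (E - γ.1 - γ.2)
      ((xV s σ a).mode s γ.2 f)))
    (hB' : ∀ γ, B' (γ + (0, 1)) = (xV s σ a).mode s γ.2 ((xV s σ b).mode s (E - γ.1 - γ.2)
      ((xV s σ a).mode s γ.1 f)))
    (hC : ∀ γ, C (γ + ((1, 0) + (1, 0))) = (xV s σ b).mode s (E - γ.1 - γ.2)
      ((xV s σ a).mode s γ.1 ((xV s σ a).mode s γ.2 f)))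
    (hC' : ∀ γ, C' (γ + ((0, 1) + (0, 1))) = (xV s σ b).mode s (E - γ.1 - γ.2)
      ((xV s σ a).mode s γ.2 ((xV s σ a).mode s γ.1 f))) (γ : ℤ × ℤ) :
    HasAdicSum K (fun d => H₀.coeffAt d • (A + C + A' + C') (γ - d) + H.coeffAt d • B (γ - d) +
      H'.coeffAt d • B' (γ - d)) 0 := by
  have hVV : expS ((xV s σ a).contr s (xV s σ a)) = selfContr (q s ^ (σ : ℤ)) :=
    expS_contr_self hs σ a
  have hVV' : expS ((xV s σ a).contr s (xV s σ b)) = linkContr (q s ^ (σ : ℤ)) :=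
    expS_contr_link hs σ hab
  have hV'V : expS ((xV s σ b).contr s (xV s σ a)) = linkContr (q s ^ (σ : ℤ)) :=
    expS_contr_link hs σ (by rw [cartan_symm, hab])
  have hQ := q_zpow_sq_ne_one hs σ
  have link : ∀ δ : ℤ × ℤ, G s (-σ) (-1) δ *
      (mono 1 (-δ) * linkFun (q s ^ (σ : ℤ)) (-δ) * linkDen (q s ^ (σ : ℤ)) δ) =
      -(G s σ (-1) δ * (linkFun (q s ^ (σ : ℤ)) δ * linkDen (q s ^ (σ : ℤ)) (-δ))) :=
    fun δ => G_mul_linkFun s σ δ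
  -- Here S, S' are the self-contractions in the two orders of z₁, z₂, and t_i, t_i' the
  -- contractions of z_i with w in the two orders, each multiplied by the opposite denominator and,
  -- except for t_i', by a normalizing monomial.
  have cub := cubic_identity hs σ hH hH' (G_mul_selfFun' s σ (1, 0) (0, 1))
    (G_mul_selfFun' s σ (0, 1) (1, 0)) (link (1, 0)) (link (0, 1))
  clear link hH hH'
  generalize xV s σ a = V at *
  generalize xV s σ b = V' at *
  generalize q s ^ (σ : ℤ) = Q at *
  have hfin := no3_support_finite s V V V' E f
  set η : ℤ × ℤ → FockPoly K n := fun γ => Vtx.no3 s V V V' γ.1 γ.2 (E - γ.1 - γ.2) f with hη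
  have hb : ∀ lam : ℤ × ℤ →+ ℤ, Bdd lam η := fun lam => bdd_of_finite lam hfin
  refine hasAdicSum_of_distAct₃ _ _ _ _ _ _ _ fun N => ?_
  have hr : ∀ lam : ℤ × ℤ →+ ℤ, Bdd lam fun γ => red K N (η γ) := fun lam => (hb lam).map _
  obtain ⟨r1, r2, r3⟩ := red_triple s hVV hVV' hV'V f (π₁ := AddMonoidHom.fst ℤ ℤ)
    (π₂ := AddMonoidHom.snd ℤ ℤ) (d₁ := (1, 0)) (d₂ := (0, 1)) rfl rfl rfl rfl (E := E)
    (e := fun γ => E - γ.1 - γ.2) (fun _ => rfl) (η := η) (fun _ => rfl) hb N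
  obtain ⟨r1', r2', r3'⟩ := red_triple s hVV hVV' hV'V f (π₁ := AddMonoidHom.snd ℤ ℤ)
    (π₂ := AddMonoidHom.fst ℤ ℤ) (d₁ := (0, 1)) (d₂ := (1, 0)) rfl rfl rfl rfl (E := E)
    (e := fun γ => E - γ.1 - γ.2) (fun _ => sub_right_comm _ _ _) (η := η)
    (fun _ => (Vtx.no3_swap_left s V V V' _ _ _ f).symm) hb N
  have hlam : ∀ x y : ℤ, ∃ lam : ℤ × ℤ →+ ℤ, lam (1, 0) = x ∧ lam (0, 1) = y := fun x y =>
    ⟨(AddMonoidHom.mulLeft x).comp (AddMonoidHom.fst ℤ ℤ) +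
      (AddMonoidHom.mulLeft y).comp (AddMonoidHom.snd ℤ ℤ), by simp, by simp⟩
  obtain ⟨ρ, hρ1, hρ2, hρ3, hρ4⟩ := exists_divisor₂ (red_pow_smul N) hQ (1, 0) (0, 1) hr hlam
  have comm : ∀ δ δ' : ℤ × ℤ, (∃ lam : ℤ × ℤ →+ ℤ, 0 < lam δ ∧ 0 < lam δ') →
      linkInv Q δ (linkInv Q δ' fun γ => red K N (η γ)) =
        linkInv Q δ' (linkInv Q δ fun γ => red K N (η γ)) := fun δ δ' ⟨lam, h, h'⟩ =>
    linkInv_comm (red_pow_smul N) Q (hr lam) h h'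
  -- With z₁ and z₂ exchanged the two divisions come out in reverse order; they commute because a
  -- half space contains both directions.
  rw [comm (-(0, 1)) (-(1, 0)) (by
    obtain ⟨lam, h, h'⟩ := hlam (-1) (-1); exact ⟨lam, by rw [map_neg, h']; simp, by rw [map_neg, h]; simp⟩)] at r1'
  rw [comm (-(0, 1)) (1, 0) (by
    obtain ⟨lam, h, h'⟩ := hlam 1 (-1); exact ⟨lam, by rw [map_neg, h']; simp, by rw [h]; simp⟩)] at r2'
  rw [comm (0, 1) (1, 0) (by
    obtain ⟨lam, h, h'⟩ := hlam 1 1; exact ⟨lam, by rw [h']; simp, by rw [h]; simp⟩)] at r3'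
  rw [hρ1, ← distAct_mul] at r1 r1'
  rw [hρ2, ← distAct_mul] at r2
  rw [hρ3, ← distAct_mul] at r2'
  rw [hρ4, ← distAct_mul] at r3 r3'
  have shift : ∀ {F F' : ℤ × ℤ → FockPoly K n} {δ : ℤ × ℤ} {h h' : Entire K (ℤ × ℤ)},
      (∀ γ, F (γ + δ) = F' γ) → (fun γ => red K N (F' γ)) = distAct (ℤ × ℤ) (red_pow_smul N) h ρ →
      h' = mono 1 δ * h → (fun γ => red K N (F γ)) = distAct (ℤ × ℤ) (red_pow_smul N) h' ρ := by
    intro F F' δ h h' h1 h2 h3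
    rw [h3, distAct_mul, ← h2, distAct_mono]
    funext γ
    rw [← h1, sub_add_cancel]
  have key := distAct_cubic (red_pow_smul N) cub (shift hA r1 ?_) (shift hA' r1' ?_)
    (shift hB r2 ?_) (shift hB' r2' ?_) (shift hC r3 ?_) (shift hC' r3' ?_) γ
  · exact key
  · exact regroup₂ (mono_shift₂ (1, 0) (0, 1))
  · exact (regroup₂ (mono_shift₂ (0, 1) (1, 0))).trans (by rw [mul_comm (linkDen Q (0, 1))])
  · exact regroup₁ (mono_shift₁ (1, 0))
  · exact (regroup₁ (mono_shift₁ (0, 1))).trans (by rw [mul_comm (linkDen Q (0, 1))])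
  · exact regroup₀ _ _ _ _ _ _
  · exact (regroup₀ _ _ _ _ _ _).trans (by rw [mul_comm (linkDen Q (-(0, 1)))])

end Cubic

end

end EllipticAlgebra


set_option linter.unusedSectionVars false

namespace EllipticAlgebra

noncomputable section

/-! ### The cubic relation on the Fock space. -/

section Serre

variable {K : Type*} [Field K] [CharZero K] {n i : ℕ} {s : Kˣ} (hs : ∀ k : ℕ, 0 < k → s ^ k ≠ 1)

theorem x_x_x_single (σ : ℤˣ) (a b c : Fin (n - 1)) (m₁ m₂ l : ℤ) (β : Coset n i)
    (f : FockPoly K n) :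
    (fockCurrents s n i).x σ a m₁ ((fockCurrents s n i).x σ b m₂
      ((fockCurrents s n i).x σ c l (Finsupp.single β f))) =
      (xSign K σ a ((β.shift σ c).shift σ b) * (xSign K σ b (β.shift σ c) * xSign K σ c β)) •
        Finsupp.single (((β.shift σ c).shift σ b).shift σ a)
          ((xV s σ a).mode s
            (xExp σ a m₁ β - CartanMatrix.A (n - 1) a b - CartanMatrix.A (n - 1) a c)
            ((xV s σ b).mode s (xExp σ b m₂ β - CartanMatrix.A (n - 1) b c)
              ((xV s σ c).mode s (xExp σ c l β) f))) := by
  have hσ : (σ : ℤ) * σ = 1 := by rw [← Units.val_mul, Int.units_mul_self, Units.val_one]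
  have e1 : xExp σ a m₁ ((β.shift σ c).shift σ b) =
      xExp σ a m₁ β - CartanMatrix.A (n - 1) a b - CartanMatrix.A (n - 1) a c := by
    rw [xExp, xExp, pairing_shift, pairing_shift]
    linear_combination (-CartanMatrix.A (n - 1) a b - CartanMatrix.A (n - 1) a c) * hσ
  rw [x_x_single, map_smul, x_single', smul_smul, hσ, one_mul, e1, mul_comm]

theorem xSign_link (σ : ℤˣ) {a b : Fin (n - 1)} (hab : CartanMatrix.A (n - 1) a b = -1)
    (β : Coset n i) : xSign K σ a (β.shift σ b) * xSign K σ b β =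
      -(xSign K σ b (β.shift σ a) * xSign K σ a β) := by
  rw [xSign_swap, hab, zpow_neg, zpow_one, inv_neg, inv_one, Units.val_neg, Units.val_one,
    Int.cast_neg, Int.cast_one, neg_one_mul]

theorem cubic_single {R M ι : Type*} [CommRing R] [AddCommGroup M] [Module R M] (h h' h'' c : R)
    (β : ι) (A A' B B' C C' : M) :
    c • Finsupp.single β (h • (A + C + A' + C') + h' • B + h'' • B') =
      h • (c • Finsupp.single β A + c • Finsupp.single β C + c • Finsupp.single β A' +
        c • Finsupp.single β C') - h' • (-c) • Finsupp.single β B -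
        h'' • (-c) • Finsupp.single β B' := by
  simp only [Finsupp.single_add, ← Finsupp.smul_single, smul_add, neg_smul, smul_neg,
    sub_neg_eq_add, smul_comm c]

theorem add_triple {R M : Type*} [CommRing R] [AddCommGroup M] [Module R M] (h h' h'' : R)
    (A A' B B' C C' a a' b b' c c' : M) :
    h • ((A + a) + (C + c) + (A' + a') + (C' + c')) - h' • (B + b) - h'' • (B' + b') =
      (h • (A + C + A' + C') - h' • B - h'' • B') + (h • (a + c + a' + c') - h' • b - h'' • b') := by
  simp only [smul_add]
  abel

theorem zero_triple {R M : Type*} [CommRing R] [AddCommGroup M] [Module R M] (h h' h'' : R) :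
    h • ((0 : M) + 0 + 0 + 0) - h' • (0 : M) - h'' • (0 : M) = 0 := by
  simp

include hs in
theorem fock_serre (σ : ℤˣ) (a b : Fin (n - 1)) (hab : CartanMatrix.A (n - 1) a b = -1)
    (H₀ H H' : Entire K (ℤ × ℤ))
    (hH : algebraMap _ (FractionRing (Entire K (ℤ × ℤ))) H =
      algebraMap _ (FractionRing (Entire K (ℤ × ℤ))) H₀ * hFrac s (1, 0) (0, 1))
    (hH' : algebraMap _ (FractionRing (Entire K (ℤ × ℤ))) H' =
      algebraMap _ (FractionRing (Entire K (ℤ × ℤ))) H₀ * hFrac s (0, 1) (1, 0))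
    (m₁ m₂ l : ℤ) (u : Fock K n i) : HasAdicSum K
      (fun d : ℤ × ℤ =>
        H₀.coeffAt d •
          ((fockCurrents s n i).x σ a (m₁ + d.1) ((fockCurrents s n i).x σ a (m₂ + d.2)
              ((fockCurrents s n i).x σ b (l - d.1 - d.2) u)) +
            (fockCurrents s n i).x σ b (l - d.1 - d.2) ((fockCurrents s n i).x σ a (m₁ + d.1)
              ((fockCurrents s n i).x σ a (m₂ + d.2) u)) +
            (fockCurrents s n i).x σ a (m₂ + d.2) ((fockCurrents s n i).x σ a (m₁ + d.1)
              ((fockCurrents s n i).x σ b (l - d.1 - d.2) u)) +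
            (fockCurrents s n i).x σ b (l - d.1 - d.2) ((fockCurrents s n i).x σ a (m₂ + d.2)
              ((fockCurrents s n i).x σ a (m₁ + d.1) u))) -
          H.coeffAt d • (fockCurrents s n i).x σ a (m₁ + d.1)
            ((fockCurrents s n i).x σ b (l - d.1 - d.2)
              ((fockCurrents s n i).x σ a (m₂ + d.2) u)) -
          H'.coeffAt d • (fockCurrents s n i).x σ a (m₂ + d.2)
            ((fockCurrents s n i).x σ b (l - d.1 - d.2)
              ((fockCurrents s n i).x σ a (m₁ + d.1) u)))
      0 := by
  induction u using Finsupp.induction_linear with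
  | zero =>
    simp only [map_zero]
    refine Eq.mp (congrArg (fun F => HasAdicSum K F (0 : Fock K n i)) (funext fun d => ?_))
      (hasAdicSum_zero (ι := ℤ × ℤ))
    exact (zero_triple (M := Fock K n i) _ _ _).symm
  | add u v hu hv =>
    have h := hu.add hv
    rw [add_zero] at h
    refine Eq.mp (congrArg (fun F => HasAdicSum K F (0 : Fock K n i)) (funext fun d => ?_)) h
    simp only [map_add]
    exact (add_triple (M := Fock K n i) _ _ _ _ _ _ _ _ _ _ _ _ _ _ _).symm
  | single β f =>
    have hba : CartanMatrix.A (n - 1) b a = -1 := by rw [cartan_symm, hab]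
    have hσ : (σ : ℤ) * σ = 1 := by rw [← Units.val_mul, Int.units_mul_self, Units.val_one]
    have e1 : ∀ m r, xExp σ a (m + r) β = xExp σ a m β - r := fun m r => by
      simp only [xExp]; ring
    have e2 : ∀ r r', xExp σ b (l - r - r') β = xExp σ b l β + r + r' := fun r r' => by
      simp only [xExp]; ring
    have s1 := xSign_link (K := K) σ hab β
    have s2 := xSign_link (K := K) σ hab (β.shift σ a)
    set E := xExp σ a m₁ β + xExp σ a m₂ β + xExp σ b l β with hE
    have key := cubic_modes hs σ hab hH hH' E f
      (A := fun γ => (xV s σ a).mode s (γ.1 - 1) ((xV s σ a).mode s (γ.2 + 1)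
        ((xV s σ b).mode s (E - γ.1 - γ.2) f)))
      (A' := fun γ => (xV s σ a).mode s (γ.2 - 1) ((xV s σ a).mode s (γ.1 + 1)
        ((xV s σ b).mode s (E - γ.1 - γ.2) f)))
      (B := fun γ => (xV s σ a).mode s (γ.1 - 1) ((xV s σ b).mode s (E - γ.1 - γ.2 + 1)
        ((xV s σ a).mode s γ.2 f)))
      (B' := fun γ => (xV s σ a).mode s (γ.2 - 1) ((xV s σ b).mode s (E - γ.1 - γ.2 + 1)
        ((xV s σ a).mode s γ.1 f)))
      (C := fun γ => (xV s σ b).mode s (E - γ.1 - γ.2 + 2)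
        ((xV s σ a).mode s (γ.1 - 2) ((xV s σ a).mode s γ.2 f)))
      (C' := fun γ => (xV s σ b).mode s (E - γ.1 - γ.2 + 2)
        ((xV s σ a).mode s (γ.2 - 2) ((xV s σ a).mode s γ.1 f)))
      (by rintro ⟨x, y⟩; simp only [Prod.mk_sub_mk, Prod.mk_add_mk]; ring_nf)
      (by rintro ⟨x, y⟩; simp only [Prod.mk_sub_mk, Prod.mk_add_mk]; ring_nf)
      (by rintro ⟨x, y⟩; simp only [Prod.mk_add_mk]; ring_nf)
      (by rintro ⟨x, y⟩; simp only [Prod.mk_add_mk]; ring_nf)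
      (by rintro ⟨x, y⟩; simp only [Prod.mk_add_mk]; ring_nf)
      (by rintro ⟨x, y⟩; simp only [Prod.mk_add_mk]; ring_nf)
      (xExp σ a m₁ β, xExp σ a m₂ β)
    have h1 := key.smul_single
      (xSign K σ b ((β.shift σ a).shift σ a) * (xSign K σ a (β.shift σ a) * xSign K σ a β))
      (((β.shift σ a).shift σ a).shift σ b)
    rw [Finsupp.single_zero, smul_zero] at h1
    refine Eq.mp (congrArg (fun F => HasAdicSum K F (0 : Fock K n i)) (funext fun d => ?_)) h1
    -- Moving x_j past one x_i changes the lattice sign, past two it does not. This turns the plus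
    -- signs of `cubic_modes` before H and H' into the minus signs of the relation.
    have c1 : xSign K σ a ((β.shift σ a).shift σ b) * (xSign K σ b (β.shift σ a) * xSign K σ a β) =
        -(xSign K σ b ((β.shift σ a).shift σ a) * (xSign K σ a (β.shift σ a) * xSign K σ a β)) := by
      rw [← mul_assoc, s2, neg_mul, mul_assoc]
    have c2 : xSign K σ a ((β.shift σ a).shift σ b) * (xSign K σ a (β.shift σ b) * xSign K σ b β) =
        xSign K σ b ((β.shift σ a).shift σ a) * (xSign K σ a (β.shift σ a) * xSign K σ a β) := by
      rw [s1, mul_neg, c1, neg_neg]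
    rw [x_x_x_single, x_x_x_single, x_x_x_single, x_x_x_single, x_x_x_single, x_x_x_single,
      Coset.shift_comm σ σ b a β,
      Coset.shift_comm σ σ b a (β.shift σ a), c1, c2, cartan_self,
      hab, hba, e1, e1, e2]
    have f1 : E - (xExp σ a m₁ β - d.1) - (xExp σ a m₂ β - d.2) = xExp σ b l β + d.1 + d.2 := by
      rw [hE]; ring
    simp only [Pi.add_apply, Prod.fst_sub, Prod.snd_sub, f1, sub_neg_eq_add]
    have f2 : ∀ x : ℤ, x - 2 + 1 = x - 1 := fun x => by ring
    have f3 : ∀ x : ℤ, x + 1 - 2 = x - 1 := fun x => by ring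
    have f4 : ∀ x : ℤ, x + 1 + 1 = x + 2 := fun x => by ring
    simp only [f2, f3, f4]
    exact cubic_single (M := FockPoly K n) _ _ _ _ _ _ _ _ _ _ _

end Serre

end

end EllipticAlgebra


set_option linter.unusedSectionVars false

namespace EllipticAlgebra

noncomputable section

/-! ### Commuting operators on the Fock space -/

section FockCommute

variable {K : Type*} [Field K] {n i : ℕ}

theorem onFock_commute {S T : Module.End K⟦X⟧ (FockPoly K n)} (h : Commute S T) :
    Commute (onFock S : Module.End K⟦X⟧ (Fock K n i)) (onFock T) := by
  refine Finsupp.lhom_ext fun β f => ?_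
  rw [Module.End.mul_apply, Module.End.mul_apply, onFock_single, onFock_single, onFock_single,
    onFock_single]
  exact congrArg _ (LinearMap.congr_fun h f)

theorem onFock_qPartial_commute (T : Module.End K⟦X⟧ (FockPoly K n)) (s : Kˣ) (m : ℤ)
    (j : Fin (n - 1)) : Commute (onFock T : Module.End K⟦X⟧ (Fock K n i)) (qPartial s m j) := by
  refine Finsupp.lhom_ext fun β f => ?_
  rw [Module.End.mul_apply, Module.End.mul_apply, onFock_single, qPartial_single, qPartial_single,
    map_smul, onFock_single]

theorem qPartial_commute (s : Kˣ) (m m' : ℤ) (j l : Fin (n - 1)) :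
    Commute (qPartial s m j : Module.End K⟦X⟧ (Fock K n i)) (qPartial s m' l) := by
  refine Finsupp.lhom_ext fun β f => ?_
  rw [Module.End.mul_apply, Module.End.mul_apply, qPartial_single, map_smul, qPartial_single,
    map_smul, qPartial_single, smul_comm]

theorem aCre_commute (j l : Fin (n - 1)) (k m : ℕ+) :
    Commute (aCre j k : Module.End K⟦X⟧ (FockPoly K n)) (aCre l m) :=
  LinearMap.ext fun _ => mul_left_comm _ _ _

theorem bCre_commute (j l : Fin (n - 1)) (k m : ℕ+) :
    Commute (bCre j k : Module.End K⟦X⟧ (FockPoly K n)) (bCre l m) :=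
  LinearMap.ext fun _ => mul_left_comm _ _ _

theorem aAnn_commute (s : Kˣ) (j l : Fin (n - 1)) (k m : ℕ+) :
    Commute (aAnn s j k : Module.End K⟦X⟧ (FockPoly K n)) (aAnn s l m) :=
  Vtx.derivation_comm _ _ (fun _ => ⟨_, MvPolynomial.mkDerivation_X _ _ _⟩)
    fun _ => ⟨_, MvPolynomial.mkDerivation_X _ _ _⟩

theorem bAnn_commute (s : Kˣ) (j l : Fin (n - 1)) (k m : ℕ+) :
    Commute (bAnn s j k : Module.End K⟦X⟧ (FockPoly K n)) (bAnn s l m) :=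
  Vtx.derivation_comm _ _ (fun _ => ⟨_, MvPolynomial.mkDerivation_X _ _ _⟩)
    fun _ => ⟨_, MvPolynomial.mkDerivation_X _ _ _⟩

theorem bAnn_aCre_commute (s : Kˣ) (j l : Fin (n - 1)) (k m : ℕ+) :
    Commute (bAnn s j k : Module.End K⟦X⟧ (FockPoly K n)) (aCre l m) := by
  refine LinearMap.ext fun f => ?_
  simp [bAnn, aCre, bComm, Derivation.leibniz, MvPolynomial.mkDerivation_X]

theorem aAnn_bCre_commute (s : Kˣ) (j l : Fin (n - 1)) (k m : ℕ+) :
    Commute (aAnn s j k : Module.End K⟦X⟧ (FockPoly K n)) (bCre l m) := by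
  refine LinearMap.ext fun f => ?_
  simp [aAnn, bCre, aComm, Derivation.leibniz, MvPolynomial.mkDerivation_X]

theorem aBar_one (s : Kˣ) (j : Fin (n - 1)) (k : ℕ+) : (fockCurrents s n i).aBar 1 j k =
    onFock ((PowerSeries.C ((q s : K) - ((q s)⁻¹ : Kˣ)) * PowerSeries.X ^ (k : ℕ) : K⟦X⟧) •
      bAnn s j k) := by
  simp only [fockCurrents, if_true]

theorem aBar_neg_one (s : Kˣ) (j : Fin (n - 1)) (k : ℕ+) : (fockCurrents s n i).aBar (-1) j k =
    onFock ((-PowerSeries.C ((q s : K) - ((q s)⁻¹ : Kˣ)) : K⟦X⟧) • aCre j k) := by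
  simp only [fockCurrents, if_neg (show ¬(-1 : ℤˣ) = 1 by decide)]

theorem bBar_one (s : Kˣ) (j : Fin (n - 1)) (k : ℕ+) : (fockCurrents s n i).bBar 1 j k =
    onFock ((PowerSeries.C ((q s : K) - ((q s)⁻¹ : Kˣ)) : K⟦X⟧) • aAnn s j k) := by
  simp only [fockCurrents, if_true]

theorem bBar_neg_one (s : Kˣ) (j : Fin (n - 1)) (k : ℕ+) : (fockCurrents s n i).bBar (-1) j k =
    onFock ((-(PowerSeries.C ((q s : K) - ((q s)⁻¹ : Kˣ)) * PowerSeries.X ^ (k : ℕ)) : K⟦X⟧) •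
      bCre j k) := by
  simp only [fockCurrents, if_neg (show ¬(-1 : ℤˣ) = 1 by decide)]

theorem fock_aBar_comm (s : Kˣ) (σ τ : ℤˣ) (j l : Fin (n - 1)) (k m : ℕ+) :
    Commute ((fockCurrents s n i).aBar σ j k) ((fockCurrents s n i).aBar τ l m) := by
  rcases Int.units_eq_one_or σ with rfl | rfl <;> rcases Int.units_eq_one_or τ with rfl | rfl <;>
    simp only [aBar_one, aBar_neg_one] <;>
    refine onFock_commute (Commute.smul_left (Commute.smul_right ?_ _) _)
  exacts [bAnn_commute .., bAnn_aCre_commute .., (bAnn_aCre_commute ..).symm, aCre_commute ..]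

theorem fock_bBar_comm (s : Kˣ) (σ τ : ℤˣ) (j l : Fin (n - 1)) (k m : ℕ+) :
    Commute ((fockCurrents s n i).bBar σ j k) ((fockCurrents s n i).bBar τ l m) := by
  rcases Int.units_eq_one_or σ with rfl | rfl <;> rcases Int.units_eq_one_or τ with rfl | rfl <;>
    simp only [bBar_one, bBar_neg_one] <;>
    refine onFock_commute (Commute.smul_left (Commute.smul_right ?_ _) _)
  exacts [aAnn_commute .., aAnn_bCre_commute .., (aAnn_bCre_commute ..).symm, bCre_commute ..]

theorem fock_aBar_aZero_comm (s : Kˣ) (σ : ℤˣ) (j l : Fin (n - 1)) (k : ℕ+) :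
    Commute ((fockCurrents s n i).aBar σ j k)
      ((fockCurrents s n i).aZero l : Module.End K⟦X⟧ (Fock K n i)) := by
  rcases Int.units_eq_one_or σ with rfl | rfl
  · rw [aBar_one]; exact onFock_qPartial_commute _ _ _ _
  · rw [aBar_neg_one]; exact onFock_qPartial_commute _ _ _ _

theorem fock_bBar_bZero_comm (s : Kˣ) (σ : ℤˣ) (j l : Fin (n - 1)) (k : ℕ+) :
    Commute ((fockCurrents s n i).bBar σ j k)
      ((fockCurrents s n i).bZero l : Module.End K⟦X⟧ (Fock K n i)) := by
  rcases Int.units_eq_one_or σ with rfl | rfl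
  · rw [bBar_one]; exact onFock_qPartial_commute _ _ _ _
  · rw [bBar_neg_one]; exact onFock_qPartial_commute _ _ _ _

end FockCommute

/-! ### The highest weight vector -/

section Vacuum

variable {K : Type*} [Field K] [CharZero K] {n i : ℕ} {s : Kˣ}

theorem one_mem_polyFilt : (1 : FockPoly K n) ∈ polyFilt K n 0 := by
  classical
  intro m hm
  have : m = 0 := by
    by_contra h
    rw [← MvPolynomial.C_1, MvPolynomial.coeff_C, if_neg (Ne.symm h)] at hm
    exact hm rfl
  simp [this, monDeg]

theorem Vtx.mode_zero_one (s : Kˣ) (V : Vtx K n) : V.mode s 0 1 = 1 := by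
  rw [V.mode_apply s 0 (N := 1) fun m hm => V.A_eq_zero s (D := 0) one_mem_polyFilt (by omega)]
  have hA : V.A s 0 1 = 1 := by simp [Vtx.A, expCoeff]
  simp [hA, Vtx.B, zext, expCoeff]

/-- On 1 ⊗ e^β this mode extracts the constant term of the exponentials, so it is a pure translation
of the lattice up to sign. -/
theorem x_single_one (σ : ℤˣ) (j : Fin (n - 1)) (β : Coset n i) :
    (fockCurrents s n i).x σ j (-(σ * pairing n j β.1 + 1)) (Finsupp.single β 1) =
      xSign K σ j β • Finsupp.single (β.shift σ j) 1 := by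
  rw [x_single', show xExp σ j (-(σ * pairing n j β.1 + 1)) β = 0 by rw [xExp]; ring,
    Vtx.mode_zero_one]

theorem x_vacuum (σ : ℤˣ) (j : Fin (n - 1)) (l : ℤ)
    (h : 0 < l + (σ * pairing n j (fundWeight n i) + 1)) :
    (fockCurrents s n i).x σ j l (vacuum K n i) = 0 := by
  rw [vacuum, x_single', Vtx.mode_eq_zero s _ (D := 0) one_mem_polyFilt (by
    simp only [xExp]; push_cast; omega)]
  rw [Finsupp.single_zero, smul_zero]

theorem xSign_mul_self (σ : ℤˣ) (j : Fin (n - 1)) (β : Coset n i) :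
    xSign K σ j β * xSign K σ j β = 1 := by
  rw [xSign, ← Int.cast_mul, ← Units.val_mul, Int.units_mul_self, Units.val_one, Int.cast_one]

theorem single_one_mem {W : Submodule K⟦X⟧ (Fock K n i)} (hv : vacuum K n i ∈ W)
    (hW : ∀ u ∈ W, ∀ j σ l, (fockCurrents s n i).x σ j l u ∈ W) (β : Coset n i) :
    Finsupp.single β 1 ∈ W := by
  have hx : ∀ (β : Coset n i) σ j, Finsupp.single β 1 ∈ W →
      Finsupp.single (β.shift σ j) 1 ∈ W := fun β σ j h => by
    have h1 := W.smul_mem (xSign K σ j β) (hW _ h j σ (-(σ * pairing n j β.1 + 1)))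
    rwa [x_single_one, smul_smul, xSign_mul_self, one_smul] at h1
  -- Stated as an equivalence so that the negation step of the closure induction is immediate; both
  -- implications hold for a simple root since x^+ and x^- translate in opposite directions.
  have key : ∀ γ ∈ rootLattice n, ∀ β β' : Coset n i, β'.1 = γ + β.1 →
      (Finsupp.single β (1 : FockPoly K n) ∈ W ↔ Finsupp.single β' (1 : FockPoly K n) ∈ W) := by
    intro γ hγ
    induction hγ using AddSubgroup.closure_induction with
    | mem γ hγ =>
      obtain ⟨j, rfl⟩ := hγ
      intro β β' h
      obtain rfl : β' = β.shift 1 j := Subtype.ext (by simpa [Coset.shift] using h)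
      refine ⟨hx β 1 j, fun h' => ?_⟩
      have := hx _ (-1) j h'
      rwa [Coset.shift_comm, Coset.shift_neg] at this
    | zero =>
      intro β β' h
      obtain rfl : β' = β := Subtype.ext (by simpa using h)
      rfl
    | add γ γ' hγ hγ' ih ih' =>
      intro β β' h
      have hm : γ' + β.1 - fundWeight n i ∈ rootLattice n := by
        rw [add_sub_assoc]; exact add_mem hγ' β.2
      exact (ih' β ⟨γ' + β.1, hm⟩ rfl).trans (ih ⟨γ' + β.1, hm⟩ β' (by rw [h, add_assoc]))
    | neg γ hγ ih =>
      intro β β' h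
      exact (ih β' β (by rw [h]; abel)).symm
  exact (key _ β.2 ⟨fundWeight n i, fundWeight_mem n i⟩ β (sub_add_cancel _ _).symm).1 hv

theorem smul_single_cancel {R M ι : Type*} [CommRing R] [AddCommGroup M] [Module R M] {c d : R}
    (h : d * c = 1) (x : R) (β : ι) (A : M) :
    (-d) • x • Finsupp.single β ((-c) • A) = x • Finsupp.single β A := by
  rw [← Finsupp.smul_single, smul_comm x, smul_smul, neg_mul_neg, h, one_smul]

theorem smul_single_cancel' {R M ι : Type*} [CommRing R] [AddCommGroup M] [Module R M] {c d : R}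
    (h : d * c = 1) (x y : R) (β : ι) (A : M) :
    (-d) • x • Finsupp.single β ((-(c * y)) • A) = (x * y) • Finsupp.single β A := by
  rw [← Finsupp.smul_single, smul_comm x, smul_smul, neg_mul_neg, ← mul_assoc, h, one_mul,
    smul_comm, smul_smul]

/-- All 1 ⊗ e^β are reached by translations, and polynomials are built up one variable at a time by
ā_j(-k) and b̄_j(-k), whose scalar q - q^{-1} is invertible. -/
theorem fock_generates (hs : ∀ k : ℕ, 0 < k → s ^ k ≠ 1) {W : Submodule K⟦X⟧ (Fock K n i)}
    (hv : vacuum K n i ∈ W)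
    (hx : ∀ u ∈ W, ∀ j σ l, (fockCurrents s n i).x σ j l u ∈ W)
    (ha : ∀ u ∈ W, ∀ j k, (fockCurrents s n i).aBar (-1) j k u ∈ W)
    (hb : ∀ u ∈ W, ∀ j k, (fockCurrents s n i).bBar (-1) j k u ∈ W) (u : Fock K n i) :
    ∃ N : ℕ, (PowerSeries.X ^ N : K⟦X⟧) • u ∈ W := by
  have add : ∀ u v : Fock K n i, (∃ N : ℕ, (PowerSeries.X ^ N : K⟦X⟧) • u ∈ W) →
      (∃ N : ℕ, (PowerSeries.X ^ N : K⟦X⟧) • v ∈ W) →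
      ∃ N : ℕ, (PowerSeries.X ^ N : K⟦X⟧) • (u + v) ∈ W := by
    rintro u v ⟨N, hN⟩ ⟨N', hN'⟩
    refine ⟨N + N', ?_⟩
    rw [smul_add, pow_add, mul_smul _ _ v, mul_comm, mul_smul]
    exact W.add_mem (W.smul_mem _ hN) (W.smul_mem _ hN')
  have hq : (PowerSeries.C ((q s : K) - ((q s)⁻¹ : Kˣ))⁻¹ : K⟦X⟧) *
      PowerSeries.C ((q s : K) - ((q s)⁻¹ : Kˣ)) = 1 := by
    rw [← map_mul, inv_mul_cancel₀ (q_sub_ne_zero hs), map_one]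
  induction u using Finsupp.induction_linear with
  | zero => exact ⟨0, by rw [smul_zero]; exact W.zero_mem⟩
  | add u v hu hv => exact add u v hu hv
  | single β f =>
    induction f using MvPolynomial.induction_on with
    | C r =>
      refine ⟨0, ?_⟩
      rw [pow_zero, one_smul]
      have := W.smul_mem r (single_one_mem hv hx β)
      rwa [Finsupp.smul_single, MvPolynomial.smul_eq_C_mul, mul_one] at this
    | add f g hf hg =>
      rw [Finsupp.single_add]
      exact add _ _ hf hg
    | mul_X f v hf =>
      obtain ⟨N, hN⟩ := hf
      rcases v with ⟨j, k⟩ | ⟨j, k⟩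
      · refine ⟨N, ?_⟩
        have := W.smul_mem (-(PowerSeries.C ((q s : K) - ((q s)⁻¹ : Kˣ))⁻¹ : K⟦X⟧)) (ha _ hN j k)
        rwa [map_smul, aBar_neg_one, onFock_single, LinearMap.smul_apply, smul_single_cancel hq,
          aCre, LinearMap.mulLeft_apply, mul_comm] at this
      -- The operator b̄_j(-k) is b_{j,-k} times p^{k/2} up to a unit; this is why generation holds
      -- only after inverting p^{1/2}.
      · refine ⟨N + k, ?_⟩
        have := W.smul_mem (-(PowerSeries.C ((q s : K) - ((q s)⁻¹ : Kˣ))⁻¹ : K⟦X⟧)) (hb _ hN j k)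
        rwa [map_smul, bBar_neg_one, onFock_single, LinearMap.smul_apply, smul_single_cancel' hq,
          ← pow_add, bCre, LinearMap.mulLeft_apply, mul_comm] at this

end Vacuum

end

end EllipticAlgebra


set_option linter.unusedSectionVars false

/-! ### Assembly of the relations and the highest weight conditions. -/

namespace EllipticAlgebra

theorem Currents.commutator_sub {K : Type*} [Field K] {n : ℕ} {M : Type*} [AddCommGroup M]
    [Module K⟦X⟧ M] (D : Currents K n M) {a : Fin (n - 1)} {m l : ℤ} {c d e : K⟦X⟧}
    (h : ∀ u, D.x 1 a m (D.x (-1) a l u) + c • d • D.phi a (m + l) u =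
      D.x (-1) a l (D.x 1 a m u) + c • e • D.psi a (m + l) u) :
    D.x 1 a m * D.x (-1) a l - D.x (-1) a l * D.x 1 a m =
      c • (e • D.psi a (m + l) - d • D.phi a (m + l)) := by
  refine LinearMap.ext fun u => ?_
  simp only [LinearMap.sub_apply, Module.End.mul_apply, LinearMap.smul_apply, smul_sub]
  rw [sub_eq_sub_iff_add_eq_add, h, add_comm]

theorem Currents.commutator_eq_zero {K : Type*} [Field K] {n : ℕ} {M : Type*} [AddCommGroup M]
    [Module K⟦X⟧ M] (D : Currents K n M) {a b : Fin (n - 1)} {m l : ℤ}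
    (h : ∀ u, D.x 1 a m (D.x (-1) b l u) = D.x (-1) b l (D.x 1 a m u)) :
    D.x 1 a m * D.x (-1) b l - D.x (-1) b l * D.x 1 a m = 0 :=
  sub_eq_zero.2 (LinearMap.ext h)

theorem fock_isRepresentation {K : Type*} [Field K] [CharZero K] {s : Kˣ}
    (hs : ∀ k : ℕ, 0 < k → s ^ k ≠ 1) (n i : ℕ) : IsRepresentation s 1 (fockCurrents s n i) where
  aBar_comm := fock_aBar_comm s
  aBar_aZero_comm := fock_aBar_aZero_comm s
  aZero_comm j l := Units.ext (qPartial_commute s _ _ j l)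
  bBar_comm := fock_bBar_comm s
  bBar_bZero_comm := fock_bBar_bZero_comm s
  bZero_comm j l := Units.ext (qPartial_commute s _ _ j l)
  phi_psi := fock_phi_psi hs
  phi_x := fock_phi_x hs
  psi_x := fock_psi_x hs
  x_plus_x_minus a b m l := by
    split_ifs with h
    · subst h
      exact (fockCurrents s n i).commutator_sub (fock_plus_minus_self hs a m l)
    · exact (fockCurrents s n i).commutator_eq_zero (fock_plus_minus_of_ne hs h m l)
  x_x := fock_x_x hs
  x_x_zero := fock_x_x_zero hs
  serre := fock_serre hs

theorem fock_isHighestWeightRep {K : Type*} [Field K] [CharZero K] {s : Kˣ}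
    (hs : ∀ k : ℕ, 0 < k → s ^ k ≠ 1) {n i : ℕ} (hi : i < n) :
    IsHighestWeightRep s 1 (fun j : Fin (n - 1) => if (j : ℕ) + 1 = i then 1 else 0)
      (fockCurrents s n i) (vacuum K n i) where
  isRepresentation := fock_isRepresentation hs n i
  ne_zero := Finsupp.single_ne_zero.2 one_ne_zero
  aBar_vec j k := by
    rw [aBar_one, vacuum, onFock_single, LinearMap.smul_apply, bAnn, Derivation.coeFn_coe,
      Derivation.map_one_eq_zero, smul_zero, Finsupp.single_zero]
  bBar_vec j k := by
    rw [bBar_one, vacuum, onFock_single, LinearMap.smul_apply, aAnn, Derivation.coeFn_coe,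
      Derivation.map_one_eq_zero, smul_zero, Finsupp.single_zero]
  xPlus_vec j l hl := x_vacuum 1 j l (by
    rw [pairing_fundWeight j i hi, Units.val_one]; split_ifs <;> omega)
  xMinus_vec j l hl := x_vacuum (-1) j l (by
    rw [pairing_fundWeight j i hi, Units.val_neg, Units.val_one]; split_ifs <;> omega)
  aZero_vec j := by
    refine (qPartial_single s (-1) j _ _).trans ?_
    rw [pairing_fundWeight j i hi, neg_one_mul]
    rfl
  bZero_vec j := by
    refine (qPartial_single s 1 j _ _).trans ?_
    rw [pairing_fundWeight j i hi, one_mul]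
    rfl
  generates W hv hW := fock_generates hs hv (fun u hu j => (hW u hu j).2.2.2.2.2)
    (fun u hu j k => ((hW u hu j).1 (-1) k).1) fun u hu j k => ((hW u hu j).1 (-1) k).2

end EllipticAlgebra

theorem mainTheorem3 {K : Type*} [Field K] [CharZero K] (s : Kˣ)
    (hs : ∀ k : ℕ, 0 < k → s ^ k ≠ 1) (n : ℕ) (hn : 2 ≤ n) (i : Fin n) :
    EllipticAlgebra.IsHighestWeightRep s 1
      (fun j : Fin (n - 1) => if (j : ℕ) + 1 = (i : ℕ) then 1 else 0)
      (EllipticAlgebra.fockCurrents s n (i : ℕ)) (EllipticAlgebra.vacuum K n (i : ℕ)) :=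
  EllipticAlgebra.fock_isHighestWeightRep hs i.2
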